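/- **Setting.** Let $q$ be odd and let $\psi$ be a nontrivial additive character of $F=\mathbb F_q$. Let $D$ be either $\mathbb F_q$ with the trivial involution (symplectic-orthogonal case) or $\mathbb F_{q^2}$ with the involution $x\mapsto x^q$ (unitary case). Let $\epsilon=\pm1$. Let $W_0$ be an anisotropic nondegenerate $\epsilon$-hermitian space over $D$ and $W'_0$ an anisotropic nondegenerate $(-\epsilon)$-hermitian space over $D$; in the symplectic-orthogonal case both are supposed to be of even dimension, so that the orthogonal groups that occur are the groups $\mathrm O^{\pm}_{2n}(q)$. Let $W_m$ (resp. $W'_{m'}$) be the orthogonal sum of $W_0$ (resp. $W'_0$) and $m$ (resp. $m'$) hyperbolic planes, and $G_m$ (resp. $G'_{m'}$) its isometry group. Thus $(G_m,G'_{m'})$ is a type I dual pair in $\mathrm{Sp}(W_m\otimes W'_{m'})$, where $W_m\otimes W'_{m'}\simeq\mathrm{Hom}_D(W_m,W'_{m'})$ carries the $F$-symplectic form $(X,Y)\mapsto \mathrm{Tr}_{D/F}\,\mathrm{tr}(X^*Y)$ and the action $(g,g')X=g'Xg^{-1}$. Put $n=\dim_D W_m$ and $n'=\dim_D W'_{m'}$.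 *The representation $\omega^\flat_{m,m'}$.* It is the restriction to $G_m\times G'_{m'}$ of the Weil representation of $\mathrm{Sp}(W_m\otimes W'_{m'})$ attached to $\psi$ (normalized so that an element $a$ of the Levi subgroup of a Siegel parabolic subgroup acts by translation multiplied by $\det(a)^{(q-1)/2}$), twisted as follows: in the unitary case by the character $(g,g')\mapsto\eta(\det g)^{n'}\eta(\det g')^{n}$, where $\eta$ is the character of order $2$ of the group of elements of norm $1$ of $D$; in the symplectic-orthogonal case by the character $\chi(\det g)^{N/2}$ of the orthogonal member, where $\chi$ is the quadratic character of $\mathbb F_q^\times$, $g$ is the orthogonal component and $N$ is the dimension of the symplectic space. *Subgroups.* For $k\le m$ let $X_k\subset W_m$ be the totally isotropic subspace spanned by the first $k$ vectors $e_1,\dots,e_k$ of a hermitian basis $e_1,\ldots,e_m,\ f_1,\ldots,f_m$ of the hyperbolic part, $P_k$ the stabilizer of $X_k$ in $G_m$, $N_k$ its unipotent radical, and $M_k\simeq \mathrm{GL}_k\times G_{m-k}$ its standard Levi subgroup. For $j\le k$ let $Q_j$ be the stabilizer of $X_j$ in $\mathrm{GL}_k=\mathrm{GL}(X_k)$, the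 group of matrices $\left(\begin{smallmatrix}a_j&*\\&a_{k-j}\end{smallmatrix}\right)$, and write $Q_jG_{m-k}=Q_j\times G_{m-k}\subset M_k$. Denote by $X'_{k'},P'_{k'},N'_{k'},M'_{k'},Q'_{j'}$ the analogous objects for $G'_{m'}$, $k'\le m'$. Let ${}^*R_k$ (resp. ${}^*R'_{k'}$) be the parabolic restriction functor from $G_m\times G'_{m'}$ to $M_k\times G'_{m'}$ (resp. $G_m\times M'_{k'}$), that is, the functor of coinvariants under $N_k$ (resp. $N'_{k'}$). Let $\mathbf R_{\mathrm{GL}_i}$ be the representation of $\mathrm{GL}_i(D)\times\mathrm{GL}_i(D)$ on the functions on $\mathrm{GL}_i(D)$ given by $(a,b)f(x)=f(a^{-1}xb)$. The representation $\mathbf R_{\mathrm{GL}_i}\otimes\omega^\flat_{m-k,m'-i}$ of $Q_{k-i}G_{m-k}\times P'_i$ is the inflation of the representation of $\mathrm{GL}_i\times G_{m-k}\times\mathrm{GL}_i\times G'_{m'-i}$ through the action on $X_k/X_{k-i}$, the projection to $G_{m-k}$, the action on $X'_i$ and the projection $P'_i\to G'_{m'-i}$. The representation $\mathbf R_{\mathrm{GL}_i}\otimes\omega^\flat_{m-i,m'-k'}$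 of $P_i\times Q'_{k'-i}G'_{m'-k'}$ is defined likewise. **Theorem.** Let $m,m'\ge 0$. a) Let $0\le k\le m$ and $r=\min\{k,m'\}$. There is an $M_k\times G'_{m'}$-invariant filtration $0=\tau_0\subset\tau_1\subset\cdots\subset\tau_{r+1}={}^*R_k(\omega^\flat_{m,m'})$ whose successive quotients satisfy, for $0\le i\le r$, $$\tau_{i+1}/\tau_i\simeq \mathrm{Ind}_{Q_{k-i}G_{m-k}\times P'_i}^{M_k\times G'_{m'}}\ \mathbf R_{\mathrm{GL}_i}\otimes\omega^\flat_{m-k,m'-i}.$$ Moreover $${}^*R_k(\omega^\flat_{m,m'})\simeq\bigoplus_{i=0}^{\min\{k,m'\}}\mathrm{Ind}_{Q_{k-i}G_{m-k}\times P'_i}^{M_k\times G'_{m'}}\ \mathbf R_{\mathrm{GL}_i}\otimes\omega^\flat_{m-k,m'-i}.$$ b) Let $0\le k'\le m'$ and $r'=\min\{k',m\}$. There is a $G_m\times M'_{k'}$-invariant filtration $0=\tau'_0\subset\tau'_1\subset\cdots\subset\tau'_{r'+1}={}^*R'_{k'}(\omega^\flat_{m,m'})$ whose successive quotients satisfy,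 for $0\le i\le r'$, $$\tau'_{i+1}/\tau'_i\simeq \mathrm{Ind}_{P_i\times Q'_{k'-i}G'_{m'-k'}}^{G_m\times M'_{k'}}\ \mathbf R_{\mathrm{GL}_i}\otimes\omega^\flat_{m-i,m'-k'}.$$ Moreover $${}^*R'_{k'}(\omega^\flat_{m,m'})\simeq\bigoplus_{i=0}^{\min\{k',m\}}\mathrm{Ind}_{P_i\times Q'_{k'-i}G'_{m'-k'}}^{G_m\times M'_{k'}}\ \mathbf R_{\mathrm{GL}_i}\otimes\omega^\flat_{m-i,m'-k'}.$$ -/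

import Mathlib

/-- The Heisenberg group `V × F` with `(v, s)(w, t) = (v + w, s + t + B(v, w)/2)`. -/
@[ext]
structure Heisenberg {F V : Type*} [Field F] [AddCommGroup V] [Module F V]
    (B : LinearMap.BilinForm F V) where
  vec : V
  scal : F

namespace Heisenberg

variable {F V : Type*} [Field F] [AddCommGroup V] [Module F V] {B : LinearMap.BilinForm F V}

instance : Mul (Heisenberg B) :=
  ⟨fun x y => ⟨x.vec + y.vec, x.scal + y.scal + 2⁻¹ * B x.vec y.vec⟩⟩

instance : One (Heisenberg B) := ⟨⟨0, 0⟩⟩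

instance : Inv (Heisenberg B) := ⟨fun x => ⟨-x.vec, -x.scal + 2⁻¹ * B x.vec x.vec⟩⟩

@[simp] theorem mul_vec (x y : Heisenberg B) : (x * y).vec = x.vec + y.vec := rfl

@[simp] theorem mul_scal (x y : Heisenberg B) :
    (x * y).scal = x.scal + y.scal + 2⁻¹ * B x.vec y.vec := rfl

@[simp] theorem one_vec : (1 : Heisenberg B).vec = 0 := rfl

@[simp] theorem one_scal : (1 : Heisenberg B).scal = 0 := rfl

@[simp] theorem inv_vec (x : Heisenberg B) : (x⁻¹).vec = -x.vec := rfl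

@[simp] theorem inv_scal (x : Heisenberg B) :
    (x⁻¹).scal = -x.scal + 2⁻¹ * B x.vec x.vec := rfl

instance : Group (Heisenberg B) := Group.ofLeftAxioms
  (fun x y z => by
    ext
    · simp [add_assoc]
    · simp only [mul_scal, mul_vec, map_add, LinearMap.add_apply]; ring)
  (fun x => by ext <;> simp)
  (fun x => by ext <;> simp)

/-- The underlying set is `V × F`. -/
def equivProd : Heisenberg B ≃ V × F where
  toFun x := (x.vec, x.scal)
  invFun p := ⟨p.1, p.2⟩
  left_inv _ := rfl
  right_inv _ := rfl

instance [Finite V] [Finite F] : Finite (Heisenberg B) := Finite.of_equiv _ equivProd.symm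

end Heisenberg

open Heisenberg Module

section HeisenbergRep

variable {F V : Type*} [Field F] [Finite F] [AddCommGroup V] [Module F V] [Finite V]
  (B : LinearMap.BilinForm F V) (ψ : AddChar F ℂ)

set_option linter.unusedSectionVars false in
theorem heis_transport {S : Type*} [AddCommGroup S] [Module ℂ S] [FiniteDimensional ℂ S]
    (ρ : Representation ℂ (Heisenberg B) S) (h : ∀ t, ρ ⟨0, t⟩ = ψ t • LinearMap.id) :
    ∃ ρ' : Representation ℂ (Heisenberg B) (Fin (finrank ℂ S) → ℂ),
      ∀ t, ρ' ⟨0, t⟩ = ψ t • LinearMap.id := by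
  let e := (finBasis ℂ S).equivFun
  refine ⟨(e.conjRingEquiv : _ →* _).comp ρ, fun t => ?_⟩
  ext v
  simp [h t]

theorem exists_heis_central : ∃ d : ℕ, 0 < d ∧
    ∃ ρ : Representation ℂ (Heisenberg B) (Fin d → ℂ),
      ∀ t, ρ ⟨0, t⟩ = ψ t • LinearMap.id := by
  let φ : Multiplicative F →* Heisenberg B :=
    { toFun := fun t => ⟨0, t.toAdd⟩
      map_one' := rfl
      map_mul' := fun s t => by ext <;> simp }
  let σ : Representation ℂ (Multiplicative F) ℂ :=
    { toFun := fun t => ψ t.toAdd • LinearMap.id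
      map_one' := by ext; simp
      map_mul' := fun s t => by ext; simp [AddChar.map_add_eq_mul, mul_comm] }
  let f₀ : Heisenberg B → ℂ := fun h => by
    classical exact if h.vec = 0 then ψ h.scal else 0
  have hf₀ : f₀ ∈ Representation.coindV φ σ := by
    rw [Representation.mem_coindV]
    intro t h
    simp only [f₀, φ, σ, MonoidHom.coe_mk, OneHom.coe_mk, mul_vec, mul_scal, zero_add, map_zero,
      LinearMap.zero_apply, mul_zero, add_zero, LinearMap.smul_apply, LinearMap.id_apply,
      AddChar.map_add_eq_mul]
    split_ifs <;> simp_all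
  have : Nontrivial (Representation.coindV φ σ) := by
    refine ⟨⟨⟨f₀, hf₀⟩, 0, fun h => ?_⟩⟩
    have := congrFun (congrArg Subtype.val h) 1
    simp [f₀] at this
  refine ⟨finrank ℂ (Representation.coindV φ σ), finrank_pos, ?_⟩
  refine heis_transport B ψ (Representation.coind φ σ) fun t => ?_
  ext f h
  have hf := (Representation.mem_coindV φ σ f.1).1 f.2 (Multiplicative.ofAdd t) h
  have hc : φ (Multiplicative.ofAdd t) * h = h * ⟨0, t⟩ := by
    ext
    · simp [φ]
    · simp [φ, add_comm]
  rw [hc] at hf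
  have hf' : f.1 (h * ⟨0, t⟩) = ψ t * f.1 h := by simpa [σ] using hf
  simpa using! hf'

theorem exists_heis : ∃ d : ℕ, ∃ ρ : Representation ℂ (Heisenberg B) (Fin d → ℂ),
    ρ.IsIrreducible ∧ ∀ t, ρ ⟨0, t⟩ = ψ t • LinearMap.id := by
  classical
  have hex := exists_heis_central B ψ
  obtain ⟨hpos, ρ, hρ⟩ := Nat.find_spec hex
  refine ⟨Nat.find hex, ρ, ?_, hρ⟩
  have : Nonempty (Fin (Nat.find hex)) := ⟨⟨0, hpos⟩⟩
  have hnt : Nontrivial (Subrepresentation ρ) := by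
    refine ⟨⟨⊥, ⊤, fun h => ?_⟩⟩
    have h' : (⊥ : Submodule ℂ (Fin (Nat.find hex) → ℂ)) = ⊤ :=
      congrArg Subrepresentation.toSubmodule h
    exact bot_ne_top h'
  refine ⟨fun W => ?_⟩
  by_cases hW : W.toSubmodule = ⊥
  · exact Or.inl (Subrepresentation.toSubmodule_injective hW)
  · right
    have h1 : 0 < finrank ℂ W.toSubmodule := by
      rw [Nat.pos_iff_ne_zero]
      exact fun h => hW (Submodule.finrank_eq_zero.1 h)
    have h2 := Nat.find_min' hex ⟨h1, heis_transport B ψ W.toRepresentation fun t => by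
      ext v : 2
      have := LinearMap.congr_fun (hρ t) v.1
      simpa [Subrepresentation.toRepresentation] using this⟩
    apply Subrepresentation.toSubmodule_injective
    apply Submodule.eq_top_of_finrank_eq
    have h3 := Submodule.finrank_le W.toSubmodule
    rw [Module.finrank_fin_fun] at h3 ⊢
    omega

/-- The dimension of the Heisenberg representation. -/
noncomputable def heisDim : ℕ := (exists_heis B ψ).choose

/-- The Heisenberg representation: an irreducible representation of the Heisenberg group on which
the centre acts by `ψ` (for symplectic `B` and `ψ ≠ 1` it is unique up to isomorphism). -/
noncomputable def heisRep : Representation ℂ (Heisenberg B) (Fin (heisDim B ψ) → ℂ) :=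
  (exists_heis B ψ).choose_spec.choose

instance heisRep_irreducible : (heisRep B ψ).IsIrreducible :=
  (exists_heis B ψ).choose_spec.choose_spec.1

theorem heisRep_center (t : F) : heisRep B ψ ⟨0, t⟩ = ψ t • LinearMap.id :=
  (exists_heis B ψ).choose_spec.choose_spec.2 t

end HeisenbergRep

section Weil

variable {F V : Type*} [Field F] [AddCommGroup V] [Module F V]

/-- `B` is a symplectic form: alternating and nondegenerate. -/
structure IsSymplectic (B : LinearMap.BilinForm F V) : Prop where
  alt : ∀ x, B x x = 0
  nondeg : ∀ x, (∀ y, B x y = 0) → x = 0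

/-- The symplectic group of `B`. -/
def symplecticGroup (B : LinearMap.BilinForm F V) : Subgroup (V ≃ₗ[F] V) where
  carrier := {g | ∀ x y, B (g x) (g y) = B x y}
  one_mem' := fun _ _ => rfl
  mul_mem' := fun {g h} hg hh x y => by
    rw [LinearEquiv.mul_apply, LinearEquiv.mul_apply, hg, hh]
  inv_mem' := fun {g} hg x y => by
    rw [← hg (g⁻¹ x) (g⁻¹ y)]
    simp

variable {B : LinearMap.BilinForm F V}

/-- The action of the symplectic group on the Heisenberg group, trivial on the centre. -/
def heisAct (g : symplecticGroup B) : Heisenberg B →* Heisenberg B where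
  toFun x := ⟨g.1 x.vec, x.scal⟩
  map_one' := by ext <;> simp
  map_mul' x y := by
    ext
    · simp
    · simp [g.2 x.vec y.vec]

theorem IsSymplectic.neg (hB : IsSymplectic B) (x y : V) : B x y = -B y x := by
  have h := hB.alt (x + y)
  simp only [map_add, LinearMap.add_apply, hB.alt, zero_add, add_zero] at h
  linear_combination h

variable [Finite F] [Finite V] [NeZero (2 : F)] {ψ : AddChar F ℂ}

theorem heis_char_zero (hB : IsSymplectic B) (hψ : ψ ≠ 1) (x : Heisenberg B) (hx : x.vec ≠ 0) :
    (heisRep B ψ).character x = 0 := by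
  obtain ⟨a, ha⟩ : ∃ a, ψ a ≠ 1 := by
    by_contra! h
    exact hψ (by ext a; simp [h a])
  obtain ⟨y, hy⟩ : ∃ y, B x.vec y ≠ 0 := by
    by_contra! h
    exact hx (hB.nondeg _ h)
  have hy' : B y x.vec ≠ 0 := by rw [hB.neg]; simpa using hy
  let w : Heisenberg B := ⟨(a / B y x.vec) • y, 0⟩
  have h2 : (2 : F) ≠ 0 := NeZero.ne 2
  have hc : w * x * w⁻¹ = ⟨0, a⟩ * x := by
    ext
    · simp [w]
    · simp only [w, mul_scal, mul_vec, inv_scal, inv_vec, map_add, map_smul, map_neg,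
        LinearMap.add_apply, LinearMap.smul_apply, smul_eq_mul, hB.alt, map_zero,
        LinearMap.zero_apply]
      rw [hB.neg x.vec y]
      field_simp
      ring
  have h1 := Representation.char_conj (heisRep B ψ) x w
  rw [hc, Representation.character, map_mul, heisRep_center, Representation.character] at h1
  have h3 : ψ a * LinearMap.trace ℂ _ (heisRep B ψ x) = LinearMap.trace ℂ _ (heisRep B ψ x) := by
    rw [← smul_eq_mul, ← map_smul]
    exact h1
  have h4 : (ψ a - 1) * LinearMap.trace ℂ _ (heisRep B ψ x) = 0 := by linear_combination h3
  exact (mul_eq_zero.1 h4).resolve_left (sub_ne_zero.2 ha)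

theorem heis_char_act (hB : IsSymplectic B) (hψ : ψ ≠ 1) (g : symplecticGroup B)
    (x : Heisenberg B) :
    (heisRep B ψ).character (heisAct g x) = (heisRep B ψ).character x := by
  by_cases hx : x.vec = 0
  · congr 1
    ext <;> simp [heisAct, hx]
  · rw [heis_char_zero hB hψ x hx, heis_char_zero hB hψ]
    simpa [heisAct] using hx

theorem exists_intertwiner (hB : IsSymplectic B) (hψ : ψ ≠ 1) (g : symplecticGroup B) :
    ∃ T : Module.End ℂ (Fin (heisDim B ψ) → ℂ),
      IsUnit T ∧ ∀ x, T * heisRep B ψ x = heisRep B ψ (heisAct g x) * T := by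
  have := Fintype.ofFinite (Heisenberg B)
  have : Invertible (Nat.card (Heisenberg B) : ℂ) :=
    invertibleOfNonzero (by simp)
  let σ : Representation ℂ (Heisenberg B) (Fin (heisDim B ψ) → ℂ) :=
    (heisRep B ψ).comp (heisAct g)
  have hσ : σ.character = (heisRep B ψ).character := funext fun x => heis_char_act hB hψ g x
  have h1 := Representation.card_inv_mul_sum_char_mul_char_eq_finrank (heisRep B ψ) σ
  rw [hσ, Representation.card_inv_mul_sum_char_mul_char_eq_finrank,
    Representation.IsIrreducible.finrank_intertwiningMap_self] at h1
  have h2 : 0 < finrank ℂ (Representation.IntertwiningMap (heisRep B ψ) σ) := by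
    have : finrank ℂ (Representation.IntertwiningMap (heisRep B ψ) σ) = 1 := by
      exact_mod_cast h1.symm
    omega
  have := finrank_pos_iff.1 h2
  obtain ⟨f, hf⟩ := exists_ne (0 : Representation.IntertwiningMap (heisRep B ψ) σ)
  have hinj := (Representation.IsIrreducible.injective_or_eq_zero f).resolve_right hf
  refine ⟨f.toLinearMap, ?_, fun x => ?_⟩
  · rw [Module.End.isUnit_iff]
    exact ⟨hinj, LinearMap.injective_iff_surjective.1 hinj⟩
  · exact LinearMap.ext fun v => f.isIntertwining _ _ x v

/-- An intertwining operator between the Heisenberg representation and its twist by `g`; it is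
unique up to a scalar. -/
noncomputable def intertwiner (hB : IsSymplectic B) (hψ : ψ ≠ 1) (g : symplecticGroup B) :
    Module.End ℂ (Fin (heisDim B ψ) → ℂ) :=
  (exists_intertwiner hB hψ g).choose

theorem intertwiner_spec (hB : IsSymplectic B) (hψ : ψ ≠ 1) (g : symplecticGroup B) :
    IsUnit (intertwiner hB hψ g) ∧ ∀ x, intertwiner hB hψ g * heisRep B ψ x =
      heisRep B ψ (heisAct g x) * intertwiner hB hψ g :=
  (exists_intertwiner hB hψ g).choose_spec

set_option linter.unusedSectionVars false in
theorem intertwiner_unique (g : symplecticGroup B)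
    (T T' : Module.End ℂ (Fin (heisDim B ψ) → ℂ)) (hT : IsUnit T) (hT' : IsUnit T')
    (h : ∀ x, T * heisRep B ψ x = heisRep B ψ (heisAct g x) * T)
    (h' : ∀ x, T' * heisRep B ψ x = heisRep B ψ (heisAct g x) * T') :
    ∃ c : ℂ, c ≠ 0 ∧ T' = c • T := by
  obtain ⟨u, rfl⟩ := hT
  let f : Representation.IntertwiningMap (heisRep B ψ) (heisRep B ψ) :=
    { toLinearMap := (↑u⁻¹ : Module.End ℂ _) * T'
      isIntertwining' := fun x => by
        change (↑u⁻¹ * T') * heisRep B ψ x = heisRep B ψ x * (↑u⁻¹ * T')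
        rw [mul_assoc, h', ← mul_assoc, ← mul_assoc]
        congr 1
        rw [Units.inv_mul_eq_iff_eq_mul, ← mul_assoc, h, mul_assoc]
        simp }
  obtain ⟨c, hc⟩ :=
    Representation.IsIrreducible.algebraMap_intertwiningMap_bijective_of_isAlgClosed.2 f
  have hc' : (↑u⁻¹ : Module.End ℂ _) * T' = c • 1 :=
    (congrArg Representation.IntertwiningMap.toLinearMap hc).symm
  rw [Units.inv_mul_eq_iff_eq_mul, mul_smul_comm, mul_one] at hc'
  by_cases hc0 : c = 0
  · refine ⟨1, one_ne_zero, ?_⟩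
    subst hc0
    rw [zero_smul] at hc'
    subst hc'
    rw [isUnit_zero_iff] at hT'
    have h0 : (u : Module.End ℂ (Fin (heisDim B ψ) → ℂ)) = 0 := by
      rw [← mul_one (u : Module.End ℂ (Fin (heisDim B ψ) → ℂ)), ← hT', mul_zero]
    rw [h0, smul_zero]
  · exact ⟨c, hc0, hc'⟩

theorem heisDim_sq (hB : IsSymplectic B) (hψ : ψ ≠ 1) :
    (heisDim B ψ : ℂ) ^ 2 = Nat.card V := by
  classical
  have := Fintype.ofFinite (Heisenberg B)
  have := Fintype.ofFinite V
  have := Fintype.ofFinite F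
  have : Invertible (Nat.card (Heisenberg B) : ℂ) :=
    invertibleOfNonzero (by simp)
  have h1 := Representation.card_inv_mul_sum_char_mul_char_eq_finrank (heisRep B ψ) (heisRep B ψ)
  rw [Representation.IsIrreducible.finrank_intertwiningMap_self, Nat.cast_one,
    inv_mul_eq_iff_eq_mul₀ (by simp), mul_one, Nat.card_congr equivProd, Nat.card_prod,
    ← Equiv.sum_comp equivProd.symm, Fintype.sum_prod_type] at h1
  have h2 : ∀ v t, (heisRep B ψ).character (equivProd.symm (v, t)) *
      (heisRep B ψ).character (equivProd.symm (v, t))⁻¹ =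
      if v = 0 then (heisDim B ψ : ℂ) ^ 2 else 0 := by
    intro v t
    split_ifs with hv
    · subst hv
      have e1 : (equivProd.symm ((0 : V), t) : Heisenberg B) = ⟨0, t⟩ := rfl
      have e2 : (⟨0, t⟩ : Heisenberg B)⁻¹ = ⟨0, -t⟩ := by ext <;> simp
      have e3 : ψ t * ψ (-t) = 1 := by rw [← AddChar.map_add_eq_mul]; simp
      rw [e1, e2]
      simp only [Representation.character, heisRep_center, map_smul, LinearMap.trace_id,
        finrank_fin_fun, smul_eq_mul]
      linear_combination (heisDim B ψ : ℂ) ^ 2 * e3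
    · rw [heis_char_zero hB hψ _ hv, zero_mul]
  simp only [h2, Finset.sum_const, Finset.card_univ, smul_ite, smul_zero, Finset.sum_ite_eq',
    Finset.mem_univ, if_true, nsmul_eq_mul] at h1
  rw [Nat.card_eq_fintype_card, Nat.card_eq_fintype_card] at h1
  have h3 : (Fintype.card F : ℂ) ≠ 0 := by simp
  rw [Nat.card_eq_fintype_card]
  apply mul_left_cancel₀ h3
  rw [h1]
  push_cast
  ring

/-- The parity operator of the Heisenberg representation: in the model on functions on a
Lagrangian subspace it is `f ↦ (x ↦ f (-x))`. -/
noncomputable def heisParity (B : LinearMap.BilinForm F V) (ψ : AddChar F ℂ) :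
    Module.End ℂ (Fin (heisDim B ψ) → ℂ) :=
  (heisDim B ψ : ℂ)⁻¹ • ∑ᶠ v : V, heisRep B ψ ⟨v, 0⟩

theorem heisDim_ne_zero (hB : IsSymplectic B) (hψ : ψ ≠ 1) : (heisDim B ψ : ℂ) ≠ 0 := by
  intro h
  have := heisDim_sq hB hψ
  rw [h] at this
  have h0 : (Nat.card V : ℂ) ≠ 0 := by exact_mod_cast Nat.card_pos.ne'
  exact h0 (by rw [← this]; simp)

theorem heisParity_trace (hB : IsSymplectic B) (hψ : ψ ≠ 1) :
    LinearMap.trace ℂ _ (heisParity B ψ) = 1 := by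
  classical
  have := Fintype.ofFinite V
  have h0 : ∀ v : V, v ≠ 0 → LinearMap.trace ℂ _ (heisRep B ψ ⟨v, 0⟩) = 0 :=
    fun v hv => heis_char_zero hB hψ ⟨v, 0⟩ hv
  rw [heisParity, finsum_eq_sum_of_fintype, map_smul, map_sum,
    Finset.sum_eq_single 0 (fun v _ hv => h0 v hv) (by simp), heisRep_center]
  simp [heisDim_ne_zero hB hψ]

theorem heisParity_sq (hB : IsSymplectic B) (hψ : ψ ≠ 1) :
    heisParity B ψ * heisParity B ψ = 1 := by
  classical
  have := Fintype.ofFinite V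
  have h2 : (2 : F) ≠ 0 := NeZero.ne 2
  have h1 : ∀ v w : V, heisRep B ψ ⟨v, 0⟩ * heisRep B ψ ⟨w, 0⟩ =
      ψ (2⁻¹ * B v w) • heisRep B ψ ⟨v + w, 0⟩ := by
    intro v w
    rw [← map_mul]
    have : (⟨v, 0⟩ * ⟨w, 0⟩ : Heisenberg B) = ⟨0, 2⁻¹ * B v w⟩ * ⟨v + w, 0⟩ := by
      ext <;> simp
    rw [this, map_mul, heisRep_center]
    rfl
  have h3 : ∀ u : V, ∑ v, ψ (2⁻¹ * B v u) = if u = 0 then (Fintype.card V : ℂ) else 0 := by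
    intro u
    split_ifs with hu
    · subst hu; simp
    · let χ : AddChar V ℂ := ψ.compAddMonoidHom ((2⁻¹ : F) • B.flip u).toAddMonoidHom
      have hχ : χ ≠ 1 := by
        obtain ⟨a, ha⟩ : ∃ a, ψ a ≠ 1 := by
          by_contra! h
          exact hψ (by ext a; simp [h a])
        obtain ⟨y, hy⟩ : ∃ y, B u y ≠ 0 := by
          by_contra! h
          exact hu (hB.nondeg _ h)
        have hy' : B y u ≠ 0 := by rw [hB.neg]; simpa using hy
        intro h
        apply ha
        have := DFunLike.congr_fun h ((2 * a / B y u) • y)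
        simp only [χ, AddChar.compAddMonoidHom_apply, AddChar.one_apply] at this
        rw [← this]
        congr 1
        simp
        field_simp
      exact AddChar.sum_eq_zero_of_ne_one hχ
  rw [heisParity, finsum_eq_sum_of_fintype, smul_mul_smul_comm, Finset.sum_mul_sum]
  have h4 : ∀ v : V, ∑ w, heisRep B ψ ⟨v, 0⟩ * heisRep B ψ ⟨w, 0⟩ =
      ∑ u, ψ (2⁻¹ * B v u) • heisRep B ψ ⟨u, 0⟩ := by
    intro v
    rw [← Equiv.sum_comp (Equiv.subRight v)]
    refine Finset.sum_congr rfl fun u _ => ?_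
    rw [h1]
    simp [hB.alt]
  simp only [h4]
  rw [Finset.sum_comm]
  simp only [← Finset.sum_smul, h3]
  simp only [ite_smul, zero_smul, Finset.sum_ite_eq', Finset.mem_univ, if_true]
  have h5 := heisDim_sq hB hψ
  have h6 := heisDim_ne_zero hB hψ
  rw [Nat.card_eq_fintype_card] at h5
  rw [← h5, heisRep_center, smul_smul]
  simp
  field_simp
  rw [one_smul]
  rfl

set_option linter.unusedSectionVars false in
theorem heisParity_comm (g : symplecticGroup B) (T : Module.End ℂ (Fin (heisDim B ψ) → ℂ))
    (h : ∀ x, T * heisRep B ψ x = heisRep B ψ (heisAct g x) * T) :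
    T * heisParity B ψ = heisParity B ψ * T := by
  have := Fintype.ofFinite V
  rw [heisParity, finsum_eq_sum_of_fintype, mul_smul_comm, smul_mul_assoc, Finset.mul_sum,
    Finset.sum_mul, ← Equiv.sum_comp g.1.toEquiv (fun v => heisRep B ψ ⟨v, 0⟩ * T)]
  congr 1
  exact Finset.sum_congr rfl fun v _ => h ⟨v, 0⟩

/-- The projection onto the even vectors. -/
noncomputable def evenProj (B : LinearMap.BilinForm F V) (ψ : AddChar F ℂ) :
    Module.End ℂ (Fin (heisDim B ψ) → ℂ) :=
  (2 : ℂ)⁻¹ • (1 + heisParity B ψ)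

/-- The determinant of the restriction of `T` to the even vectors (for `T` commuting with the
parity operator). -/
noncomputable def evenDet (B : LinearMap.BilinForm F V) (ψ : AddChar F ℂ)
    (T : Module.End ℂ (Fin (heisDim B ψ) → ℂ)) : ℂ :=
  LinearMap.det (evenProj B ψ * T + (1 - evenProj B ψ))

/-- The determinant of the restriction of `T` to the odd vectors (for `T` commuting with the
parity operator). -/
noncomputable def oddDet (B : LinearMap.BilinForm F V) (ψ : AddChar F ℂ)
    (T : Module.End ℂ (Fin (heisDim B ψ) → ℂ)) : ℂ :=
  LinearMap.det ((1 - evenProj B ψ) * T + evenProj B ψ)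

theorem evenProj_idem (hB : IsSymplectic B) (hψ : ψ ≠ 1) :
    evenProj B ψ * evenProj B ψ = evenProj B ψ := by
  have h := heisParity_sq hB hψ
  rw [evenProj, smul_mul_smul_comm, add_mul, mul_add, mul_add, h]
  simp only [mul_one, one_mul]
  module

theorem det_idem_block {M : Type*} [AddCommGroup M] [Module ℂ M] [FiniteDimensional ℂ M]
    (e : Module.End ℂ M) (he : e * e = e) :
    ∃ n : ℕ, LinearMap.trace ℂ M e = n ∧
      ∀ c : ℂ, LinearMap.det (e * (c • 1) + (1 - e)) = c ^ n := by
  have hp := (LinearMap.isProj_range_iff_isIdempotentElem e).2 he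
  refine ⟨_, hp.trace, fun c => ?_⟩
  let E := (LinearMap.range e).prodEquivOfIsCompl (LinearMap.ker e) hp.isCompl
  have h1 : e = E.conj (LinearMap.prodMap LinearMap.id 0) := hp.eq_conj_prodMap
  have h2 : e * (c • 1) + (1 - e) =
      E.conj (LinearMap.prodMap (c • LinearMap.id) LinearMap.id) := by
    have h3 : (1 : Module.End ℂ M) = E.conj LinearMap.id := by simp; rfl
    have h4 : c • e + (1 - e) = c • E.conj (LinearMap.prodMap LinearMap.id 0) +
        (E.conj LinearMap.id - E.conj (LinearMap.prodMap LinearMap.id 0)) := by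
      rw [← h1, ← h3]
    rw [mul_smul_comm, mul_one, h4, ← map_smul, ← map_sub, ← map_add]
    congr 1
    ext x <;> simp
  rw [h2, LinearEquiv.conj_apply, LinearMap.comp_assoc, LinearMap.det_conj,
    LinearMap.det_prodMap]
  simp

theorem evenDet_mul (hB : IsSymplectic B) (hψ : ψ ≠ 1)
    (T T' : Module.End ℂ (Fin (heisDim B ψ) → ℂ))
    (hT : T * heisParity B ψ = heisParity B ψ * T) :
    evenDet B ψ (T * T') = evenDet B ψ T * evenDet B ψ T' ∧
      oddDet B ψ (T * T') = oddDet B ψ T * oddDet B ψ T' := by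
  have he := evenProj_idem hB hψ
  have hc : T * evenProj B ψ = evenProj B ψ * T := by
    rw [evenProj, mul_smul_comm, smul_mul_assoc, mul_add, add_mul, hT, mul_one, one_mul]
  constructor
  · rw [evenDet, evenDet, evenDet, ← map_mul]
    congr 1
    generalize evenProj B ψ = e at he hc
    have h1 : e * T * (e * T') = e * (T * T') := by
      rw [mul_assoc, ← mul_assoc T, hc, ← mul_assoc, ← mul_assoc, he]
      simp only [mul_assoc]
    have h2 : e * T * e = e * T := by rw [mul_assoc, hc, ← mul_assoc, he]
    simp only [mul_add, add_mul, mul_sub, sub_mul, mul_one, one_mul, h1, h2, he]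
    rw [← mul_assoc e e, he]
    abel
  · rw [oddDet, oddDet, oddDet, ← map_mul]
    congr 1
    generalize evenProj B ψ = e at he hc
    have h2 : e * T * e = e * T := by rw [mul_assoc, hc, ← mul_assoc, he]
    have h4 : e * T * (e * T') = e * T * T' := by rw [← mul_assoc, h2]
    have h5 : T * (e * T') = e * T * T' := by rw [← mul_assoc, hc]
    simp only [mul_add, add_mul, mul_sub, sub_mul, one_mul, h2, h4, h5, he, hc]
    simp only [← mul_assoc, he]
    abel

theorem evenDet_smul (hB : IsSymplectic B) (hψ : ψ ≠ 1) (c : ℂ) (hc : c ≠ 0)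
    (T : Module.End ℂ (Fin (heisDim B ψ) → ℂ)) :
    oddDet B ψ (c • T) * (evenDet B ψ (c • T))⁻¹ * c =
      oddDet B ψ T * (evenDet B ψ T)⁻¹ := by
  have he := evenProj_idem hB hψ
  have ho : (1 - evenProj B ψ) * (1 - evenProj B ψ) = 1 - evenProj B ψ := by
    simp [mul_sub, sub_mul, he]
  obtain ⟨n, hn, hn'⟩ := det_idem_block _ he
  obtain ⟨k, hk, hk'⟩ := det_idem_block _ ho
  have hnk : n = k + 1 := by
    have h1 := heisParity_trace hB hψ
    have h2 : heisParity B ψ = evenProj B ψ - (1 - evenProj B ψ) := by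
      rw [evenProj]; module
    rw [h2, map_sub, hn, hk, sub_eq_iff_eq_add] at h1
    rw [add_comm]
    exact_mod_cast h1
  have hcm : (c • (1 : Module.End ℂ (Fin (heisDim B ψ) → ℂ))) * heisParity B ψ =
      heisParity B ψ * (c • 1) := by simp
  have h1 := evenDet_mul hB hψ (c • 1) T hcm
  rw [smul_one_mul] at h1
  have h2 : evenDet B ψ (c • 1) = c ^ n := hn' c
  have h3 : oddDet B ψ (c • 1) = c ^ k := by
    rw [← hk' c, oddDet, sub_sub_cancel]
  rw [h1.1, h1.2, h2, h3, hnk, mul_inv]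
  generalize oddDet B ψ T = x
  generalize evenDet B ψ T = y
  have : (c ^ (k + 1))⁻¹ * c ^ k * c = 1 := by
    rw [mul_assoc, ← pow_succ]
    exact inv_mul_cancel₀ (pow_ne_zero _ hc)
  linear_combination (x * y⁻¹) * this

/-- The Weil representation attached to `ψ` of the symplectic group of `B`, on the space of the
Heisenberg representation `ρ`. It satisfies `ω(g) ρ(h) ω(g)⁻¹ = ρ(g · h)`, so that `ω(g)` is an
intertwining operator `T`, and this leaves only the scalar to be fixed. The space of even vectors
has one dimension more than the space of odd vectors, so `det (T | odd) / det (T | even) • T` does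
not depend on the choice of `T`; this choice of scalars makes `ω` a representation. (In the model
on functions on a Lagrangian subspace, a Levi element `a` of the Siegel parabolic subgroup acts by
translation multiplied by the quadratic character of `det a`, and a unipotent element by the
standard quadratic exponential.) -/
noncomputable def weilRep (hB : IsSymplectic B) (hψ : ψ ≠ 1) :
    Representation ℂ (symplecticGroup B) (Fin (heisDim B ψ) → ℂ) :=
  have key : ∀ (g : symplecticGroup B) (T : Module.End ℂ (Fin (heisDim B ψ) → ℂ)), IsUnit T →
      (∀ x, T * heisRep B ψ x = heisRep B ψ (heisAct g x) * T) →
      (oddDet B ψ (intertwiner hB hψ g) * (evenDet B ψ (intertwiner hB hψ g))⁻¹) •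
        intertwiner hB hψ g = (oddDet B ψ T * (evenDet B ψ T)⁻¹) • T := fun g T hT h => by
    have hg := intertwiner_spec hB hψ g
    obtain ⟨c, hc, h1⟩ := intertwiner_unique g T (intertwiner hB hψ g) hT hg.1 h hg.2
    rw [h1, smul_smul, evenDet_smul hB hψ c hc]
  { toFun := fun g => (oddDet B ψ (intertwiner hB hψ g) *
      (evenDet B ψ (intertwiner hB hψ g))⁻¹) • intertwiner hB hψ g
    map_one' := by
      rw [key 1 1 isUnit_one fun x => by rw [one_mul, mul_one]; rfl]
      simp [oddDet, evenDet]
    map_mul' := fun g h => by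
      have hg := intertwiner_spec hB hψ g
      have hh := intertwiner_spec hB hψ h
      have h2 := evenDet_mul hB hψ _ (intertwiner hB hψ h) (heisParity_comm g _ hg.2)
      rw [key (g * h) (intertwiner hB hψ g * intertwiner hB hψ h) (hg.1.mul hh.1) fun x => by
        rw [mul_assoc, hh.2 x, ← mul_assoc, hg.2 (heisAct h x), mul_assoc]
        rfl, h2.1, h2.2, smul_mul_smul_comm, mul_inv]
      congr 1
      ring }

/-- The defining relation of the Weil representation. -/
theorem weilRep_intertwines (hB : IsSymplectic B) (hψ : ψ ≠ 1) (g : symplecticGroup B)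
    (x : Heisenberg B) :
    weilRep hB hψ g * heisRep B ψ x * weilRep hB hψ g⁻¹ = heisRep B ψ (heisAct g x) := by
  have h1 : weilRep hB hψ g * heisRep B ψ x = heisRep B ψ (heisAct g x) * weilRep hB hψ g := by
    change ((_ : ℂ) • intertwiner hB hψ g) * heisRep B ψ x =
      heisRep B ψ (heisAct g x) * ((_ : ℂ) • intertwiner hB hψ g)
    rw [smul_mul_assoc, mul_smul_comm, (intertwiner_spec hB hψ g).2 x]
  rw [h1, mul_assoc, ← map_mul, mul_inv_cancel, map_one, mul_one]

end Weil


/-! ### Hermitian spaces and their isometry groups -/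

open scoped Matrix

/-- `F` is the fixed field of the involution `star` of `D`: either the involution is trivial and
`D = F`, or `D` is a quadratic extension of `F` and the involution is its conjugation. -/
class IsFixedField (F D : Type*) [Field F] [Field D] [StarRing D] [Algebra F D] : Prop where
  fixed : ∀ x : D, star x = x ↔ x ∈ Set.range (algebraMap F D)

/-- A nondegenerate `ε`-hermitian form on the space `D^ι` of column vectors, given by its Gram
matrix `J`; the form is `(x, y) ↦ xᴴ J y`. -/
structure HermForm (D : Type*) [Field D] [StarRing D] (ε : ℤˣ) (ι : Type*) [Fintype ι]
    [DecidableEq ι] where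
  gram : Matrix ι ι D
  herm : gramᴴ = (ε : ℤ) • gram
  nondeg : IsUnit gram.det

namespace HermForm

section Basic

variable {D : Type*} [Field D] [StarRing D] {ε : ℤˣ} {ι : Type*} [Fintype ι] [DecidableEq ι]

/-- The form has no nonzero isotropic vector. -/
def Anisotropic (h : HermForm D ε ι) : Prop :=
  ∀ x : ι → D, star x ⬝ᵥ h.gram *ᵥ x = 0 → x = 0

/-- The isometry group of the form. -/
def isom (h : HermForm D ε ι) : Subgroup (GL ι D) where
  carrier := {g | (g : Matrix ι ι D)ᴴ * h.gram * (g : Matrix ι ι D) = h.gram}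
  one_mem' := by simp
  mul_mem' := fun {a b} ha hb => by
    simp only [Set.mem_ofPred_eq, Units.val_mul, Matrix.conjTranspose_mul] at *
    calc (b : Matrix ι ι D)ᴴ * (a : Matrix ι ι D)ᴴ * h.gram * ((a : Matrix ι ι D) * b)
        = (b : Matrix ι ι D)ᴴ * ((a : Matrix ι ι D)ᴴ * h.gram * (a : Matrix ι ι D)) * b := by
          simp only [Matrix.mul_assoc]
      _ = h.gram := by rw [ha, hb]
  inv_mem' := fun {a} ha => by
    simp only [Set.mem_ofPred_eq] at *
    have h1 : (a : Matrix ι ι D) * (↑a⁻¹ : Matrix ι ι D) = 1 := by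
      rw [← Units.val_mul]; simp
    have h2 : (↑a⁻¹ : Matrix ι ι D)ᴴ * (a : Matrix ι ι D)ᴴ = 1 := by
      rw [← Matrix.conjTranspose_mul, h1, Matrix.conjTranspose_one]
    calc (↑a⁻¹ : Matrix ι ι D)ᴴ * h.gram * (↑a⁻¹ : Matrix ι ι D)
        = (↑a⁻¹ : Matrix ι ι D)ᴴ * ((a : Matrix ι ι D)ᴴ * h.gram * (a : Matrix ι ι D)) *
            (↑a⁻¹ : Matrix ι ι D) := by rw [ha]
      _ = ((↑a⁻¹ : Matrix ι ι D)ᴴ * (a : Matrix ι ι D)ᴴ) * h.gram *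
            ((a : Matrix ι ι D) * (↑a⁻¹ : Matrix ι ι D)) := by simp only [Matrix.mul_assoc]
      _ = h.gram := by rw [h1, h2, one_mul, mul_one]

theorem isom_iff (h : HermForm D ε ι) (g : GL ι D) : g ∈ h.isom ↔
    (g : Matrix ι ι D)ᴴ * h.gram * (g : Matrix ι ι D) = h.gram := Iff.rfl

theorem isom_mul (h : HermForm D ε ι) {g : GL ι D} (hg : g ∈ h.isom) :
    h.gram * (g : Matrix ι ι D) = (↑g⁻¹ : Matrix ι ι D)ᴴ * h.gram := by
  have h1 : (↑g⁻¹ : Matrix ι ι D)ᴴ * (g : Matrix ι ι D)ᴴ = 1 := by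
    rw [← Matrix.conjTranspose_mul, ← Units.val_mul]; simp
  calc h.gram * (g : Matrix ι ι D)
      = ((↑g⁻¹ : Matrix ι ι D)ᴴ * (g : Matrix ι ι D)ᴴ) * h.gram * (g : Matrix ι ι D) := by
        rw [h1, one_mul]
    _ = (↑g⁻¹ : Matrix ι ι D)ᴴ * ((g : Matrix ι ι D)ᴴ * h.gram * (g : Matrix ι ι D)) := by
        simp only [Matrix.mul_assoc]
    _ = _ := by rw [hg]

/-- The determinant of an isometry, an element `z` of `D` with `z * star z = 1`. -/
def isomDet (h : HermForm D ε ι) : h.isom →* unitary D where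
  toFun g := ⟨(g.1 : Matrix ι ι D).det, by
    have h1 := congrArg Matrix.det ((h.isom_iff g.1).1 g.2)
    rw [Matrix.det_mul, Matrix.det_mul, Matrix.det_conjTranspose] at h1
    have h2 : star (g.1 : Matrix ι ι D).det * (g.1 : Matrix ι ι D).det = 1 := by
      apply mul_left_cancel₀ h.nondeg.ne_zero
      linear_combination h1
    exact Unitary.mem_iff.2 ⟨h2, by rw [mul_comm]; exact h2⟩⟩
  map_one' := by ext; simp
  map_mul' a b := by ext; simp

end Basic

end HermForm

theorem neg_one_ne_one_of_two {D : Type*} [Field D] [NeZero (2 : D)] : (-1 : D) ≠ 1 := by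
  intro h
  have h2 : (2 : D) = 0 := by linear_combination -h
  exact NeZero.ne (2 : D) h2

/-! ### The modified Weil representation of a dual pair -/

section DualPair

variable (F : Type*) {D : Type*} [Field F] [Field D] [StarRing D] [Algebra F D]
  [hFD : IsFixedField F D] {ε : ℤˣ} {ι ι' : Type*} [Fintype ι] [DecidableEq ι]
  [Fintype ι'] [DecidableEq ι'] (h : HermForm D ε ι) (h' : HermForm D (-ε) ι')

theorem star_algebraMap_of_fixed (c : F) : star (algebraMap F D c) = algebraMap F D c :=
  (IsFixedField.fixed _).2 ⟨c, rfl⟩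

/-- The symplectic form on `W ⊗ W' ≃ Hom_D(W, W')`, for `W = D^ι` and `W' = D^ι'`, namely
`(X, Y) ↦ Tr_{D/F} tr (X* Y)` where `X* = J⁻¹ Xᴴ J' : W' → W` is the adjoint of `X`. -/
noncomputable def pairForm : LinearMap.BilinForm F (Matrix ι' ι D) :=
  LinearMap.mk₂ F
    (fun X Y => Algebra.trace F D (Matrix.trace (h.gram⁻¹ * Xᴴ * h'.gram * Y)))
    (fun X X' Y => by
      simp [Matrix.conjTranspose_add, Matrix.mul_add, Matrix.add_mul])
    (fun c X Y => by
      have h1 : (c • X)ᴴ = c • Xᴴ := by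
        ext i j
        simp [Algebra.smul_def, star_algebraMap_of_fixed]
      rw [h1]
      simp)
    (fun X Y Y' => by simp [Matrix.mul_add])
    (fun c X Y => by simp)

theorem pairForm_apply (X Y : Matrix ι' ι D) : pairForm F h h' X Y =
    Algebra.trace F D (Matrix.trace (h.gram⁻¹ * Xᴴ * h'.gram * Y)) := rfl

/-- The involution as an automorphism of `D` over `F`. -/
def starAlgEquiv : D ≃ₐ[F] D :=
  AlgEquiv.ofRingEquiv (f := starRingAut) (fun c => star_algebraMap_of_fixed F c)

theorem pairForm_isSymplectic [Finite F] [Finite D] [NeZero (2 : F)] :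
    IsSymplectic (pairForm F h h') where
  alt X := by
    rw [pairForm_apply]
    set s := Matrix.trace (h.gram⁻¹ * Xᴴ * h'.gram * X) with hs
    have h1 : star s = -s := by
      rw [hs, ← Matrix.trace_conjTranspose]
      have e1 : (h.gram⁻¹)ᴴ = (ε : ℤ) • h.gram⁻¹ := by
        rw [Matrix.conjTranspose_nonsing_inv, h.herm]
        rcases Int.units_eq_one_or ε with rfl | rfl
        · simp
        · have hn : (-h.gram)⁻¹ = -h.gram⁻¹ :=
            Matrix.inv_eq_right_inv (by simp [Matrix.mul_nonsing_inv _ h.nondeg])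
          simp [hn]
      rw [Matrix.conjTranspose_mul, Matrix.conjTranspose_mul, Matrix.conjTranspose_mul,
        Matrix.conjTranspose_conjTranspose, e1, h'.herm]
      have e2 : Xᴴ * (((-ε : ℤˣ) : ℤ) • h'.gram * (X * (ε : ℤ) • h.gram⁻¹)) =
          -(Xᴴ * h'.gram * X * h.gram⁻¹) := by
        rcases Int.units_eq_one_or ε with rfl | rfl <;> simp [Matrix.mul_assoc]
      rw [e2, Matrix.trace_neg, Matrix.trace_mul_comm]
      simp only [Matrix.mul_assoc]
    have h2 : Algebra.trace F D (star s) = Algebra.trace F D s :=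
      Algebra.trace_eq_of_algEquiv (starAlgEquiv F) s
    rw [h1, map_neg] at h2
    have h3 : (2 : F) * Algebra.trace F D s = 0 := by linear_combination -h2
    exact (mul_eq_zero.1 h3).resolve_left (NeZero.ne 2)
  nondeg X hX := by
    have hfin : Module.Finite F D := Module.Finite.of_finite
    have h1 : ∀ Y : Matrix ι' ι D, Matrix.trace (h.gram⁻¹ * Xᴴ * h'.gram * Y) = 0 := by
      intro Y
      apply (traceForm_nondegenerate F D).1
      intro z
      have := hX (z • Y)
      rw [pairForm_apply] at this
      rw [Algebra.traceForm_apply, mul_comm]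
      simpa using this
    have h2 : h.gram⁻¹ * Xᴴ * h'.gram = 0 := by
      rw [Matrix.ext_iff_trace_mul_right]
      intro Y
      rw [h1 Y]
      simp
    have h3 : Xᴴ = 0 := by
      have := congrArg (fun A => h.gram * A * h'.gram⁻¹) h2
      simpa [Matrix.mul_assoc, Matrix.mul_nonsing_inv _ h'.nondeg,
        Matrix.mul_nonsing_inv_cancel_left _ _ h.nondeg] using this
    rw [← Matrix.conjTranspose_conjTranspose X, h3, Matrix.conjTranspose_zero]

/-- The action `X ↦ g' X g⁻¹` of the isometry groups on `Hom_D(W, W')`. -/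
def pairAct (p : GL ι D × GL ι' D) : Matrix ι' ι D ≃ₗ[F] Matrix ι' ι D where
  toFun X := (p.2 : Matrix ι' ι' D) * X * (↑p.1⁻¹ : Matrix ι ι D)
  invFun X := (↑p.2⁻¹ : Matrix ι' ι' D) * X * (p.1 : Matrix ι ι D)
  map_add' X Y := by simp [Matrix.mul_add, Matrix.add_mul]
  map_smul' c X := by simp
  left_inv X := by
    have h1 : (↑p.2⁻¹ : Matrix ι' ι' D) * (p.2 : Matrix ι' ι' D) = 1 := by
      rw [← Units.val_mul]; simp
    have h2 : (↑p.1⁻¹ : Matrix ι ι D) * (p.1 : Matrix ι ι D) = 1 := by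
      rw [← Units.val_mul]; simp
    calc (↑p.2⁻¹ : Matrix ι' ι' D) * ((p.2 : Matrix ι' ι' D) * X * (↑p.1⁻¹ : Matrix ι ι D)) *
          (p.1 : Matrix ι ι D)
        = ((↑p.2⁻¹ : Matrix ι' ι' D) * (p.2 : Matrix ι' ι' D)) * X *
          ((↑p.1⁻¹ : Matrix ι ι D) * (p.1 : Matrix ι ι D)) := by simp only [Matrix.mul_assoc]
      _ = X := by rw [h1, h2, Matrix.one_mul, Matrix.mul_one]
  right_inv X := by
    have h1 : (p.2 : Matrix ι' ι' D) * (↑p.2⁻¹ : Matrix ι' ι' D) = 1 := by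
      rw [← Units.val_mul]; simp
    have h2 : (p.1 : Matrix ι ι D) * (↑p.1⁻¹ : Matrix ι ι D) = 1 := by
      rw [← Units.val_mul]; simp
    calc (p.2 : Matrix ι' ι' D) * ((↑p.2⁻¹ : Matrix ι' ι' D) * X * (p.1 : Matrix ι ι D)) *
          (↑p.1⁻¹ : Matrix ι ι D)
        = ((p.2 : Matrix ι' ι' D) * (↑p.2⁻¹ : Matrix ι' ι' D)) * X *
          ((p.1 : Matrix ι ι D) * (↑p.1⁻¹ : Matrix ι ι D)) := by simp only [Matrix.mul_assoc]
      _ = X := by rw [h1, h2, Matrix.one_mul, Matrix.mul_one]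

/-- The homomorphism from the product of the isometry groups to the symplectic group of
`W ⊗ W'`. -/
def pairHom : h.isom × h'.isom →* symplecticGroup (pairForm F h h') where
  toFun p := ⟨pairAct F (p.1.1, p.2.1), fun X Y => by
    have e1 := (h'.isom_iff p.2.1).1 p.2.2
    have e2 := (h.isom_iff _).1 (h.isom.inv_mem p.1.2)
    rw [pairForm_apply, pairForm_apply]
    congr 1
    simp only [pairAct, LinearEquiv.coe_mk, LinearMap.coe_mk, AddHom.coe_mk]
    have e3 : h.gram⁻¹ * (↑(p.1.1)⁻¹ : Matrix ι ι D)ᴴ =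
        (p.1.1 : Matrix ι ι D) * h.gram⁻¹ := by
      have e4 := h.isom_mul p.1.2
      calc h.gram⁻¹ * (↑(p.1.1)⁻¹ : Matrix ι ι D)ᴴ
          = h.gram⁻¹ * ((↑(p.1.1)⁻¹ : Matrix ι ι D)ᴴ * h.gram) * h.gram⁻¹ := by
            simp [Matrix.mul_assoc, Matrix.mul_nonsing_inv _ h.nondeg]
        _ = _ := by
            rw [← e4, Matrix.nonsing_inv_mul_cancel_left _ _ h.nondeg]
    have e5 : h.gram⁻¹ * ((p.2.1 : Matrix ι' ι' D) * X * (↑(p.1.1)⁻¹ : Matrix ι ι D))ᴴ =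
        (p.1.1 : Matrix ι ι D) * h.gram⁻¹ * (Xᴴ * (p.2.1 : Matrix ι' ι' D)ᴴ) := by
      rw [Matrix.conjTranspose_mul, Matrix.conjTranspose_mul, ← Matrix.mul_assoc, e3]
    rw [e5]
    calc Matrix.trace ((p.1.1 : Matrix ι ι D) * h.gram⁻¹ *
            (Xᴴ * (p.2.1 : Matrix ι' ι' D)ᴴ) * h'.gram *
            ((p.2.1 : Matrix ι' ι' D) * Y * (↑(p.1.1)⁻¹ : Matrix ι ι D)))
        = Matrix.trace ((p.1.1 : Matrix ι ι D) * (h.gram⁻¹ * Xᴴ *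
            ((p.2.1 : Matrix ι' ι' D)ᴴ * h'.gram * (p.2.1 : Matrix ι' ι' D)) * Y *
            (↑(p.1.1)⁻¹ : Matrix ι ι D))) := by simp only [Matrix.mul_assoc]
      _ = Matrix.trace (h.gram⁻¹ * Xᴴ * h'.gram * Y * ((↑(p.1.1)⁻¹ : Matrix ι ι D) *
            (p.1.1 : Matrix ι ι D))) := by
          rw [e1, Matrix.trace_mul_comm]
          simp only [Matrix.mul_assoc]
      _ = _ := by
          rw [← Units.val_mul, inv_mul_cancel, Units.val_one, Matrix.mul_one]⟩
  map_one' := by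
    ext X
    simp [pairAct]
  map_mul' p q := by
    ext X
    simp [pairAct, Matrix.mul_assoc]

/-- The character of order two of the cyclic group `{z ∈ D | z * star z = 1}` of even order `2e`;
it is given by `z ↦ z ^ e`. -/
noncomputable def etaChar (D : Type*) [Field D] [StarRing D] [Finite D] [NeZero (2 : D)] :
    unitary D →* ℤˣ := by
  classical
  exact
  { toFun := fun z => if z ^ (Nat.card (unitary D) / 2) = 1 then 1 else -1
    map_one' := by simp
    map_mul' := fun z w => by
      have heven : 2 ∣ Nat.card (unitary D) := by
        have h1 : orderOf (-1 : unitary D) = 2 := by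
          apply orderOf_eq_prime
          · simp
          · intro h
            exact neg_one_ne_one_of_two (D := D) (congrArg Subtype.val h)
        rw [← h1]
        exact orderOf_dvd_natCard _
      have key : ∀ z : unitary D, z ^ (Nat.card (unitary D) / 2) = 1 ∨
          z ^ (Nat.card (unitary D) / 2) = -1 := by
        intro z
        have h1 : (z ^ (Nat.card (unitary D) / 2)) ^ 2 = 1 := by
          rw [← pow_mul, Nat.div_mul_cancel heven, pow_card_eq_one']
        have h2 : ((z ^ (Nat.card (unitary D) / 2) : unitary D) : D) ^ 2 = 1 := by
          have := congrArg Subtype.val h1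
          simpa using this
        rcases eq_or_eq_neg_of_sq_eq_sq _ 1 (h2.trans (one_pow 2).symm) with h3 | h3
        · exact Or.inl (Subtype.ext h3)
        · exact Or.inr (Subtype.ext h3)
      have hne : (-1 : unitary D) ≠ 1 := fun h =>
        neg_one_ne_one_of_two (D := D) (congrArg Subtype.val h)
      rw [mul_pow]
      rcases key z with hz | hz <;> rcases key w with hw | hw <;> simp [hz, hw, hne] }

end DualPair


section FlatRep

variable (F : Type*) {D : Type*} [Field F] [Field D] [StarRing D] [Algebra F D]
  [IsFixedField F D] [Finite F] [Finite D] [NeZero (2 : F)] {ε : ℤˣ} {ι ι' : Type*}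
  [Fintype ι] [DecidableEq ι] [Fintype ι'] [DecidableEq ι']

/-- For a unitary pair this is the character `η (det g) ^ n'` of the first isometry group, where
`η` is the character of order two of the norm one group of `D`. For a symplectic-orthogonal pair
it is the character `χ (det g) ^ (n' / 2)`, where `χ` is the quadratic character of `D`; recall
that `det g = ±1` and `χ (-1) = (-1) ^ ((q - 1) / 2)`. -/
noncomputable def flatChar (h : HermForm D ε ι) (n' : ℕ) : h.isom →* ℤˣ :=
  haveI : NeZero (2 : D) := ⟨fun h2 => NeZero.ne (2 : F) <| (algebraMap F D).injective <| by
    rw [map_ofNat, h2, map_zero]⟩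
  open Classical in
  (powMonoidHom (if ∀ x : D, star x = x then (Nat.card D - 1) / 2 * (n' / 2) else n')).comp
    ((etaChar D).comp h.isomDet)

/-- The modified Weil representation `ω♭` of the dual pair of isometry groups of `W = D^ι` and
`W' = D^ι'`: the restriction to the pair of the Weil representation of the symplectic group of
`W ⊗ W'`, multiplied by the characters of the two groups that make Levi subgroups act by
translations, without signs, in the mixed Schrödinger models. -/
noncomputable def flatRep (h : HermForm D ε ι) (h' : HermForm D (-ε) ι') {ψ : AddChar F ℂ}
    (hψ : ψ ≠ 1) :
    Representation ℂ (h.isom × h'.isom) (Fin (heisDim (pairForm F h h') ψ) → ℂ) where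
  toFun p := (((flatChar F h (Fintype.card ι') p.1 * flatChar F h' (Fintype.card ι) p.2 : ℤˣ) :
    ℤ) : ℂ) • weilRep (pairForm_isSymplectic F h h') hψ (pairHom F h h' p)
  map_one' := by simp
  map_mul' p q := by
    rw [smul_mul_smul_comm, ← map_mul, ← map_mul]
    congr 1
    simp only [Prod.fst_mul, Prod.snd_mul, map_mul, Units.val_mul, Int.cast_mul]
    ring

end FlatRep

/-! ### Witt towers, parabolic subgroups and Levi subgroups -/

/-- The indices of a hermitian basis `e_1, …, e_m`, anisotropic part, `f_1, …, f_m`. -/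
abbrev Idx (m d : ℕ) : Type := Fin m ⊕ Fin d ⊕ Fin m

section Tower

variable {D : Type*} [Field D] [StarRing D] {ε : ℤˣ} {d : ℕ}

/-- The Gram matrix of the orthogonal sum of the form `J₀` and `m` hyperbolic planes. -/
def towerGram (ε : ℤˣ) (J₀ : Matrix (Fin d) (Fin d) D) (m : ℕ) :
    Matrix (Idx m d) (Idx m d) D :=
  Matrix.of fun
    | .inl i, .inr (.inr j) => if i = j then 1 else 0
    | .inr (.inr i), .inl j => if i = j then ((ε : ℤ) : D) else 0
    | .inr (.inl a), .inr (.inl b) => J₀ a b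
    | _, _ => 0

/-- The member of index `m` of the Witt tower of `h₀`: the orthogonal sum of `h₀` and `m`
hyperbolic planes. If `h₀` is anisotropic, it has Witt index `m`. -/
def HermForm.tower (h₀ : HermForm D ε (Fin d)) (m : ℕ) : HermForm D ε (Idx m d) where
  gram := towerGram ε h₀.gram m
  herm := by
    have h1 : ((ε : ℤ) : D) * ((ε : ℤ) : D) = 1 := by
      rcases Int.units_eq_one_or ε with rfl | rfl <;> simp
    have h0 : ∀ a b, star (h₀.gram b a) = ((ε : ℤ) : D) * h₀.gram a b := fun a b => by
      have := congrFun (congrFun h₀.herm a) b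
      simpa using this
    ext r c
    rcases r with i | a | i <;> rcases c with j | b | j <;>
      simp [towerGram, Matrix.conjTranspose_apply, h0, apply_ite, eq_comm, h1] <;>
      split_ifs <;> simp_all
  nondeg := by
    have h1 : ((ε : ℤ) : D) * ((ε : ℤ) : D) = 1 := by
      rcases Int.units_eq_one_or ε with rfl | rfl <;> simp
    have h0 : ∀ a b, ∑ x, h₀.gram a x * h₀.gram⁻¹ x b = if a = b then 1 else 0 := fun a b => by
      rw [← Matrix.mul_apply, Matrix.mul_nonsing_inv _ h₀.nondeg, Matrix.one_apply]
    refine Matrix.isUnit_det_of_right_inverse (B := Matrix.of fun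
      | .inl i, .inr (.inr j) => if i = j then ((ε : ℤ) : D) else 0
      | .inr (.inr i), .inl j => if i = j then 1 else 0
      | .inr (.inl a), .inr (.inl b) => h₀.gram⁻¹ a b
      | _, _ => 0) ?_
    ext r c
    rcases r with i | a | i <;> rcases c with j | b | j <;>
      simp [towerGram, Matrix.mul_apply, h0, Matrix.one_apply, h1]

/-- The stabilizer of a subspace. -/
def stab {ι : Type*} [Fintype ι] [DecidableEq ι] (p : Submodule D (ι → D)) :
    Subgroup (GL ι D) where
  carrier := {g | ∀ x, (g : Matrix ι ι D) *ᵥ x ∈ p ↔ x ∈ p}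
  one_mem' := by simp
  mul_mem' := fun {a b} ha hb x => by
    rw [Units.val_mul, ← Matrix.mulVec_mulVec, ha, hb]
  inv_mem' := fun {a} ha x => by
    rw [← ha, Matrix.mulVec_mulVec, ← Units.val_mul]
    simp

/-- The totally isotropic subspace `X_k` spanned by `e_1, …, e_k`. -/
def isoX (D : Type*) [Field D] (m d k : ℕ) : Submodule D (Idx m d → D) :=
  Submodule.span D {x | ∃ j : Fin m, j.val < k ∧ x = Pi.single (Sum.inl j) 1}

/-- The totally isotropic subspace spanned by `f_1, …, f_k`, dual to `X_k`. -/
def isoY (D : Type*) [Field D] (m d k : ℕ) : Submodule D (Idx m d → D) :=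
  Submodule.span D {x | ∃ j : Fin m, j.val < k ∧ x = Pi.single (Sum.inr (Sum.inr j)) 1}

set_option linter.unusedSectionVars false in
theorem stab_isoX_entry {m k : ℕ} {g : GL (Idx m d) D} (hg : g ∈ stab (isoX D m d k))
    {j : Fin m} (hj : j.val < k) {c : Idx m d} (hc : ∀ i : Fin m, i.val < k → c ≠ Sum.inl i) :
    (g : Matrix (Idx m d) (Idx m d) D) c (Sum.inl j) = 0 := by
  have h1 : (g : Matrix (Idx m d) (Idx m d) D) *ᵥ Pi.single (Sum.inl j) 1 ∈ isoX D m d k :=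
    (hg _).2 (Submodule.subset_span ⟨j, hj, rfl⟩)
  have h2 : isoX D m d k ≤ LinearMap.ker (LinearMap.proj (R := D) (φ := fun _ => D) c) := by
    refine Submodule.span_le.2 ?_
    rintro _ ⟨i, hi, rfl⟩
    simp [hc i hi]
  simpa using h2 h1

variable (h₀ : HermForm D ε (Fin d)) {m : ℕ}

/-- The parabolic subgroup `P_k`, the stabilizer of `X_k` in the isometry group `G_m`. -/
def parab (m k : ℕ) : Subgroup (h₀.tower m).isom :=
  (stab (isoX D m d k)).comap (h₀.tower m).isom.subtype

/-- The standard Levi subgroup `M_k ≃ GL_k × G_{m-k}` of `P_k`: the stabilizer of `e_1, …, e_k`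
and of `f_1, …, f_k` (of their spans). -/
def levi (m k : ℕ) : Subgroup (h₀.tower m).isom :=
  parab h₀ m k ⊓ (stab (isoY D m d k)).comap (h₀.tower m).isom.subtype

theorem levi_le (m k : ℕ) : levi h₀ m k ≤ parab h₀ m k := inf_le_left

theorem parab_entry {k : ℕ} {g : (h₀.tower m).isom} (hg : g ∈ parab h₀ m k)
    {j : Fin m} (hj : j.val < k) {b : Idx m d}
    (hb : ∀ i : Fin m, i.val < k → b ≠ Sum.inr (Sum.inr i)) :
    (g.1 : Matrix (Idx m d) (Idx m d) D) (Sum.inr (Sum.inr j)) b = 0 := by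
  have h1 := congrFun (congrFun ((h₀.tower m).isom_mul g.2) (Sum.inl j)) b
  have hinv : (g.1)⁻¹ ∈ stab (isoX D m d k) := (stab _).inv_mem hg
  have h2 : ((h₀.tower m).gram * (g.1 : Matrix (Idx m d) (Idx m d) D)) (Sum.inl j) b =
      (g.1 : Matrix (Idx m d) (Idx m d) D) (Sum.inr (Sum.inr j)) b := by
    simp [Matrix.mul_apply, HermForm.tower, towerGram]
  rw [← h2, h1, Matrix.mul_apply]
  refine Finset.sum_eq_zero fun c _ => ?_
  by_cases hc : ∃ i : Fin m, i.val < k ∧ c = Sum.inl i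
  · obtain ⟨i, hi, rfl⟩ := hc
    have h3 : (h₀.tower m).gram (Sum.inl i) b = 0 := by
      rcases b with b | b | b
      · simp [HermForm.tower, towerGram]
      · simp [HermForm.tower, towerGram]
      · have : i ≠ b := fun h => hb i hi (by rw [h])
        simp [HermForm.tower, towerGram, this]
    rw [h3, mul_zero]
  · push Not at hc
    rw [Matrix.conjTranspose_apply, stab_isoX_entry hinv hj hc, star_zero, zero_mul]

/-- The homomorphism to `GL` given by a diagonal block, for block triangular matrices. -/
def blockHom {Γ ι κ : Type*} [Group Γ] [Fintype ι] [DecidableEq ι] [Fintype κ] [DecidableEq κ]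
    (φ : Γ →* GL ι D) (e : κ → ι) (he : Function.Injective e)
    (H : ∀ a b i j c, c ∉ Set.range e →
      (φ a : Matrix ι ι D) (e i) c * (φ b : Matrix ι ι D) c (e j) = 0) : Γ →* GL κ D :=
  MonoidHom.toHomUnits
    { toFun := fun g => (φ g : Matrix ι ι D).submatrix e e
      map_one' := by
        ext i j
        simp [Matrix.one_apply, he.eq_iff]
      map_mul' := fun a b => by
        ext i j
        rw [Matrix.submatrix_apply, map_mul, Units.val_mul, Matrix.mul_apply, Matrix.mul_apply]
        exact (Finset.sum_of_injOn e he.injOn (by simp)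
          (fun c _ hc => H a b i j c (by simpa using hc)) (fun _ _ => rfl)).symm }

set_option linter.unusedSectionVars false in
theorem blockHom_apply {Γ ι κ : Type*} [Group Γ] [Fintype ι] [DecidableEq ι] [Fintype κ]
    [DecidableEq κ] (φ : Γ →* GL ι D) (e : κ → ι) (he : Function.Injective e)
    (H : ∀ a b i j c, c ∉ Set.range e →
      (φ a : Matrix ι ι D) (e i) c * (φ b : Matrix ι ι D) c (e j) = 0) (g : Γ) :
    (blockHom φ e he H g : Matrix κ κ D) = (φ g : Matrix ι ι D).submatrix e e := rfl

/-- The index of the basis vector `e_{s+j}` of `W_m`, for `j = 1, …, i`. -/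
def idxX (m d s i : ℕ) (hi : s + i ≤ m) (j : Fin i) : Idx m d :=
  Sum.inl ⟨s + j.val, by omega⟩

/-- The indices of the orthogonal complement `W_{m-k}` of the first `k` hyperbolic planes. -/
def idxW (m d k : ℕ) : Idx (m - k) d → Idx m d
  | .inl j => .inl ⟨k + j.val, by omega⟩
  | .inr (.inl a) => .inr (.inl a)
  | .inr (.inr j) => .inr (.inr ⟨k + j.val, by omega⟩)

theorem idxX_injective (m d s i : ℕ) (hi : s + i ≤ m) :
    Function.Injective (idxX m d s i hi) := by
  intro a b h
  simpa [idxX, Fin.ext_iff] using h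

theorem idxW_injective (m d k : ℕ) : Function.Injective (idxW m d k) := by
  rintro (a | a | a) (b | b | b) h <;> simp_all [idxW, Fin.ext_iff]

theorem idxW_ne_inl (m d k : ℕ) (a : Idx (m - k) d) (i : Fin m) (hi : i.val < k) :
    idxW m d k a ≠ Sum.inl i := by
  rcases a with a | a | a <;> simp [idxW, Fin.ext_iff]; omega

theorem idxW_ne_inr (m d k : ℕ) (a : Idx (m - k) d) (i : Fin m) (hi : i.val < k) :
    idxW m d k a ≠ Sum.inr (Sum.inr i) := by
  rcases a with a | a | a <;> simp [idxW, Fin.ext_iff]; omega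

theorem notMem_range_idxW {m k : ℕ} {c : Idx m d} (hc : c ∉ Set.range (idxW m d k)) :
    (∃ i : Fin m, i.val < k ∧ c = Sum.inl i) ∨
      ∃ i : Fin m, i.val < k ∧ c = Sum.inr (Sum.inr i) := by
  rcases c with i | a | i
  · refine Or.inl ⟨i, ?_, rfl⟩
    by_contra h
    exact hc ⟨Sum.inl ⟨i.val - k, by omega⟩, by simp [idxW, Fin.ext_iff]; omega⟩
  · exact absurd ⟨Sum.inr (Sum.inl a), rfl⟩ hc
  · refine Or.inr ⟨i, ?_, rfl⟩
    by_contra h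
    exact hc ⟨Sum.inr (Sum.inr ⟨i.val - k, by omega⟩), by simp [idxW, Fin.ext_iff]; omega⟩

/-- The action of `P_k` on `X_k`, as a homomorphism `P_k → GL_k`. -/
def toGL (k : ℕ) (hk : k ≤ m) : parab h₀ m k →* GL (Fin k) D :=
  blockHom ((h₀.tower m).isom.subtype.comp (parab h₀ m k).subtype)
    (idxX m d 0 k (by omega)) (idxX_injective _ _ _ _ _) fun a b i j c hc => by
      have h1 : ∀ i : Fin m, i.val < k → c ≠ Sum.inl i := by
        rintro i hi rfl
        exact hc ⟨⟨i.val, hi⟩, by simp [idxX]⟩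
      have h2 := stab_isoX_entry (g := b.1.1) b.2 (j := ⟨0 + j.val, by omega⟩)
        (by simp) h1
      exact mul_eq_zero_of_right _ h2

/-- The action of `P_k` on `X_k^⊥ / X_k ≃ W_{m-k}`, as a homomorphism to `GL(W_{m-k})`. -/
def toGLW (k : ℕ) : parab h₀ m k →* GL (Idx (m - k) d) D :=
  blockHom ((h₀.tower m).isom.subtype.comp (parab h₀ m k).subtype)
    (idxW m d k) (idxW_injective _ _ _) fun a b i j c hc => by
      rcases notMem_range_idxW hc with ⟨x, hx, rfl⟩ | ⟨x, hx, rfl⟩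
      · exact mul_eq_zero_of_left
          (stab_isoX_entry (g := a.1.1) a.2 hx fun y hy => idxW_ne_inl _ _ _ _ y hy) _
      · exact mul_eq_zero_of_right _
          (parab_entry h₀ b.2 hx fun y hy => idxW_ne_inr _ _ _ _ y hy)

theorem tower_gram_idxW (k : ℕ) (a b : Idx (m - k) d) :
    (h₀.tower m).gram (idxW m d k a) (idxW m d k b) = (h₀.tower (m - k)).gram a b := by
  rcases a with a | a | a <;> rcases b with b | b | b <;>
    simp [HermForm.tower, towerGram, idxW, Fin.ext_iff]

theorem toGLW_mem (k : ℕ) (g : parab h₀ m k) : toGLW h₀ k g ∈ (h₀.tower (m - k)).isom := by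
  rw [HermForm.isom_iff]
  ext a b
  have h1 := congrFun (congrFun (((h₀.tower m).isom_iff _).1 g.1.2) (idxW m d k a)) (idxW m d k b)
  rw [tower_gram_idxW] at h1
  rw [← h1, Matrix.mul_assoc, Matrix.mul_assoc, Matrix.mul_apply, Matrix.mul_apply]
  have hY : ∀ x : Fin m, x.val < k → ∀ b,
      (g.1.1 : Matrix (Idx m d) (Idx m d) D) (Sum.inr (Sum.inr x)) (idxW m d k b) = 0 :=
    fun x hx b => parab_entry h₀ g.2 hx fun y hy => idxW_ne_inr _ _ _ _ y hy
  have hcol : ∀ c : Idx (m - k) d,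
      ((h₀.tower (m - k)).gram *
        (toGLW h₀ k g : Matrix (Idx (m - k) d) (Idx (m - k) d) D)) c b =
      ((h₀.tower m).gram * (g.1.1 : Matrix (Idx m d) (Idx m d) D)) (idxW m d k c)
        (idxW m d k b) := by
    intro c
    rw [Matrix.mul_apply, Matrix.mul_apply]
    refine Finset.sum_of_injOn (idxW m d k) (idxW_injective _ _ _).injOn (by simp) ?_ ?_
    · intro x _ hx
      rcases notMem_range_idxW (by simpa using hx) with ⟨y, hy, rfl⟩ | ⟨y, hy, rfl⟩
      · refine mul_eq_zero_of_left ?_ _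
        rcases c with c | c | c <;> simp [HermForm.tower, towerGram, idxW, Fin.ext_iff]
        omega
      · exact mul_eq_zero_of_right _ (hY y hy b)
    · intro x _
      rw [tower_gram_idxW]
      rfl
  refine Finset.sum_of_injOn (idxW m d k) (idxW_injective _ _ _).injOn (by simp) ?_ ?_
  · intro x _ hx
    rcases notMem_range_idxW (by simpa using hx) with ⟨y, hy, rfl⟩ | ⟨y, hy, rfl⟩
    · refine mul_eq_zero_of_right _ ?_
      have : ((h₀.tower m).gram * (g.1.1 : Matrix (Idx m d) (Idx m d) D)) (Sum.inl y)
          (idxW m d k b) =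
          (g.1.1 : Matrix (Idx m d) (Idx m d) D) (Sum.inr (Sum.inr y)) (idxW m d k b) := by
        simp [Matrix.mul_apply, HermForm.tower, towerGram]
      rw [this, hY y hy b]
    · refine mul_eq_zero_of_left ?_ _
      rw [Matrix.conjTranspose_apply, hY y hy a, star_zero]
  · intro c _
    rw [hcol c]
    rfl

/-- The homomorphism `P_k → G_{m-k}`. -/
def toIsom (k : ℕ) : parab h₀ m k →* (h₀.tower (m - k)).isom :=
  (toGLW h₀ k).codRestrict _ (toGLW_mem h₀ k)

/-- The unipotent radical `N_k` of `P_k`, the kernel of `P_k → GL_k × G_{m-k}`. -/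
def unipRad (k : ℕ) (hk : k ≤ m) : Subgroup (parab h₀ m k) :=
  ((toGL h₀ k hk).prod (toIsom h₀ k)).ker

instance (k : ℕ) (hk : k ≤ m) : (unipRad h₀ k hk).Normal := MonoidHom.normal_ker _

/-- The subgroup `Q_j G_{m-k}` of `M_k = GL_k × G_{m-k}`, the stabilizer of `X_j ⊆ X_k`. -/
def leviParab (m k j : ℕ) : Subgroup (levi h₀ m k) :=
  (parab h₀ m j).subgroupOf (levi h₀ m k)

/-- The homomorphism `Q_{k-i} G_{m-k} → GL_i` given by the action on `X_k / X_{k-i}`, that is the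
lower right block of size `i` of the component in `Q_{k-i}`. -/
def leviParabGL (k i : ℕ) (hk : k ≤ m) (hi : i ≤ k) :
    leviParab h₀ m k (k - i) →* GL (Fin i) D :=
  blockHom ((h₀.tower m).isom.subtype.comp ((levi h₀ m k).subtype.comp
    (leviParab h₀ m k (k - i)).subtype))
    (idxX m d (k - i) i (by omega)) (idxX_injective _ _ _ _ _) fun a b x y c hc => by
      by_cases h1 : ∃ j : Fin m, j.val < k ∧ c = Sum.inl j
      · obtain ⟨j, hj, rfl⟩ := h1
        have h2 : j.val < k - i := by
          by_contra h
          exact hc ⟨⟨j.val - (k - i), by omega⟩, by simp [idxX, Fin.ext_iff]; omega⟩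
        refine mul_eq_zero_of_left (stab_isoX_entry (g := a.1.1.1) a.2 h2 fun z hz => ?_) _
        simp [idxX, Fin.ext_iff]
        omega
      · push Not at h1
        have h2 := stab_isoX_entry (g := b.1.1.1) (levi_le h₀ m k b.1.2)
          (j := ⟨k - i + y.val, by omega⟩) (by simp; omega) h1
        exact mul_eq_zero_of_right _ h2

/-- The homomorphism `Q_j G_{m-k} → G_{m-k}`. -/
def leviParabIsom (k j : ℕ) : leviParab h₀ m k j →* (h₀.tower (m - k)).isom :=
  (toIsom h₀ k).comp ((Subgroup.inclusion (levi_le h₀ m k)).comp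
    (leviParab h₀ m k j).subtype)

end Tower

/-! ### Parabolic restriction and the successive quotients -/

/-- The representation `R_G` of `G × G` on the functions on `G`. -/
def regRep (G : Type*) [Group G] : Representation ℂ (G × G) (G → ℂ) where
  toFun p :=
    { toFun := fun f x => f (p.1⁻¹ * x * p.2)
      map_add' := fun _ _ => rfl
      map_smul' := fun _ _ => rfl }
  map_one' := by ext; simp
  map_mul' p q := by
    ext f x
    simp [mul_assoc]

section Main

variable (F : Type*) {D : Type*} [Field F] [Field D] [StarRing D] [Algebra F D]
  [IsFixedField F D] [Finite F] [Finite D] [NeZero (2 : F)] {ε : ℤˣ} {d d' : ℕ}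
  (h₀ : HermForm D ε (Fin d)) (h₀' : HermForm D (-ε) (Fin d')) {ψ : AddChar F ℂ} (hψ : ψ ≠ 1)
  (m m' : ℕ)

/-- The representation `ω♭_{m,m'}` of `G_m × G'_{m'}`. -/
noncomputable abbrev omegaFlat :
    Representation ℂ ((h₀.tower m).isom × (h₀'.tower m').isom)
      (Fin (heisDim (pairForm F (h₀.tower m) (h₀'.tower m')) ψ) → ℂ) :=
  flatRep F (h₀.tower m) (h₀'.tower m') hψ

/-- The parabolic restriction of `ω♭_{m,m'}` to `M_k × G'_{m'}`: the coinvariants of `N_k`. -/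
noncomputable def restrictLeft (k : ℕ) (hk : k ≤ m) :=
  show Representation ℂ (levi h₀ m k × (h₀'.tower m').isom) _ from
  (Representation.toCoinvariants ((omegaFlat F h₀ h₀' hψ m m').comp
      ((parab h₀ m k).subtype.prodMap (MonoidHom.id (h₀'.tower m').isom)))
    ((unipRad h₀ k hk).prod ⊥)).comp
    ((Subgroup.inclusion (levi_le h₀ m k)).prodMap (MonoidHom.id (h₀'.tower m').isom))

/-- The parabolic restriction of `ω♭_{m,m'}` to `G_m × M'_{k'}`: the coinvariants of `N'_{k'}`. -/
noncomputable def restrictRight (k' : ℕ) (hk' : k' ≤ m') :=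
  show Representation ℂ ((h₀.tower m).isom × levi h₀' m' k') _ from
  (Representation.toCoinvariants ((omegaFlat F h₀ h₀' hψ m m').comp
      ((MonoidHom.id (h₀.tower m).isom).prodMap (parab h₀' m' k').subtype))
    ((⊥ : Subgroup (h₀.tower m).isom).prod (unipRad h₀' k' hk'))).comp
    ((MonoidHom.id (h₀.tower m).isom).prodMap (Subgroup.inclusion (levi_le h₀' m' k')))

/-- The representation `R_{GL_i} ⊗ ω♭_{m-k,m'-i}` of `Q_{k-i} G_{m-k} × P'_i`. -/
noncomputable def gradedLeft (k i : ℕ) (hk : k ≤ m) (hi : i ≤ k) (hi' : i ≤ m') :=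
  show Representation ℂ ((leviParab h₀ m k (k - i)).prod (parab h₀' m' i)) _ from
  (Representation.tprod
    ((regRep (GL (Fin i) D)).comp ((leviParabGL h₀ k i hk hi).prodMap (toGL h₀' i hi')))
    ((omegaFlat F h₀ h₀' hψ (m - k) (m' - i)).comp
      ((leviParabIsom h₀ k (k - i)).prodMap (toIsom h₀' i)))).comp
    (Subgroup.prodEquiv (leviParab h₀ m k (k - i)) (parab h₀' m' i)).toMonoidHom

/-- The representation `R_{GL_i} ⊗ ω♭_{m-i,m'-k'}` of `P_i × Q'_{k'-i} G'_{m'-k'}`. -/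
noncomputable def gradedRight (k' i : ℕ) (hk' : k' ≤ m') (hi' : i ≤ k') (hi : i ≤ m) :=
  show Representation ℂ ((parab h₀ m i).prod (leviParab h₀' m' k' (k' - i))) _ from
  (Representation.tprod
    ((regRep (GL (Fin i) D)).comp ((toGL h₀ i hi).prodMap (leviParabGL h₀' k' i hk' hi')))
    ((omegaFlat F h₀ h₀' hψ (m - i) (m' - k')).comp
      ((toIsom h₀ i).prodMap (leviParabIsom h₀' k' (k' - i))))).comp
    (Subgroup.prodEquiv (parab h₀ m i) (leviParab h₀' m' k' (k' - i))).toMonoidHom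

/-- `Ind` from `Q_{k-i} G_{m-k} × P'_i` to `M_k × G'_{m'}` of `R_{GL_i} ⊗ ω♭_{m-k,m'-i}`. For finite
groups, `Representation.coind` is the induced representation: functions `f` on the group with
`f (h x) = σ(h) f(x)`, on which the group acts by right translations. -/
noncomputable def indLeft (k i : ℕ) (hk : k ≤ m) (hi : i ≤ k) (hi' : i ≤ m') :=
  Representation.coind ((leviParab h₀ m k (k - i)).prod (parab h₀' m' i)).subtype
    (gradedLeft F h₀ h₀' hψ m m' k i hk hi hi')

/-- `Ind` from `P_i × Q'_{k'-i} G'_{m'-k'}` to `G_m × M'_{k'}` of `R_{GL_i} ⊗ ω♭_{m-i,m'-k'}`. -/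
noncomputable def indRight (k' i : ℕ) (hk' : k' ≤ m') (hi' : i ≤ k') (hi : i ≤ m) :=
  Representation.coind ((parab h₀ m i).prod (leviParab h₀' m' k' (k' - i))).subtype
    (gradedRight F h₀ h₀' hψ m m' k' i hk' hi' hi)

end Main

/-- The subquotient `B / (A ∩ B)` of a representation. -/
def Subrepresentation.subquotient {G V : Type*} [Monoid G] [AddCommGroup V] [Module ℂ V]
    {ρ : Representation ℂ G V} (A B : Subrepresentation ρ) :
    Representation ℂ G (B.toSubmodule ⧸ A.toSubmodule.submoduleOf B.toSubmodule) :=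
  B.toRepresentation.quotient _ fun g _ hv => A.apply_mem_toSubmodule g hv

/-- `ρ` has an invariant filtration `0 = τ_0 ⊆ τ_1 ⊆ ⋯ ⊆ τ_{r+1} = ρ` with successive quotients
`τ_{i+1} / τ_i ≃ σ_i`, for `i = 0, …, r`. -/
def HasFiltration {G V : Type*} [Monoid G] [AddCommGroup V] [Module ℂ V]
    (ρ : Representation ℂ G V) {r : ℕ} {U : Fin (r + 1) → Type*} [∀ i, AddCommMonoid (U i)]
    [∀ i, Module ℂ (U i)] (σ : ∀ i, Representation ℂ G (U i)) : Prop :=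
  ∃ τ : Fin (r + 2) → Subrepresentation ρ, Monotone τ ∧ τ 0 = ⊥ ∧ τ (Fin.last (r + 1)) = ⊤ ∧
    ∀ i : Fin (r + 1),
      Nonempty (((τ i.castSucc).subquotient (τ i.succ)).Equiv (σ i))

theorem le_left_of_fin {a b : ℕ} (i : Fin (min a b + 1)) : i.val ≤ a :=
  (Nat.le_of_lt_succ i.isLt).trans (min_le_left a b)

theorem le_right_of_fin {a b : ℕ} (i : Fin (min a b + 1)) : i.val ≤ b :=
  (Nat.le_of_lt_succ i.isLt).trans (min_le_right a b)

/-! Write `W = X ⊕ W₁ ⊕ Y` with `X = X_k`, `W₁ = W_{m-k}` and `Y` dual to `X`, and let `N = N_k`.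
All groups are finite, so the coinvariants of `N` can be studied through the vectors fixed by `N`.
The isotropic subspace `Hom(Y, W')` of `Hom(W, W')` acts on the Heisenberg representation through
characters indexed by the homomorphisms `y : X → W'`. This is the mixed Schrödinger model, with one
component for each `y`. The component of `y = 0` is `ω♭` of the pair `(W₁, W')`, and `N` acts
trivially on it; the other components are its translates under the Heisenberg group.

The elements of `N` that are trivial on `W₁` act on the component of `y` through values of `ψ` at
traces that involve `yᴴ J' y`. Hence a vector fixed by `N` has components only at those `y` whose
image is totally isotropic (`HypSplit.eq_zero_of_unip_fixed`). By Witt's theorem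
(`exists_isom_mul_eq_X`) the orbits of `M_k × G'` on these `y` are classified by the rank `i`, and
the anisotropy of `W'_0` gives `i ≤ m'`. A representative is `partialIso`, which kills `X_{k-i}` and
maps `X_k / X_{k-i}` onto `X'_i`. In its component a vector fixed by `N` is, up to the translation,
fixed by the larger isotropic space `HypSplit.isoSub` (`HypSplit.fixed_of_unip_fixed`), and the
fixed vectors of this space form `ω♭_{m-k,m'-i}`. The stabilizer of `partialIso` consists of the
pairs in `Q_{k-i} G_{m-k} × P'_i` with the same image in `GL_i`, and induction from it to this group
produces the factor `R_{GL_i}`. So each orbit contributes one induced representation.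
`coinvariants_equiv_directSum` is the abstract form of this argument and `exists_mackey_data`
provides its input. The filtration is then read off from the direct sum.

The delicate point is the scalars. The Weil representation is not given by formulas but normalized
by the equality of the determinants on even and odd vectors. From this, `exists_weilRep_embedding`
deduces that the vectors fixed by an isotropic subspace `A` of `V` carry the Weil representation of
`A^⊥ / A` multiplied by the sign of the permutation of `V / A^⊥`. The sign comes from the components
other than the one of `0`, by a variant of Gauss's lemma (`sign_eq_neg_one_pow_halfFlips`,
`projDet_even_eq_sign_mul_projDet_odd`). For a dual pair it is a product of quadratic characters of
determinants, and the twist in `ω♭` cancels it (`etaChar_compare`,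
`HypSplit.exists_flatRep_embedding`).

Part b) is part a) for the pair with its members exchanged; the adjoint `X ↦ X*` identifies the two
Weil representations (`exists_flatRep_swap`). -/

set_option linter.unusedSectionVars false

/-! ### Filtrations from direct sums. -/

section Filtration

/-- The partial sums of a direct sum form the filtration: `τ j` consists of the vectors whose
components of index at least `j` vanish, and the `i`-th component induces the isomorphism of the
`i`-th quotient. -/
theorem hasFiltration_of_equiv {G V : Type*} [Monoid G] [AddCommGroup V] [Module ℂ V]
    (ρ : Representation ℂ G V) {r : ℕ} {U : Fin (r + 1) → Type*} [∀ i, AddCommMonoid (U i)]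
    [∀ i, Module ℂ (U i)] (σ : ∀ i, Representation ℂ G (U i))
    (e : ρ.Equiv (Representation.directSum σ)) : HasFiltration ρ σ := by
  classical
  let _ : ∀ i, AddCommGroup (U i) := fun i => Module.addCommMonoidToAddCommGroup ℂ
  let c : ∀ i, V →ₗ[ℂ] U i := fun i => (DirectSum.component ℂ _ U i).comp e.toLinearMap
  have hc : ∀ i g v, c i (ρ g v) = σ i g (c i v) := by
    intro i g v
    simp only [c, LinearMap.comp_apply]
    have := e.toIntertwiningMap.isIntertwining _ _ g v
    change DirectSum.component ℂ _ U i (e (ρ g v)) = σ i g (DirectSum.component ℂ _ U i (e v))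
    change DirectSum.component ℂ _ U i (e.toIntertwiningMap (ρ g v)) = _
    rw [this]
    rfl
  have hz : ∀ v, (∀ i, c i v = 0) → v = 0 := by
    intro v h
    apply e.toLinearEquiv.injective
    rw [map_zero]
    exact DFinsupp.ext h
  have hs : ∀ i (u : U i), ∃ v, c i v = u ∧ ∀ j, j ≠ i → c j v = 0 := by
    intro i u
    refine ⟨e.toLinearEquiv.symm (DirectSum.lof ℂ _ U i u), ?_, fun j hj => ?_⟩
    · change DirectSum.component ℂ _ U i (e.toLinearEquiv (e.toLinearEquiv.symm _)) = _
      rw [LinearEquiv.apply_symm_apply, DirectSum.component.lof_self]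
    · change DirectSum.component ℂ _ U j (e.toLinearEquiv (e.toLinearEquiv.symm _)) = _
      rw [LinearEquiv.apply_symm_apply, DirectSum.component.of]
      simp [hj.symm]
  let τ : Fin (r + 2) → Subrepresentation ρ := fun j =>
    { toSubmodule := ⨅ i : {i : Fin (r + 1) // j ≤ i.castSucc}, LinearMap.ker (c i)
      apply_mem_toSubmodule := fun g v hv => by
        simp only [Submodule.mem_iInf, LinearMap.mem_ker] at hv ⊢
        intro i
        rw [hc, hv i, map_zero] }
  have hτ : ∀ j v, v ∈ (τ j).toSubmodule ↔ ∀ i : Fin (r + 1), j ≤ i.castSucc → c i v = 0 := by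
    intro j v
    simp [τ, Submodule.mem_iInf]
  refine ⟨τ, fun a b hab v hv => ?_, ?_, ?_, fun i => ?_⟩
  · exact (hτ _ _).2 fun i hi => (hτ _ _).1 hv i (hab.trans hi)
  · apply Subrepresentation.toSubmodule_injective
    refine (Submodule.eq_bot_iff _).2 fun v hv => hz v fun i => (hτ _ _).1 hv i (Fin.zero_le _)
  · apply Subrepresentation.toSubmodule_injective
    refine (Submodule.eq_top_iff').2 fun v => (hτ _ _).2 fun i hi => ?_
    exact absurd hi (not_le.2 (Fin.castSucc_lt_last i))
  · let f : (τ i.succ).toSubmodule →ₗ[ℂ] U i := (c i).comp (τ i.succ).toSubmodule.subtype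
    have hk : LinearMap.ker f =
        (τ i.castSucc).toSubmodule.submoduleOf (τ i.succ).toSubmodule := by
      ext ⟨v, hv⟩
      rw [LinearMap.mem_ker]
      refine Iff.trans ?_ (hτ _ v).symm
      constructor
      · intro h j hj
        rcases eq_or_lt_of_le (Fin.castSucc_le_castSucc_iff.1 hj) with h1 | h1
        · rw [← h1]; exact h
        · exact (hτ _ _).1 hv j (Fin.succ_le_castSucc_iff.2 h1)
      · intro h
        exact h i le_rfl
    have hf : Function.Surjective f := by
      intro u
      obtain ⟨v, h1, h2⟩ := hs i u
      exact ⟨⟨v, (hτ _ _).2 fun j hj => h2 j (Fin.succ_le_castSucc_iff.1 hj).ne'⟩, h1⟩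
    let E := (Submodule.quotEquivOfEq _ _ hk.symm).trans (f.quotKerEquivOfSurjective hf)
    refine ⟨Representation.Equiv.mk E fun g => ?_⟩
    refine Submodule.linearMap_qext _ (LinearMap.ext fun v => ?_)
    exact hc i g v.1

end Filtration

/-! ### Coinvariants as sums of induced representations. -/

section Mackey

open TensorProduct DirectSum

variable {C T : Type*} [AddCommGroup T] [Module ℂ T]

/-- Evaluation at `x`, a linear map from the `T`-valued functions on `C` to `T`. -/
noncomputable def evalTensor (x : C) : (C → ℂ) ⊗[ℂ] T →ₗ[ℂ] T :=
  TensorProduct.lift ((LinearMap.lsmul ℂ T).comp (LinearMap.proj x))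

theorem evalTensor_tmul (x : C) (f : C → ℂ) (t : T) : evalTensor x (f ⊗ₜ[ℂ] t) = f x • t := rfl

/-- For finite `C` the tensor product is the space of `T`-valued functions on `C`, and the delta
functions give its coordinates. -/
theorem evalTensor_decomp [Fintype C] [DecidableEq C] (z : (C → ℂ) ⊗[ℂ] T) :
    z = ∑ x, (Pi.single x (1 : ℂ)) ⊗ₜ[ℂ] evalTensor x z := by
  induction z with
  | zero => simp
  | add a b ha hb =>
    conv_lhs => rw [ha, hb]
    simp [TensorProduct.tmul_add, Finset.sum_add_distrib]
  | tmul f t =>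
    simp only [evalTensor_tmul, TensorProduct.tmul_smul]
    simp only [TensorProduct.smul_tmul', ← TensorProduct.sum_tmul]
    congr 1
    ext y
    simp [Pi.single_apply]

theorem evalTensor_ext [Finite C] (z w : (C → ℂ) ⊗[ℂ] T)
    (h : ∀ x, evalTensor x z = evalTensor x w) : z = w := by
  classical
  have := Fintype.ofFinite C
  rw [evalTensor_decomp z, evalTensor_decomp w]
  simp [h]

theorem evalTensor_twist {H : Type*} [Group H] [Group C] {α β : H →* C}
    {τ : Representation ℂ H T} {σ : Representation ℂ H ((C → ℂ) ⊗[ℂ] T)}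
    (hσ : ∀ h f t, σ h (f ⊗ₜ t) = (fun x => f ((α h)⁻¹ * x * β h)) ⊗ₜ τ h t)
    (h : H) (x : C) (z : (C → ℂ) ⊗[ℂ] T) :
    evalTensor x (σ h z) = τ h (evalTensor ((α h)⁻¹ * x * β h) z) := by
  induction z with
  | zero => simp
  | add a b ha hb => simp [ha, hb]
  | tmul f t => rw [hσ, evalTensor_tmul, evalTensor_tmul, map_smul]

/-- All `ρ n u` have the class of `u` in the coinvariants, so the class of their sum is `|N|` times
that of `u`, and `|N|` is invertible in `ℂ`. This allows coinvariants to be tested on invariant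
vectors. -/
theorem mk_eq_zero_of_average {N S : Type*} [Group N] [Fintype N] [AddCommGroup S] [Module ℂ S]
    (ρ : Representation ℂ N S) (u : S) (h : ∑ n, ρ n u = 0) :
    Representation.Coinvariants.mk ρ u = 0 := by
  have h1 := congrArg (Representation.Coinvariants.mk ρ) h
  rw [map_sum, map_zero] at h1
  simp only [Representation.Coinvariants.mk_self_apply, Finset.sum_const, Finset.card_univ] at h1
  rw [← Nat.cast_smul_eq_nsmul ℂ] at h1
  exact (smul_eq_zero.1 h1).resolve_left (by simp)

/-- A criterion for the coinvariants of a representation to be a direct sum of induced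
representations: `φ i` and `θ i` exhibit `T i` as a direct factor supported on the stabilizer
`{h ∈ H i | α i h = β i h}`, and together the `φ i` detect all coinvariants. -/
theorem coinvariants_equiv_directSum {Γ Λ S I : Type*} [Group Γ] [Group Λ] [Finite Γ] [Finite Λ]
    (N : Subgroup Γ) [N.Normal] (f : Λ →* Γ) [AddCommGroup S] [Module ℂ S]
    (Ω : Representation ℂ Γ S) [Fintype I] [DecidableEq I] (H : I → Subgroup Λ)
    {C : I → Type*} [∀ i, Group (C i)] [∀ i, Finite (C i)] {T : I → Type*}
    [∀ i, AddCommGroup (T i)] [∀ i, Module ℂ (T i)] (α β : ∀ i, H i →* C i)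
    (τ : ∀ i, Representation ℂ (H i) (T i))
    (σ : ∀ i, Representation ℂ (H i) ((C i → ℂ) ⊗[ℂ] T i))
    (hσ : ∀ i h f t, σ i h (f ⊗ₜ[ℂ] t) =
      (fun x => f ((α i h)⁻¹ * x * β i h)) ⊗ₜ[ℂ] τ i h t)
    (φ : ∀ i, S →ₗ[ℂ] T i) (θ : ∀ i, T i →ₗ[ℂ] S)
    (h1 : ∀ i h, α i h = β i h → ∀ u, φ i (Ω (f h.1) u) = τ i h (φ i u))
    (h3 : ∀ i, ∀ n ∈ N, ∀ u, φ i (Ω n u) = φ i u)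
    (h4 : ∀ i t, φ i (θ i t) = t)
    (h5 : ∀ i j, i ≠ j → ∀ g t, φ i (Ω (f g) (θ j t)) = 0)
    (h5' : ∀ i g t, (∀ hg : g ∈ H i, α i ⟨g, hg⟩ ≠ β i ⟨g, hg⟩) → φ i (Ω (f g) (θ i t)) = 0)
    (h6 : ∀ u, (∀ n ∈ N, Ω n u = u) → (∀ i g, φ i (Ω (f g) u) = 0) → u = 0)
    (h7 : ∀ i x, ∃ h, (α i h)⁻¹ * β i h = x) :
    Nonempty ((show Representation ℂ Λ _ from
      (Representation.toCoinvariants Ω N).comp f).Equiv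
      (Representation.directSum fun i => Representation.coind (H i).subtype (σ i))) := by
  classical
  have := Fintype.ofFinite N
  have := Fintype.ofFinite Λ
  have := fun i => Fintype.ofFinite (C i)
  choose ℓ hℓ using h7
  -- Frobenius reciprocity: `b i x g u` is the value at `x` of the function that `u` has at `g`.
  -- Translation by `ℓ i x` carries the point `x` of `C i` to the point `1`, where the value is
  -- given by `φ i`.
  let b : ∀ i, C i → Λ → S →ₗ[ℂ] T i := fun i x g =>
    (τ i (ℓ i x)⁻¹).comp ((φ i).comp (Ω (f ((ℓ i x).1 * g))))
  have hb : ∀ i x g u, b i x g u = τ i (ℓ i x)⁻¹ (φ i (Ω (f ((ℓ i x).1 * g)) u)) :=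
    fun i x g u => rfl
  let a : ∀ i, S →ₗ[ℂ] (Λ → (C i → ℂ) ⊗[ℂ] T i) := fun i =>
    LinearMap.pi fun g => ∑ x, (TensorProduct.mk ℂ _ _ (Pi.single x (1 : ℂ))).comp (b i x g)
  have ha : ∀ i u g x, evalTensor x (a i u g) = b i x g u := by
    intro i u g x
    have e1 : a i u g = ∑ y, (Pi.single y (1 : ℂ)) ⊗ₜ[ℂ] b i y g u := by
      simp [a]
    rw [e1, map_sum]
    simp [evalTensor_tmul, Pi.single_apply]
  -- The choice of `ℓ i x` does not matter: two choices differ by an element with `α = β`, and for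
  -- such elements `φ i` is equivariant by `h1`.
  have hb' : ∀ i x (h : H i), (α i h)⁻¹ * β i h = x → ∀ g u,
      b i x g u = τ i h⁻¹ (φ i (Ω (f (h.1 * g)) u)) := by
    intro i x h hx g u
    have hk : α i (ℓ i x * h⁻¹) = β i (ℓ i x * h⁻¹) := by
      have e1 := (hℓ i x).trans hx.symm
      rw [inv_mul_eq_iff_eq_mul] at e1
      rw [map_mul, map_mul, map_inv, map_inv, e1]
      group
    have e2 : (ℓ i x).1 * g = (ℓ i x * h⁻¹).1 * (h.1 * g) := by
      simp [mul_assoc]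
    rw [hb, e2, map_mul, map_mul, Module.End.mul_apply, h1 i _ hk, ← Module.End.mul_apply,
      ← map_mul]
    congr 3
    group
  have hmem : ∀ i u, a i u ∈ Representation.coindV (H i).subtype (σ i) := by
    intro i u
    rw [Representation.mem_coindV]
    intro h g
    refine evalTensor_ext _ _ fun x => ?_
    rw [evalTensor_twist (hσ i), ha, ha, hb]
    set x' := (α i h)⁻¹ * x * β i h with hx'
    rw [hb' i x' (ℓ i x * h) (by
      rw [map_mul, map_mul, hx']
      nth_rewrite 3 [← hℓ i x]
      group), ← Module.End.mul_apply, ← map_mul]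
    congr 2
    · group
    · simp [mul_assoc]
  let A : ∀ i, S →ₗ[ℂ] Representation.coindV (H i).subtype (σ i) := fun i =>
    (a i).codRestrict _ (hmem i)
  let Φ₀ : S →ₗ[ℂ] ⨁ i, Representation.coindV (H i).subtype (σ i) :=
    (DirectSum.linearEquivFunOnFintype ℂ I
      (fun i => Representation.coindV (H i).subtype (σ i))).symm.toLinearMap.comp
        (LinearMap.pi A)
  have hΦ₀ : ∀ u i, (Φ₀ u) i = A i u := by
    intro u i
    have e1 := LinearEquiv.apply_symm_apply (DirectSum.linearEquivFunOnFintype ℂ I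
      (fun i => Representation.coindV (H i).subtype (σ i))) (LinearMap.pi A u)
    exact congrFun e1 i
  have hN : ∀ (n : N), Φ₀ ∘ₗ ((Ω.comp N.subtype) n) = Φ₀ := by
    intro n
    refine LinearMap.ext fun u => DFinsupp.ext fun i => ?_
    change (Φ₀ (Ω n.1 u)) i = Φ₀ u i
    rw [hΦ₀, hΦ₀]
    refine Subtype.ext (funext fun g => evalTensor_ext _ _ fun x => ?_)
    change evalTensor x (a i (Ω n.1 u) g) = evalTensor x (a i u g)
    rw [ha, ha, hb, hb]
    congr 1
    rw [← Module.End.mul_apply, ← map_mul]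
    set y := f ((ℓ i x).1 * g)
    have e1 : y * n.1 = (y * n.1 * y⁻¹) * y := by group
    rw [e1, map_mul, Module.End.mul_apply]
    exact h3 i _ (Subgroup.Normal.conj_mem ‹_› _ n.2 _) _
  let _ : AddCommGroup (⨁ i, Representation.coindV (H i).subtype (σ i)) :=
    Module.addCommMonoidToAddCommGroup ℂ
  let Φ := Representation.Coinvariants.lift (Ω.comp N.subtype) Φ₀ hN
  have hΦ : ∀ u, Φ (Representation.Coinvariants.mk _ u) = Φ₀ u := fun u => rfl
  have hint : ∀ g u, Φ₀ (Ω (f g) u) =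
      Representation.directSum (fun i => Representation.coind (H i).subtype (σ i)) g (Φ₀ u) := by
    intro g u
    refine DFinsupp.ext fun i => ?_
    have e1 : (Representation.directSum (fun i => Representation.coind (H i).subtype (σ i)) g
        (Φ₀ u)) i = Representation.coind (H i).subtype (σ i) g (Φ₀ u i) := by
      simp [Representation.directSum]
    rw [e1, hΦ₀, hΦ₀]
    refine Subtype.ext (funext fun g' => evalTensor_ext _ _ fun x => ?_)
    change evalTensor x (a i (Ω (f g) u) g') = evalTensor x (a i u (g' * g))
    rw [ha, ha, hb, hb, ← Module.End.mul_apply, ← map_mul, ← map_mul, mul_assoc]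
  have hφ0 : ∀ u, Φ₀ u = 0 → ∀ i g, φ i (Ω (f g) u) = 0 := by
    intro u hu i g
    have e1 : b i 1 g u = 0 := by
      rw [← ha, show a i u g = (A i u).1 g from rfl, ← hΦ₀, hu]
      simp
    rw [hb' i 1 1 (by simp)] at e1
    simpa using e1
  have hinj : Function.Injective Φ := by
    rw [injective_iff_map_eq_zero]
    intro z hz
    induction z using Representation.Coinvariants.induction_on with
    | h u =>
    -- The sum of the translates of `u` under `N` is invariant, so `h6` applies to it.
    apply mk_eq_zero_of_average
    apply h6
    · intro n hn
      rw [map_sum]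
      exact Fintype.sum_equiv (Equiv.mulLeft (⟨n, hn⟩ : N)) _ _ fun n' => by simp
    · intro i g
      apply hφ0
      rw [map_sum]
      have : ∀ n : N, Φ₀ ((Ω.comp N.subtype) n u) = Φ₀ u := fun n =>
        LinearMap.congr_fun (hN n) u
      simp only [this]
      rw [← hΦ u, hz]
      simp
  have hsurj : Function.Surjective Φ := by
    let F : ∀ i, Representation.coindV (H i).subtype (σ i) → Λ → T i := fun i z g =>
      evalTensor 1 (z.1 g)
    have hF : ∀ i (z : Representation.coindV (H i).subtype (σ i)) (h : H i) g,
        F i z (h.1 * g) = τ i h (evalTensor ((α i h)⁻¹ * β i h) (z.1 g)) := by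
      intro i z h g
      have e1 := (Representation.mem_coindV _ _ _).1 z.2 h g
      have e2 : z.1 (h.1 * g) = σ i h (z.1 g) := e1
      simp only [F]
      rw [e2, evalTensor_twist (hσ i), mul_one]
    let K : I → Finset Λ := fun i => Finset.univ.filter fun k =>
      ∃ hk : k ∈ H i, α i ⟨k, hk⟩ = β i ⟨k, hk⟩
    have hK : ∀ i, ((K i).card : ℂ) ≠ 0 := by
      intro i
      have : 1 ∈ K i := by
        simp only [K, Finset.mem_filter, Finset.mem_univ, true_and]
        refine ⟨(H i).one_mem, ?_⟩
        change α i 1 = β i 1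
        simp
      exact_mod_cast Finset.card_ne_zero_of_mem this
    intro z
    -- The preimage: `θ i` is applied to the value at each `g` and the result is translated back.
    -- Evaluation at `g₀` receives the same contribution from every `g` with `g₀ * g⁻¹` in the
    -- stabilizer `K i`, whence the factor `|K i|⁻¹`; the other contributions vanish by `h5` and
    -- `h5'`.
    let u : S := ∑ i, ((K i).card : ℂ)⁻¹ • ∑ g, Ω (f g⁻¹) (θ i (F i (z i) g))
    have hu : ∀ j g₀, φ j (Ω (f g₀) u) = F j (z j) g₀ := by
      intro j g₀
      simp only [u, map_sum, map_smul, ← Module.End.mul_apply, ← map_mul]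
      rw [Finset.sum_eq_single j]
      · have e1 : ∀ g, φ j (Ω (f (g₀ * g⁻¹)) (θ j (F j (z j) g))) =
            if g₀ * g⁻¹ ∈ K j then F j (z j) g₀ else 0 := by
          intro g
          split_ifs with hk
          · simp only [K, Finset.mem_filter, Finset.mem_univ, true_and] at hk
            obtain ⟨hk, hk'⟩ := hk
            have e2 := h1 j ⟨_, hk⟩ hk' (θ j (F j (z j) g))
            have e3 := hF j (z j) ⟨_, hk⟩ g
            rw [hk'] at e3
            simp only [inv_mul_cancel, inv_mul_cancel_right] at e3
            rw [e2, h4, e3]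
          · refine h5' j _ _ fun hg he => hk ?_
            simp only [K, Finset.mem_filter, Finset.mem_univ, true_and]
            exact ⟨hg, he⟩
        simp only [e1]
        rw [← Equiv.sum_comp ((Equiv.inv Λ).trans (Equiv.mulRight g₀))]
        simp only [Equiv.trans_apply, Equiv.inv_apply, Equiv.coe_mulRight, mul_inv_rev, inv_inv,
          mul_inv_cancel_left]
        rw [← Finset.sum_filter, Finset.filter_mem_eq_inter, Finset.univ_inter, Finset.sum_const,
          ← Nat.cast_smul_eq_nsmul ℂ, smul_smul, inv_mul_cancel₀ (hK j), one_smul]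
      · intro i _ hi
        rw [Finset.sum_eq_zero fun g _ => h5 j i hi.symm _ _, smul_zero]
      · simp
    refine ⟨Representation.Coinvariants.mk _ u, ?_⟩
    rw [hΦ]
    refine DFinsupp.ext fun i => ?_
    rw [hΦ₀]
    refine Subtype.ext (funext fun g => evalTensor_ext _ _ fun x => ?_)
    change evalTensor x (a i u g) = _
    rw [ha, hb, hu, hF, hℓ, ← Module.End.mul_apply, ← map_mul]
    simp
  refine ⟨Representation.Equiv.mk (LinearEquiv.ofBijective Φ ⟨hinj, hsurj⟩) fun g => ?_⟩
  refine LinearMap.ext fun z => ?_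
  induction z using Representation.Coinvariants.induction_on with
  | h u => exact hint g u

end Mackey

/-! ### A Gauss lemma for permutations that commute with negation. -/

section HalfSystem

open Equiv Equiv.Perm

variable {Y : Type*} [AddCommGroup Y] [Fintype Y] [DecidableEq Y]

/-- The elements of `Y` that `g` moves from one half of `Y` to the other. -/
def halfFlips (P : Y → Prop) [DecidablePred P] (g : Perm Y) : Finset Y :=
  Finset.univ.filter fun y => ¬(P (g y) ↔ P y)

/-- Of `y` and `-y` the half contains the one that comes first in a fixed enumeration; the absence
of 2-torsion makes them distinct for `y ≠ 0`. -/
theorem exists_half_system (h2 : ∀ y : Y, -y = y → y = 0) :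
    ∃ P : Y → Prop, ¬P 0 ∧ ∀ y, y ≠ 0 → (P (-y) ↔ ¬P y) := by
  let e := Fintype.equivFin Y
  refine ⟨fun y => e y < e (-y), by simp, fun y hy => ?_⟩
  have h1 : e y ≠ e (-y) := fun h => hy (h2 y (e.injective h).symm)
  simp only [neg_neg, not_lt]
  exact ⟨le_of_lt, fun h => lt_of_le_of_ne h h1.symm⟩

/-- Let `t` replace by `-y` each `y` that `g` moves from one half to the other. Then `g * t`
preserves the halves and commutes with negation, so it acts in the same way on both and is even.
Hence `sign g = sign t`, and `t` is an involution with support `halfFlips P g`. -/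
theorem sign_eq_neg_one_pow_halfFlips (h2 : ∀ y : Y, -y = y → y = 0) (P : Y → Prop)
    [DecidablePred P] (hP0 : ¬P 0) (hP : ∀ y, y ≠ 0 → (P (-y) ↔ ¬P y)) (g : Perm Y)
    (hg : ∀ y, g (-y) = -g y) :
    Even (halfFlips P g).card ∧ sign g = (-1) ^ ((halfFlips P g).card / 2) := by
  have hg0 : g 0 = 0 := h2 _ (by rw [← hg, neg_zero])
  have hgn : ∀ y, y ≠ 0 → g y ≠ 0 := fun y hy h => hy (g.injective (h.trans hg0.symm))
  have hE : ∀ y, (P (g (-y)) ↔ P (-y)) ↔ (P (g y) ↔ P y) := by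
    intro y
    by_cases hy : y = 0
    · simp [hy]
    · rw [hg, hP _ (hgn y hy), hP y hy, not_iff_not]
  have hinv : Function.Involutive fun y => if (P (g y) ↔ P y) then y else -y := by
    intro y
    by_cases h : P (g y) ↔ P y
    · simp [h]
    · simp only [h, if_false, hE, neg_neg]
  let t : Perm Y := hinv.toPerm
  have ht : ∀ y, t y = if (P (g y) ↔ P y) then y else -y := fun y => rfl
  have ht2 : t ^ 2 = 1 := by
    ext y
    rw [pow_two]
    exact hinv y
  have htn : ∀ y, t (-y) = -t y := by
    intro y
    rw [ht, ht]
    simp only [hE]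
    split_ifs <;> rfl
  have hsupp : t.support = halfFlips P g := by
    ext y
    rw [mem_support, ht, halfFlips, Finset.mem_filter]
    by_cases h : P (g y) ↔ P y
    · simp [h]
    · simp only [h, if_false, not_false_eq_true, and_true, Finset.mem_univ, iff_true]
      intro h'
      have := h2 y h'
      subst this
      simp [hg0] at h
  have hcard : Fintype.card Y - Fintype.card (Function.fixedPoints t) =
      (halfFlips P g).card := by
    rw [← hsupp]
    have : Fintype.card (Function.fixedPoints t) = (t.supportᶜ).card := by
      rw [Fintype.card_subtype]
      congr 1
      ext y
      simp [Function.IsFixedPt]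
    rw [this, Finset.card_compl, Nat.sub_sub_self (Finset.card_le_univ _)]
  have hst := sign_of_pow_two_eq_one ht2
  rw [hcard] at hst
  refine ⟨?_, ?_⟩
  · have h1 := card_compl_support_modEq (p := 2) (n := 1) (σ := t) (by simpa using ht2)
    rw [Nat.modEq_iff_dvd' (Finset.card_le_univ _), Finset.card_compl,
      Nat.sub_sub_self (Finset.card_le_univ _), hsupp] at h1
    exact even_iff_two_dvd.2 h1
  rw [← hst]
  have hg' : ∀ y, P ((g * t) y) ↔ P y := by
    intro y
    rw [Perm.mul_apply, ht]
    by_cases h : P (g y) ↔ P y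
    · simp [h]
    · have hy : y ≠ 0 := by
        rintro rfl
        simp [hg0] at h
      simp only [h, if_false, hg, hP _ (hgn y hy)]
      tauto
  -- `a` is `g * t` on the half `P` and the identity elsewhere; its conjugate by negation is `g * t`
  -- on the opposite half.
  let a : Perm Y := ofSubtype ((g * t).subtypePerm hg')
  have ha : ∀ y, P y → a y = g (t y) := fun y hy => ofSubtype_apply_of_mem _ hy
  have ha' : ∀ y, ¬P y → a y = y := fun y hy => ofSubtype_apply_of_not_mem _ hy
  have hdec : g * t = a * (Equiv.neg Y * a * (Equiv.neg Y)⁻¹) := by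
    ext y
    have e1 : (Equiv.neg Y * a * (Equiv.neg Y)⁻¹) y = -a (-y) := rfl
    rw [Perm.mul_apply, Perm.mul_apply, e1]
    by_cases hy : y = 0
    · subst hy
      rw [neg_zero, ha' 0 hP0, neg_zero, ha' 0 hP0, ht]
      simp [hg0]
    · by_cases hy' : P y
      · rw [ha' (-y) (by rw [hP y hy]; exact not_not.2 hy'), neg_neg, ha y hy']
      · rw [ha (-y) ((hP y hy).2 hy'), htn, hg, neg_neg, ha']
        rw [← Perm.mul_apply, hg']
        exact hy'
  have h1 : sign (g * t) = 1 := by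
    rw [hdec, map_mul, map_mul, map_mul, map_inv, mul_comm (sign (Equiv.neg Y)),
      mul_inv_cancel_right, ← pow_two, Int.units_sq]
  rw [map_mul] at h1
  rw [← mul_one (sign t), ← h1, mul_comm (sign g), ← mul_assoc, ← pow_two, Int.units_sq, one_mul]

end HalfSystem

/-! ### Determinants on the range of a projection. -/

section BlockDet

variable {S : Type*} [AddCommGroup S] [Module ℂ S]

/-- The determinant of the restriction of `T` to the range of the projection `e`. -/
noncomputable def projDet (e T : Module.End ℂ S) : ℂ := LinearMap.det (e * T + (1 - e))

theorem projDet_mul {e T T' : Module.End ℂ S} (he : e * e = e) (hT : T * e = e * T) :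
    projDet e (T * T') = projDet e T * projDet e T' := by
  rw [projDet, projDet, projDet, ← map_mul]
  congr 1
  have h1 : e * T * (e * T') = e * (T * T') := by
    rw [mul_assoc, ← mul_assoc T, hT, ← mul_assoc, ← mul_assoc, he]
    simp only [mul_assoc]
  have h2 : e * T * e = e * T := by rw [mul_assoc, hT, ← mul_assoc, he]
  simp only [mul_add, add_mul, mul_sub, sub_mul, mul_one, one_mul, h1, h2, he]
  rw [← mul_assoc e e, he]
  abel

/-- Sylvester's determinant identity in coordinates. It transports determinants along an embedding
with a left inverse. -/
theorem linearMap_det_one_add_comp_comm {S' : Type*} [AddCommGroup S'] [Module ℂ S']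
    [FiniteDimensional ℂ S] [FiniteDimensional ℂ S'] (f : S →ₗ[ℂ] S') (g : S' →ₗ[ℂ] S) :
    LinearMap.det (1 + f.comp g : Module.End ℂ S') =
      LinearMap.det (1 + g.comp f : Module.End ℂ S) := by
  classical
  let b := finBasis ℂ S
  let b' := finBasis ℂ S'
  rw [← LinearMap.det_toMatrix b, ← LinearMap.det_toMatrix b', map_add, map_add,
    LinearMap.toMatrix_one, LinearMap.toMatrix_one, LinearMap.toMatrix_comp b' b b',
    LinearMap.toMatrix_comp b b' b, Matrix.det_one_add_mul_comm]

/-- The determinant of the operator that is `T` on the image of `J` and the identity on a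
complement. -/
theorem projDet_extend {S' : Type*} [AddCommGroup S'] [Module ℂ S'] [FiniteDimensional ℂ S]
    [FiniteDimensional ℂ S'] (J : S →ₗ[ℂ] S') (R : S' →ₗ[ℂ] S) (hRJ : R.comp J = 1)
    (e : Module.End ℂ S) (e' : Module.End ℂ S') (he : e'.comp J = J.comp e)
    (T : Module.End ℂ S) (T' : Module.End ℂ S') (hT : T'.comp J = J.comp T) :
    projDet e' (T' * J.comp R + (1 - J.comp R)) = projDet e T := by
  -- The operator differs from `1` by a map that factors through `R` and `J`, so Sylvester's
  -- identity moves the determinant to `S`.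
  have h1 : e' * (T' * J.comp R + (1 - J.comp R)) + (1 - e') =
      1 + (J.comp (e * (T - 1))).comp R := by
    have e1 : e' * (T' * J.comp R) = (J.comp (e * T)).comp R := by
      refine LinearMap.ext fun v => ?_
      have a1 := LinearMap.congr_fun hT (R v)
      have a2 := LinearMap.congr_fun he (T (R v))
      simp only [LinearMap.comp_apply] at a1 a2
      simp only [Module.End.mul_apply, LinearMap.comp_apply, a1, a2]
    have e2 : e' * J.comp R = (J.comp e).comp R := by
      rw [← he]; rfl
    rw [mul_add, mul_sub, e1, e2, mul_sub, LinearMap.comp_sub, LinearMap.sub_comp]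
    simp only [mul_one]
    abel
  rw [projDet, h1, projDet, linearMap_det_one_add_comp_comm, ← LinearMap.comp_assoc, hRJ]
  congr 1
  rw [mul_sub, mul_one]
  change 1 + 1 * (e * T - e) = _
  rw [one_mul]
  abel

end BlockDet

/-! ### Even and odd determinants of an operator that permutes a grading. -/

section GradedSign

open Equiv Equiv.Perm

variable {S : Type*} [AddCommGroup S] [Module ℂ S] [FiniteDimensional ℂ S]
  {Y : Type*} [AddCommGroup Y] [Fintype Y] [DecidableEq Y]

/-- If `S` is graded by `Y`, with all components of odd dimension `d`, and `T` permutes the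
components through `g`, then off the component of `0` the determinants of `T` on the even and on the
odd vectors differ by the sign of `g`. -/
theorem projDet_even_eq_sign_mul_projDet_odd (h2 : ∀ y : Y, -y = y → y = 0)
    (M : (Y → ℂ) →ₐ[ℂ] Module.End ℂ S) {d : ℕ} (hd : Odd d)
    (htr : ∀ f, LinearMap.trace ℂ S (M f) = d * ∑ y, f y)
    (P T : Module.End ℂ S) (hPP : P * P = 1) (hPT : T * P = P * T)
    (hPM : ∀ f, P * M f = M (fun y => f (-y)) * P)
    (g : Perm Y) (hg : ∀ y, g (-y) = -g y)
    (hTM : ∀ f, M f * T = T * M (fun y => f (g y))) (e : Module.End ℂ S)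
    (he : e = (2 : ℂ)⁻¹ • (1 + P)) :
    projDet e (T * (1 - M (Pi.single 0 1)) + M (Pi.single 0 1)) =
      ((sign g : ℤ) : ℂ) *
        projDet (1 - e) (T * (1 - M (Pi.single 0 1)) + M (Pi.single 0 1)) := by
  classical
  obtain ⟨H, hH0, hH⟩ := exists_half_system h2
  have hg0 : g 0 = 0 := h2 _ (by rw [← hg, neg_zero])
  have hgi : ∀ y, g y = 0 ↔ y = 0 := fun y => by rw [← hg0, g.injective.eq_iff, hg0]
  obtain ⟨hEven, hsign⟩ := sign_eq_neg_one_pow_halfFlips h2 H hH0 hH g hg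
  set δ : Y → ℂ := Pi.single 0 1 with hδ
  have hδy : ∀ y, δ y = if y = 0 then 1 else 0 := fun y => by simp [hδ, Pi.single_apply]
  -- Off the component of `0` the involution `M q` anticommutes with `P`, because `q` is odd there;
  -- so it exchanges even and odd vectors.
  let q : Y → ℂ := fun y => if y = 0 then 1 else if H y then 1 else -1
  -- `s` is the factor that conjugation by `M q` introduces into `T`. It is `-1` exactly on the
  -- components that `g` moves between the halves, and `E` is the indicator function of these.
  let s : Y → ℂ := fun y => if (H (g y) ↔ H y) then 1 else -1
  let E : Y → ℂ := fun y => if (H (g y) ↔ H y) then 0 else 1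
  have hqq : q * q = 1 := by
    ext y
    simp only [q, Pi.mul_apply, Pi.one_apply]
    split_ifs <;> norm_num
  have hq0 : q 0 = 1 := by simp [q]
  have hqn : ∀ y, y ≠ 0 → q (-y) * q y = -1 := by
    intro y hy
    simp only [q, neg_eq_zero, hy, if_false, hH y hy]
    by_cases h : H y <;> simp [h]
  have hqs : ∀ y, s y = q (g y) * q y := by
    intro y
    simp only [q, s, hgi]
    by_cases hy : y = 0
    · simp [hy, hg0]
    · by_cases h : H y <;> by_cases h' : H (g y) <;> simp [hy, h, h']
  have hs0 : s 0 = 1 := by simp [s, hg0]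
  have hEn : ∀ y, E (-y) = E y := by
    intro y
    by_cases hy : y = 0
    · simp [hy]
    · have h1 : H (g (-y)) ↔ ¬H (g y) := by rw [hg, hH _ (by rwa [Ne, hgi])]
      simp only [E, h1, hH y hy, not_iff_not]
  have hEE : E * E = E := by
    ext y
    simp only [E, Pi.mul_apply]
    split_ifs <;> norm_num
  have hE0 : E 0 = 0 := by simp [E, hg0]
  have hsE : s = 1 - (2 : ℂ) • E := by
    ext y
    simp only [s, E, Pi.sub_apply, Pi.smul_apply, Pi.one_apply, smul_eq_mul]
    split_ifs <;> norm_num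
  have hEsum : ∑ y, E y = (halfFlips H g).card := by
    rw [halfFlips, Finset.card_filter]
    push_cast
    refine Finset.sum_congr rfl fun y _ => ?_
    simp only [E]
    split_ifs <;> simp_all
  have hQQ : M q * M q = 1 := by rw [← map_mul, hqq, map_one]
  have hδδ : δ * δ = δ := by
    ext y
    simp [hδy]
  set X := T * (1 - M δ) + M δ with hX
  have hMδT : M δ * T = T * M δ := by
    rw [hTM]
    congr 2
    ext y
    simp [hδy, hgi]
  have hPδ : P * M δ = M δ * P := by
    rw [hPM]
    congr 2
    ext y
    simp [hδy]
  have hδX : M δ * X = M δ := by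
    have : M δ * M δ = M δ := by rw [← map_mul, hδδ]
    rw [hX, mul_add, ← mul_assoc, hMδT, mul_assoc, mul_sub, mul_one, this, sub_self, mul_zero,
      zero_add]
  have hXs : M q * X * M q = X * M s := by
    have e1 : M q * (T * (1 - M δ)) * M q = T * (M (fun y => q (g y)) * (M (1 - δ) * M q)) := by
      rw [← mul_assoc, hTM, map_sub, map_one]
      simp only [mul_assoc]
    have e2 : T * (1 - M δ) * M s = T * (M (1 - δ) * M s) := by
      rw [map_sub, map_one, mul_assoc]
    rw [hX, mul_add, add_mul, add_mul, e1, e2, ← map_mul, ← map_mul, ← map_mul, ← map_mul,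
      ← map_mul, ← map_mul]
    congr 1
    · congr 2
      ext y
      simp only [Pi.mul_apply, hqs]
      ring
    · congr 1
      ext y
      simp only [Pi.mul_apply, hδy]
      by_cases hy : y = 0
      · simp [hy, hq0, hs0]
      · simp [hy]
  have hδs : M δ * M s = M δ := by
    rw [← map_mul]
    congr 1
    ext y
    simp only [Pi.mul_apply, hδy]
    by_cases hy : y = 0
    · simp [hy, hs0]
    · simp [hy]
  have hQP : M q * P * M q = M ((2 : ℂ) • δ - 1) * P := by
    rw [mul_assoc, hPM, ← mul_assoc, ← map_mul]
    congr 2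
    ext y
    simp only [Pi.mul_apply, Pi.sub_apply, Pi.smul_apply, hδy, Pi.one_apply, smul_eq_mul]
    by_cases hy : y = 0
    · simp [hy, hq0]; norm_num
    · rw [mul_comm, hqn y hy]; simp [hy]
  -- Conjugation by `M q` turns a determinant on even vectors into one on odd vectors. The component
  -- of `0` behaves differently, but there `X` is the identity.
  have hev : projDet e X = projDet (1 - e) (X * M s) := by
    have e1 : LinearMap.det (M q) * LinearMap.det (M q) = 1 := by
      rw [← map_mul, hQQ, map_one]
    have e2 : projDet e X = LinearMap.det (M q * (e * X + (1 - e)) * M q) := by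
      rw [map_mul, map_mul, mul_right_comm, e1, one_mul, projDet]
    rw [e2, projDet]
    congr 1
    have e3 : M q * e * M q = (1 - e) + M δ * P := by
      rw [he, mul_smul_comm, smul_mul_assoc, mul_add, add_mul, mul_one, hQQ, hQP, map_sub,
        map_smul, map_one, sub_mul, smul_mul_assoc, one_mul]
      module
    have e4 : M q * (e * X) * M q = (M q * e * M q) * (M q * X * M q) := by
      have : (M q * e * M q) * (M q * X * M q) = M q * e * (M q * M q) * X * M q := by
        simp only [mul_assoc]
      rw [this, hQQ, mul_one]
      simp only [mul_assoc]
    have e5 : M δ * P * (X * M s) = M δ * P := by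
      rw [← hPδ, mul_assoc, ← mul_assoc (M δ), hδX, hδs]
    rw [mul_add, add_mul, e4, mul_sub, sub_mul, mul_one, hQQ, e3, hXs, add_mul, e5]
    abel
  have hPe : P * e = e * P := by
    rw [he, mul_smul_comm, smul_mul_assoc, mul_add, add_mul, mul_one, one_mul]
  have hee : e * e = e := by
    rw [he, smul_mul_smul_comm, add_mul, mul_add, mul_add, hPP]
    simp only [mul_one, one_mul]
    module
  have hTe : T * e = e * T := by
    rw [he, mul_smul_comm, smul_mul_assoc, mul_add, add_mul, mul_one, one_mul, hPT]
  have hδe : M δ * e = e * M δ := by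
    rw [he, mul_smul_comm, smul_mul_assoc, mul_add, add_mul, mul_one, one_mul, hPδ]
  have hXe : X * (1 - e) = (1 - e) * X := by
    have : X * e = e * X := by
      have e1 : (1 - M δ) * e = e * (1 - M δ) := by
        rw [sub_mul, mul_sub, one_mul, mul_one, hδe]
      rw [hX, add_mul, mul_add, hδe, mul_assoc, e1, ← mul_assoc, hTe, mul_assoc]
    rw [mul_sub, sub_mul, this, mul_one, one_mul]
  have hee' : (1 - e) * (1 - e) = 1 - e := by simp [mul_sub, sub_mul, hee]
  have hME : M E * e = e * M E := by
    have : P * M E = M E * P := by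
      rw [hPM]; simp only [hEn]
    rw [he, mul_smul_comm, smul_mul_assoc, mul_add, add_mul, mul_one, one_mul, this]
  have hpp : ((1 - e) * M E) * ((1 - e) * M E) = (1 - e) * M E := by
    have e1 : M E * (1 - e) = (1 - e) * M E := by rw [mul_sub, sub_mul, hME, mul_one, one_mul]
    rw [mul_assoc, ← mul_assoc (M E), e1, mul_assoc, ← map_mul, hEE, ← mul_assoc, hee']
  -- `n` is the dimension of the odd vectors in the components indicated by `E`. Since `P * M E` has
  -- trace zero, even and odd vectors have equal dimension there, and `n` is half of `d` times the
  -- number of flips.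
  obtain ⟨n, hn, hn'⟩ := det_idem_block _ hpp
  have hPE : LinearMap.trace ℂ S (P * M E) = 0 := by
    have e1 : LinearMap.trace ℂ S (P * M E) = -LinearMap.trace ℂ S (P * M E) := by
      conv_lhs => rw [← mul_one (P * M E), ← hQQ, ← mul_assoc, LinearMap.trace_mul_comm]
      have : M q * (P * M E * M q) = -(P * M E) := by
        have e3 : M q * P = P * M (fun y => q (-y)) := by
          rw [hPM]; simp
        rw [mul_assoc, ← mul_assoc, e3, mul_assoc, ← map_mul, ← map_mul, ← mul_neg, ← map_neg]
        congr 2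
        ext y
        simp only [Pi.mul_apply, Pi.neg_apply]
        by_cases hy : y = 0
        · simp [hy, hE0]
        · linear_combination E y * hqn y hy
      rw [this, map_neg]
    exact self_eq_neg.1 e1
  have hn2 : 2 * n = d * (halfFlips H g).card := by
    have e1 : (1 - e) * M E = (2 : ℂ)⁻¹ • (M E - P * M E) := by
      rw [he, sub_mul, smul_mul_assoc, add_mul, one_mul]
      module
    rw [e1, map_smul, map_sub, hPE, htr, hEsum, sub_zero, smul_eq_mul] at hn
    have : (2 * n : ℂ) = d * (halfFlips H g).card := by
      rw [← hn]; ring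
    exact_mod_cast this
  have hods : projDet (1 - e) (M s) = ((sign g : ℤ) : ℂ) := by
    have e1 : (1 - e) * M s + (1 - (1 - e)) =
        ((1 - e) * M E) * ((-1 : ℂ) • 1) + (1 - (1 - e) * M E) := by
      rw [hsE, map_sub, map_one, map_smul, mul_sub, mul_smul_comm, mul_smul_comm, mul_one, mul_one]
      module
    rw [projDet, e1, hn', hsign]
    obtain ⟨k, hk⟩ := hEven
    have e2 : n = d * k := by
      rw [hk] at hn2
      nlinarith
    have e3 : (halfFlips H g).card / 2 = k := by omega
    rw [e2, e3, pow_mul, hd.neg_one_pow]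
    push_cast
    rfl
  rw [hev, projDet_mul hee' hXe, hods, mul_comm]

end GradedSign

/-! ### Components of the Heisenberg representation under an isotropic subspace. -/

section Isotypic

variable {F V : Type*} [Field F] [Finite F] [NeZero (2 : F)] [AddCommGroup V] [Module F V]
  [Finite V] {B : LinearMap.BilinForm F V} {ψ : AddChar F ℂ}

theorem heisRep_mul (v w : V) : heisRep B ψ ⟨v, 0⟩ * heisRep B ψ ⟨w, 0⟩ =
    ψ (2⁻¹ * B v w) • heisRep B ψ ⟨v + w, 0⟩ := by
  rw [← map_mul]
  have : (⟨v, 0⟩ * ⟨w, 0⟩ : Heisenberg B) = ⟨0, 2⁻¹ * B v w⟩ * ⟨v + w, 0⟩ := by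
    ext <;> simp
  rw [this, map_mul, heisRep_center]
  rfl

theorem heisRep_scal (v : V) (t : F) :
    heisRep B ψ ⟨v, t⟩ = ψ t • heisRep B ψ ⟨v, 0⟩ := by
  have : (⟨v, t⟩ : Heisenberg B) = ⟨0, t⟩ * ⟨v, 0⟩ := by
    ext <;> simp
  rw [this, map_mul, heisRep_center]
  rfl

theorem heisRep_zero : heisRep B ψ ⟨0, 0⟩ = 1 := map_one _

theorem heisRep_mul_comm (hB : IsSymplectic B) (v w : V) :
    heisRep B ψ ⟨v, 0⟩ * heisRep B ψ ⟨w, 0⟩ =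
      ψ (B v w) • (heisRep B ψ ⟨w, 0⟩ * heisRep B ψ ⟨v, 0⟩) := by
  have h2 : (2 : F) ≠ 0 := NeZero.ne 2
  rw [heisRep_mul, heisRep_mul, smul_smul, ← AddChar.map_add_eq_mul, hB.neg w v, add_comm w v]
  congr 2
  field_simp
  ring

theorem heisParity_mul_heisRep (hB : IsSymplectic B) (x : V) :
    heisParity B ψ * heisRep B ψ ⟨x, 0⟩ = heisRep B ψ ⟨-x, 0⟩ * heisParity B ψ := by
  have := Fintype.ofFinite V
  rw [heisParity, finsum_eq_sum_of_fintype, mul_smul_comm, smul_mul_assoc, Finset.mul_sum,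
    Finset.sum_mul]
  congr 1
  -- With `v + 2x` in place of `v` on the right, both products are multiples of the operator of `v +
  -- x`, with equal scalars.
  refine Fintype.sum_equiv (Equiv.addRight (x + x)) _ _ fun v => ?_
  rw [heisRep_mul, heisRep_mul]
  simp only [Equiv.coe_addRight, map_add, map_neg, LinearMap.neg_apply, hB.alt]
  rw [hB.neg x v]
  congr 3
  · ring
  · abel

/-- A nonzero linear form takes every value, so its composition with `ψ` is a nontrivial character.
-/
theorem sum_addChar_bilin {U : Type*} [AddCommGroup U] [Module F U] [Fintype U] (hψ : ψ ≠ 1)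
    (f : U →ₗ[F] F) (hf : ∃ u, f u ≠ 0) : ∑ u, ψ (f u) = 0 := by
  let χ : AddChar U ℂ := ψ.compAddMonoidHom f.toAddMonoidHom
  have hχ : χ ≠ 1 := by
    obtain ⟨a, ha⟩ : ∃ a, ψ a ≠ 1 := by
      by_contra! h
      exact hψ (by ext a; simp [h a])
    obtain ⟨u, hu⟩ := hf
    intro h
    apply ha
    have := DFunLike.congr_fun h ((a / f u) • u)
    simp only [χ, AddChar.compAddMonoidHom_apply, AddChar.one_apply] at this
    rw [← this]
    congr 1
    simp [hu]
  exact AddChar.sum_eq_zero_of_ne_one hχ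

variable (B ψ) in
/-- The projection onto the vectors on which the isotropic subspace `A` acts through the
character `a ↦ ψ (B a v)`. -/
noncomputable def isoProj (A : Submodule F V) (v : V) : Module.End ℂ (Fin (heisDim B ψ) → ℂ) :=
  (Nat.card A : ℂ)⁻¹ • ∑ᶠ a : A, ψ (-B a v) • heisRep B ψ ⟨a, 0⟩

variable {A : Submodule F V}

theorem isoProj_eq [Fintype A] (v : V) : isoProj B ψ A v =
    (Nat.card A : ℂ)⁻¹ • ∑ a : A, ψ (-B a v) • heisRep B ψ ⟨a, 0⟩ := by
  rw [isoProj, finsum_eq_sum_of_fintype]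

theorem heisRep_mul_isoProj (hA : ∀ a ∈ A, ∀ b ∈ A, B a b = 0) (a : A) (v : V) :
    heisRep B ψ ⟨a, 0⟩ * isoProj B ψ A v = ψ (B a v) • isoProj B ψ A v := by
  have := Fintype.ofFinite A
  rw [isoProj_eq, mul_smul_comm, smul_comm (ψ (B a v)), Finset.mul_sum,
    Finset.smul_sum (r := ψ (B a v))]
  congr 1
  refine Fintype.sum_equiv (Equiv.addLeft a) _ _ fun b => ?_
  rw [mul_smul_comm, heisRep_mul, hA a a.2 b b.2, mul_zero, AddChar.map_zero_eq_one, one_smul,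
    smul_smul, ← AddChar.map_add_eq_mul]
  simp

theorem isoProj_apply_eq_self (v : V) (w : Fin (heisDim B ψ) → ℂ)
    (h : ∀ a ∈ A, heisRep B ψ ⟨a, 0⟩ w = ψ (B a v) • w) : isoProj B ψ A v w = w := by
  have := Fintype.ofFinite A
  rw [isoProj_eq, LinearMap.smul_apply, LinearMap.sum_apply]
  have : ∀ a : A, (ψ (-B a v) • heisRep B ψ ⟨a, 0⟩) w = w := fun a => by
    rw [LinearMap.smul_apply, h a a.2, smul_smul, ← AddChar.map_add_eq_mul, neg_add_cancel,
      AddChar.map_zero_eq_one, one_smul]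
  simp only [this, Finset.sum_const, Finset.card_univ]
  rw [← Nat.cast_smul_eq_nsmul ℂ, smul_smul, Nat.card_eq_fintype_card, inv_mul_cancel₀ (by simp),
    one_smul]

/-- Orthogonality of the characters `a ↦ ψ (B a v)` of `A`; two of them coincide exactly when the
vectors differ by an element of `A^⊥`. -/
theorem isoProj_mul_isoProj (hψ : ψ ≠ 1) (hA : ∀ a ∈ A, ∀ b ∈ A, B a b = 0) (v v' : V)
    [Decidable (∀ a ∈ A, B a (v' - v) = 0)] :
    isoProj B ψ A v * isoProj B ψ A v' =
      if ∀ a ∈ A, B a (v' - v) = 0 then isoProj B ψ A v' else 0 := by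
  have := Fintype.ofFinite A
  have e1 : isoProj B ψ A v * isoProj B ψ A v' =
      ((Nat.card A : ℂ)⁻¹ * ∑ a : A, ψ (B a (v' - v))) • isoProj B ψ A v' := by
    rw [isoProj_eq v, smul_mul_assoc, mul_smul, Finset.sum_mul, Finset.sum_smul]
    congr 1
    refine Finset.sum_congr rfl fun a _ => ?_
    rw [smul_mul_assoc, heisRep_mul_isoProj hA, smul_smul, ← AddChar.map_add_eq_mul, map_sub,
      sub_eq_neg_add]
  rw [e1]
  split_ifs with h
  · simp only [h _ (Subtype.prop _), AddChar.map_zero_eq_one, Finset.sum_const, Finset.card_univ]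
    simp
  · push Not at h
    obtain ⟨a, ha, h⟩ := h
    have h0 : ∑ a : A, ψ (B a (v' - v)) = 0 :=
      sum_addChar_bilin hψ ((B.flip (v' - v)).comp A.subtype) ⟨⟨a, ha⟩, h⟩
    rw [h0, mul_zero, zero_smul]

theorem intertwiner_mul_isoProj (g : symplecticGroup B) (hg : ∀ a ∈ A, g.1 a ∈ A)
    (T : Module.End ℂ (Fin (heisDim B ψ) → ℂ))
    (hT : ∀ x, T * heisRep B ψ x = heisRep B ψ (heisAct g x) * T) (v : V) :
    T * isoProj B ψ A v = isoProj B ψ A (g.1 v) * T := by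
  have := Fintype.ofFinite A
  have hbij : Function.Bijective fun a : A => (⟨g.1 a, hg a a.2⟩ : A) := by
    refine Finite.injective_iff_bijective.1 fun a b h => Subtype.ext (g.1.injective ?_)
    exact congrArg Subtype.val h
  rw [isoProj_eq, isoProj_eq, mul_smul_comm, smul_mul_assoc, Finset.mul_sum, Finset.sum_mul]
  congr 1
  refine Fintype.sum_equiv (Equiv.ofBijective _ hbij) _ _ fun a => ?_
  rw [mul_smul_comm, hT, smul_mul_assoc]
  simp only [Equiv.ofBijective_apply, g.2 a v]
  rfl

theorem heisParity_mul_isoProj (hB : IsSymplectic B) (v : V) :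
    heisParity B ψ * isoProj B ψ A v = isoProj B ψ A (-v) * heisParity B ψ := by
  have := Fintype.ofFinite A
  rw [isoProj_eq, isoProj_eq, mul_smul_comm, smul_mul_assoc, Finset.mul_sum, Finset.sum_mul]
  congr 1
  refine Fintype.sum_equiv (Equiv.neg A) _ _ fun a => ?_
  rw [mul_smul_comm, heisParity_mul_heisRep hB, smul_mul_assoc]
  simp

/-- Only the term `a = 0` contributes, because the character of the Heisenberg representation
vanishes off the centre. In particular all components have the same dimension. -/
theorem trace_isoProj (hB : IsSymplectic B) (hψ : ψ ≠ 1) (v : V) :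
    LinearMap.trace ℂ _ (isoProj B ψ A v) = (Nat.card A : ℂ)⁻¹ * heisDim B ψ := by
  classical
  have := Fintype.ofFinite A
  have h0 : ∀ v : V, v ≠ 0 → LinearMap.trace ℂ _ (heisRep B ψ ⟨v, 0⟩) = 0 :=
    fun v hv => heis_char_zero hB hψ ⟨v, 0⟩ hv
  rw [isoProj_eq, map_smul, map_sum, Finset.sum_eq_single 0]
  · simp [heisRep_zero]
  · intro a _ ha
    rw [map_smul, h0 a (by simpa using ha), smul_zero]
  · simp

/-! ### The grading by `V / A^⊥`. -/

section Grading

variable {Y : Type*} [AddCommGroup Y] [Module F Y] {q : V →ₗ[F] Y}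

variable (B ψ A q) in
/-- The operator that is multiplication by `f y` on the component of `S` attached to `y`. -/
noncomputable def gradOp [Fintype V] (f : Y → ℂ) : Module.End ℂ (Fin (heisDim B ψ) → ℂ) :=
  ((Nat.card A : ℂ) * (Nat.card V : ℂ)⁻¹) • ∑ v : V, f (q v) • isoProj B ψ A v

variable [Fintype V]

/-- By nondegeneracy of `B`, summation over all `v` of the characters of `A` leaves only `a = 0`; so
the components exhaust the space. -/
theorem gradOp_one (hB : IsSymplectic B) (hψ : ψ ≠ 1) : gradOp B ψ A q 1 = 1 := by
  classical
  have := Fintype.ofFinite A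
  have h1 : ∀ a : A, ∑ v, ψ (-B a v) = if a = 0 then (Nat.card V : ℂ) else 0 := by
    intro a
    split_ifs with h
    · subst h
      simp
    · refine sum_addChar_bilin hψ (-B a) ?_
      by_contra! h'
      refine h (Subtype.ext (hB.nondeg _ fun y => ?_))
      simpa using h' y
  rw [gradOp]
  simp only [Pi.one_apply, one_smul, isoProj_eq]
  rw [← Finset.smul_sum, Finset.sum_comm]
  simp only [← Finset.sum_smul, h1, ite_smul, zero_smul, Finset.sum_ite_eq', Finset.mem_univ,
    if_true]
  rw [Submodule.coe_zero, heisRep_zero, smul_smul, smul_smul, Nat.card_eq_fintype_card,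
    Nat.card_eq_fintype_card]
  have e1 : (Fintype.card A : ℂ) ≠ 0 := by simp
  have e2 : (Fintype.card V : ℂ) ≠ 0 := by simp
  field_simp
  rw [one_smul]

/-- Each component occurs once for every `v` in a coset of `ker q`. The cardinality of `ker q` is
kept as a factor here; `card_ker_eq` cancels it against the normalization. -/
theorem gradOp_mul_isoProj_aux (hqA : ∀ v, q v = 0 ↔ ∀ a ∈ A, B a v = 0)
    (hψ : ψ ≠ 1)
    (hA : ∀ a ∈ A, ∀ b ∈ A, B a b = 0) (f : Y → ℂ) (v : V) :
    gradOp B ψ A q f * isoProj B ψ A v =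
      ((Nat.card A : ℂ) * (Nat.card V : ℂ)⁻¹ * Nat.card (LinearMap.ker q)) •
        (f (q v) • isoProj B ψ A v) := by
  classical
  rw [gradOp, smul_mul_assoc, mul_smul _ (Nat.card (LinearMap.ker q) : ℂ), Finset.sum_mul]
  congr 1
  have h1 : ∀ v', f (q v') • isoProj B ψ A v' * isoProj B ψ A v =
      if q v' = q v then f (q v) • isoProj B ψ A v else 0 := by
    intro v'
    rw [smul_mul_assoc, isoProj_mul_isoProj hψ hA]
    simp only [← hqA, smul_ite, smul_zero]
    simp only [map_sub, sub_eq_zero]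
    by_cases h : q v = q v'
    · rw [if_pos h, if_pos h.symm, h]
    · rw [if_neg h, if_neg fun h' => h h'.symm]
  simp only [h1]
  rw [← Finset.sum_filter, Finset.sum_const, ← Nat.cast_smul_eq_nsmul ℂ]
  congr 2
  rw [← Fintype.card_subtype, ← Nat.card_eq_fintype_card]
  refine Nat.card_congr ⟨fun x => ⟨x.1 - v, ?_⟩, fun x => ⟨x.1 + v, ?_⟩, fun x => ?_, fun x => ?_⟩
  · rw [LinearMap.mem_ker, map_sub, x.2, sub_self]
  · have := LinearMap.mem_ker.1 x.2
    rw [map_add, this, zero_add]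
  · simp
  · simp

/-- The relation `|A| |A^⊥| = |V|`, read off from the representation: for `f = 1` the preceding
identity equates a projection of nonzero trace with a multiple of itself. -/
theorem card_ker_eq (hqA : ∀ v, q v = 0 ↔ ∀ a ∈ A, B a v = 0)
    (hB : IsSymplectic B) (hψ : ψ ≠ 1) (hA : ∀ a ∈ A, ∀ b ∈ A, B a b = 0) :
    (Nat.card A : ℂ) * (Nat.card V : ℂ)⁻¹ * Nat.card (LinearMap.ker q) = 1 := by
  have h1 := gradOp_mul_isoProj_aux (ψ := ψ) hqA hψ hA 1 0
  rw [gradOp_one hB hψ, one_mul, Pi.one_apply, one_smul] at h1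
  have h2 := congrArg (LinearMap.trace ℂ _) h1
  rw [map_smul, trace_isoProj hB hψ, smul_eq_mul] at h2
  have h3 : (Nat.card A : ℂ)⁻¹ * heisDim B ψ ≠ 0 :=
    mul_ne_zero (inv_ne_zero (by exact_mod_cast Nat.card_pos.ne')) (heisDim_ne_zero hB hψ)
  exact (mul_eq_right₀ h3).1 h2.symm

theorem gradOp_mul_isoProj (hqA : ∀ v, q v = 0 ↔ ∀ a ∈ A, B a v = 0)
    (hB : IsSymplectic B) (hψ : ψ ≠ 1)
    (hA : ∀ a ∈ A, ∀ b ∈ A, B a b = 0) (f : Y → ℂ) (v : V) :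
    gradOp B ψ A q f * isoProj B ψ A v = f (q v) • isoProj B ψ A v := by
  rw [gradOp_mul_isoProj_aux hqA hψ hA, card_ker_eq hqA hB hψ hA, one_smul]

theorem gradOp_mul (hqA : ∀ v, q v = 0 ↔ ∀ a ∈ A, B a v = 0)
    (hB : IsSymplectic B) (hψ : ψ ≠ 1)
    (hA : ∀ a ∈ A, ∀ b ∈ A, B a b = 0) (f f' : Y → ℂ) :
    gradOp B ψ A q (f * f') = gradOp B ψ A q f * gradOp B ψ A q f' := by
  rw [gradOp, gradOp.eq_1 B ψ A q f', mul_smul_comm, Finset.mul_sum]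
  congr 1
  refine Finset.sum_congr rfl fun v _ => ?_
  rw [mul_smul_comm, gradOp_mul_isoProj hqA hB hψ hA, smul_smul, Pi.mul_apply, mul_comm]

variable (ψ) in
/-- `gradOp` as a homomorphism of algebras. -/
noncomputable def gradHom (hqA : ∀ v, q v = 0 ↔ ∀ a ∈ A, B a v = 0)
    (hB : IsSymplectic B) (hψ : ψ ≠ 1)
    (hA : ∀ a ∈ A, ∀ b ∈ A, B a b = 0) : (Y → ℂ) →ₐ[ℂ] Module.End ℂ (Fin (heisDim B ψ) → ℂ) :=
  AlgHom.ofLinearMap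
    { toFun := gradOp B ψ A q
      map_add' := fun f f' => by
        simp only [gradOp, Pi.add_apply, add_smul, Finset.sum_add_distrib, smul_add]
      map_smul' := fun c f => by
        simp only [gradOp, Pi.smul_apply, smul_assoc, ← Finset.smul_sum, RingHom.id_apply]
        rw [smul_comm] }
    (gradOp_one hB hψ) (gradOp_mul hqA hB hψ hA)

theorem gradOp_single [DecidableEq Y] (hqA : ∀ v, q v = 0 ↔ ∀ a ∈ A, B a v = 0)
    (hB : IsSymplectic B) (hψ : ψ ≠ 1)
    (hA : ∀ a ∈ A, ∀ b ∈ A, B a b = 0) (v : V) :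
    gradOp B ψ A q (Pi.single (q v) 1) = isoProj B ψ A v := by
  have h1 : ∀ v', (Pi.single (q v) (1 : ℂ) : Y → ℂ) (q v') • isoProj B ψ A v' =
      (Pi.single (q v) (1 : ℂ) : Y → ℂ) (q v') • isoProj B ψ A v := by
    intro v'
    by_cases h : q v' = q v
    · congr 1
      rw [isoProj, isoProj]
      congr 1
      refine finsum_congr fun a => ?_
      have h2 := (hqA (v' - v)).1 (by rw [map_sub, h, sub_self]) a a.2
      rw [map_sub, sub_eq_zero] at h2
      rw [h2]
    · simp [h]
  have h2 := gradOp_mul_isoProj (ψ := ψ) hqA hB hψ hA (Pi.single (q v) 1) v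
  rw [Pi.single_eq_same, one_smul] at h2
  have hee : isoProj B ψ A v * isoProj B ψ A v = isoProj B ψ A v := by
    classical
    rw [isoProj_mul_isoProj hψ hA, if_pos (by simp)]
  rw [← h2]
  simp only [gradOp, h1]
  rw [← Finset.sum_smul, smul_mul_assoc, smul_mul_assoc, hee]

theorem trace_gradOp [Fintype Y] (hqA : ∀ v, q v = 0 ↔ ∀ a ∈ A, B a v = 0)
    (hq : Function.Surjective q) (hB : IsSymplectic B) (hψ : ψ ≠ 1)
    (hA : ∀ a ∈ A, ∀ b ∈ A, B a b = 0) (f : Y → ℂ) :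
    LinearMap.trace ℂ _ (gradOp B ψ A q f) =
      (Nat.card A : ℂ)⁻¹ * heisDim B ψ * ∑ y, f y := by
  classical
  have h1 : f = ∑ y, f y • (Pi.single y (1 : ℂ) : Y → ℂ) := by
    ext y
    simp [Finset.sum_apply, Pi.single_apply]
  have h2 : gradOp B ψ A q f = ∑ y, f y • gradOp B ψ A q (Pi.single y (1 : ℂ)) := by
    have := congrArg (gradHom ψ hqA hB hψ hA) h1
    rw [map_sum] at this
    simp only [map_smul] at this
    exact this
  rw [h2, map_sum, Finset.mul_sum]
  refine Finset.sum_congr rfl fun y _ => ?_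
  obtain ⟨v, rfl⟩ := hq y
  rw [map_smul, gradOp_single hqA hB hψ hA, trace_isoProj hB hψ, smul_eq_mul, mul_comm]

theorem heisParity_mul_gradOp (hB : IsSymplectic B) (f : Y → ℂ) :
    heisParity B ψ * gradOp B ψ A q f =
      gradOp B ψ A q (fun y => f (-y)) * heisParity B ψ := by
  rw [gradOp, gradOp, mul_smul_comm, smul_mul_assoc, Finset.mul_sum, Finset.sum_mul]
  congr 1
  refine Fintype.sum_equiv (Equiv.neg V) _ _ fun v => ?_
  rw [mul_smul_comm, heisParity_mul_isoProj hB, smul_mul_assoc]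
  simp

theorem gradOp_mul_intertwiner (g : symplecticGroup B) (hg : ∀ a ∈ A, g.1 a ∈ A)
    (T : Module.End ℂ (Fin (heisDim B ψ) → ℂ))
    (hT : ∀ x, T * heisRep B ψ x = heisRep B ψ (heisAct g x) * T) (gY : Y → Y)
    (hgY : ∀ v, q (g.1 v) = gY (q v)) (f : Y → ℂ) :
    gradOp B ψ A q f * T = T * gradOp B ψ A q (fun y => f (gY y)) := by
  rw [gradOp, gradOp, mul_smul_comm, smul_mul_assoc, Finset.mul_sum, Finset.sum_mul]
  congr 1
  refine (Fintype.sum_equiv g.1.toEquiv _ _ fun v => ?_).symm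
  rw [mul_smul_comm, intertwiner_mul_isoProj g hg T hT, smul_mul_assoc, ← hgY]
  rfl

end Grading

end Isotypic

/-! ### The Weil representation of `A^⊥ / A` inside that of `V`. -/

section Embedding

variable {F V V' : Type*} [Field F] [Finite F] [NeZero (2 : F)] [AddCommGroup V] [Module F V]
  [Finite V] [AddCommGroup V'] [Module F V'] [Finite V'] {B : LinearMap.BilinForm F V}
  {B' : LinearMap.BilinForm F V'} {ψ : AddChar F ℂ}

/-- The homomorphism of Heisenberg groups defined by an isometry. -/
def heisMap (inc : V' →ₗ[F] V) (hinc : ∀ u v, B (inc u) (inc v) = B' u v) :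
    Heisenberg B' →* Heisenberg B where
  toFun x := ⟨inc x.vec, x.scal⟩
  map_one' := by ext <;> simp
  map_mul' x y := by ext <;> simp [hinc]

/-- The character of the Heisenberg representation vanishes off the centre, so only the centre
contributes to its scalar product with the character of `τ`, and this contribution is not zero. With
irreducibility and equal dimensions it gives the uniqueness of Stone and von Neumann. -/
theorem heisRep_isIntertwining_of_center (hB : IsSymplectic B) (hψ : ψ ≠ 1) {S : Type*}
    [AddCommGroup S] [Module ℂ S] [FiniteDimensional ℂ S] (τ : Representation ℂ (Heisenberg B) S)
    (hτ : ∀ t, τ ⟨0, t⟩ = ψ t • LinearMap.id) (hS : finrank ℂ S ≠ 0) :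
    ∃ f : Representation.IntertwiningMap (heisRep B ψ) τ, f ≠ 0 := by
  classical
  have := Fintype.ofFinite (Heisenberg B)
  have := Fintype.ofFinite V
  have := Fintype.ofFinite F
  have : Invertible (Nat.card (Heisenberg B) : ℂ) :=
    invertibleOfNonzero (by simp)
  have h1 := Representation.card_inv_mul_sum_char_mul_char_eq_finrank (heisRep B ψ) τ
  have h2 : ∀ v t, τ.character (equivProd.symm (v, t)) *
      (heisRep B ψ).character (equivProd.symm (v, t))⁻¹ =
      if v = 0 then (finrank ℂ S : ℂ) * heisDim B ψ else 0 := by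
    intro v t
    split_ifs with hv
    · subst hv
      have e1 : (equivProd.symm ((0 : V), t) : Heisenberg B) = ⟨0, t⟩ := rfl
      have e2 : (⟨0, t⟩ : Heisenberg B)⁻¹ = ⟨0, -t⟩ := by ext <;> simp
      have e3 : ψ t * ψ (-t) = 1 := by rw [← AddChar.map_add_eq_mul]; simp
      rw [e1, e2]
      simp only [Representation.character, heisRep_center, hτ, map_smul, LinearMap.trace_id,
        finrank_fin_fun, smul_eq_mul]
      linear_combination (finrank ℂ S : ℂ) * heisDim B ψ * e3
    · rw [heis_char_zero hB hψ (equivProd.symm (v, t))⁻¹ (neg_ne_zero.2 hv), mul_zero]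
  rw [← Equiv.sum_comp equivProd.symm, Fintype.sum_prod_type] at h1
  simp only [h2, Finset.sum_const, Finset.card_univ, smul_ite, smul_zero, Finset.sum_ite_eq',
    Finset.mem_univ, if_true, nsmul_eq_mul] at h1
  have h3 : (finrank ℂ (Representation.IntertwiningMap (heisRep B ψ) τ) : ℂ) ≠ 0 := by
    rw [← h1]
    refine mul_ne_zero (inv_ne_zero (by simp)) (mul_ne_zero (by simp) (mul_ne_zero ?_ ?_))
    · exact_mod_cast hS
    · exact heisDim_ne_zero hB hψ
  have h4 : 0 < finrank ℂ (Representation.IntertwiningMap (heisRep B ψ) τ) :=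
    Nat.pos_of_ne_zero (by exact_mod_cast h3)
  have := finrank_pos_iff.1 h4
  exact exists_ne 0

/-- Otherwise Cauchy's theorem would provide an element of order two. Oddness is what lets a sign
raised to the power of such a cardinality be replaced by the sign itself. -/
theorem odd_natCard_of_two_ne_zero (F V : Type*) [Field F] [NeZero (2 : F)] [AddCommGroup V]
    [Module F V] [Finite V] : Odd (Nat.card V) := by
  rw [← Nat.not_even_iff_odd, even_iff_two_dvd]
  intro h
  obtain ⟨x, hx⟩ := exists_prime_addOrderOf_dvd_card' (G := V) 2 h
  have h1 : (2 : F) • x = 0 := by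
    have h2 := addOrderOf_nsmul_eq_zero x
    rw [hx, two_nsmul] at h2
    rw [two_smul, h2]
  rw [smul_eq_zero_iff_right (NeZero.ne 2)] at h1
  rw [h1] at hx
  simp at hx

theorem weilRep_comm (hB : IsSymplectic B) (hψ : ψ ≠ 1) (g : symplecticGroup B)
    (x : Heisenberg B) :
    weilRep hB hψ g * heisRep B ψ x = heisRep B ψ (heisAct g x) * weilRep hB hψ g := by
  rw [← weilRep_intertwines hB hψ g x, mul_assoc, mul_assoc, ← map_mul, inv_mul_cancel, map_one,
    mul_one]

theorem isUnit_weilRep (hB : IsSymplectic B) (hψ : ψ ≠ 1) (g : symplecticGroup B) :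
    IsUnit (weilRep hB hψ g) :=
  IsUnit.of_mul_eq_one (weilRep hB hψ g⁻¹) (by rw [← map_mul, mul_inv_cancel, map_one])

theorem evenDet_oddDet_ne_zero (hB : IsSymplectic B) (hψ : ψ ≠ 1) (g : symplecticGroup B)
    (T : Module.End ℂ (Fin (heisDim B ψ) → ℂ)) (hu : IsUnit T)
    (hT : ∀ x, T * heisRep B ψ x = heisRep B ψ (heisAct g x) * T) :
    evenDet B ψ T ≠ 0 ∧ oddDet B ψ T ≠ 0 := by
  obtain ⟨U, rfl⟩ := hu
  have h1 := evenDet_mul hB hψ _ (↑U⁻¹ : Module.End ℂ (Fin (heisDim B ψ) → ℂ))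
    (heisParity_comm g _ hT)
  rw [Units.mul_inv] at h1
  have h2 : evenDet B ψ 1 = 1 := by simp [evenDet]
  have h3 : oddDet B ψ 1 = 1 := by simp [oddDet]
  rw [h2, h3] at h1
  exact ⟨fun h => by simp [h] at h1, fun h => by simp [h] at h1⟩

/-- The normalization of the Weil representation. -/
theorem evenDet_weilRep (hB : IsSymplectic B) (hψ : ψ ≠ 1) (g : symplecticGroup B) :
    evenDet B ψ (weilRep hB hψ g) = oddDet B ψ (weilRep hB hψ g) := by
  have hT := intertwiner_spec hB hψ g
  have h0 := evenDet_oddDet_ne_zero hB hψ g _ hT.1 hT.2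
  set T := intertwiner hB hψ g
  set c := oddDet B ψ T * (evenDet B ψ T)⁻¹ with hc
  have hc0 : c ≠ 0 := mul_ne_zero h0.2 (inv_ne_zero h0.1)
  have h1 : weilRep hB hψ g = c • T := rfl
  have h2 := evenDet_smul hB hψ c hc0 T
  rw [← h1, ← hc] at h2
  have h3 := mul_right_cancel₀ hc0 (h2.trans (one_mul c).symm)
  have h4 := (evenDet_oddDet_ne_zero hB hψ g _ (isUnit_weilRep hB hψ g)
    (weilRep_comm hB hψ g)).1
  exact (mul_inv_eq_one₀ h4).1 h3 |>.symm

/-- For an isotropic subspace `A`, the vectors fixed by `A` form the Weil representation of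
`A^⊥ / A`, up to the sign of the permutation of `V / A^⊥`. -/
theorem exists_weilRep_embedding {Y : Type*} [AddCommGroup Y] [Module F Y] [Fintype Y]
    [DecidableEq Y] (hB : IsSymplectic B) (hB' : IsSymplectic B') (hψ : ψ ≠ 1)
    (inc : V' →ₗ[F] V) (hinc : ∀ u v, B (inc u) (inc v) = B' u v) (A : Submodule F V)
    (hA : ∀ a ∈ A, ∀ b ∈ A, B a b = 0) (hAi : ∀ a ∈ A, ∀ u, B a (inc u) = 0)
    (hperp : ∀ v, (∀ a ∈ A, B a v = 0) → ∃ u, v - inc u ∈ A) (q : V →ₗ[F] Y)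
    (hq : Function.Surjective q) (hqA : ∀ v, q v = 0 ↔ ∀ a ∈ A, B a v = 0) :
    ∃ J : (Fin (heisDim B' ψ) → ℂ) →ₗ[ℂ] (Fin (heisDim B ψ) → ℂ), Function.Injective J ∧
      (∀ w, (∃ w', J w' = w) ↔ ∀ a ∈ A, heisRep B ψ ⟨a, 0⟩ w = w) ∧
      (∀ u t w, J (heisRep B' ψ ⟨u, t⟩ w) = heisRep B ψ ⟨inc u, t⟩ (J w)) ∧
      ∀ (g : symplecticGroup B) (g' : symplecticGroup B') (gY : Equiv.Perm Y),
        (∀ a ∈ A, g.1 a ∈ A) → (∀ u, g.1 (inc u) - inc (g'.1 u) ∈ A) →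
        (∀ v, q (g.1 v) = gY (q v)) → ∀ w,
          weilRep hB hψ g (J w) =
            ((Equiv.Perm.sign gY : ℤ) : ℂ) • J (weilRep hB' hψ g' w) := by
  classical
  have := Fintype.ofFinite V
  set δ := isoProj B ψ A 0 with hδ
  have hδy : gradOp B ψ A q (Pi.single 0 1) = δ := by
    have := gradOp_single (ψ := ψ) hqA hB hψ hA 0
    rwa [map_zero] at this
  have hδδ : δ * δ = δ := by
    rw [hδ, isoProj_mul_isoProj hψ hA, if_pos (by simp)]
  have hAδ : ∀ a ∈ A, ∀ w, heisRep B ψ ⟨a, 0⟩ (δ w) = δ w := by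
    intro a ha w
    have := LinearMap.congr_fun (heisRep_mul_isoProj (ψ := ψ) hA ⟨a, ha⟩ 0) w
    simpa using this
  have hfix : ∀ w, (∀ a ∈ A, heisRep B ψ ⟨a, 0⟩ w = w) → δ w = w := by
    intro w hw
    refine isoProj_apply_eq_self 0 w fun a ha => ?_
    simp [hw a ha]
  -- the representation of the smaller Heisenberg group on the vectors fixed by `A`
  let S₀ : Submodule ℂ (Fin (heisDim B ψ) → ℂ) := LinearMap.range δ
  have hS₀ : ∀ w, w ∈ S₀ ↔ ∀ a ∈ A, heisRep B ψ ⟨a, 0⟩ w = w := by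
    intro w
    constructor
    · rintro ⟨w, rfl⟩ a ha
      exact hAδ a ha w
    · intro h
      exact ⟨w, hfix w h⟩
  have hinv : ∀ x : Heisenberg B', ∀ w ∈ S₀, heisRep B ψ (heisMap inc hinc x) w ∈ S₀ := by
    intro x w hw
    rw [hS₀] at hw ⊢
    intro a ha
    have h1 : heisMap inc hinc x = ⟨inc x.vec, x.scal⟩ := rfl
    have h2 := LinearMap.congr_fun (heisRep_mul_comm (ψ := ψ) hB a (inc x.vec)) w
    rw [hAi a ha, AddChar.map_zero_eq_one, one_smul, Module.End.mul_apply,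
      Module.End.mul_apply, hw a ha] at h2
    rw [h1, heisRep_scal (inc x.vec), LinearMap.smul_apply, map_smul, h2]
  let W₀ : Subrepresentation ((heisRep B ψ).comp (heisMap inc hinc)) :=
    ⟨S₀, fun x w hw => hinv x w hw⟩
  let τ : Representation ℂ (Heisenberg B') S₀ := W₀.toRepresentation
  have hτ : ∀ x (w : S₀), (τ x w : Fin (heisDim B ψ) → ℂ) =
      heisRep B ψ ⟨inc x.vec, x.scal⟩ w := fun x w => rfl
  have hproj := (LinearMap.isProj_range_iff_isIdempotentElem δ).2 hδδ
  have htr : (finrank ℂ S₀ : ℂ) = (Nat.card A : ℂ)⁻¹ * heisDim B ψ := by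
    rw [← trace_isoProj hB hψ 0]
    exact hproj.trace.symm
  have hcA : (Nat.card A : ℂ) ≠ 0 := by exact_mod_cast Nat.card_pos.ne'
  have hcV : (Nat.card V : ℂ) ≠ 0 := by exact_mod_cast Nat.card_pos.ne'
  -- `A^⊥` is the direct sum of `A` and the image of `V'`. With `|A| |A^⊥| = |V|` this shows that
  -- the `A`-fixed vectors have the dimension of the Heisenberg representation of `V'`.
  have hcardker : Nat.card (LinearMap.ker q) = Nat.card A * Nat.card V' := by
    have hq0 : ∀ a ∈ A, q a = 0 := fun a ha => (hqA a).2 fun b hb => hA b hb a ha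
    have hqi : ∀ u, q (inc u) = 0 := fun u => (hqA _).2 fun b hb => hAi b hb u
    rw [← Nat.card_prod]
    symm
    refine Nat.card_congr (Equiv.ofBijective (fun p : A × V' =>
      (⟨p.1 + inc p.2, by
        rw [LinearMap.mem_ker, map_add, hq0 _ p.1.2, hqi, add_zero]⟩ : LinearMap.ker q)) ⟨?_, ?_⟩)
    · rintro ⟨a, u⟩ ⟨b, v⟩ h
      have h1 : (a : V) + inc u = b + inc v := congrArg Subtype.val h
      have h2 : inc (u - v) = b - a := by
        rw [map_sub, sub_eq_sub_iff_add_eq_add, add_comm, h1, add_comm]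
      have h3 : u - v = 0 := by
        refine hB'.nondeg _ fun w => ?_
        rw [← hinc, h2]
        exact hAi _ (A.sub_mem b.2 a.2) w
      have h4 : u = v := sub_eq_zero.1 h3
      subst h4
      rw [add_left_inj] at h1
      rw [Subtype.ext h1]
    · rintro ⟨v, hv⟩
      obtain ⟨u, hu⟩ := hperp v ((hqA v).1 hv)
      exact ⟨(⟨_, hu⟩, u), Subtype.ext (by simp)⟩
  have hdim : finrank ℂ S₀ = heisDim B' ψ := by
    have h1 : (finrank ℂ S₀ : ℂ) ^ 2 = (heisDim B' ψ : ℂ) ^ 2 := by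
      rw [heisDim_sq hB' hψ, htr, mul_pow, heisDim_sq hB hψ]
      have h2 := card_ker_eq (ψ := ψ) hqA hB hψ hA
      rw [hcardker] at h2
      push_cast at h2
      field_simp at h2 ⊢
      linear_combination -h2
    have h2 : finrank ℂ S₀ ^ 2 = heisDim B' ψ ^ 2 := by exact_mod_cast h1
    exact Nat.pow_left_injective two_ne_zero h2
  have hd0 : finrank ℂ S₀ ≠ 0 := by
    intro h
    have := heisDim_ne_zero hB' hψ
    rw [← hdim, h] at this
    simp at this
  obtain ⟨f, hf⟩ := heisRep_isIntertwining_of_center hB' hψ τ (fun t => by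
    refine LinearMap.ext fun w => Subtype.ext ?_
    rw [hτ]
    simp only [map_zero, heisRep_center]
    rfl) hd0
  have hfinj := (Representation.IsIrreducible.injective_or_eq_zero f).resolve_right hf
  have hfsurj : Function.Surjective f.toLinearMap := by
    refine (LinearMap.injective_iff_surjective_of_finrank_eq_finrank ?_).1 hfinj
    rw [hdim, finrank_fin_fun]
  let J : (Fin (heisDim B' ψ) → ℂ) →ₗ[ℂ] (Fin (heisDim B ψ) → ℂ) := S₀.subtype.comp f.toLinearMap
  have hJinj : Function.Injective J := Subtype.val_injective.comp hfinj
  have hJr : ∀ w, (∃ w', J w' = w) ↔ ∀ a ∈ A, heisRep B ψ ⟨a, 0⟩ w = w := by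
    intro w
    rw [← hS₀]
    constructor
    · rintro ⟨w', rfl⟩
      exact (f.toLinearMap w').2
    · intro hw
      obtain ⟨w', hw'⟩ := hfsurj ⟨w, hw⟩
      exact ⟨w', congrArg Subtype.val hw'⟩
  have hJh : ∀ u t w, J (heisRep B' ψ ⟨u, t⟩ w) = heisRep B ψ ⟨inc u, t⟩ (J w) := by
    intro u t w
    exact congrArg Subtype.val (f.isIntertwining _ _ ⟨u, t⟩ w)
  -- the parity operators correspond
  let fe := LinearEquiv.ofBijective f.toLinearMap ⟨hfinj, hfsurj⟩
  let R : (Fin (heisDim B ψ) → ℂ) →ₗ[ℂ] (Fin (heisDim B' ψ) → ℂ) :=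
    fe.symm.toLinearMap.comp δ.rangeRestrict
  have hJR : J.comp R = δ := by
    refine LinearMap.ext fun w => ?_
    have : fe (fe.symm (δ.rangeRestrict w)) = δ.rangeRestrict w := fe.apply_symm_apply _
    exact congrArg Subtype.val this
  have hδJ : ∀ w, δ (J w) = J w := fun w => hfix _ ((hJr _).1 ⟨w, rfl⟩)
  have hJR' : ∀ w, J (R w) = δ w := fun w => LinearMap.congr_fun hJR w
  have hRJ : R.comp J = 1 := by
    refine LinearMap.ext fun w => hJinj ?_
    change J (R (J w)) = J w
    rw [hJR', hδJ]
  have hδP : heisParity B ψ * δ = δ * heisParity B ψ := by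
    rw [hδ, heisParity_mul_isoProj hB, neg_zero]
  have hPJ : (heisParity B ψ).comp J = J.comp (heisParity B' ψ) := by
    -- `K` is the large parity operator seen on the small space. Both `K` and the small parity
    -- operator intertwine the action of `-1`, so they are proportional, and they are equal because
    -- both have trace one.
    let K : Module.End ℂ (Fin (heisDim B' ψ) → ℂ) := R.comp ((heisParity B ψ).comp J)
    have hJK : ∀ w, J (K w) = heisParity B ψ (J w) := by
      intro w
      change J (R (heisParity B ψ (J w))) = _
      rw [hJR', ← Module.End.mul_apply, ← hδP, Module.End.mul_apply, hδJ]
    let n : symplecticGroup B' := ⟨LinearEquiv.neg F, fun x y => by simp⟩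
    have hneg : ∀ x : Heisenberg B', heisAct n x = ⟨-x.vec, x.scal⟩ := fun x => rfl
    have hP' : ∀ x, heisParity B' ψ * heisRep B' ψ x =
        heisRep B' ψ (heisAct n x) * heisParity B' ψ := by
      rintro ⟨u, t⟩
      rw [hneg, heisRep_scal, heisRep_scal (-u), mul_smul_comm, smul_mul_assoc,
        heisParity_mul_heisRep hB']
    have hK : ∀ x, K * heisRep B' ψ x = heisRep B' ψ (heisAct n x) * K := by
      rintro ⟨u, t⟩
      refine LinearMap.ext fun w => hJinj ?_
      rw [Module.End.mul_apply, Module.End.mul_apply, hJK, hJh, hneg, hJh, hJK, map_neg,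
        ← Module.End.mul_apply, ← Module.End.mul_apply, heisRep_scal, heisRep_scal (-inc u),
        mul_smul_comm, smul_mul_assoc, heisParity_mul_heisRep hB]
    have hKK : K * K = 1 := by
      refine LinearMap.ext fun w => hJinj ?_
      rw [Module.End.mul_apply, hJK, hJK, ← Module.End.mul_apply, heisParity_sq hB hψ]
      rfl
    obtain ⟨c, hc0, hc⟩ := intertwiner_unique n (heisParity B' ψ) K
      (IsUnit.of_mul_eq_one _ (heisParity_sq hB' hψ)) (IsUnit.of_mul_eq_one _ hKK) hP' hK
    have htrK : LinearMap.trace ℂ _ K = 1 := by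
      have e1 : LinearMap.trace ℂ _ K = LinearMap.trace ℂ _ (δ * heisParity B ψ) := by
        rw [← hδP, ← hJR]
        exact LinearMap.trace_comp_comm' ((heisParity B ψ).comp J) R
      have := Fintype.ofFinite A
      have h0 : ∀ v : V, LinearMap.trace ℂ _ (heisRep B ψ ⟨v, 0⟩) =
          if v = 0 then (heisDim B ψ : ℂ) else 0 := by
        intro v
        split_ifs with hv
        · subst hv
          simp [heisRep_zero]
        · exact heis_char_zero hB hψ ⟨v, 0⟩ hv
      -- Of the terms of the parity operator only `v = -a` becomes central after multiplication by
      -- the operator of `a`.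
      have h1 : ∀ a : A, LinearMap.trace ℂ _ (heisRep B ψ ⟨a, 0⟩ * heisParity B ψ) = 1 := by
        intro a
        rw [heisParity, finsum_eq_sum_of_fintype, mul_smul_comm, Finset.mul_sum, map_smul, map_sum,
          Finset.sum_eq_single (-(a : V))]
        · rw [heisRep_mul, map_smul, h0, if_pos (add_neg_cancel _), map_neg, hB.alt]
          simp [heisDim_ne_zero hB hψ]
        · intro v _ hv
          rw [heisRep_mul, map_smul, h0, if_neg, smul_zero]
          intro h
          exact hv (eq_neg_of_add_eq_zero_right h)
        · simp
      rw [e1, hδ, isoProj_eq, smul_mul_assoc, Finset.sum_mul, map_smul, map_sum]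
      simp only [map_zero, neg_zero, AddChar.map_zero_eq_one, one_smul, h1]
      simp
    rw [hc, map_smul, heisParity_trace hB' hψ, smul_eq_mul, mul_one] at htrK
    rw [htrK, one_smul] at hc
    refine LinearMap.ext fun w => ?_
    change heisParity B ψ (J w) = J (heisParity B' ψ w)
    rw [← hJK, hc]
  have heJ : (evenProj B ψ).comp J = J.comp (evenProj B' ψ) := by
    refine LinearMap.ext fun w => ?_
    have := LinearMap.congr_fun hPJ w
    simp only [LinearMap.comp_apply] at this
    simp only [evenProj, LinearMap.comp_apply, LinearMap.smul_apply, LinearMap.add_apply,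
      Module.End.one_apply, map_smul, map_add, this]
  have hoJ : (1 - evenProj B ψ).comp J = J.comp (1 - evenProj B' ψ) := by
    rw [LinearMap.sub_comp, LinearMap.comp_sub, heJ]
    rfl
  have hoddp : ∀ T, oddDet B ψ T = projDet (1 - evenProj B ψ) T := fun T => by
    rw [oddDet, projDet, sub_sub_cancel]
  have hoddp' : ∀ T, oddDet B' ψ T = projDet (1 - evenProj B' ψ) T := fun T => by
    rw [oddDet, projDet, sub_sub_cancel]
  refine ⟨J, hJinj, hJr, hJh, fun g g' gY hgA hgi hgY w => ?_⟩
  set T := weilRep hB hψ g with hTdef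
  have hT : ∀ x, T * heisRep B ψ x = heisRep B ψ (heisAct g x) * T := weilRep_comm hB hψ g
  have hTδ : T * δ = δ * T := by
    rw [hδ, intertwiner_mul_isoProj g hgA T hT, map_zero]
  -- `T'` is the restriction of `T` to the `A`-fixed vectors. It intertwines the action of `g'`, so
  -- it is a multiple of the small Weil operator, and the task is to find the factor `c`.
  let T' : Module.End ℂ (Fin (heisDim B' ψ) → ℂ) := R.comp (T.comp J)
  have hJT' : ∀ w, J (T' w) = T (J w) := by
    intro w
    change J (R (T (J w))) = _
    rw [hJR', ← Module.End.mul_apply, ← hTδ, Module.End.mul_apply, hδJ]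
  have hT' : ∀ x, T' * heisRep B' ψ x = heisRep B' ψ (heisAct g' x) * T' := by
    rintro ⟨u, t⟩
    refine LinearMap.ext fun w => hJinj ?_
    have h1 : heisAct g' ⟨u, t⟩ = ⟨g'.1 u, t⟩ := rfl
    have h2 : heisAct g ⟨inc u, t⟩ = ⟨inc (g'.1 u), t⟩ * ⟨g.1 (inc u) - inc (g'.1 u), 0⟩ := by
      ext
      · simp [heisAct]
      · have : B (inc (g'.1 u)) (g.1 (inc u) - inc (g'.1 u)) = 0 := by
          rw [hB.neg, hAi _ (hgi u), neg_zero]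
        simp [heisAct, this]
    rw [Module.End.mul_apply, Module.End.mul_apply, hJT', hJh, h1, hJh, hJT',
      ← Module.End.mul_apply, hT, h2, map_mul, Module.End.mul_apply, Module.End.mul_apply,
      ← hJT', (hJr _).1 ⟨_, rfl⟩ _ (hgi u)]
  have hTu := isUnit_weilRep hB hψ g
  have hT'u : IsUnit T' := by
    have hinj : Function.Injective T' := by
      intro a b hab
      have h1 := congrArg J hab
      rw [hJT', hJT'] at h1
      exact hJinj (((Module.End.isUnit_iff _).1 hTu).1 h1)
    exact (Module.End.isUnit_iff _).2 ⟨hinj, LinearMap.injective_iff_surjective.1 hinj⟩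
  obtain ⟨c, hc0, hc⟩ := intertwiner_unique g' _ T' (isUnit_weilRep hB' hψ g') hT'u
    (weilRep_comm hB' hψ g') hT'
  suffices hcs : c = ((Equiv.Perm.sign gY : ℤ) : ℂ) by
    rw [← hJT', hc, LinearMap.smul_apply, map_smul, hcs]
  have hTP := heisParity_comm g T hT
  have hcomm : ∀ X : Module.End ℂ (Fin (heisDim B ψ) → ℂ),
      X * heisParity B ψ = heisParity B ψ * X → X * evenProj B ψ = evenProj B ψ * X := by
    intro X hX
    rw [evenProj, mul_smul_comm, smul_mul_assoc, mul_add, add_mul, mul_one, one_mul, hX]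
  -- `T` is the product of its part on the `A`-fixed vectors and its part on the other components,
  -- each extended by the identity. The first part has the determinants of `T'`; for the second the
  -- even and odd determinants differ by the sign of `gY`.
  have hTa : T = (T * J.comp R + (1 - J.comp R)) * (T * (1 - δ) + δ) := by
    have e0 : T * (1 - δ) = (1 - δ) * T := by rw [mul_sub, sub_mul, mul_one, one_mul, hTδ]
    have e1 : T * δ * (T * (1 - δ)) = 0 := by
      rw [e0, mul_assoc, ← mul_assoc δ, mul_sub, mul_one, hδδ, sub_self, zero_mul, mul_zero]
    have e2 : (1 - δ) * (T * (1 - δ)) = T * (1 - δ) := by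
      have : (1 - δ) * (1 - δ) = 1 - δ := by simp [mul_sub, sub_mul, hδδ]
      rw [e0, ← mul_assoc, this]
    have e3 : (1 - δ) * δ = 0 := by rw [sub_mul, one_mul, hδδ, sub_self]
    rw [hJR, add_mul, mul_add, mul_add, e1, e2, e3, mul_assoc, hδδ, mul_sub, mul_one]
    abel
  have hTac : (T * J.comp R + (1 - J.comp R)) * heisParity B ψ =
      heisParity B ψ * (T * J.comp R + (1 - J.comp R)) := by
    rw [hJR, add_mul, mul_add, sub_mul, mul_sub, ← hδP, mul_assoc, ← hδP, ← mul_assoc, hTP,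
      mul_one, one_mul, mul_assoc]
  have hdets := evenDet_mul hB hψ _ (T * (1 - δ) + δ) hTac
  rw [← hTa] at hdets
  have hJT'' : T.comp J = J.comp T' := LinearMap.ext fun w => (hJT' w).symm
  have hev : evenDet B ψ (T * J.comp R + (1 - J.comp R)) = evenDet B' ψ T' :=
    projDet_extend J R hRJ _ _ heJ _ _ hJT''
  have hod : oddDet B ψ (T * J.comp R + (1 - J.comp R)) = oddDet B' ψ T' := by
    rw [hoddp, hoddp']
    exact projDet_extend J R hRJ _ _ hoJ _ _ hJT''
  have h2Y : ∀ y : Y, -y = y → y = 0 := by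
    intro y hy
    have h1 : (2 : F) • y = 0 := by
      rw [two_smul]
      nth_rewrite 1 [← hy]
      simp
    exact (smul_eq_zero_iff_right (NeZero.ne 2)).1 h1
  have hgYn : ∀ y, gY (-y) = -gY y := by
    intro y
    obtain ⟨v, rfl⟩ := hq y
    rw [← map_neg, ← hgY, ← hgY, map_neg, map_neg]
  have hodd : Odd (heisDim B' ψ) := by
    have h1 : heisDim B' ψ ^ 2 = Nat.card V' := by exact_mod_cast heisDim_sq hB' hψ
    have h2 := odd_natCard_of_two_ne_zero F V'
    rw [← h1] at h2
    exact Nat.Odd.of_mul_left (by rwa [pow_two] at h2)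
  have hTb := projDet_even_eq_sign_mul_projDet_odd h2Y (gradHom ψ hqA hB hψ hA) hodd
    (fun f => by
      rw [← hdim, htr]
      exact trace_gradOp hqA hq hB hψ hA f) (heisParity B ψ) T (heisParity_sq hB hψ) hTP
    (fun f => heisParity_mul_gradOp hB f) gY hgYn
    (fun f => gradOp_mul_intertwiner g hgA T hT gY hgY f) (evenProj B ψ) rfl
  have hMδ : gradHom ψ hqA hB hψ hA (Pi.single 0 1) = δ := hδy
  rw [hMδ, ← hoddp] at hTb
  change evenDet B ψ (T * (1 - δ) + δ) = _ at hTb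
  have hnorm := evenDet_weilRep hB hψ g
  have hne := evenDet_oddDet_ne_zero hB hψ g T hTu hT
  rw [← hTdef, hdets.1, hdets.2, hev, hod, hTb] at hnorm
  rw [hdets.2] at hne
  have hob := right_ne_zero_of_mul hne.2
  -- The even and odd determinants of `T` agree by the normalization, so the sign from the other
  -- components must be compensated in `T'`.
  have h1 : oddDet B' ψ T' = ((Equiv.Perm.sign gY : ℤ) : ℂ) * evenDet B' ψ T' := by
    apply mul_right_cancel₀ hob
    linear_combination -hnorm
  -- Scaling by `c` divides the ratio of odd to even determinant by `c`. This ratio is one for the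
  -- small Weil operator and the sign for `T'`, which determines `c`.
  have h2 := evenDet_smul hB' hψ c hc0 (weilRep hB' hψ g')
  have h3 := (evenDet_oddDet_ne_zero hB' hψ g' _ (isUnit_weilRep hB' hψ g')
    (weilRep_comm hB' hψ g'))
  have h4 := (evenDet_oddDet_ne_zero hB' hψ g' T' hT'u hT').1
  rw [← hc, h1, ← evenDet_weilRep hB' hψ g', mul_inv_cancel₀ h3.1, mul_inv_cancel_right₀ h4] at h2
  rcases Int.units_eq_one_or (Equiv.Perm.sign gY) with h5 | h5
  · rw [h5] at h2 ⊢
    simpa using h2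
  · rw [h5] at h2 ⊢
    push_cast at h2 ⊢
    linear_combination -h2

end Embedding

/-! ### Signs of permutations of finite vector spaces. -/

section PermSign

/-- The sign of a permutation of a finite set, without a choice of an enumeration. -/
noncomputable def permSign (Y : Type*) [Finite Y] : Equiv.Perm Y →* ℤˣ :=
  @Equiv.Perm.sign Y (Classical.decEq Y) (Fintype.ofFinite Y)

theorem permSign_eq {Y : Type*} [DecidableEq Y] [Fintype Y] (f : Equiv.Perm Y) :
    permSign Y f = Equiv.Perm.sign f := by
  classical
  exact @Equiv.Perm.sign_eq_sign_of_equiv Y (Classical.decEq Y) Y (Fintype.ofFinite Y) _ _ f f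
    (Equiv.refl Y) (fun _ => rfl)

theorem permSign_eq_of_equiv {Y Z : Type*} [Finite Y] [Finite Z] (f : Equiv.Perm Y)
    (g : Equiv.Perm Z) (e : Y ≃ Z) (h : ∀ x, e (f x) = g (e x)) : permSign Y f = permSign Z g :=
  @Equiv.Perm.sign_eq_sign_of_equiv Y (Classical.decEq Y) Z (Fintype.ofFinite Y)
    (Classical.decEq Z) (Fintype.ofFinite Z) f g e h

theorem permSign_prodCongrRight {Y Z : Type*} [Fintype Y] [Finite Z] (σ : Y → Equiv.Perm Z) :
    permSign (Y × Z) (Equiv.prodCongrRight σ) = ∏ y, permSign Z (σ y) := by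
  classical
  have := Fintype.ofFinite Z
  simp only [permSign_eq, Equiv.Perm.sign_prodCongrRight]

theorem permSign_prodCongrLeft {Y Z : Type*} [Fintype Y] [Finite Z] (σ : Y → Equiv.Perm Z) :
    permSign (Z × Y) (Equiv.prodCongrLeft σ) = ∏ y, permSign Z (σ y) := by
  classical
  have := Fintype.ofFinite Z
  simp only [permSign_eq, Equiv.Perm.sign_prodCongrLeft]

theorem units_pow_of_odd (s : ℤˣ) {n : ℕ} (hn : Odd n) : s ^ n = s := by
  rcases Int.units_eq_one_or s with rfl | rfl
  · simp
  · exact hn.neg_one_pow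

/-- A translation is the square of the translation by half the vector. -/
theorem permSign_addRight {F Y : Type*} [Field F] [NeZero (2 : F)] [AddCommGroup Y] [Module F Y]
    [Finite Y] (v : Y) : permSign Y (Equiv.addRight v) = 1 := by
  have h1 : Equiv.addRight v =
      (Equiv.addRight ((2⁻¹ : F) • v) * Equiv.addRight ((2⁻¹ : F) • v) : Equiv.Perm Y) := by
    ext x
    have h2 : (2⁻¹ : F) • v + (2⁻¹ : F) • v = v := by
      rw [← add_smul, ← two_mul, mul_inv_cancel₀ (NeZero.ne _), one_smul]
    simp [add_assoc, h2]
  rw [h1, map_mul, Int.units_mul_self]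

/-- The permutation `(y, z) ↦ (σ y, τ z + L y)`. -/
def shearPerm {Y Z : Type*} [AddGroup Z] (σ : Equiv.Perm Y) (τ : Equiv.Perm Z)
    (L : Y → Z) : Equiv.Perm (Y × Z) :=
  (Equiv.prodCongrRight fun y => τ.trans (Equiv.addRight (L y))).trans
    (Equiv.prodCongrLeft fun _ => σ)

theorem shearPerm_apply {Y Z : Type*} [AddGroup Z] (σ : Equiv.Perm Y) (τ : Equiv.Perm Z)
    (L : Y → Z) (p : Y × Z) : shearPerm σ τ L p = (σ p.1, τ p.2 + L p.1) := rfl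

/-- The translations are even, and `Y` and `Z` have odd cardinality, so each of `σ` and `τ`
contributes its sign once. -/
theorem permSign_shearPerm {F Y Z : Type*} [Field F] [NeZero (2 : F)] [Finite Y] [AddCommGroup Y]
    [Module F Y] [AddCommGroup Z] [Module F Z] [Finite Z] (σ : Equiv.Perm Y) (τ : Equiv.Perm Z)
    (L : Y → Z) : permSign (Y × Z) (shearPerm σ τ L) = permSign Y σ * permSign Z τ := by
  have := Fintype.ofFinite Y
  have := Fintype.ofFinite Z
  have h1 : shearPerm σ τ L = (Equiv.prodCongrLeft fun _ => σ) *
    (Equiv.prodCongrRight fun y => Equiv.addRight (L y) * τ) := rfl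
  rw [h1, map_mul, permSign_prodCongrLeft, permSign_prodCongrRight]
  simp only [map_mul, permSign_addRight (F := F), one_mul, Finset.prod_const, Finset.card_univ]
  rw [← Nat.card_eq_fintype_card, ← Nat.card_eq_fintype_card,
    units_pow_of_odd _ (odd_natCard_of_two_ne_zero F Z),
    units_pow_of_odd _ (odd_natCard_of_two_ne_zero F Y)]

end PermSign

/-! ### The sign of multiplication by matrices. -/

section MulSign

variable {D : Type*} [Field D] [Finite D] [NeZero (2 : D)] {ι κ : Type*} [Fintype ι]
  [DecidableEq ι] [Fintype κ] [DecidableEq κ]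

/-- The sign of the permutation of `D` defined by the multiplication by a unit. -/
noncomputable def mulSign (D : Type*) [Field D] [Finite D] : Dˣ →* ℤˣ :=
  (permSign D).comp (MulAction.toPermHom Dˣ D)

/-- By multiplicativity it suffices to scale one coordinate. The remaining coordinates only repeat
this permutation of `D` an odd number of times. -/
theorem permSign_pi_smul (x : ι → Dˣ) :
    permSign (ι → D) (MulAction.toPermHom (ι → Dˣ) (ι → D) x) = ∏ i, mulSign D (x i) := by
  have key : (permSign (ι → D)).comp (MulAction.toPermHom (ι → Dˣ) (ι → D)) =
      ∏ i, (mulSign D).comp (Pi.evalMonoidHom (fun _ : ι => Dˣ) i) := by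
    refine MonoidHom.functions_ext (M := fun _ : ι => Dˣ) _ _ _ fun i u => ?_
    rw [MonoidHom.finsetProd_apply, Finset.prod_eq_single i]
    · have := Fintype.ofFinite ({j // j ≠ i} → D)
      rw [MonoidHom.comp_apply, permSign_eq_of_equiv _ (Equiv.prodCongrLeft
        fun _ : ({j // j ≠ i} → D) => MulAction.toPermHom Dˣ D u) (Equiv.funSplitAt i D),
        permSign_prodCongrLeft]
      · rw [Finset.prod_const, Finset.card_univ, ← Nat.card_eq_fintype_card,
          units_pow_of_odd _ (odd_natCard_of_two_ne_zero D _)]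
        simp [mulSign]
      · intro f
        refine Prod.ext ?_ ?_
        · simp [Equiv.funSplitAt, Equiv.piSplitAt, Units.smul_def]
        · ext j
          simp [Equiv.funSplitAt, Equiv.piSplitAt, j.2]
    · intro j _ hj
      simp [Pi.mulSingle_eq_of_ne hj]
    · simp
  have := DFunLike.congr_fun key x
  rwa [MonoidHom.finsetProd_apply] at this

/-- The diagonal matrices in the general linear group. -/
def diagGL (ι : Type*) [Fintype ι] [DecidableEq ι] (D : Type*) [Field D] : (ι → Dˣ) →* GL ι D :=
  (Units.map (Matrix.diagonalRingHom ι D).toMonoidHom).comp MulEquiv.piUnits.symm.toMonoidHom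

theorem coe_diagGL (x : ι → Dˣ) :
    (diagGL ι D x : Matrix ι ι D) = Matrix.diagonal fun i => (x i : D) := rfl

theorem det_diagGL (x : ι → Dˣ) : (diagGL ι D x).det = ∏ i, x i := by
  ext
  simp [coe_diagGL]

/-- The group is generated by diagonal matrices and transvections, and a transvection is the square
of the one with half the parameter, so homomorphisms to `±1` do not see it. -/
theorem hom_units_ext_of_diagGL (f₁ f₂ : GL ι D →* ℤˣ)
    (h : ∀ x, f₁ (diagGL ι D x) = f₂ (diagGL ι D x)) : f₁ = f₂ := by
  ext1 g
  have key : ∀ M : Matrix ι ι D, M.det ≠ 0 → ∀ g : GL ι D, (g : Matrix ι ι D) = M →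
      f₁ g = f₂ g := by
    intro M hM
    refine Matrix.diagonal_transvection_induction_of_det_ne_zero
      (fun M => ∀ g : GL ι D, (g : Matrix ι ι D) = M → f₁ g = f₂ g) M hM ?_ ?_ ?_
    · intro x hx g hg
      rw [Matrix.det_diagonal, Finset.prod_ne_zero_iff] at hx
      have : g = diagGL ι D fun i => Units.mk0 (x i) (hx i (Finset.mem_univ i)) := by
        apply Units.ext
        rw [hg, coe_diagGL]
        rfl
      rw [this, h]
    · rintro ⟨i, j, hij, c⟩ g hg
      have h2 : (Matrix.transvection i j (2⁻¹ * c)).det ≠ 0 := by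
        rw [Matrix.det_transvection_of_ne _ _ hij]; exact one_ne_zero
      have : g = Matrix.GeneralLinearGroup.mkOfDetNeZero _ h2 *
          Matrix.GeneralLinearGroup.mkOfDetNeZero _ h2 := by
        apply Units.ext
        rw [hg, Units.val_mul]
        change Matrix.transvection i j c =
          Matrix.transvection i j (2⁻¹ * c) * Matrix.transvection i j (2⁻¹ * c)
        rw [Matrix.transvection_mul_transvection_same _ _ hij, ← add_mul, ← two_mul,
          mul_inv_cancel₀ (NeZero.ne _), one_mul]
      rw [this, map_mul, map_mul, Int.units_mul_self, Int.units_mul_self]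
    · intro A B hA hB h1 h2 g hg
      have : g = Matrix.GeneralLinearGroup.mkOfDetNeZero A hA *
          Matrix.GeneralLinearGroup.mkOfDetNeZero B hB := by
        apply Units.ext
        rw [hg, Units.val_mul]
        rfl
      rw [this, map_mul, map_mul, h1 _ rfl, h2 _ rfl]
  refine key _ ?_ g rfl
  exact ((Matrix.isUnit_iff_isUnit_det _).1 g.isUnit).ne_zero

/-- The permutation `X ↦ g X a⁻¹` of the matrices. -/
def matPerm (ι κ D : Type*) [Fintype ι] [DecidableEq ι] [Fintype κ] [DecidableEq κ] [Field D] :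
    GL ι D × GL κ D →* Equiv.Perm (Matrix ι κ D) where
  toFun p :=
    { toFun := fun X => (p.1 : Matrix ι ι D) * X * (↑p.2⁻¹ : Matrix κ κ D)
      invFun := fun X => (↑p.1⁻¹ : Matrix ι ι D) * X * (p.2 : Matrix κ κ D)
      left_inv := fun X => by
        have h1 : (↑p.1⁻¹ : Matrix ι ι D) * (p.1 : Matrix ι ι D) = 1 := p.1.inv_mul
        have h2 : (↑p.2⁻¹ : Matrix κ κ D) * (p.2 : Matrix κ κ D) = 1 := p.2.inv_mul
        simp only [Matrix.mul_assoc, h2, Matrix.mul_one]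
        rw [← Matrix.mul_assoc, h1, Matrix.one_mul]
      right_inv := fun X => by
        have h1 : (p.1 : Matrix ι ι D) * (↑p.1⁻¹ : Matrix ι ι D) = 1 := p.1.mul_inv
        have h2 : (p.2 : Matrix κ κ D) * (↑p.2⁻¹ : Matrix κ κ D) = 1 := p.2.mul_inv
        simp only [Matrix.mul_assoc, h2, Matrix.mul_one]
        rw [← Matrix.mul_assoc, h1, Matrix.one_mul] }
  map_one' := by ext; simp
  map_mul' p q := by ext1 X; simp [Matrix.mul_assoc]

theorem matPerm_apply (p : GL ι D × GL κ D) (X : Matrix ι κ D) :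
    matPerm ι κ D p X = (p.1 : Matrix ι ι D) * X * (↑p.2⁻¹ : Matrix κ κ D) := rfl

/-- Both sides are multiplicative in each factor, so diagonal matrices suffice, and these scale the
entries separately. -/
theorem permSign_matPerm (p : GL ι D × GL κ D) :
    permSign (Matrix ι κ D) (matPerm ι κ D p) =
      mulSign D p.1.det ^ Fintype.card κ * mulSign D p.2.det ^ Fintype.card ι := by
  have h1 : ((permSign (Matrix ι κ D)).comp (matPerm ι κ D)).comp (MonoidHom.inl _ _) =
      (powMonoidHom (Fintype.card κ)).comp
        ((mulSign D).comp Matrix.GeneralLinearGroup.det) := by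
    refine hom_units_ext_of_diagGL _ _ fun x => ?_
    simp only [MonoidHom.comp_apply, powMonoidHom_apply, det_diagGL, MonoidHom.inl_apply]
    rw [permSign_eq_of_equiv _ (MulAction.toPermHom (ι × κ → Dˣ) (ι × κ → D) fun i => x i.1)
      (show Matrix ι κ D ≃ (ι × κ → D) from (Equiv.curry ι κ D).symm), permSign_pi_smul,
      Fintype.prod_prod_type, map_prod,
      ← Finset.prod_pow]
    · simp
    · intro X
      ext ⟨i, j⟩
      change (matPerm ι κ D (diagGL ι D x, 1) X) i j = x i • X i j
      simp [matPerm_apply, coe_diagGL, Units.smul_def]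
  have h2 : ((permSign (Matrix ι κ D)).comp (matPerm ι κ D)).comp (MonoidHom.inr _ _) =
      (powMonoidHom (Fintype.card ι)).comp
        ((mulSign D).comp Matrix.GeneralLinearGroup.det) := by
    refine hom_units_ext_of_diagGL _ _ fun x => ?_
    simp only [MonoidHom.comp_apply, powMonoidHom_apply, det_diagGL, MonoidHom.inr_apply]
    rw [permSign_eq_of_equiv _ (MulAction.toPermHom (ι × κ → Dˣ) (ι × κ → D) fun i => (x i.2)⁻¹)
      (show Matrix ι κ D ≃ (ι × κ → D) from (Equiv.curry ι κ D).symm), permSign_pi_smul,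
      Fintype.prod_prod_type, map_prod,
      ← Finset.card_univ, ← Finset.prod_const]
    · simp
    · intro X
      ext ⟨i, j⟩
      change (matPerm ι κ D (1, diagGL κ D x) X) i j = (x j)⁻¹ • X i j
      rw [matPerm_apply, ← map_inv, coe_diagGL]
      simp [Units.smul_def, mul_comm]
  have h3 : p = (p.1, 1) * (1, p.2) := by simp
  have e1 := DFunLike.congr_fun h1 p.1
  have e2 := DFunLike.congr_fun h2 p.2
  simp only [MonoidHom.comp_apply, powMonoidHom_apply, MonoidHom.inl_apply,
    MonoidHom.inr_apply] at e1 e2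
  rw [← e1, ← e2, ← map_mul, ← map_mul, ← h3]

end MulSign

/-! ### Quadratic characters and the twist of `ω♭`. -/

section Characters

variable {D : Type*} [Field D] [Finite D] [NeZero (2 : D)]

/-- A generator of the cyclic group `Dˣ` permutes the nonzero elements in one cycle of length `|D| -
1`, which is even, and a cycle of even length is an odd permutation. So `mulSign` is the quadratic
character of `D`. -/
theorem exists_generator_mulSign (D : Type*) [Field D] [Finite D] [NeZero (2 : D)] :
    ∃ ζ : Dˣ, (∀ x, x ∈ Subgroup.zpowers ζ) ∧ mulSign D ζ = -1 := by
  classical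
  obtain ⟨ζ, hζ⟩ := IsCyclic.exists_generator (α := Dˣ)
  refine ⟨ζ, hζ, ?_⟩
  have := Fintype.ofFinite D
  have hζ1 : ζ ≠ 1 := by
    rintro rfl
    have h1 := hζ (-1)
    rw [Subgroup.zpowers_one_eq_bot, Subgroup.mem_bot] at h1
    exact neg_one_ne_one_of_two (D := D) (congrArg Units.val h1)
  have hcyc : Equiv.Perm.IsCycle (MulAction.toPermHom Dˣ D ζ) := by
    refine ⟨1, ?_, fun y hy => ?_⟩
    · simpa [Units.smul_def] using hζ1
    · have hy0 : y ≠ 0 := by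
        rintro rfl
        simp at hy
      obtain ⟨n, hn⟩ := hζ (Units.mk0 y hy0)
      refine ⟨n, ?_⟩
      simp only at hn
      rw [← map_zpow, hn]
      simp [Units.smul_def]
  have hsupp : (MulAction.toPermHom Dˣ D ζ).support = Finset.univ.erase 0 := by
    ext y
    simp only [Equiv.Perm.mem_support, Finset.mem_erase, Finset.mem_univ, and_true,
      MulAction.toPermHom_apply, MulAction.toPerm_apply, Units.smul_def, smul_eq_mul]
    constructor
    · rintro h rfl
      simp at h
    · intro h h2
      exact hζ1 (Units.ext (mul_right_cancel₀ h (by rw [h2]; simp)))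
  rw [mulSign, MonoidHom.comp_apply, permSign_eq, hcyc.sign, hsupp,
    Finset.card_erase_of_mem (Finset.mem_univ _), Finset.card_univ, Even.neg_one_pow]
  rw [← Nat.card_eq_fintype_card]
  exact Nat.Odd.sub_odd (odd_natCard_of_two_ne_zero D D) odd_one

/-- The multiplication signs give the only nontrivial character of order two. -/
theorem eq_mulSign (f : Dˣ →* ℤˣ) (hf : ∃ x, f x ≠ 1) : f = mulSign D := by
  obtain ⟨ζ, hζ, hs⟩ := exists_generator_mulSign D
  have h1 : f ζ = -1 := by
    rcases Int.units_eq_one_or (f ζ) with h | h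
    · obtain ⟨x, hx⟩ := hf
      obtain ⟨n, rfl⟩ := hζ x
      simp [h] at hx
    · exact h
  ext1 x
  obtain ⟨n, rfl⟩ := hζ x
  simp [h1, hs]

/-- `-1` is the power of a generator with exponent `(|D| - 1) / 2`. -/
theorem mulSign_neg_one : mulSign D (-1) = (-1) ^ ((Nat.card D - 1) / 2) := by
  obtain ⟨ζ, hζ, hs⟩ := exists_generator_mulSign D
  have hcard : Nat.card Dˣ = Nat.card D - 1 := by
    have := Fintype.ofFinite D
    classical
    rw [Nat.card_eq_fintype_card, Nat.card_eq_fintype_card, Fintype.card_units]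
  have hord : orderOf ζ = Nat.card D - 1 := by
    rw [orderOf_eq_card_of_forall_mem_zpowers hζ, hcard]
  have heven : Even (Nat.card D - 1) := Nat.Odd.sub_odd (odd_natCard_of_two_ne_zero D D) odd_one
  have hlt : 1 < Nat.card D := Finite.one_lt_card
  have h2 : ζ ^ ((Nat.card D - 1) / 2) = -1 := by
    have h3 : ((ζ ^ ((Nat.card D - 1) / 2) : Dˣ) : D) ^ 2 = 1 ^ 2 := by
      rw [← Units.val_pow_eq_pow_val, ← pow_mul, Nat.div_mul_cancel heven.two_dvd, ← hord,
        pow_orderOf_eq_one]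
      simp
    rcases eq_or_eq_neg_of_sq_eq_sq _ _ h3 with h4 | h4
    · have h5 : ζ ^ ((Nat.card D - 1) / 2) = 1 := Units.ext h4
      have := Nat.le_of_dvd (by obtain ⟨r, hr⟩ := heven; omega) (orderOf_dvd_of_pow_eq_one h5)
      obtain ⟨r, hr⟩ := heven
      omega
    · exact Units.ext h4
  rw [← h2, map_pow, hs]

variable [StarRing D]

/-- The involution conjugates multiplication by `x` into multiplication by `star x`. -/
theorem mulSign_star (x y : Dˣ) (h : (y : D) = star (x : D)) : mulSign D y = mulSign D x := by
  rw [mulSign, MonoidHom.comp_apply, MonoidHom.comp_apply]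
  refine permSign_eq_of_equiv _ _ (starRingAut (R := D)).toEquiv fun z => ?_
  simp [Units.smul_def, h]

theorem isCyclic_unitary : IsCyclic (unitary D) :=
  isCyclic_of_injective_ringHom (unitary D).subtype Subtype.val_injective

theorem exists_etaChar_ne_one : ∃ z, etaChar D z ≠ 1 := by
  have := isCyclic_unitary (D := D)
  obtain ⟨ζ, hζ⟩ := IsCyclic.exists_generator (α := unitary D)
  have hord : orderOf ζ = Nat.card (unitary D) := orderOf_eq_card_of_forall_mem_zpowers hζ
  refine ⟨ζ, fun h => ?_⟩
  have h1 : ζ ^ (Nat.card (unitary D) / 2) = 1 := by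
    by_contra h2
    simp [etaChar, h2] at h
  have hnt : Nontrivial (unitary D) := ⟨-1, 1, fun h =>
    neg_one_ne_one_of_two (D := D) (congrArg Subtype.val h)⟩
  have h3 : 1 < Nat.card (unitary D) := Finite.one_lt_card
  have := Nat.le_of_dvd (by omega) (orderOf_dvd_of_pow_eq_one h1)
  omega

/-- The homomorphism `x ↦ x / star x`. -/
def divStar (D : Type*) [Field D] [StarRing D] : Dˣ →* unitary D where
  toFun x := ⟨x * (star (x : D))⁻¹, by
    have h1 : star (x : D) ≠ 0 := star_ne_zero.2 x.ne_zero
    have h2 : (x : D) ≠ 0 := x.ne_zero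
    rw [Unitary.mem_iff, star_mul, star_inv₀, star_star]
    constructor <;> field_simp⟩
  map_one' := by ext; simp
  map_mul' x y := by
    ext
    simp only [Units.val_mul, star_mul, mul_inv_rev, Submonoid.coe_mul]
    ring

theorem coe_divStar (x : Dˣ) : (divStar D x : D) = x * (star (x : D))⁻¹ := rfl

/-- Hilbert's Theorem 90: `x = 1 + z` satisfies `x / star x = z` unless `z = -1`, and in that case
`y - star y` does, for any `y` moved by the involution. -/
theorem divStar_surjective (hD : ¬ ∀ x : D, star x = x) : Function.Surjective (divStar D) := by
  intro z
  have hz : star (z : D) * z = 1 := (Unitary.mem_iff.1 z.2).1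
  have hz0 : (z : D) ≠ 0 := right_ne_zero_of_mul_eq_one hz
  by_cases h : (1 + z : D) = 0
  · push Not at hD
    obtain ⟨y, hy⟩ := hD
    have h1 : y - star y ≠ 0 := sub_ne_zero.2 (Ne.symm hy)
    refine ⟨Units.mk0 _ h1, Subtype.ext ?_⟩
    rw [coe_divStar, Units.val_mk0, star_sub, star_star, ← neg_sub y (star y), inv_neg, mul_neg,
      mul_inv_cancel₀ h1]
    exact (eq_neg_of_add_eq_zero_right h).symm
  · refine ⟨Units.mk0 _ h, Subtype.ext ?_⟩
    rw [coe_divStar, Units.val_mk0, ← div_eq_mul_inv, div_eq_iff (star_ne_zero.2 h), star_add,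
      star_one, mul_add, mul_comm (z : D) (star _), hz]
    ring

/-- By Theorem 90 the left side is a nontrivial character of `Dˣ` with values `±1`, and there is
only one. -/
theorem etaChar_divStar (hD : ¬ ∀ x : D, star x = x) (x : Dˣ) :
    etaChar D (divStar D x) = mulSign D x := by
  refine DFunLike.congr_fun (eq_mulSign ((etaChar D).comp (divStar D)) ?_) x
  obtain ⟨z, hz⟩ := exists_etaChar_ne_one (D := D)
  obtain ⟨x, rfl⟩ := divStar_surjective hD z
  exact ⟨x, hz⟩

/-- By Theorem 90 the element is `y / star y`, and `y` and `star y` have the same sign. -/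
theorem mulSign_unitary (hD : ¬ ∀ x : D, star x = x) (x : Dˣ) (z : unitary D)
    (h : (x : D) = z) : mulSign D x = 1 := by
  obtain ⟨y, rfl⟩ := divStar_surjective hD z
  have h1 : x = y * (Units.mk0 (star (y : D)) (star_ne_zero.2 y.ne_zero))⁻¹ := by
    ext
    rw [h, coe_divStar]
    simp
  rw [h1, map_mul, map_inv, mulSign_star y (Units.mk0 _ _) rfl, mul_inv_cancel]

/-- For the trivial involution only `1` and `-1` occur, so the exponent is dictated by
`mulSign_neg_one`. -/
theorem mulSign_unitary_of_trivial (hD : ∀ x : D, star x = x) (x : Dˣ) (z : unitary D)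
    (h : (x : D) = z) : mulSign D x = etaChar D z ^ ((Nat.card D - 1) / 2) := by
  have hz : ∀ z : unitary D, z = 1 ∨ z = -1 := fun z => by
    have h1 : (z : D) ^ 2 = 1 ^ 2 := by
      have := (Unitary.mem_iff.1 z.2).1
      rw [hD] at this
      rw [one_pow, ← this, sq]
    rcases eq_or_eq_neg_of_sq_eq_sq _ _ h1 with h2 | h2
    · exact Or.inl (Subtype.ext h2)
    · exact Or.inr (Subtype.ext h2)
  rcases hz z with rfl | rfl
  · have : x = 1 := Units.ext h
    simp [this]
  · have : x = -1 := Units.ext h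
    obtain ⟨w, hw⟩ := exists_etaChar_ne_one (D := D)
    rcases hz w with rfl | rfl
    · simp at hw
    · rw [this, mulSign_neg_one, (Int.units_eq_one_or _).resolve_left hw]

theorem divStar_of_trivial (hD : ∀ x : D, star x = x) (x : Dˣ) : divStar D x = 1 := by
  apply Subtype.ext
  rw [coe_divStar, hD, mul_inv_cancel₀ x.ne_zero]
  rfl

/-- The exponent of the twist by which `ω♭` differs from the Weil representation. -/
noncomputable def flatExp (D : Type*) [Field D] [StarRing D] (n : ℕ) : ℕ :=
  open Classical in if ∀ x : D, star x = x then (Nat.card D - 1) / 2 * (n / 2) else n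

/-- The characters that occur in the comparison of two members of the Witt towers. -/
theorem etaChar_compare {n n' n₁ n₁' k i : ℕ} (hn : n = n₁ + 2 * k) (hn' : n' = n₁' + 2 * i)
    (heven : (∀ x : D, star x = x) → Even n ∧ Even n') (x x' w' w₀ : Dˣ)
    (z₀ z₀' : unitary D) (hw' : (w' : D) = (divStar D x' * z₀' : unitary D))
    (hw₀ : (w₀ : D) = z₀) :
    etaChar D (divStar D x * z₀) ^ flatExp D n' * etaChar D (divStar D x' * z₀') ^ flatExp D n *
      (mulSign D w' ^ k * mulSign D x ^ n' * (mulSign D x' ^ n₁ * mulSign D w₀ ^ i)) =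
    etaChar D z₀ ^ flatExp D n₁' * etaChar D z₀' ^ flatExp D n₁ := by
  by_cases hD : ∀ x : D, star x = x
  -- Symplectic-orthogonal case: `divStar` is trivial and the powers with the even exponents `n'`
  -- and `n₁` disappear. The halved dimensions in `flatExp` change by `k` and `i`, which the
  -- remaining two signs compensate.
  · obtain ⟨hev, hev'⟩ := heven hD
    have hev1 : Even n₁ := by rw [hn, Nat.even_add] at hev; simpa using hev
    rw [mulSign_unitary_of_trivial hD w' _ hw', mulSign_unitary_of_trivial hD w₀ _ hw₀]
    simp only [divStar_of_trivial hD, one_mul, flatExp, if_pos hD]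
    have hsq : ∀ (s : ℤˣ) {n : ℕ}, Even n → s ^ n = 1 := by
      rintro s n ⟨r, rfl⟩
      rw [pow_add, Int.units_mul_self]
    rw [hsq _ hev', hsq _ hev1, mul_one, one_mul, ← pow_mul, ← pow_mul, hn', hn,
      Nat.add_mul_div_left _ _ two_pos, Nat.add_mul_div_left _ _ two_pos, mul_add, mul_add,
      pow_add, pow_add]
    generalize etaChar D z₀ ^ (_ * i) = a
    have e2 := Int.units_mul_self (etaChar D z₀' ^ ((Nat.card D - 1) / 2 * k))
    have e1 := Int.units_mul_self a
    calc _ = etaChar D z₀ ^ ((Nat.card D - 1) / 2 * (n₁' / 2)) *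
          etaChar D z₀' ^ ((Nat.card D - 1) / 2 * (n₁ / 2)) * (a * a) *
          (etaChar D z₀' ^ ((Nat.card D - 1) / 2 * k) *
            etaChar D z₀' ^ ((Nat.card D - 1) / 2 * k)) := by ac_rfl
      _ = _ := by rw [e1, e2, mul_one, mul_one]
  -- Unitary case: `mulSign` is trivial on norm one elements, and `etaChar` of `divStar` is
  -- `mulSign`. The remaining signs occur in pairs, as the dimensions in each tower have the same
  -- parity.
  · rw [mulSign_unitary hD w' _ hw', mulSign_unitary hD w₀ _ hw₀]
    simp only [flatExp, if_neg hD, map_mul, etaChar_divStar hD, one_pow, one_mul, mul_one]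
    have hsq : ∀ (s : ℤˣ) (n : ℕ), s ^ (2 * n) = 1 := fun s n => by
      rw [two_mul, pow_add, Int.units_mul_self]
    rw [hn, hn', mul_pow, mul_pow]
    simp only [pow_add, hsq, mul_one]
    have e1 := Int.units_mul_self (mulSign D x ^ n₁')
    have e2 := Int.units_mul_self (mulSign D x' ^ n₁)
    calc _ = etaChar D z₀ ^ n₁' * etaChar D z₀' ^ n₁ * (mulSign D x ^ n₁' * mulSign D x ^ n₁') *
          (mulSign D x' ^ n₁ * mulSign D x' ^ n₁) := by ac_rfl
      _ = _ := by rw [e1, e2, mul_one, mul_one]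

end Characters

/-! ### Splittings `W = X ⊕ W₁ ⊕ Y` and the parabolic subgroup of `X`. -/

/-- The matrices of the inclusions of the summands of a decomposition `W = X ⊕ W₁ ⊕ Y` in which
`X` and `Y` are totally isotropic and dual to each other and orthogonal to `W₁`. The Gram matrices
of the forms on `W` and `W₁` are `J` and `J₁`. -/
structure HypSplit {D ι ι₁ : Type*} [Field D] [StarRing D] [Fintype ι] [DecidableEq ι]
    [Fintype ι₁] [DecidableEq ι₁] (J : Matrix ι ι D) (J₁ : Matrix ι₁ ι₁ D) (κ : Type*)
    [Fintype κ] [DecidableEq κ] where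
  X : Matrix ι κ D
  W : Matrix ι ι₁ D
  Y : Matrix ι κ D
  sum : X * Xᴴ + W * Wᴴ + Y * Yᴴ = 1
  XX : Xᴴ * X = 1
  WW : Wᴴ * W = 1
  YY : Yᴴ * Y = 1
  XW : Xᴴ * W = 0
  XY : Xᴴ * Y = 0
  WY : Wᴴ * Y = 0
  XJ : Xᴴ * J = Yᴴ
  JY : J * Y = X
  JW : J * W = W * J₁
  WJ : Wᴴ * J = J₁ * Wᴴ

namespace HypSplit

variable {D ι ι₁ κ lam : Type*} [Field D] [StarRing D] [Fintype ι] [DecidableEq ι] [Fintype ι₁]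
  [DecidableEq ι₁] [Fintype κ] [DecidableEq κ] {J : Matrix ι ι D}
  {J₁ : Matrix ι₁ ι₁ D} (s : HypSplit J J₁ κ)

theorem WX : s.Wᴴ * s.X = 0 := by
  have := congrArg Matrix.conjTranspose s.XW
  simpa using this

theorem YX : s.Yᴴ * s.X = 0 := by
  have := congrArg Matrix.conjTranspose s.XY
  simpa using this

theorem YW : s.Yᴴ * s.W = 0 := by
  have := congrArg Matrix.conjTranspose s.WY
  simpa using this

theorem decomp (M : Matrix ι lam D) :
    M = s.X * (s.Xᴴ * M) + s.W * (s.Wᴴ * M) + s.Y * (s.Yᴴ * M) := by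
  have := congrArg (· * M) s.sum
  simp only [Matrix.add_mul, Matrix.mul_assoc, Matrix.one_mul] at this
  exact this.symm

theorem decomp' [Fintype lam] (M : Matrix lam ι D) :
    M = M * s.X * s.Xᴴ + M * s.W * s.Wᴴ + M * s.Y * s.Yᴴ := by
  have := congrArg (M * ·) s.sum
  simp only [Matrix.mul_add, ← Matrix.mul_assoc, Matrix.mul_one] at this
  exact this.symm

/-- `g` stabilizes `X`, and `a` and `g₀` are its actions on `X` and on `X^⊥ / X`. -/
def IsPara (g : GL ι D) (a : GL κ D) (g₀ : GL ι₁ D) : Prop :=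
  (g : Matrix ι ι D) * s.X = s.X * (a : Matrix κ κ D) ∧
    (g₀ : Matrix ι₁ ι₁ D) = s.Wᴴ * (g : Matrix ι ι D) * s.W

variable {ε : ℤˣ} {h : HermForm D ε ι} {h₁ : HermForm D ε ι₁}
  {s : HypSplit h.gram h₁.gram κ}

theorem inv_mul_X {g : GL ι D} {a : GL κ D}
    (hg : (g : Matrix ι ι D) * s.X = s.X * (a : Matrix κ κ D)) :
    (↑g⁻¹ : Matrix ι ι D) * s.X = s.X * (↑a⁻¹ : Matrix κ κ D) := by
  have h1 : (a : Matrix κ κ D) * (↑a⁻¹ : Matrix κ κ D) = 1 := a.mul_inv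
  have h2 : (↑g⁻¹ : Matrix ι ι D) * (g : Matrix ι ι D) = 1 := g.inv_mul
  calc (↑g⁻¹ : Matrix ι ι D) * s.X
      = (↑g⁻¹ : Matrix ι ι D) * (s.X * (a : Matrix κ κ D)) * (↑a⁻¹ : Matrix κ κ D) := by
        simp only [Matrix.mul_assoc, h1, Matrix.mul_one]
    _ = _ := by
        rw [← hg, ← Matrix.mul_assoc, h2, Matrix.one_mul]

/-- The form identifies `Y` with the conjugate dual of `X`, so the `Y`-coordinates transform
contragrediently to `X`. -/
theorem Y_mul {g : GL ι D} (hgi : g ∈ h.isom) {a : GL κ D}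
    (hg : (g : Matrix ι ι D) * s.X = s.X * (a : Matrix κ κ D)) :
    s.Yᴴ * (g : Matrix ι ι D) = (↑a⁻¹ : Matrix κ κ D)ᴴ * s.Yᴴ := by
  have h1 := h.isom_mul hgi
  have h2 := congrArg Matrix.conjTranspose (inv_mul_X hg)
  rw [Matrix.conjTranspose_mul, Matrix.conjTranspose_mul] at h2
  rw [← s.XJ, Matrix.mul_assoc, h1, ← Matrix.mul_assoc, h2, Matrix.mul_assoc]

theorem IsPara.Y_mul_W {g : GL ι D} (hgi : g ∈ h.isom) {a : GL κ D} {g₀ : GL ι₁ D}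
    (hg : s.IsPara g a g₀) : s.Yᴴ * ((g : Matrix ι ι D) * s.W) = 0 := by
  rw [← Matrix.mul_assoc, Y_mul hgi hg.1, Matrix.mul_assoc, s.YW, Matrix.mul_zero]

theorem IsPara.mul_W {g : GL ι D} (hgi : g ∈ h.isom) {a : GL κ D} {g₀ : GL ι₁ D}
    (hg : s.IsPara g a g₀) : (g : Matrix ι ι D) * s.W =
      s.X * (s.Xᴴ * ((g : Matrix ι ι D) * s.W)) + s.W * (g₀ : Matrix ι₁ ι₁ D) := by
  conv_lhs => rw [s.decomp ((g : Matrix ι ι D) * s.W), hg.Y_mul_W hgi, Matrix.mul_zero, add_zero]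
  rw [hg.2, Matrix.mul_assoc s.Wᴴ]

theorem IsPara.W_mul {g : GL ι D} {a : GL κ D} {g₀ : GL ι₁ D}
    (hg : s.IsPara g a g₀) : s.Wᴴ * (g : Matrix ι ι D) =
      (g₀ : Matrix ι₁ ι₁ D) * s.Wᴴ + s.Wᴴ * (g : Matrix ι ι D) * s.Y * s.Yᴴ := by
  conv_lhs => rw [s.decomp' (s.Wᴴ * (g : Matrix ι ι D)), Matrix.mul_assoc s.Wᴴ _ s.X, hg.1,
    ← Matrix.mul_assoc s.Wᴴ s.X, s.WX, Matrix.zero_mul, Matrix.zero_mul, zero_add]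
  rw [hg.2]

theorem IsPara.inv {g : GL ι D} (hgi : g ∈ h.isom) {a : GL κ D} {g₀ : GL ι₁ D}
    (hg : s.IsPara g a g₀) : s.IsPara g⁻¹ a⁻¹ g₀⁻¹ := by
  refine ⟨inv_mul_X hg.1, ?_⟩
  have h1 : s.Wᴴ * (↑g⁻¹ : Matrix ι ι D) * s.W * (g₀ : Matrix ι₁ ι₁ D) = 1 := by
    have h2 := hg.mul_W hgi
    have h3 : s.W * (g₀ : Matrix ι₁ ι₁ D) = (g : Matrix ι ι D) * s.W -
        s.X * (s.Xᴴ * ((g : Matrix ι ι D) * s.W)) := by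
      rw [eq_sub_iff_add_eq, add_comm, ← h2]
    have h4 : (↑g⁻¹ : Matrix ι ι D) * (g : Matrix ι ι D) = 1 := g.inv_mul
    rw [Matrix.mul_assoc, h3, Matrix.mul_sub]
    rw [Matrix.mul_assoc, ← Matrix.mul_assoc _ _ s.W, h4, Matrix.one_mul, s.WW, Matrix.mul_assoc,
      ← Matrix.mul_assoc _ s.X, inv_mul_X hg.1, Matrix.mul_assoc, ← Matrix.mul_assoc _ s.X,
      s.WX, Matrix.zero_mul, sub_zero]
  have h5 : (g₀ : Matrix ι₁ ι₁ D) * (↑g₀⁻¹ : Matrix ι₁ ι₁ D) = 1 := g₀.mul_inv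
  calc (↑g₀⁻¹ : Matrix ι₁ ι₁ D)
      = s.Wᴴ * (↑g⁻¹ : Matrix ι ι D) * s.W * (g₀ : Matrix ι₁ ι₁ D) *
        (↑g₀⁻¹ : Matrix ι₁ ι₁ D) := by rw [h1, Matrix.one_mul]
    _ = _ := by rw [Matrix.mul_assoc, h5, Matrix.mul_one]

/-- In the decomposition `X ⊕ W₁ ⊕ Y` the matrix of `g` is block triangular, with diagonal blocks
`a`, `g₀` and the conjugate transpose of `a⁻¹`. -/
theorem IsPara.det {g : GL ι D} (hgi : g ∈ h.isom) {a : GL κ D} {g₀ : GL ι₁ D}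
    (hg : s.IsPara g a g₀) : (g : Matrix ι ι D).det =
      (a : Matrix κ κ D).det * ((g₀ : Matrix ι₁ ι₁ D).det *
        (star (a : Matrix κ κ D).det)⁻¹) := by
  set U : Matrix ι (κ ⊕ (ι₁ ⊕ κ)) D := Matrix.fromCols s.X (Matrix.fromCols s.W s.Y) with hU
  set U' : Matrix (κ ⊕ (ι₁ ⊕ κ)) ι D := Matrix.fromRows s.Xᴴ (Matrix.fromRows s.Wᴴ s.Yᴴ) with hU'
  have h1 : U * U' = 1 := by
    rw [hU, hU', Matrix.fromCols_mul_fromRows, Matrix.fromCols_mul_fromRows, ← add_assoc, s.sum]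
  have h2 : U' * U = 1 := by
    rw [hU, hU', Matrix.fromRows_mul_fromCols, Matrix.fromRows_mul, Matrix.mul_fromCols,
      Matrix.fromRows_mul_fromCols, s.XX, s.XW, s.XY, s.WX, s.YX, s.WW, s.WY, s.YW, s.YY]
    ext (i | i | i) (j | j | j) <;> simp [Matrix.one_apply]
  have h3 := Matrix.det_conj_of_mul_eq_one (N := (g : Matrix ι ι D)) h2 h1
  rw [← h3, hU', Matrix.fromRows_mul, hU, Matrix.fromRows_mul_fromCols, Matrix.fromRows_mul,
    Matrix.fromRows_mul, Matrix.fromRows_mul_fromCols]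
  have e1 : Matrix.fromRows (s.Wᴴ * (g : Matrix ι ι D) * s.X)
      (s.Yᴴ * (g : Matrix ι ι D) * s.X) = 0 := by
    rw [Matrix.mul_assoc, hg.1, Matrix.mul_assoc, hg.1, ← Matrix.mul_assoc, s.WX,
      ← Matrix.mul_assoc, s.YX, Matrix.zero_mul, Matrix.zero_mul]
    ext (i | i) j <;> rfl
  rw [e1, Matrix.det_fromBlocks_zero₂₁, Matrix.mul_assoc s.Yᴴ, hg.Y_mul_W hgi,
    Matrix.det_fromBlocks_zero₂₁, ← hg.2, Y_mul hgi hg.1, Matrix.mul_assoc, hg.1,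
    ← Matrix.mul_assoc, s.XX, Matrix.one_mul, Matrix.mul_assoc, s.YY, Matrix.mul_one,
    Matrix.det_conjTranspose, Matrix.coe_units_inv, Matrix.det_nonsing_inv, Ring.inverse_eq_inv',
    star_inv₀]

end HypSplit

theorem neZero_two_of_algebra (F D : Type*) [Field F] [Field D] [Algebra F D] [NeZero (2 : F)] :
    NeZero (2 : D) :=
  ⟨fun h2 => NeZero.ne (2 : F) <| (algebraMap F D).injective <| by
    rw [map_ofNat, h2, map_zero]⟩

/-- The trace pairing of matrices over `D` is nondegenerate, and so is the trace form of `D` over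
`F`. -/
theorem eq_zero_of_trace_mul (F : Type*) {D lam μ : Type*} [Field F] [Field D] [Algebra F D]
    [Finite F] [Finite D] [Fintype lam] [Fintype μ] (Z : Matrix lam μ D)
    (h : ∀ M : Matrix μ lam D, Algebra.trace F D (Matrix.trace (M * Z)) = 0) : Z = 0 := by
  have hfin : Module.Finite F D := Module.Finite.of_finite
  rw [Matrix.ext_iff_trace_mul_left]
  intro M
  rw [Matrix.mul_zero, Matrix.trace_zero]
  apply (traceForm_nondegenerate F D).1
  intro z
  rw [Algebra.traceForm_apply, mul_comm]
  simpa using h (z • M)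

/-! ### The inverse Gram matrix in a splitting. -/

namespace HypSplit

section Inverse

variable {D ι ι₁ κ : Type*} [Field D] [StarRing D] [Fintype ι] [DecidableEq ι] [Fintype ι₁]
  [DecidableEq ι₁] [Fintype κ] [DecidableEq κ] {ε : ℤˣ} {h : HermForm D ε ι}
  {h₁ : HermForm D ε ι₁} (s : HypSplit h.gram h₁.gram κ)

theorem gram_X : h.gram * s.X = (ε : ℤ) • s.Y := by
  have h1 := congrArg Matrix.conjTranspose s.XJ
  rw [Matrix.conjTranspose_mul, Matrix.conjTranspose_conjTranspose,
    Matrix.conjTranspose_conjTranspose, h.herm] at h1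
  rcases Int.units_eq_one_or ε with rfl | rfl
  · simpa using h1
  · simp at h1 ⊢
    rw [← h1, neg_neg]

theorem inv_X : h.gram⁻¹ * s.X = s.Y := by
  conv_lhs => rw [← s.JY, Matrix.nonsing_inv_mul_cancel_left _ _ h.nondeg]

theorem inv_Y : h.gram⁻¹ * s.Y = (ε : ℤ) • s.X := by
  have h1 : s.Y = h.gram * ((ε : ℤ) • s.X) := by
    rw [Matrix.mul_smul, s.gram_X]
    rcases Int.units_eq_one_or ε with rfl | rfl <;> simp
  conv_lhs => rw [h1, Matrix.nonsing_inv_mul_cancel_left _ _ h.nondeg]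

theorem inv_W : h.gram⁻¹ * s.W = s.W * h₁.gram⁻¹ := by
  have h1 : s.W = h.gram * (s.W * h₁.gram⁻¹) := by
    rw [← Matrix.mul_assoc, s.JW, Matrix.mul_assoc, Matrix.mul_nonsing_inv _ h₁.nondeg,
      Matrix.mul_one]
  conv_lhs => rw [h1, Matrix.nonsing_inv_mul_cancel_left _ _ h.nondeg]

end Inverse

/-! ### The smaller dual pair inside the larger one. -/

section Embedding

variable (F : Type*) {D ι ι₁ κ ι' ι₁' κ' : Type*} [Field F] [Field D] [StarRing D] [Algebra F D]
  [IsFixedField F D] [Finite F] [Finite D] [NeZero (2 : F)] [Fintype ι] [DecidableEq ι]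
  [Fintype ι₁] [DecidableEq ι₁] [Fintype κ] [DecidableEq κ] [Fintype ι'] [DecidableEq ι']
  [Fintype ι₁'] [DecidableEq ι₁'] [Fintype κ'] [DecidableEq κ'] {ε : ℤˣ}
  {h : HermForm D ε ι} {h₁ : HermForm D ε ι₁} {h' : HermForm D (-ε) ι'}
  {h₁' : HermForm D (-ε) ι₁'} (s : HypSplit h.gram h₁.gram κ)
  (s' : HypSplit h'.gram h₁'.gram κ')

/-- The map `u ↦ (u|X, u|W₁ mod X'^⊥)`. -/
def quotMap : Matrix ι' ι D →ₗ[F] Matrix ι' κ D × Matrix κ' ι₁ D where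
  toFun u := (u * s.X, s'.Yᴴ * (u * s.W))
  map_add' u v := by simp [Matrix.add_mul, Matrix.mul_add]
  map_smul' c u := by simp

/-- The homomorphisms `u` with `u(X) = 0` and `u(W₁) ⊆ X'`. -/
def isoSub : Submodule F (Matrix ι' ι D) where
  carrier := {u | u * s.X = 0 ∧ s'.Yᴴ * (u * s.W) = 0 ∧ s'.Wᴴ * (u * s.W) = 0}
  zero_mem' := by simp
  add_mem' := fun {a b} ha hb => by
    simp only [Set.mem_ofPred_eq] at *
    simp [Matrix.add_mul, Matrix.mul_add, ha, hb]
  smul_mem' := fun c a ha => by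
    simp only [Set.mem_ofPred_eq] at *
    simp [ha]

theorem mem_isoSub {u : Matrix ι' ι D} : u ∈ isoSub F s s' ↔
    u * s.X = 0 ∧ s'.Yᴴ * (u * s.W) = 0 ∧ s'.Wᴴ * (u * s.W) = 0 := Iff.rfl

/-- The inclusion of `Hom(W₁, W₁')` in `Hom(W, W')`. -/
def incMap : Matrix ι₁' ι₁ D →ₗ[F] Matrix ι' ι D where
  toFun u := s'.W * u * s.Wᴴ
  map_add' u v := by simp [Matrix.add_mul, Matrix.mul_add]
  map_smul' c u := by simp

theorem quotMap_surjective : Function.Surjective (quotMap F s s') := by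
  rintro ⟨y, z⟩
  refine ⟨y * s.Xᴴ + s'.Y * z * s.Wᴴ, ?_⟩
  simp only [quotMap, LinearMap.coe_mk, AddHom.coe_mk, Matrix.add_mul, Matrix.mul_assoc, s.XX,
    s.XW, s.WW, s.WX, Matrix.mul_zero, Matrix.mul_one, add_zero, zero_add]
  rw [← Matrix.mul_assoc, s'.YY, Matrix.one_mul]

theorem pairForm_incMap (u v : Matrix ι₁' ι₁ D) :
    pairForm F h h' (incMap F s s' u) (incMap F s s' v) = pairForm F h₁ h₁' u v := by
  rw [pairForm_apply, pairForm_apply]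
  congr 1
  simp only [incMap, LinearMap.coe_mk, AddHom.coe_mk, Matrix.conjTranspose_mul,
    Matrix.conjTranspose_conjTranspose]
  have e1 : h.gram⁻¹ * (s.W * (uᴴ * s'.Wᴴ)) * h'.gram * (s'.W * v * s.Wᴴ) =
      s.W * (h₁.gram⁻¹ * uᴴ * h₁'.gram * v * s.Wᴴ) := by
    calc _ = (h.gram⁻¹ * s.W) * uᴴ * (s'.Wᴴ * h'.gram) * s'.W * v * s.Wᴴ := by
          simp only [Matrix.mul_assoc]
      _ = s.W * h₁.gram⁻¹ * uᴴ * (h₁'.gram * (s'.Wᴴ * s'.W)) * v * s.Wᴴ := by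
          rw [s.inv_W, s'.WJ]
          simp only [Matrix.mul_assoc]
      _ = _ := by
          rw [s'.WW, Matrix.mul_one]
          simp only [Matrix.mul_assoc]
  rw [e1, Matrix.trace_mul_comm, Matrix.mul_assoc, s.WW, Matrix.mul_one]

/-- Among the elements of `isoSub`, those that vanish off `Y` detect the restriction of `v` to `X`,
and those that map `W₁` into `X'` detect `v` on `W₁` modulo `X'^⊥`. So `quotMap` is the projection
modulo the orthogonal space of `isoSub`. -/
theorem quotMap_eq_zero_iff (v : Matrix ι' ι D) :
    quotMap F s s' v = 0 ↔ ∀ a ∈ isoSub F s s', pairForm F h h' a v = 0 := by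
  have hsmul : ∀ M : Matrix ι' κ D, (ε : ℤ) • M = 0 → M = 0 := by
    intro M hM
    rcases Int.units_eq_one_or ε with rfl | rfl <;> simpa using hM
  constructor
  · intro hv a ha
    have hv1 : v * s.X = 0 := congrArg Prod.fst hv
    have hv2 : s'.Yᴴ * (v * s.W) = 0 := congrArg Prod.snd hv
    obtain ⟨h1, h2, h3⟩ := ha
    have hW : a * s.W = s'.X * (s'.Xᴴ * (a * s.W)) := by
      conv_lhs => rw [s'.decomp (a * s.W), h2, h3, Matrix.mul_zero, Matrix.mul_zero, add_zero,
        add_zero]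
    have hadj : aᴴ = s.W * (s'.X * (s'.Xᴴ * (a * s.W)))ᴴ + s.Y * (a * s.Y)ᴴ := by
      rw [← hW]
      conv_lhs => rw [s.decomp' a, h1, Matrix.zero_mul, zero_add]
      simp
    have e1 : h.gram⁻¹ * aᴴ * h'.gram * v =
        s.W * (h₁.gram⁻¹ * (s'.Xᴴ * (a * s.W))ᴴ * s'.Yᴴ * v) +
          (ε : ℤ) • (s.X * ((a * s.Y)ᴴ * h'.gram * v)) := by
      rw [hadj, Matrix.mul_add, ← Matrix.mul_assoc, ← Matrix.mul_assoc _ s.Y, s.inv_W, s.inv_Y,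
        Matrix.conjTranspose_mul, ← s'.XJ, Matrix.add_mul, Matrix.add_mul]
      simp only [Matrix.mul_assoc, Matrix.smul_mul]
    rw [pairForm_apply, e1, Matrix.trace_add, Matrix.trace_smul, Matrix.trace_mul_comm,
      Matrix.trace_mul_comm s.X, Matrix.mul_assoc, Matrix.mul_assoc, Matrix.mul_assoc, hv2,
      Matrix.mul_assoc _ v, hv1]
    simp
  · intro hv
    refine Prod.ext ?_ ?_
    · change v * s.X = 0
      have h1 : h'.gram * v * (h.gram⁻¹ * s.Y) = 0 := by
        refine eq_zero_of_trace_mul F _ fun M => ?_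
        have := hv (Mᴴ * s.Yᴴ) ⟨by rw [Matrix.mul_assoc, s.YX, Matrix.mul_zero],
          by rw [Matrix.mul_assoc, s.YW, Matrix.mul_zero, Matrix.mul_zero],
          by rw [Matrix.mul_assoc, s.YW, Matrix.mul_zero, Matrix.mul_zero]⟩
        rw [pairForm_apply, Matrix.conjTranspose_mul, Matrix.conjTranspose_conjTranspose,
          Matrix.conjTranspose_conjTranspose, ← Matrix.mul_assoc, Matrix.mul_assoc,
          Matrix.mul_assoc, Matrix.trace_mul_comm] at this
        rw [← this]
        simp only [Matrix.mul_assoc]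
      have h2 := congrArg (h'.gram⁻¹ * ·) h1
      simp only [Matrix.mul_zero, Matrix.mul_assoc,
        Matrix.nonsing_inv_mul_cancel_left _ _ h'.nondeg] at h2
      rw [s.inv_Y, Matrix.mul_smul] at h2
      exact hsmul _ h2
    · change s'.Yᴴ * (v * s.W) = 0
      have h1 : s'.Yᴴ * v * (h.gram⁻¹ * s.W) = 0 := by
        refine eq_zero_of_trace_mul F _ fun M => ?_
        have := hv (s'.X * Mᴴ * s.Wᴴ) ⟨by rw [Matrix.mul_assoc, s.WX, Matrix.mul_zero],
          by rw [Matrix.mul_assoc, Matrix.mul_assoc, ← Matrix.mul_assoc, s'.YX, Matrix.zero_mul],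
          by rw [Matrix.mul_assoc, Matrix.mul_assoc, ← Matrix.mul_assoc, s'.WX, Matrix.zero_mul]⟩
        rw [pairForm_apply, Matrix.conjTranspose_mul, Matrix.conjTranspose_conjTranspose,
          Matrix.conjTranspose_mul, Matrix.conjTranspose_conjTranspose, ← Matrix.mul_assoc,
          Matrix.mul_assoc, Matrix.mul_assoc, Matrix.trace_mul_comm] at this
        rw [← this, ← s'.XJ]
        simp only [Matrix.mul_assoc]
      rw [s.inv_W, ← Matrix.mul_assoc] at h1
      have h2 := congrArg (· * h₁.gram) h1
      simp only [Matrix.zero_mul, Matrix.nonsing_inv_mul_cancel_right _ _ h₁.nondeg] at h2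
      rw [← h2, Matrix.mul_assoc]

theorem etaChar_pow_eq_flatChar [NeZero (2 : D)] (n : ℕ) (g : h.isom) :
    flatChar F h n g = etaChar D (h.isomDet g) ^ flatExp D n := rfl

/-- The members of the Witt towers are related by the spaces of invariants of totally isotropic
subspaces. -/
theorem exists_flatRep_embedding {ψ : AddChar F ℂ} (hψ : ψ ≠ 1)
    (hn : Fintype.card ι = Fintype.card ι₁ + 2 * Fintype.card κ)
    (hn' : Fintype.card ι' = Fintype.card ι₁' + 2 * Fintype.card κ')
    (heven : (∀ x : D, star x = x) → Even (Fintype.card ι) ∧ Even (Fintype.card ι')) :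
    ∃ j : (Fin (heisDim (pairForm F h₁ h₁') ψ) → ℂ) →ₗ[ℂ] (Fin (heisDim (pairForm F h h') ψ) → ℂ),
      Function.Injective j ∧
      (∀ w, (∃ w', j w' = w) ↔
        ∀ a ∈ isoSub F s s', heisRep (pairForm F h h') ψ ⟨a, 0⟩ w = w) ∧
      (∀ u t w, j (heisRep (pairForm F h₁ h₁') ψ ⟨u, t⟩ w) =
        heisRep (pairForm F h h') ψ ⟨s'.W * u * s.Wᴴ, t⟩ (j w)) ∧
      ∀ (p : h.isom) (p' : h'.isom) (a : GL κ D) (a' : GL κ' D) (g₀ : h₁.isom) (g₀' : h₁'.isom),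
        s.IsPara p.1 a g₀.1 → s'.IsPara p'.1 a' g₀'.1 → ∀ w,
          flatRep F h h' hψ (p, p') (j w) = j (flatRep F h₁ h₁' hψ (g₀, g₀') w) := by
  classical
  have := neZero_two_of_algebra F D
  have := Fintype.ofFinite (Matrix ι' κ D × Matrix κ' ι₁ D)
  obtain ⟨j, j1, j2, j3, j4⟩ := exists_weilRep_embedding (pairForm_isSymplectic F h h')
    (pairForm_isSymplectic F h₁ h₁') hψ (incMap F s s') (pairForm_incMap F s s') (isoSub F s s')
    (fun a ha b hb => (quotMap_eq_zero_iff F s s' b).1 (Prod.ext hb.1 hb.2.1) a ha)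
    (fun a ha u => (quotMap_eq_zero_iff F s s' _).1 (Prod.ext
      (by simp [quotMap, incMap, Matrix.mul_assoc, s.WX])
      (by
        change s'.Yᴴ * (s'.W * u * s.Wᴴ * s.W) = 0
        rw [Matrix.mul_assoc s'.W, Matrix.mul_assoc s'.W, ← Matrix.mul_assoc, s'.YW,
          Matrix.zero_mul])) a ha)
    (fun v hv => by
      have hv := (quotMap_eq_zero_iff F s s' v).2 hv
      have hv1 : v * s.X = 0 := congrArg Prod.fst hv
      have hv2 : s'.Yᴴ * (v * s.W) = 0 := congrArg Prod.snd hv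
      refine ⟨s'.Wᴴ * v * s.W, ?_⟩
      change v - s'.W * (s'.Wᴴ * v * s.W) * s.Wᴴ ∈ isoSub F s s'
      have e1 : s'.W * (s'.Wᴴ * v * s.W) * s.Wᴴ * s.X = 0 := by
        rw [Matrix.mul_assoc, s.WX, Matrix.mul_zero]
      have e2 : s'.W * (s'.Wᴴ * v * s.W) * s.Wᴴ * s.W = s'.W * (s'.Wᴴ * (v * s.W)) := by
        rw [Matrix.mul_assoc, s.WW, Matrix.mul_one, Matrix.mul_assoc s'.Wᴴ]
      refine ⟨?_, ?_, ?_⟩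
      · rw [Matrix.sub_mul, hv1, e1, sub_zero]
      · rw [Matrix.sub_mul, Matrix.mul_sub, hv2, e2, ← Matrix.mul_assoc, s'.YW, Matrix.zero_mul,
          sub_zero]
      · rw [Matrix.sub_mul, Matrix.mul_sub, e2, ← Matrix.mul_assoc, ← Matrix.mul_assoc, s'.WW,
          Matrix.one_mul, Matrix.mul_assoc, sub_self])
    (quotMap F s s') (quotMap_surjective F s s') (quotMap_eq_zero_iff F s s')
  refine ⟨j, j1, j2, j3, fun p p' a a' g₀ g₀' hp hp' w => ?_⟩
  have hpi := hp.inv p.2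
  have hb' : ((star a'⁻¹ : GL κ' D) : Matrix κ' κ' D) = (↑a'⁻¹ : Matrix κ' κ' D)ᴴ := rfl
  have hY' := Y_mul p'.2 hp'.1
  -- On pairs `(u|X, u|W₁ mod X'^⊥)` the element acts by multiplications by matrices on both entries
  -- and a correction of the second entry that depends on the first. This is a shear, and only the
  -- multiplications contribute to its sign.
  have key := j4 (pairHom F h h' (p, p')) (pairHom F h₁ h₁' (g₀, g₀'))
    (shearPerm (matPerm ι' κ D (p'.1, a)) (matPerm κ' ι₁ D (star a'⁻¹, g₀.1))
      fun y => (↑a'⁻¹ : Matrix κ' κ' D)ᴴ *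
        (s'.Yᴴ * (y * (s.Xᴴ * ((↑p.1⁻¹ : Matrix ι ι D) * s.W))))) ?_ ?_ ?_ w
  · rw [← permSign_eq, permSign_shearPerm (F := F), permSign_matPerm, permSign_matPerm] at key
    have hdet : h.isomDet p = divStar D a.det * h₁.isomDet g₀ := by
      apply Subtype.ext
      refine (hp.det p.2).trans ?_
      change _ = (a : Matrix κ κ D).det * (star (a : Matrix κ κ D).det)⁻¹ *
        (g₀.1 : Matrix ι₁ ι₁ D).det
      ring
    have hdet' : h'.isomDet p' = divStar D a'.det * h₁'.isomDet g₀' := by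
      apply Subtype.ext
      refine (hp'.det p'.2).trans ?_
      change _ = (a' : Matrix κ' κ' D).det * (star (a' : Matrix κ' κ' D).det)⁻¹ *
        (g₀'.1 : Matrix ι₁' ι₁' D).det
      ring
    have hstar : mulSign D (star a'⁻¹ : GL κ' D).det = mulSign D a'.det := by
      rw [mulSign_star (a'⁻¹).det _ (by
        change ((star a'⁻¹ : GL κ' D) : Matrix κ' κ' D).det = _
        rw [hb', Matrix.det_conjTranspose]
        rfl), map_inv, map_inv, Int.units_inv_eq_self]
    -- The sign of the permutation is exactly the discrepancy between the twists of the two pairs.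
    have hcmp := etaChar_compare hn hn' heven a.det a'.det p'.1.det g₀.1.det (h₁.isomDet g₀)
      (h₁'.isomDet g₀') (by rw [← hdet']; rfl) rfl
    rw [← hdet, ← hdet'] at hcmp
    change ((((flatChar F h (Fintype.card ι') p * flatChar F h' (Fintype.card ι) p' : ℤˣ) :
      ℤ) : ℂ) • weilRep (pairForm_isSymplectic F h h') hψ (pairHom F h h' (p, p'))) (j w) =
      j (((((flatChar F h₁ (Fintype.card ι₁') g₀ * flatChar F h₁' (Fintype.card ι₁) g₀' : ℤˣ) :
      ℤ) : ℂ) • weilRep (pairForm_isSymplectic F h₁ h₁') hψ (pairHom F h₁ h₁' (g₀, g₀'))) w)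
    rw [LinearMap.smul_apply, key, LinearMap.smul_apply, map_smul, smul_smul, ← Int.cast_mul,
      ← Units.val_mul, etaChar_pow_eq_flatChar, etaChar_pow_eq_flatChar, etaChar_pow_eq_flatChar,
      etaChar_pow_eq_flatChar, ← hcmp, hstar]
  · rintro u ⟨h1, h2, h3⟩
    have hW : (u * (↑p.1⁻¹ : Matrix ι ι D)) * s.W = u * s.W * (↑g₀.1⁻¹ : Matrix ι₁ ι₁ D) := by
      rw [Matrix.mul_assoc, hpi.mul_W (h.isom.inv_mem p.2), Matrix.mul_add, ← Matrix.mul_assoc, h1,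
        Matrix.zero_mul, zero_add, ← Matrix.mul_assoc]
    change (p'.1 : Matrix ι' ι' D) * u * (↑p.1⁻¹ : Matrix ι ι D) ∈ isoSub F s s'
    refine ⟨?_, ?_, ?_⟩
    · rw [Matrix.mul_assoc, hpi.1, Matrix.mul_assoc, ← Matrix.mul_assoc u, h1, Matrix.zero_mul,
        Matrix.mul_zero]
    · rw [Matrix.mul_assoc _ u, Matrix.mul_assoc, hW, ← Matrix.mul_assoc, hY', Matrix.mul_assoc,
        ← Matrix.mul_assoc s'.Yᴴ, h2, Matrix.zero_mul, Matrix.mul_zero]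
    · rw [Matrix.mul_assoc _ u, Matrix.mul_assoc, hW, ← Matrix.mul_assoc, hp'.W_mul,
        Matrix.add_mul, Matrix.mul_assoc, ← Matrix.mul_assoc s'.Wᴴ, h3, Matrix.zero_mul,
        Matrix.mul_zero, zero_add, Matrix.mul_assoc, ← Matrix.mul_assoc s'.Yᴴ, h2,
        Matrix.zero_mul, Matrix.mul_zero]
  · intro u
    change (p'.1 : Matrix ι' ι' D) * (s'.W * u * s.Wᴴ) * (↑p.1⁻¹ : Matrix ι ι D) -
      s'.W * ((g₀'.1 : Matrix ι₁' ι₁' D) * u * (↑g₀.1⁻¹ : Matrix ι₁ ι₁ D)) * s.Wᴴ ∈ isoSub F s s'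
    have e1 : s.Wᴴ * ((↑p.1⁻¹ : Matrix ι ι D) * s.X) = 0 := by
      rw [hpi.1, ← Matrix.mul_assoc, s.WX, Matrix.zero_mul]
    have e2 : s.Wᴴ * ((↑p.1⁻¹ : Matrix ι ι D) * s.W) = (↑g₀.1⁻¹ : Matrix ι₁ ι₁ D) := by
      rw [← Matrix.mul_assoc]
      exact hpi.2.symm
    have e3 : s'.Wᴴ * ((p'.1 : Matrix ι' ι' D) * s'.W) = (g₀'.1 : Matrix ι₁' ι₁' D) := by
      rw [← Matrix.mul_assoc]
      exact hp'.2.symm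
    have e4 := hp'.Y_mul_W p'.2
    simp only [Matrix.mul_assoc, Matrix.sub_mul, mem_isoSub, e1, e2, s.WX, s.WW, Matrix.mul_zero,
      Matrix.mul_one, sub_self, Matrix.mul_sub, true_and]
    constructor
    · rw [← Matrix.mul_assoc (p'.1 : Matrix ι' ι' D), ← Matrix.mul_assoc s'.Yᴴ, e4,
        ← Matrix.mul_assoc s'.Yᴴ, s'.YW, Matrix.zero_mul, Matrix.zero_mul, sub_self]
    · rw [← Matrix.mul_assoc (p'.1 : Matrix ι' ι' D), ← Matrix.mul_assoc s'.Wᴴ, e3,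
        ← Matrix.mul_assoc s'.Wᴴ, s'.WW, Matrix.one_mul, sub_self]
  · intro v
    rw [shearPerm_apply, matPerm_apply, matPerm_apply]
    refine Prod.ext ?_ ?_
    · change (p'.1 : Matrix ι' ι' D) * v * (↑p.1⁻¹ : Matrix ι ι D) * s.X =
        (p'.1 : Matrix ι' ι' D) * (v * s.X) * (↑a⁻¹ : Matrix κ κ D)
      rw [Matrix.mul_assoc, hpi.1]
      simp only [Matrix.mul_assoc]
    · change s'.Yᴴ * ((p'.1 : Matrix ι' ι' D) * v * (↑p.1⁻¹ : Matrix ι ι D) * s.W) =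
        (↑a'⁻¹ : Matrix κ' κ' D)ᴴ * (s'.Yᴴ * (v * s.W)) * (↑g₀.1⁻¹ : Matrix ι₁ ι₁ D) +
        (↑a'⁻¹ : Matrix κ' κ' D)ᴴ *
          (s'.Yᴴ * (v * s.X * (s.Xᴴ * ((↑p.1⁻¹ : Matrix ι ι D) * s.W))))
      have e1 := hpi.mul_W (h.isom.inv_mem p.2)
      rw [Matrix.mul_assoc _ _ s.W, Matrix.mul_assoc _ v, ← Matrix.mul_assoc s'.Yᴴ, hY']
      conv_lhs => rw [e1]
      simp only [Matrix.mul_add, Matrix.mul_assoc]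
      rw [add_comm]

end Embedding

end HypSplit

/-! ### Levi elements and unipotent elements. -/

namespace HypSplit

variable {D ι ι₁ κ lam : Type*} [Field D] [StarRing D] [Fintype ι] [DecidableEq ι]
  [Fintype ι₁] [DecidableEq ι₁] [Fintype κ] [DecidableEq κ] {ε : ℤˣ} {h : HermForm D ε ι}
  {h₁ : HermForm D ε ι₁}

/-- A matrix that preserves the form, as an element of the isometry group. -/
noncomputable def isomOf (h : HermForm D ε ι) (M : Matrix ι ι D) (hM : Mᴴ * h.gram * M = h.gram) :
    h.isom :=
  ⟨Matrix.GeneralLinearGroup.mkOfDetNeZero M (by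
    intro h0
    have h1 := congrArg Matrix.det hM
    rw [Matrix.det_mul, h0, mul_zero] at h1
    exact h.nondeg.ne_zero h1.symm), hM⟩

theorem ext_mul (s : HypSplit h.gram h₁.gram κ) [Fintype lam] {M N : Matrix lam ι D}
    (h1 : M * s.X = N * s.X) (h2 : M * s.W = N * s.W) (h3 : M * s.Y = N * s.Y) : M = N := by
  rw [s.decomp' M, h1, h2, h3, ← s.decomp' N]

/-- The splitting with `X = Y = 0`. -/
def refl (h : HermForm D ε ι) : HypSplit h.gram h.gram (Fin 0) where
  X := 0
  W := 1
  Y := 0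
  sum := by simp
  XX := Subsingleton.elim _ _
  WW := by simp
  YY := Subsingleton.elim _ _
  XW := Subsingleton.elim _ _
  XY := Subsingleton.elim _ _
  WY := by simp
  XJ := by simp
  JY := by simp
  JW := by simp
  WJ := by simp

variable (s : HypSplit h.gram h₁.gram κ)

theorem exists_levi (a : GL κ D) : ∃ g : h.isom,
    (g.1 : Matrix ι ι D) * s.X = s.X * (a : Matrix κ κ D) ∧
    (g.1 : Matrix ι ι D) * s.W = s.W ∧
    (g.1 : Matrix ι ι D) * s.Y = s.Y * (↑a⁻¹ : Matrix κ κ D)ᴴ := by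
  set M : Matrix ι ι D := s.X * (a : Matrix κ κ D) * s.Xᴴ + s.W * s.Wᴴ +
    s.Y * (↑a⁻¹ : Matrix κ κ D)ᴴ * s.Yᴴ with hM
  have hX : M * s.X = s.X * (a : Matrix κ κ D) := by
    simp only [hM, Matrix.add_mul, Matrix.mul_assoc, s.XX, s.WX, s.YX, Matrix.mul_zero,
      Matrix.mul_one, add_zero]
  have hW : M * s.W = s.W := by
    simp only [hM, Matrix.add_mul, Matrix.mul_assoc, s.XW, s.WW, s.YW, Matrix.mul_zero,
      Matrix.mul_one, add_zero, zero_add]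
  have hY : M * s.Y = s.Y * (↑a⁻¹ : Matrix κ κ D)ᴴ := by
    simp only [hM, Matrix.add_mul, Matrix.mul_assoc, s.XY, s.WY, s.YY, Matrix.mul_zero,
      Matrix.mul_one, zero_add]
  have h1 : (↑a⁻¹ : Matrix κ κ D) * (a : Matrix κ κ D) = 1 := a.inv_mul
  have h2 : (a : Matrix κ κ D)ᴴ * (↑a⁻¹ : Matrix κ κ D)ᴴ = 1 := by
    rw [← Matrix.conjTranspose_mul, h1, Matrix.conjTranspose_one]
  have hadj : Mᴴ = s.X * (a : Matrix κ κ D)ᴴ * s.Xᴴ + s.W * s.Wᴴ +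
      s.Y * (↑a⁻¹ : Matrix κ κ D) * s.Yᴴ := by
    simp [hM, Matrix.mul_assoc]
  refine ⟨isomOf h M (s.ext_mul ?_ ?_ ?_), hX, hW, hY⟩
  · rw [Matrix.mul_assoc, hX, Matrix.mul_assoc, ← Matrix.mul_assoc h.gram, s.gram_X,
      Matrix.smul_mul, Matrix.mul_smul, ← Matrix.mul_assoc, hadj]
    simp only [Matrix.add_mul, Matrix.mul_assoc, s.XY, s.WY, s.YY, Matrix.mul_zero,
      Matrix.mul_one, zero_add, h1]
  · rw [Matrix.mul_assoc, hW, Matrix.mul_assoc, s.JW, ← Matrix.mul_assoc, hadj]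
    simp only [Matrix.add_mul, Matrix.mul_assoc, s.XW, s.WW, s.YW, Matrix.mul_zero,
      Matrix.mul_one, zero_add, add_zero]
  · rw [Matrix.mul_assoc, hY, Matrix.mul_assoc, ← Matrix.mul_assoc h.gram, s.JY,
      ← Matrix.mul_assoc, hadj]
    simp only [Matrix.add_mul, Matrix.mul_assoc, s.XX, s.WX, s.YX, Matrix.mul_zero,
      Matrix.mul_one, add_zero]
    rw [h2, Matrix.mul_one]

/-- `b` and `c` are the blocks `Y → W₁` and `Y → X`. The block `W₁ → X` is forced by `b`, and `hc`
is the condition that the form on `Y` is preserved. -/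
theorem exists_unip (b : Matrix ι₁ κ D) (c : Matrix κ κ D)
    (hc : (ε : ℤ) • c + cᴴ + bᴴ * h₁.gram * b = 0) : ∃ g : h.isom,
    (g.1 : Matrix ι ι D) * s.X = s.X ∧
    (g.1 : Matrix ι ι D) * s.W = s.W - s.X * (h₁.gram * b)ᴴ ∧
    (g.1 : Matrix ι ι D) * s.Y = s.Y + s.W * b + s.X * c := by
  set M : Matrix ι ι D := s.X * s.Xᴴ + (s.W - s.X * (h₁.gram * b)ᴴ) * s.Wᴴ +
    (s.Y + s.W * b + s.X * c) * s.Yᴴ with hM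
  have hX : M * s.X = s.X := by
    simp only [hM, Matrix.add_mul, Matrix.mul_assoc, s.XX, s.WX, s.YX, Matrix.mul_zero,
      Matrix.mul_one, add_zero]
  have hW : M * s.W = s.W - s.X * (h₁.gram * b)ᴴ := by
    simp only [hM, Matrix.add_mul, Matrix.mul_assoc, s.XW, s.WW, s.YW, Matrix.mul_zero,
      Matrix.mul_one, add_zero, zero_add]
  have hY : M * s.Y = s.Y + s.W * b + s.X * c := by
    simp only [hM, Matrix.add_mul, Matrix.mul_assoc, s.XY, s.WY, s.YY, Matrix.mul_zero,
      Matrix.mul_one, zero_add]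
  have hadj : Mᴴ = s.X * s.Xᴴ + s.W * (s.Wᴴ - h₁.gram * b * s.Xᴴ) +
      s.Y * (s.Yᴴ + bᴴ * s.Wᴴ + cᴴ * s.Xᴴ) := by
    rw [hM]
    simp [Matrix.conjTranspose_mul, Matrix.mul_assoc]
  have aX : Mᴴ * s.X = s.X - s.W * (h₁.gram * b) + s.Y * cᴴ := by
    simp only [hadj, Matrix.add_mul, Matrix.sub_mul, Matrix.mul_assoc, s.XX, s.WX, s.YX,
      Matrix.mul_zero, Matrix.mul_one, zero_add, zero_sub, Matrix.mul_neg]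
    abel
  have aW : Mᴴ * s.W = s.W + s.Y * bᴴ := by
    simp only [hadj, Matrix.add_mul, Matrix.sub_mul, Matrix.mul_assoc, s.XW, s.WW, s.YW,
      Matrix.mul_zero, Matrix.mul_one, zero_add, add_zero, sub_zero]
  have aY : Mᴴ * s.Y = s.Y := by
    simp only [hadj, Matrix.add_mul, Matrix.sub_mul, Matrix.mul_assoc, s.XY, s.WY, s.YY,
      Matrix.mul_zero, Matrix.mul_one, zero_add, add_zero, sub_zero]
  refine ⟨isomOf h M (s.ext_mul ?_ ?_ ?_), hX, hW, hY⟩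
  · rw [Matrix.mul_assoc, hX, Matrix.mul_assoc, s.gram_X, Matrix.mul_smul, aY]
  · rw [Matrix.mul_assoc, hW, Matrix.mul_assoc, Matrix.mul_sub, ← Matrix.mul_assoc h.gram s.X,
      s.gram_X, s.JW, Matrix.mul_sub, Matrix.smul_mul, Matrix.mul_smul, ← Matrix.mul_assoc,
      ← Matrix.mul_assoc, aW, aY, Matrix.conjTranspose_mul, h₁.herm, Matrix.mul_smul,
      Matrix.mul_smul, smul_smul]
    have : ((ε : ℤ) * (ε : ℤ)) = 1 := by
      rcases Int.units_eq_one_or ε with rfl | rfl <;> simp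
    rw [this, one_smul, Matrix.add_mul, Matrix.mul_assoc s.Y, add_sub_cancel_right]
  · rw [Matrix.mul_assoc, hY, Matrix.mul_assoc, Matrix.mul_add h.gram, Matrix.mul_add h.gram,
      ← Matrix.mul_assoc h.gram s.X, ← Matrix.mul_assoc h.gram s.W, s.gram_X, s.JW, s.JY,
      Matrix.mul_add, Matrix.mul_add, aX, Matrix.smul_mul, Matrix.mul_smul,
      Matrix.mul_assoc s.W, ← Matrix.mul_assoc _ s.W, ← Matrix.mul_assoc _ s.Y, aW, aY]
    have h3 : s.Y * ((ε : ℤ) • c + cᴴ + bᴴ * h₁.gram * b) = 0 := by rw [hc, Matrix.mul_zero]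
    simp only [Matrix.mul_add, Matrix.mul_smul, Matrix.add_mul, Matrix.mul_assoc] at h3 ⊢
    calc _ = s.X + ((ε : ℤ) • (s.Y * c) + s.Y * cᴴ + s.Y * (bᴴ * (h₁.gram * b))) := by abel
      _ = _ := by rw [h3, add_zero]

end HypSplit

/-! ### Translation of components by the Heisenberg group. -/

section IsoProj

variable {F V : Type*} [Field F] [Finite F] [NeZero (2 : F)] [AddCommGroup V] [Module F V]
  [Finite V] {B : LinearMap.BilinForm F V} {ψ : AddChar F ℂ} {A : Submodule F V}

theorem isoProj_congr {v v' : V} (h : ∀ a ∈ A, B a v = B a v') :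
    isoProj B ψ A v = isoProj B ψ A v' := by
  have := Fintype.ofFinite A
  rw [isoProj_eq, isoProj_eq]
  congr 1
  exact Finset.sum_congr rfl fun a _ => by rw [h a a.2]

theorem isoProj_mul_heisRep (hB : IsSymplectic B) (v w : V) :
    isoProj B ψ A v * heisRep B ψ ⟨w, 0⟩ = heisRep B ψ ⟨w, 0⟩ * isoProj B ψ A (v - w) := by
  have := Fintype.ofFinite A
  rw [isoProj_eq, isoProj_eq, mul_smul_comm, smul_mul_assoc, Finset.mul_sum, Finset.sum_mul]
  congr 1
  refine Finset.sum_congr rfl fun a _ => ?_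
  rw [smul_mul_assoc, heisRep_mul_comm hB, smul_smul, ← AddChar.map_add_eq_mul, mul_smul_comm]
  congr 2
  rw [map_sub]
  ring

theorem isoProj_fixed (hA : ∀ a ∈ A, ∀ b ∈ A, B a b = 0) (w : Fin (heisDim B ψ) → ℂ) :
    ∀ a ∈ A, heisRep B ψ ⟨a, 0⟩ (isoProj B ψ A 0 w) = isoProj B ψ A 0 w := by
  intro a ha
  have := LinearMap.congr_fun (heisRep_mul_isoProj (ψ := ψ) hA ⟨a, ha⟩ 0) w
  simpa using this

theorem isoProj_zero_apply_eq_self {w : Fin (heisDim B ψ) → ℂ}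
    (h : ∀ a ∈ A, heisRep B ψ ⟨a, 0⟩ w = w) : isoProj B ψ A 0 w = w :=
  isoProj_apply_eq_self _ _ fun a ha => by simpa using h a ha

theorem heisRep_add_apply (v w : V) (h : B v w = 0) (x : Fin (heisDim B ψ) → ℂ) :
    heisRep B ψ ⟨v + w, 0⟩ x = heisRep B ψ ⟨v, 0⟩ (heisRep B ψ ⟨w, 0⟩ x) := by
  have := LinearMap.congr_fun (heisRep_mul (B := B) (ψ := ψ) v w) x
  simpa [h] using this.symm

theorem heisRep_neg_apply (hB : IsSymplectic B) (v : V) (x : Fin (heisDim B ψ) → ℂ) :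
    heisRep B ψ ⟨-v, 0⟩ (heisRep B ψ ⟨v, 0⟩ x) = x := by
  rw [← heisRep_add_apply _ _ (by simp [hB.alt v]), neg_add_cancel, heisRep_zero]
  rfl

theorem heisRep_apply_neg (hB : IsSymplectic B) (v : V) (x : Fin (heisDim B ψ) → ℂ) :
    heisRep B ψ ⟨v, 0⟩ (heisRep B ψ ⟨-v, 0⟩ x) = x := by
  have := heisRep_neg_apply (ψ := ψ) hB (-v) x
  rwa [neg_neg] at this

end IsoProj

/-! ### The action of the unipotent radical on the components. -/

namespace HypSplit

variable (F : Type*) {D ι ι₁ κ ι' ι₁' κ' : Type*} [Field F] [Field D] [StarRing D] [Algebra F D]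
  [IsFixedField F D] [Finite F] [Finite D] [NeZero (2 : F)] [Fintype ι] [DecidableEq ι]
  [Fintype ι₁] [DecidableEq ι₁] [Fintype κ] [DecidableEq κ] [Fintype ι'] [DecidableEq ι']
  [Fintype ι₁'] [DecidableEq ι₁'] [Fintype κ'] [DecidableEq κ'] {ε : ℤˣ}
  {h : HermForm D ε ι} {h₁ : HermForm D ε ι₁} {h' : HermForm D (-ε) ι'}
  {h₁' : HermForm D (-ε) ι₁'} (s : HypSplit h.gram h₁.gram κ)
  (s' : HypSplit h'.gram h₁'.gram κ') {ψ : AddChar F ℂ} (hψ : ψ ≠ 1)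

theorem flatRep_heisRep (p : h.isom × h'.isom) (u : Matrix ι' ι D) (t : F)
    (w : Fin (heisDim (pairForm F h h') ψ) → ℂ) :
    flatRep F h h' hψ p (heisRep (pairForm F h h') ψ ⟨u, t⟩ w) =
      heisRep (pairForm F h h') ψ
        ⟨(p.2.1 : Matrix ι' ι' D) * u * (↑p.1.1⁻¹ : Matrix ι ι D), t⟩ (flatRep F h h' hψ p w) := by
  have := LinearMap.congr_fun (weilRep_comm (pairForm_isSymplectic F h h') hψ
    (pairHom F h h' p) ⟨u, t⟩) w
  change (((flatChar F h (Fintype.card ι') p.1 * flatChar F h' (Fintype.card ι) p.2 : ℤˣ) :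
    ℤ) : ℂ) • (weilRep (pairForm_isSymplectic F h h') hψ (pairHom F h h' p) *
      heisRep (pairForm F h h') ψ ⟨u, t⟩) w = _
  rw [this]
  change _ = heisRep (pairForm F h h') ψ (heisAct (pairHom F h h' p) ⟨u, t⟩)
    ((((flatChar F h (Fintype.card ι') p.1 * flatChar F h' (Fintype.card ι) p.2 : ℤˣ) :
    ℤ) : ℂ) • (weilRep (pairForm_isSymplectic F h h') hψ (pairHom F h h' p)) w)
  rw [map_smul]
  rfl

theorem flatRep_isoProj (p : h.isom × h'.isom) (A : Submodule F (Matrix ι' ι D))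
    (hA : ∀ a ∈ A, (p.2.1 : Matrix ι' ι' D) * a * (↑p.1.1⁻¹ : Matrix ι ι D) ∈ A)
    (u : Matrix ι' ι D) (w : Fin (heisDim (pairForm F h h') ψ) → ℂ) :
    flatRep F h h' hψ p (isoProj (pairForm F h h') ψ A u w) =
      isoProj (pairForm F h h') ψ A ((p.2.1 : Matrix ι' ι' D) * u * (↑p.1.1⁻¹ : Matrix ι ι D))
        (flatRep F h h' hψ p w) := by
  have := LinearMap.congr_fun (intertwiner_mul_isoProj (B := pairForm F h h') (ψ := ψ) (A := A)
    (pairHom F h h' p) hA _ (weilRep_comm (pairForm_isSymplectic F h h') hψ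
    (pairHom F h h' p)) u) w
  change (((flatChar F h (Fintype.card ι') p.1 * flatChar F h' (Fintype.card ι) p.2 : ℤˣ) :
    ℤ) : ℂ) • (weilRep (pairForm_isSymplectic F h h') hψ (pairHom F h h' p) *
      isoProj (pairForm F h h') ψ A u) w = _
  rw [this]
  change _ = isoProj (pairForm F h h') ψ A _
    ((((flatChar F h (Fintype.card ι') p.1 * flatChar F h' (Fintype.card ι) p.2 : ℤˣ) :
    ℤ) : ℂ) • (weilRep (pairForm_isSymplectic F h h') hψ (pairHom F h h' p)) w)
  rw [map_smul]
  rfl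

theorem isoSub_isotropic : ∀ a ∈ isoSub F s s', ∀ b ∈ isoSub F s s', pairForm F h h' a b = 0 :=
  fun a ha b hb => (quotMap_eq_zero_iff F s s' b).1 (Prod.ext hb.1 hb.2.1) a ha

/-- The homomorphisms that vanish on `X ⊕ W₁`. -/
def ySub : Submodule F (Matrix ι' ι D) := isoSub F s (refl h')

theorem mem_ySub {u : Matrix ι' ι D} : u ∈ ySub (h' := h') F s ↔ u * s.X = 0 ∧ u * s.W = 0 := by
  refine Iff.trans (mem_isoSub F s (refl h')) ?_
  simp only [refl, Matrix.conjTranspose_one, Matrix.one_mul]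
  exact ⟨fun ⟨h1, _, h2⟩ => ⟨h1, h2⟩, fun ⟨h1, h2⟩ => ⟨h1, Subsingleton.elim _ _, h2⟩⟩

theorem mul_Y_mem_ySub (c : Matrix ι' κ D) : c * s.Yᴴ ∈ ySub (h' := h') F s := by
  rw [mem_ySub, Matrix.mul_assoc, Matrix.mul_assoc, s.YX, s.YW, Matrix.mul_zero, Matrix.mul_zero]
  exact ⟨rfl, rfl⟩

theorem ySub_le_isoSub : ySub (h' := h') F s ≤ isoSub F s s' := by
  intro u hu
  rw [mem_ySub] at hu
  rw [mem_isoSub, hu.1, hu.2, Matrix.mul_zero, Matrix.mul_zero]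
  exact ⟨rfl, rfl, rfl⟩

theorem pairForm_ySub {a b : Matrix ι' ι D} (ha : a ∈ ySub (h' := h') F s) (hb : b * s.X = 0) :
    pairForm F h h' a b = 0 :=
  (quotMap_eq_zero_iff F s (refl h') b).1 (Prod.ext hb (Subsingleton.elim _ _)) a ha

theorem ySub_perp {v : Matrix ι' ι D} (hv : ∀ a ∈ ySub (h' := h') F s, pairForm F h h' a v = 0) :
    v * s.X = 0 :=
  congrArg Prod.fst ((quotMap_eq_zero_iff F s (refl h') v).2 hv)

theorem pairForm_mul_X (y : Matrix ι' κ D) (u : Matrix κ ι D) :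
    pairForm F h h' (y * s.Xᴴ) (y * u) =
      Algebra.trace F D (Matrix.trace (yᴴ * h'.gram * y * (u * s.Y))) := by
  rw [pairForm_apply, Matrix.conjTranspose_mul, Matrix.conjTranspose_conjTranspose,
    ← Matrix.mul_assoc, ← Matrix.mul_assoc, s.inv_X, Matrix.mul_assoc, Matrix.mul_assoc,
    Matrix.mul_assoc, Matrix.trace_mul_comm]
  simp only [Matrix.mul_assoc]

theorem isPara_one {g : GL ι D} (h1 : (g : Matrix ι ι D) * s.X = s.X)
    (h2 : s.Wᴴ * (g : Matrix ι ι D) * s.W = 1) : s.IsPara g 1 (1 : h₁.isom).1 :=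
  ⟨by rw [h1]; simp, by rw [h2]; rfl⟩

theorem isPara_one_one : s.IsPara (1 : h.isom).1 1 (1 : h₁.isom).1 :=
  ⟨by simp, by simp [s.WW]⟩

/-- The fixed vectors of `isoSub` form `ω♭` of the smaller pair, on which the parabolic subgroup
acts through its quotient; the image of `n` there is trivial. -/
theorem flatRep_fixed (hn : Fintype.card ι = Fintype.card ι₁ + 2 * Fintype.card κ)
    (hn' : Fintype.card ι' = Fintype.card ι₁' + 2 * Fintype.card κ')
    (heven : (∀ x : D, star x = x) → Even (Fintype.card ι) ∧ Even (Fintype.card ι'))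
    (n : h.isom) (hnp : s.IsPara n.1 1 (1 : h₁.isom).1)
    {v : Fin (heisDim (pairForm F h h') ψ) → ℂ}
    (hv : ∀ a ∈ isoSub F s s', heisRep (pairForm F h h') ψ ⟨a, 0⟩ v = v) :
    flatRep F h h' hψ (n, 1) v = v := by
  obtain ⟨j, -, j2, -, j4⟩ := exists_flatRep_embedding F s s' hψ hn hn' heven
  obtain ⟨w, rfl⟩ := (j2 v).2 hv
  rw [j4 n 1 1 1 1 1 hnp (isPara_one_one s')]
  have : flatRep F h₁ h₁' hψ (1, 1) = 1 := map_one _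
  rw [this]
  rfl

/-- `n` fixes `v`, so it moves the translate of `v` by `y` only through the Heisenberg group. The
difference of `y Xᴴ n` and `y Xᴴ` has a part on `W₁`, which remains, and a part in `ySub`, which
fixes `v`; the scalar is the cocycle of the two translations. -/
theorem unip_fixed_condition (hn : Fintype.card ι = Fintype.card ι₁ + 2 * Fintype.card κ)
    (heven : (∀ x : D, star x = x) → Even (Fintype.card ι) ∧ Even (Fintype.card ι'))
    (n : h.isom) (hnp : s.IsPara n.1 1 (1 : h₁.isom).1)
    (y : Matrix ι' κ D) {v : Fin (heisDim (pairForm F h h') ψ) → ℂ}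
    (hv : ∀ a ∈ ySub (h' := h') F s, heisRep (pairForm F h h') ψ ⟨a, 0⟩ v = v)
    (hu : flatRep F h h' hψ (n⁻¹, 1) (heisRep (pairForm F h h') ψ ⟨y * s.Xᴴ, 0⟩ v) =
      heisRep (pairForm F h h') ψ ⟨y * s.Xᴴ, 0⟩ v) :
    ψ (-(2⁻¹ * Algebra.trace F D (Matrix.trace (yᴴ * h'.gram * y *
      (s.Xᴴ * (n.1 : Matrix ι ι D) * s.Y))))) •
      heisRep (pairForm F h h') ψ ⟨y * (s.Xᴴ * (n.1 : Matrix ι ι D) * s.W) * s.Wᴴ, 0⟩ v = v := by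
  have hB := pairForm_isSymplectic F h h'
  have hfix : flatRep F h h' hψ (n⁻¹, 1) v = v :=
    -- For `X' = 0` the space `isoSub` is `ySub` and the smaller pair is `(W₁, W')`.
    flatRep_fixed F s (refl h') hψ hn (by simp) heven n⁻¹ (by simpa using hnp.inv n.2) hv
  rw [flatRep_heisRep, hfix] at hu
  have e0 : ((1 : h'.isom).1 : Matrix ι' ι' D) * (y * s.Xᴴ) * (↑(n⁻¹).1⁻¹ : Matrix ι ι D) =
      y * (s.Xᴴ * (n.1 : Matrix ι ι D)) := by
    simp [Matrix.mul_assoc]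
  have hu' : heisRep (pairForm F h h') ψ ⟨y * (s.Xᴴ * (n.1 : Matrix ι ι D)), 0⟩ v =
      heisRep (pairForm F h h') ψ ⟨y * s.Xᴴ, 0⟩ v := by
    rw [← hu]
    exact congrArg (fun z => heisRep (pairForm F h h') ψ ⟨z, 0⟩ v) e0.symm
  have e1 := congrArg (heisRep (pairForm F h h') ψ ⟨-(y * s.Xᴴ), 0⟩) hu'
  rw [heisRep_neg_apply hB] at e1
  have e2 := LinearMap.congr_fun (heisRep_mul (B := pairForm F h h') (ψ := ψ) (-(y * s.Xᴴ))
    (y * (s.Xᴴ * (n.1 : Matrix ι ι D)))) v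
  rw [Module.End.mul_apply, e1, LinearMap.smul_apply, map_neg, LinearMap.neg_apply,
    pairForm_mul_X, mul_neg] at e2
  have hX : s.Xᴴ * (n.1 : Matrix ι ι D) * s.X = 1 := by
    rw [Matrix.mul_assoc, hnp.1, Units.val_one, Matrix.mul_one, s.XX]
  have e3 : -(y * s.Xᴴ) + y * (s.Xᴴ * (n.1 : Matrix ι ι D)) =
      y * (s.Xᴴ * (n.1 : Matrix ι ι D) * s.W) * s.Wᴴ +
        y * (s.Xᴴ * (n.1 : Matrix ι ι D) * s.Y) * s.Yᴴ := by
    have := s.decomp' (s.Xᴴ * (n.1 : Matrix ι ι D))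
    rw [hX, Matrix.one_mul] at this
    conv_lhs => rw [this]
    simp only [Matrix.mul_add, Matrix.mul_assoc]
    abel
  rw [e3, heisRep_add_apply, hv _ (mul_Y_mem_ySub F s _)] at e2
  · exact e2.symm
  · rw [hB.neg, pairForm_ySub F s (mul_Y_mem_ySub F s _), neg_zero]
    rw [Matrix.mul_assoc, s.WX, Matrix.mul_zero]

end HypSplit

/-! ### Vectors fixed by the unipotent radical. -/

namespace HypSplit

variable (F : Type*) {D ι ι₁ κ ι' ι₁' κ' : Type*} [Field F] [Field D] [StarRing D] [Algebra F D]
  [IsFixedField F D] [Finite F] [Finite D] [NeZero (2 : F)] [Fintype ι] [DecidableEq ι]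
  [Fintype ι₁] [DecidableEq ι₁] [Fintype κ] [DecidableEq κ] [Fintype ι'] [DecidableEq ι']
  [Fintype ι₁'] [DecidableEq ι₁'] [Fintype κ'] [DecidableEq κ'] {ε : ℤˣ}
  {h : HermForm D ε ι} {h₁ : HermForm D ε ι₁} {h' : HermForm D (-ε) ι'}
  {h₁' : HermForm D (-ε) ι₁'} (s : HypSplit h.gram h₁.gram κ)
  (s' : HypSplit h'.gram h₁'.gram κ') {ψ : AddChar F ℂ} (hψ : ψ ≠ 1)

/-- The unipotent radical maps onto `Hom(W₁, X)`: the block `Y → W₁` is determined by `b`, and half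
of its hermitian square solves the remaining quadratic condition. -/
theorem exists_isPara_one [NeZero (2 : D)] (b : Matrix κ ι₁ D) :
    ∃ g : h.isom, s.IsPara g.1 1 (1 : h₁.isom).1 ∧ s.Xᴴ * (g.1 : Matrix ι ι D) * s.W = b := by
  obtain ⟨c, hc⟩ : ∃ c : Matrix ι₁ κ D, c = -(h₁.gram⁻¹ * bᴴ) := ⟨_, rfl⟩
  have hsk : (cᴴ * h₁.gram * c)ᴴ = (ε : ℤ) • (cᴴ * h₁.gram * c) := by
    rw [Matrix.conjTranspose_mul, Matrix.conjTranspose_mul, h₁.herm]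
    rcases Int.units_eq_one_or ε with rfl | rfl <;> simp [Matrix.mul_assoc]
  have hskε : (ε : ℤ) • (ε : ℤ) • (cᴴ * h₁.gram * c) = cᴴ * h₁.gram * c := by
    rcases Int.units_eq_one_or ε with rfl | rfl <;> simp
  have h2 : star (2⁻¹ : D) = 2⁻¹ := by simp
  obtain ⟨g, g1, g2, g3⟩ := exists_unip s c (-((2⁻¹ : D) • (ε : ℤ) • (cᴴ * h₁.gram * c))) (by
    rw [smul_neg, smul_comm, hskε, Matrix.conjTranspose_neg, Matrix.conjTranspose_smul, h2,
      Matrix.conjTranspose_smul, hsk, star_trivial, hskε, ← neg_add, ← add_smul, ← two_mul,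
      mul_inv_cancel₀ (NeZero.ne _), one_smul, neg_add_cancel])
  refine ⟨g, isPara_one s g1 ?_, ?_⟩
  · rw [Matrix.mul_assoc, g2, Matrix.mul_sub, s.WW, ← Matrix.mul_assoc, s.WX, Matrix.zero_mul,
      sub_zero]
  · rw [Matrix.mul_assoc, g2, Matrix.mul_sub, s.XW, ← Matrix.mul_assoc, s.XX, Matrix.one_mul,
      zero_sub, hc, Matrix.mul_neg, Matrix.mul_nonsing_inv_cancel_left _ _ h₁.nondeg]
    simp

/-- A vector that is fixed by the unipotent radical has no component attached to a homomorphism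
`X → W'` with image not totally isotropic. -/
theorem eq_zero_of_unip_fixed (hn : Fintype.card ι = Fintype.card ι₁ + 2 * Fintype.card κ)
    (heven : (∀ x : D, star x = x) → Even (Fintype.card ι) ∧ Even (Fintype.card ι'))
    (y : Matrix ι' κ D) (hy : yᴴ * h'.gram * y ≠ 0) {v : Fin (heisDim (pairForm F h h') ψ) → ℂ}
    (hv : ∀ a ∈ ySub (h' := h') F s, heisRep (pairForm F h h') ψ ⟨a, 0⟩ v = v)
    (hu : ∀ n : h.isom, s.IsPara n.1 1 (1 : h₁.isom).1 →
      flatRep F h h' hψ (n, 1) (heisRep (pairForm F h h') ψ ⟨y * s.Xᴴ, 0⟩ v) =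
      heisRep (pairForm F h h') ψ ⟨y * s.Xᴴ, 0⟩ v) : v = 0 := by
  by_contra hv0
  apply hy
  set C := yᴴ * h'.gram * y with hC
  have hCadj : Cᴴ = -((ε : ℤ) • C) := by
    rw [hC, Matrix.conjTranspose_mul, Matrix.conjTranspose_mul, h'.herm]
    rcases Int.units_eq_one_or ε with rfl | rfl <;> simp [Matrix.mul_assoc]
  have h2F : (2 : F) ≠ 0 := NeZero.ne 2
  have key : ∀ G : Matrix κ κ D, ψ (-Algebra.trace F D (Matrix.trace (G * C))) = 1 := by
    intro G
    -- These are the elements with `b = 0`, which act on the component of `y` by scalars. The two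
    -- terms of `c` contribute equally to the trace, by the symmetry of `C`, and the factor `2⁻¹`
    -- cancels.
    set c : Matrix κ κ D := G - (ε : ℤ) • Gᴴ with hc
    obtain ⟨g, g1, g2, g3⟩ := exists_unip s 0 c (by
      rcases Int.units_eq_one_or ε with rfl | rfl <;> simp [hc])
    have hg : s.IsPara g.1 1 (1 : h₁.isom).1 := isPara_one s g1 (by
      rw [Matrix.mul_assoc, g2]
      simp [s.WW])
    have h1 := unip_fixed_condition F s hψ hn heven g hg y hv
      (hu _ (by simpa using hg.inv g.2))
    have e1 : s.Xᴴ * (g.1 : Matrix ι ι D) * s.W = 0 := by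
      rw [Matrix.mul_assoc, g2]
      simp [s.XW]
    have e2 : s.Xᴴ * (g.1 : Matrix ι ι D) * s.Y = c := by
      rw [Matrix.mul_assoc, g3, Matrix.mul_zero, add_zero, Matrix.mul_add, s.XY,
        ← Matrix.mul_assoc, s.XX, Matrix.one_mul, zero_add]
    have e3 : Algebra.trace F D (Matrix.trace (C * c)) =
        2 * Algebra.trace F D (Matrix.trace (G * C)) := by
      have e4 : Matrix.trace (C * Gᴴ) = -((ε : ℤ) • star (Matrix.trace (G * C))) := by
        rw [← Matrix.trace_conjTranspose, Matrix.conjTranspose_mul, hCadj]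
        rcases Int.units_eq_one_or ε with rfl | rfl <;> simp
      have e5 : Algebra.trace F D (star (Matrix.trace (G * C))) =
          Algebra.trace F D (Matrix.trace (G * C)) :=
        Algebra.trace_eq_of_algEquiv (starAlgEquiv F) _
      rw [hc, Matrix.mul_sub, Matrix.mul_smul, Matrix.trace_sub, Matrix.trace_smul, e4,
        Matrix.trace_mul_comm, smul_neg, sub_neg_eq_add, map_add, two_mul]
      congr 1
      rw [← e5]
      rcases Int.units_eq_one_or ε with rfl | rfl <;> simp
    rw [← hC, e1, e2, e3, Matrix.mul_zero, Matrix.zero_mul, heisRep_zero,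
      inv_mul_cancel_left₀ h2F] at h1
    by_contra h3
    have h4 : (ψ (-Algebra.trace F D (Matrix.trace (G * C))) - 1) • v = 0 := by
      rw [sub_smul, one_smul, sub_eq_zero]
      exact h1
    rcases smul_eq_zero.1 h4 with h5 | h5
    · exact h3 (sub_eq_zero.1 h5)
    · exact hv0 h5
  refine eq_zero_of_trace_mul F C fun G => ?_
  by_contra ht
  obtain ⟨a, ha⟩ := AddChar.ne_one_iff.1 hψ
  -- The multiple of `G` has trace `-a`, so `key` would give `ψ a = 1`.
  have h3 := key ((-a / Algebra.trace F D (Matrix.trace (G * C))) • G)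
  rw [Matrix.smul_mul, Matrix.trace_smul, map_smul, smul_eq_mul, div_mul_cancel₀ _ ht,
    neg_neg] at h3
  exact ha h3

theorem isotropic_mul_X (π : Matrix κ' κ D) : (s'.X * π)ᴴ * h'.gram * (s'.X * π) = 0 := by
  rw [Matrix.conjTranspose_mul, Matrix.mul_assoc πᴴ, s'.XJ, Matrix.mul_assoc,
    ← Matrix.mul_assoc s'.Yᴴ, s'.YX, Matrix.zero_mul, Matrix.mul_zero]

/-- A vector that is fixed by the unipotent radical and lies in the component attached to a map of
`X` onto `X'` is determined by its projection to a smaller space of invariants. -/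
theorem fixed_of_unip_fixed (hn : Fintype.card ι = Fintype.card ι₁ + 2 * Fintype.card κ)
    (heven : (∀ x : D, star x = x) → Even (Fintype.card ι) ∧ Even (Fintype.card ι'))
    (π : Matrix κ' κ D) (hπ : π * πᴴ = 1) {v : Fin (heisDim (pairForm F h h') ψ) → ℂ}
    (hv : ∀ a ∈ ySub (h' := h') F s, heisRep (pairForm F h h') ψ ⟨a, 0⟩ v = v)
    (hu : ∀ n : h.isom, s.IsPara n.1 1 (1 : h₁.isom).1 →
      flatRep F h h' hψ (n, 1) (heisRep (pairForm F h h') ψ ⟨s'.X * π * s.Xᴴ, 0⟩ v) =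
      heisRep (pairForm F h h') ψ ⟨s'.X * π * s.Xᴴ, 0⟩ v) :
    ∀ a ∈ isoSub F s s', heisRep (pairForm F h h') ψ ⟨a, 0⟩ v = v := by
  intro a ha
  have := neZero_two_of_algebra F D
  have hW : a * s.W = s'.X * (s'.Xᴴ * (a * s.W)) := by
    conv_lhs => rw [s'.decomp (a * s.W), ha.2.1, ha.2.2, Matrix.mul_zero, Matrix.mul_zero,
      add_zero, add_zero]
  -- With this block the relation `π * πᴴ = 1` recovers the part of `a` on `W₁`. The scalar in the
  -- condition is trivial, because the image of `X' π` is totally isotropic.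
  obtain ⟨g, hg, hgb⟩ := exists_isPara_one s (πᴴ * (s'.Xᴴ * (a * s.W)))
  have h1 := unip_fixed_condition F s hψ hn heven g hg (s'.X * π) hv
      (hu _ (by simpa using hg.inv g.2))
  rw [isotropic_mul_X, hgb, Matrix.zero_mul, Matrix.trace_zero, map_zero, mul_zero, neg_zero,
    AddChar.map_zero_eq_one, one_smul] at h1
  have e1 : s'.X * π * (πᴴ * (s'.Xᴴ * (a * s.W))) * s.Wᴴ = a * s.W * s.Wᴴ := by
    rw [Matrix.mul_assoc s'.X, ← Matrix.mul_assoc π, hπ, Matrix.one_mul, ← hW]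
  rw [e1] at h1
  have e2 : a = a * s.W * s.Wᴴ + a * s.Y * s.Yᴴ := by
    conv_lhs => rw [s.decomp' a, ha.1, Matrix.zero_mul, zero_add]
  have e3 := mul_Y_mem_ySub (h' := h') F s (a * s.Y)
  rw [e2, heisRep_add_apply, hv _ e3, h1]
  rw [(pairForm_isSymplectic F h h').neg, pairForm_ySub F s e3, neg_zero]
  rw [Matrix.mul_assoc, s.WX, Matrix.mul_zero]

/-- Moving `n` past the translation by `y` changes the translation by an element of `isoSub`, since
the image of `y` lies in `X'`. This change and `n` itself act trivially on the fixed vectors of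
`isoSub`. -/
theorem isoProj_flatRep_unip (hn : Fintype.card ι = Fintype.card ι₁ + 2 * Fintype.card κ)
    (hn' : Fintype.card ι' = Fintype.card ι₁' + 2 * Fintype.card κ')
    (heven : (∀ x : D, star x = x) → Even (Fintype.card ι) ∧ Even (Fintype.card ι'))
    (π : Matrix κ' κ D) (n : h.isom) (hnp : s.IsPara n.1 1 (1 : h₁.isom).1)
    (u : Fin (heisDim (pairForm F h h') ψ) → ℂ) :
    isoProj (pairForm F h h') ψ (isoSub F s s') 0 (heisRep (pairForm F h h') ψ
      ⟨-(s'.X * π * s.Xᴴ), 0⟩ (flatRep F h h' hψ (n, 1) u)) =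
    isoProj (pairForm F h h') ψ (isoSub F s s') 0 (heisRep (pairForm F h h') ψ
      ⟨-(s'.X * π * s.Xᴴ), 0⟩ u) := by
  have hB := pairForm_isSymplectic F h h'
  set y := s'.X * π with hy
  have hX : s.Xᴴ * (n.1 : Matrix ι ι D) * s.X = 1 := by
    rw [Matrix.mul_assoc, hnp.1, Units.val_one, Matrix.mul_one, s.XX]
  have hmem : y * (s.Xᴴ * (n.1 : Matrix ι ι D)) - y * s.Xᴴ ∈ isoSub F s s' := by
    rw [← Matrix.mul_sub]
    refine ⟨?_, ?_, ?_⟩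
    · rw [Matrix.mul_assoc, Matrix.sub_mul, hX, s.XX, sub_self, Matrix.mul_zero]
    · rw [hy, Matrix.mul_assoc, Matrix.mul_assoc, ← Matrix.mul_assoc, s'.YX, Matrix.zero_mul]
    · rw [hy, Matrix.mul_assoc, Matrix.mul_assoc, ← Matrix.mul_assoc, s'.WX, Matrix.zero_mul]
  have e1 : flatRep F h h' hψ (n, 1) (heisRep (pairForm F h h') ψ
      ⟨-(y * (s.Xᴴ * (n.1 : Matrix ι ι D))), 0⟩ u) =
      heisRep (pairForm F h h') ψ ⟨-(y * s.Xᴴ), 0⟩ (flatRep F h h' hψ (n, 1) u) := by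
    rw [flatRep_heisRep]
    have : (n.1 : Matrix ι ι D) * (↑(n.1)⁻¹ : Matrix ι ι D) = 1 := n.1.mul_inv
    have e0 : ((1 : h'.isom).1 : Matrix ι' ι' D) * -(y * (s.Xᴴ * (n.1 : Matrix ι ι D))) *
        (↑n.1⁻¹ : Matrix ι ι D) = -(y * s.Xᴴ) := by
      simp only [Matrix.mul_neg, Matrix.neg_mul, Matrix.mul_assoc, this, Matrix.mul_one]
      simp
    exact congrArg (fun z => heisRep (pairForm F h h') ψ ⟨z, 0⟩ (flatRep F h h' hψ (n, 1) u)) e0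
  have hstab : ∀ a ∈ isoSub F s s', ((1 : h'.isom).1 : Matrix ι' ι' D) * a *
      (↑n.1⁻¹ : Matrix ι ι D) ∈ isoSub F s s' := by
    intro a ha
    have hni := hnp.inv n.2
    have h1 : a * (↑n.1⁻¹ : Matrix ι ι D) * s.W = a * s.W := by
      rw [Matrix.mul_assoc, hni.mul_W (h.isom.inv_mem n.2), Matrix.mul_add, ← Matrix.mul_assoc,
        ha.1, Matrix.zero_mul, zero_add]
      simp
    have h2 : a * (↑n.1⁻¹ : Matrix ι ι D) * s.X = 0 := by
      rw [Matrix.mul_assoc, hni.1, ← Matrix.mul_assoc, ha.1, Matrix.zero_mul]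
    have h3 : ((1 : h'.isom).1 : Matrix ι' ι' D) = 1 := rfl
    rw [h3, Matrix.one_mul, mem_isoSub, h1, h2]
    exact ⟨rfl, ha.2⟩
  have e2 := flatRep_isoProj F hψ (n, 1) (isoSub F s s') hstab 0
    (heisRep (pairForm F h h') ψ ⟨-(y * (s.Xᴴ * (n.1 : Matrix ι ι D))), 0⟩ u)
  rw [e1, Matrix.mul_zero, Matrix.zero_mul, flatRep_fixed F s s' hψ hn hn' heven n hnp
    (isoProj_fixed (isoSub_isotropic F s s') _)] at e2
  rw [← e2]
  have e3 : -(y * (s.Xᴴ * (n.1 : Matrix ι ι D))) =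
      -(y * (s.Xᴴ * (n.1 : Matrix ι ι D)) - y * s.Xᴴ) + -(y * s.Xᴴ) := by abel
  have hz : pairForm F h h' (-(y * (s.Xᴴ * (n.1 : Matrix ι ι D)) - y * s.Xᴴ)) (-(y * s.Xᴴ)) =
      0 := by
    rw [map_neg, map_neg, LinearMap.neg_apply, neg_neg, hB.neg, map_sub, pairForm_mul_X,
      pairForm_mul_X, hy, isotropic_mul_X, Matrix.zero_mul, Matrix.zero_mul]
    simp
  rw [e3, heisRep_add_apply _ _ hz]
  have e4 := LinearMap.congr_fun (isoProj_mul_heisRep (ψ := ψ) (A := isoSub F s s') hB 0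
    (-(y * (s.Xᴴ * (n.1 : Matrix ι ι D)) - y * s.Xᴴ)))
    (heisRep (pairForm F h h') ψ ⟨-(y * s.Xᴴ), 0⟩ u)
  rw [Module.End.mul_apply, Module.End.mul_apply] at e4
  have e5 : isoProj (pairForm F h h') ψ (isoSub F s s')
      (0 - -(y * (s.Xᴴ * (n.1 : Matrix ι ι D)) - y * s.Xᴴ)) =
      isoProj (pairForm F h h') ψ (isoSub F s s') 0 := by
    refine isoProj_congr fun a ha => ?_
    rw [sub_neg_eq_add, zero_add, map_zero]
    exact isoSub_isotropic F s s' a ha _ hmem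
  rw [e4, e5]
  exact isoProj_fixed (isoSub_isotropic F s s') _ _ (Submodule.neg_mem _ hmem)

end HypSplit

/-! ### Exchange of the members of a dual pair. -/

section Swap

variable (F : Type*) {D ι ι' : Type*} [Field F] [Field D] [StarRing D] [Algebra F D]
  [IsFixedField F D] [Finite F] [Finite D] [NeZero (2 : F)] [Fintype ι] [DecidableEq ι]
  [Fintype ι'] [DecidableEq ι'] {ε ε' : ℤˣ}

/-- A form with the sign written in another way. -/
def HermForm.cast (e : ε' = -ε) (h : HermForm D ε' ι) : HermForm D (-ε) ι :=
  ⟨h.gram, e ▸ h.herm, h.nondeg⟩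

/-- The isometry groups do not depend on the way in which the sign is written. -/
def castIsom (e : ε' = -ε) (h : HermForm D ε' ι) : h.isom →* (h.cast e).isom where
  toFun g := ⟨g.1, g.2⟩
  map_one' := rfl
  map_mul' _ _ := rfl

/-- The adjoint `X ↦ X*`. -/
noncomputable def adjMap (h : HermForm D ε ι) (h' : HermForm D (-ε) ι') :
    Matrix ι ι' D →ₗ[F] Matrix ι' ι D where
  toFun u := h'.gram⁻¹ * uᴴ * h.gram
  map_add' u v := by simp [Matrix.add_mul, Matrix.mul_add]
  map_smul' c u := by
    have h1 : (c • u)ᴴ = c • uᴴ := by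
      ext i j
      simp [Algebra.smul_def, star_algebraMap_of_fixed]
    simp [h1]

variable (h : HermForm D ε ι) (h' : HermForm D (-ε) ι') {ψ : AddChar F ℂ} (hψ : ψ ≠ 1)

/-- The signs of the two forms are opposite, so the double adjoint is `-1`; this sign makes up for
the exchange of the arguments of an alternating form. -/
theorem pairForm_adjMap (u v : Matrix ι ι' D) :
    pairForm F h h' (adjMap F h h' u) (adjMap F h h' v) =
      pairForm F h' (h.cast (neg_neg ε).symm) u v := by
  have hJ : IsUnit (h'.gramᴴ).det := by
    rw [Matrix.det_conjTranspose]
    exact h'.nondeg.star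
  have e1 : h.gram⁻¹ * (adjMap F h h' u)ᴴ * h'.gram = -u := by
    change h.gram⁻¹ * (h'.gram⁻¹ * uᴴ * h.gram)ᴴ * h'.gram = -u
    rw [Matrix.conjTranspose_mul, Matrix.conjTranspose_mul, Matrix.conjTranspose_conjTranspose,
      Matrix.conjTranspose_nonsing_inv, h.herm]
    have e2 : (h'.gramᴴ)⁻¹ * h'.gram = -((ε : ℤ) • (1 : Matrix ι' ι' D)) := by
      have e3 : h'.gram = h'.gramᴴ * -((ε : ℤ) • (1 : Matrix ι' ι' D)) := by
        rw [h'.herm]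
        rcases Int.units_eq_one_or ε with rfl | rfl <;> simp
      calc (h'.gramᴴ)⁻¹ * h'.gram
          = (h'.gramᴴ)⁻¹ * (h'.gramᴴ * -((ε : ℤ) • (1 : Matrix ι' ι' D))) := by rw [← e3]
        _ = _ := Matrix.nonsing_inv_mul_cancel_left _ _ hJ
    rw [Matrix.mul_assoc, Matrix.mul_assoc, Matrix.mul_assoc, e2, Matrix.smul_mul,
      Matrix.mul_smul, Matrix.nonsing_inv_mul_cancel_left _ _ h.nondeg]
    rcases Int.units_eq_one_or ε with rfl | rfl <;> simp
  rw [pairForm_apply, e1, (pairForm_isSymplectic F h' (h.cast (neg_neg ε).symm)).neg,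
    pairForm_apply]
  change _ = -Algebra.trace F D (Matrix.trace (h'.gram⁻¹ * vᴴ * h.gram * u))
  rw [Matrix.neg_mul, Matrix.trace_neg, map_neg, Matrix.trace_mul_comm]
  rfl

theorem adjMap_surjective : Function.Surjective (adjMap F h h') := by
  intro v
  refine ⟨(h'.gram * v * h.gram⁻¹)ᴴ, ?_⟩
  change h'.gram⁻¹ * ((h'.gram * v * h.gram⁻¹)ᴴ)ᴴ * h.gram = v
  rw [Matrix.conjTranspose_conjTranspose, Matrix.mul_assoc, Matrix.mul_assoc, Matrix.mul_assoc,
    Matrix.nonsing_inv_mul _ h.nondeg, Matrix.mul_one,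
    Matrix.nonsing_inv_mul_cancel_left _ _ h'.nondeg]

theorem gram_inv_mul_conjTranspose (g : h.isom) : h.gram⁻¹ * (g.1 : Matrix ι ι D)ᴴ =
    (↑g.1⁻¹ : Matrix ι ι D) * h.gram⁻¹ := by
  have h1 : (g.1 : Matrix ι ι D)ᴴ * h.gram = h.gram * (↑g.1⁻¹ : Matrix ι ι D) := by
    have := h.isom_mul (h.isom.inv_mem g.2)
    rw [this, inv_inv]
  calc h.gram⁻¹ * (g.1 : Matrix ι ι D)ᴴ
      = h.gram⁻¹ * ((g.1 : Matrix ι ι D)ᴴ * h.gram) * h.gram⁻¹ := by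
        rw [Matrix.mul_assoc, Matrix.mul_assoc, Matrix.mul_nonsing_inv _ h.nondeg, Matrix.mul_one]
    _ = _ := by rw [h1, Matrix.nonsing_inv_mul_cancel_left _ _ h.nondeg]

/-- An isometry of symplectic spaces identifies their Weil representations: this is
`exists_weilRep_embedding` for `A = 0`, where the quotient is a point and the sign is trivial. The
twist is symmetric in the two members. -/
theorem exists_flatRep_swap : ∃ E : (Fin (heisDim (pairForm F h h') ψ) → ℂ) ≃ₗ[ℂ]
    (Fin (heisDim (pairForm F h' (h.cast (neg_neg ε).symm)) ψ) → ℂ),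
    ∀ g g' w, E (flatRep F h h' hψ (g, g') w) =
      flatRep F h' (h.cast (neg_neg ε).symm) hψ (g', castIsom (neg_neg ε).symm h g) (E w) := by
  obtain ⟨j, j1, j2, -, j4⟩ := exists_weilRep_embedding (Y := PUnit.{1})
    (pairForm_isSymplectic F h h') (pairForm_isSymplectic F h' (h.cast (neg_neg ε).symm)) hψ
    (adjMap F h h') (pairForm_adjMap F h h') ⊥ (by simp) (by simp)
    (fun v _ => by
      obtain ⟨u, hu⟩ := adjMap_surjective F h h' v
      exact ⟨u, by simp [hu]⟩) 0 (fun _ => ⟨0, rfl⟩) (by simp)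
  have hsurj : Function.Surjective j := fun w => (j2 w).2 (by
    intro a ha
    rw [(Submodule.mem_bot F).1 ha, heisRep_zero]
    rfl)
  refine ⟨(LinearEquiv.ofBijective j ⟨j1, hsurj⟩).symm, fun g g' w => ?_⟩
  rw [LinearEquiv.symm_apply_eq]
  obtain ⟨w, rfl⟩ := hsurj w
  have e0 : (LinearEquiv.ofBijective j ⟨j1, hsurj⟩).symm (j w) = w := by
    rw [LinearEquiv.symm_apply_eq]
    rfl
  rw [e0]
  have key := j4 (pairHom F h h' (g, g')) (pairHom F h' (h.cast (neg_neg ε).symm)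
    (g', castIsom (neg_neg ε).symm h g)) 1 (by simp) (fun u => by
      rw [Submodule.mem_bot, sub_eq_zero]
      change (g'.1 : Matrix ι' ι' D) * (h'.gram⁻¹ * uᴴ * h.gram) * (↑g.1⁻¹ : Matrix ι ι D) =
        h'.gram⁻¹ * ((g.1 : Matrix ι ι D) * u * (↑g'.1⁻¹ : Matrix ι' ι' D))ᴴ * h.gram
      have e1 := gram_inv_mul_conjTranspose h' g'⁻¹
      have e2 := h.isom_mul (h.isom.inv_mem g.2)
      simp only [Subgroup.coe_inv, inv_inv] at e1 e2
      rw [Matrix.conjTranspose_mul, Matrix.conjTranspose_mul, ← Matrix.mul_assoc h'.gram⁻¹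
        (↑g'.1⁻¹ : Matrix ι' ι' D)ᴴ, e1]
      simp only [Matrix.mul_assoc]
      rw [e2]) (fun _ => rfl) w
  rw [map_one, Units.val_one, Int.cast_one, one_smul] at key
  change ((((flatChar F h (Fintype.card ι') g * flatChar F h' (Fintype.card ι) g' : ℤˣ) :
    ℤ) : ℂ) • weilRep (pairForm_isSymplectic F h h') hψ (pairHom F h h' (g, g'))) (j w) =
    j (((((flatChar F h' (Fintype.card ι) g' * flatChar F h (Fintype.card ι') g : ℤˣ) :
    ℤ) : ℂ) • weilRep (pairForm_isSymplectic F h' (h.cast (neg_neg ε).symm)) hψ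
      (pairHom F h' (h.cast (neg_neg ε).symm) (g', castIsom (neg_neg ε).symm h g))) w)
  rw [LinearMap.smul_apply, LinearMap.smul_apply, key, map_smul, mul_comm]

end Swap

/-! ### The splitting of `W_m` defined by `X_k`, and its parabolic subgroup. -/

section TowerSplit

variable {D : Type*} [Field D] [StarRing D] {ε : ℤˣ} {d : ℕ} (h₀ : HermForm D ε (Fin d))

theorem one_submatrix_conjTranspose_mul {ι κ lam : Type*} [Fintype ι] [DecidableEq ι]
    (e : κ → ι) (M : Matrix ι lam D) :
    ((1 : Matrix ι ι D).submatrix id e)ᴴ * M = M.submatrix e id := by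
  ext i j
  simp [Matrix.mul_apply, Matrix.one_apply]

theorem mul_one_submatrix {ι κ lam : Type*} [Fintype ι] [DecidableEq ι]
    (e : κ → ι) (M : Matrix lam ι D) :
    M * ((1 : Matrix ι ι D).submatrix id e) = M.submatrix id e := by
  ext i j
  simp [Matrix.mul_apply, Matrix.one_apply]

/-- The index of the basis vector `f_j`. -/
def idxY (m d k : ℕ) (hk : k ≤ m) (j : Fin k) : Idx m d :=
  Sum.inr (Sum.inr ⟨j.val, by omega⟩)

theorem one_submatrix_orthonormal {ι κ : Type*} [Fintype ι] [DecidableEq ι] [DecidableEq κ]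
    (e : κ → ι) (he : Function.Injective e) :
    ((1 : Matrix ι ι D).submatrix id e)ᴴ * (1 : Matrix ι ι D).submatrix id e = 1 := by
  rw [one_submatrix_conjTranspose_mul, Matrix.submatrix_submatrix]
  exact Matrix.submatrix_one e he

theorem one_submatrix_orthogonal {ι κ lam : Type*} [Fintype ι] [DecidableEq ι]
    (e : κ → ι) (f : lam → ι) (h : ∀ a b, e a ≠ f b) :
    ((1 : Matrix ι ι D).submatrix id e)ᴴ * (1 : Matrix ι ι D).submatrix id f = 0 := by
  rw [one_submatrix_conjTranspose_mul, Matrix.submatrix_submatrix]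
  ext a b
  simp [h a b]

theorem one_submatrix_sum {ι κ lam μ : Type*} [Fintype ι] [DecidableEq ι] [Fintype κ]
    [DecidableEq κ] [Fintype lam] [DecidableEq lam] [Fintype μ] [DecidableEq μ]
    (e : κ → ι) (f : lam → ι) (g : μ → ι) (he : Function.Injective e) (hf : Function.Injective f)
    (hg : Function.Injective g) (hef : ∀ a b, e a ≠ f b) (heg : ∀ a b, e a ≠ g b)
    (hfg : ∀ a b, f a ≠ g b)
    (hr : ∀ i, (∃ a, i = e a) ∨ (∃ a, i = f a) ∨ ∃ a, i = g a) :
    (1 : Matrix ι ι D).submatrix id e * ((1 : Matrix ι ι D).submatrix id e)ᴴ +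
      (1 : Matrix ι ι D).submatrix id f * ((1 : Matrix ι ι D).submatrix id f)ᴴ +
      (1 : Matrix ι ι D).submatrix id g * ((1 : Matrix ι ι D).submatrix id g)ᴴ = 1 := by
  set M := (1 : Matrix ι ι D).submatrix id e * ((1 : Matrix ι ι D).submatrix id e)ᴴ +
      (1 : Matrix ι ι D).submatrix id f * ((1 : Matrix ι ι D).submatrix id f)ᴴ +
      (1 : Matrix ι ι D).submatrix id g * ((1 : Matrix ι ι D).submatrix id g)ᴴ with hM
  ext i j
  rcases hr i with ⟨a, rfl⟩ | ⟨a, rfl⟩ | ⟨a, rfl⟩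
  · have := one_submatrix_orthonormal (D := D) e he
    have h2 := one_submatrix_orthogonal (D := D) e f hef
    have h3 := one_submatrix_orthogonal (D := D) e g heg
    refine congrFun (congrFun (?_ : M.submatrix e id = (1 : Matrix ι ι D).submatrix e id) a) j
    rw [← one_submatrix_conjTranspose_mul, ← one_submatrix_conjTranspose_mul, hM, Matrix.mul_add,
      Matrix.mul_add, ← Matrix.mul_assoc, ← Matrix.mul_assoc, ← Matrix.mul_assoc, this, h2, h3]
    simp
  · have := one_submatrix_orthonormal (D := D) f hf
    have h2 := one_submatrix_orthogonal (D := D) f e fun a b => (hef b a).symm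
    have h3 := one_submatrix_orthogonal (D := D) f g hfg
    refine congrFun (congrFun (?_ : M.submatrix f id = (1 : Matrix ι ι D).submatrix f id) a) j
    rw [← one_submatrix_conjTranspose_mul, ← one_submatrix_conjTranspose_mul, hM, Matrix.mul_add,
      Matrix.mul_add, ← Matrix.mul_assoc, ← Matrix.mul_assoc, ← Matrix.mul_assoc, this, h2, h3]
    simp
  · have := one_submatrix_orthonormal (D := D) g hg
    have h2 := one_submatrix_orthogonal (D := D) g e fun a b => (heg b a).symm
    have h3 := one_submatrix_orthogonal (D := D) g f fun a b => (hfg b a).symm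
    refine congrFun (congrFun (?_ : M.submatrix g id = (1 : Matrix ι ι D).submatrix g id) a) j
    rw [← one_submatrix_conjTranspose_mul, ← one_submatrix_conjTranspose_mul, hM, Matrix.mul_add,
      Matrix.mul_add, ← Matrix.mul_assoc, ← Matrix.mul_assoc, ← Matrix.mul_assoc, this, h2, h3]
    simp

theorem idxY_injective (m d k : ℕ) (hk : k ≤ m) : Function.Injective (idxY m d k hk) := by
  intro a b h
  simpa [idxY, Fin.ext_iff] using h

theorem tower_gram_mul_W (m k : ℕ) : (h₀.tower m).gram *
    (1 : Matrix (Idx m d) (Idx m d) D).submatrix id (idxW m d k) =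
    (1 : Matrix (Idx m d) (Idx m d) D).submatrix id (idxW m d k) *
      (h₀.tower (m - k)).gram := by
  rw [mul_one_submatrix]
  ext i j
  by_cases hi : i ∈ Set.range (idxW m d k)
  · obtain ⟨a, rfl⟩ := hi
    rw [Matrix.submatrix_apply, id, tower_gram_idxW, Matrix.mul_apply, Finset.sum_eq_single a]
    · rw [Matrix.submatrix_apply, id, Matrix.one_apply_eq, one_mul]
    · intro b _ hb
      simp [(idxW_injective m d k).eq_iff, hb.symm]
    · simp
  · have h2 : ∀ a, (1 : Matrix (Idx m d) (Idx m d) D).submatrix id (idxW m d k) i a = 0 := by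
      intro a
      have : i ≠ idxW m d k a := fun h => hi ⟨a, h.symm⟩
      simp [this]
    rw [Matrix.mul_apply, Finset.sum_eq_zero fun a _ => by rw [h2, zero_mul]]
    rcases notMem_range_idxW hi with ⟨x, hx, rfl⟩ | ⟨x, hx, rfl⟩ <;>
      rcases j with j | j | j <;> simp [HermForm.tower, towerGram, idxW, Fin.ext_iff] <;> omega

/-- The decomposition of `W_m` defined by `X_k`. -/
def towerSplit (m k : ℕ) (hk : k ≤ m) :
    HypSplit (h₀.tower m).gram (h₀.tower (m - k)).gram (Fin k) where
  X := (1 : Matrix (Idx m d) (Idx m d) D).submatrix id (idxX m d 0 k (by omega))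
  W := (1 : Matrix (Idx m d) (Idx m d) D).submatrix id (idxW m d k)
  Y := (1 : Matrix (Idx m d) (Idx m d) D).submatrix id (idxY m d k hk)
  sum := by
    refine one_submatrix_sum _ _ _ (idxX_injective _ _ _ _ _) (idxW_injective _ _ _)
      (idxY_injective _ _ _ _) (fun a b => (idxW_ne_inl m d k b _ (by simp)).symm)
      (fun a b => by simp [idxX, idxY]) (fun a b => idxW_ne_inr m d k a _ b.2) fun i => ?_
    by_cases hi : i ∈ Set.range (idxW m d k)
    · obtain ⟨a, rfl⟩ := hi
      exact Or.inr (Or.inl ⟨a, rfl⟩)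
    · rcases notMem_range_idxW hi with ⟨x, hx, rfl⟩ | ⟨x, hx, rfl⟩
      · exact Or.inl ⟨⟨x.val, hx⟩, by simp [idxX]⟩
      · exact Or.inr (Or.inr ⟨⟨x.val, hx⟩, by simp [idxY]⟩)
  XX := one_submatrix_orthonormal _ (idxX_injective _ _ _ _ _)
  WW := one_submatrix_orthonormal _ (idxW_injective _ _ _)
  YY := one_submatrix_orthonormal _ (idxY_injective _ _ _ _)
  XW := one_submatrix_orthogonal _ _ fun a b => (idxW_ne_inl m d k b _ (by simp)).symm
  XY := one_submatrix_orthogonal _ _ fun a b => by simp [idxX, idxY]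
  WY := one_submatrix_orthogonal _ _ fun a b => idxW_ne_inr m d k a _ b.2
  XJ := by
    rw [one_submatrix_conjTranspose_mul]
    ext i j
    rcases j with j | j | j <;>
      simp [HermForm.tower, towerGram, idxX, idxY, Matrix.one_apply, Fin.ext_iff, eq_comm]
    split_ifs <;> simp
  JY := by
    rw [mul_one_submatrix]
    ext i j
    rcases i with i | i | i <;>
      simp [HermForm.tower, towerGram, idxX, idxY, Matrix.one_apply, Fin.ext_iff, eq_comm]
  JW := tower_gram_mul_W h₀ m k
  WJ := by
    have h1 := congrArg Matrix.conjTranspose (tower_gram_mul_W h₀ m k)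
    rw [Matrix.conjTranspose_mul, Matrix.conjTranspose_mul, (h₀.tower m).herm,
      (h₀.tower (m - k)).herm] at h1
    rcases Int.units_eq_one_or ε with rfl | rfl
    · simpa using h1
    · simpa using h1

variable {h₀} {m : ℕ}

/-- An injective map of a finite subspace into itself is onto. -/
theorem mem_stab_of_le [Finite D] {ι : Type*} [Fintype ι] [DecidableEq ι]
    {p : Submodule D (ι → D)} {g : GL ι D} (h : ∀ x ∈ p, (g : Matrix ι ι D) *ᵥ x ∈ p) :
    g ∈ stab p := by
  have hginj : Function.Injective fun x : ι → D => (g : Matrix ι ι D) *ᵥ x := by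
    intro x y hxy
    have h1 : (↑g⁻¹ : Matrix ι ι D) * (g : Matrix ι ι D) = 1 := g.inv_mul
    have := congrArg (fun z => (↑g⁻¹ : Matrix ι ι D) *ᵥ z) hxy
    simpa [Matrix.mulVec_mulVec, h1] using this
  have hsurj : Function.Surjective fun x : p => (⟨(g : Matrix ι ι D) *ᵥ x, h x x.2⟩ : p) :=
    Finite.surjective_of_injective fun x y hxy =>
      Subtype.ext (hginj (congrArg Subtype.val hxy))
  intro x
  refine ⟨fun hx => ?_, h x⟩
  obtain ⟨y, hy⟩ := hsurj ⟨_, hx⟩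
  have := hginj (congrArg Subtype.val hy)
  rw [← this]
  exact y.2

theorem mem_isoX_iff {k : ℕ} (hk : k ≤ m) (x : Idx m d → D) :
    x ∈ isoX D m d k ↔ ∃ c, x = (towerSplit h₀ m k hk).X *ᵥ c := by
  constructor
  · intro hx
    induction hx using Submodule.span_induction with
    | mem x hx =>
      obtain ⟨j, hj, rfl⟩ := hx
      refine ⟨Pi.single ⟨j.val, hj⟩ 1, ?_⟩
      ext i
      simp [towerSplit, idxX, Matrix.one_apply, Pi.single_apply]
    | zero => exact ⟨0, by simp⟩
    | add x y _ _ hx hy =>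
      obtain ⟨c, rfl⟩ := hx
      obtain ⟨c', rfl⟩ := hy
      exact ⟨c + c', by rw [Matrix.mulVec_add]⟩
    | smul r x _ hx =>
      obtain ⟨c, rfl⟩ := hx
      exact ⟨r • c, by rw [Matrix.mulVec_smul]⟩
  · rintro ⟨c, rfl⟩
    have : (towerSplit h₀ m k hk).X *ᵥ c = ∑ j, c j • Pi.single (idxX m d 0 k (by omega) j) 1 := by
      ext i
      simp [towerSplit, Matrix.mulVec, dotProduct, Matrix.one_apply, Pi.single_apply, mul_comm]
    rw [this]
    refine Submodule.sum_mem _ fun j _ => Submodule.smul_mem _ _ (Submodule.subset_span ?_)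
    exact ⟨⟨0 + j.val, by omega⟩, by simp, rfl⟩

theorem mem_isoY_iff {k : ℕ} (hk : k ≤ m) (x : Idx m d → D) :
    x ∈ isoY D m d k ↔ ∃ c, x = (towerSplit h₀ m k hk).Y *ᵥ c := by
  constructor
  · intro hx
    induction hx using Submodule.span_induction with
    | mem x hx =>
      obtain ⟨j, hj, rfl⟩ := hx
      refine ⟨Pi.single ⟨j.val, hj⟩ 1, ?_⟩
      ext i
      rw [Matrix.mulVec_single_one]
      simp [towerSplit, idxY, Matrix.one_apply, Pi.single_apply]
      exact if_congr Iff.rfl rfl rfl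
    | zero => exact ⟨0, by simp⟩
    | add x y _ _ hx hy =>
      obtain ⟨c, rfl⟩ := hx
      obtain ⟨c', rfl⟩ := hy
      exact ⟨c + c', by rw [Matrix.mulVec_add]⟩
    | smul r x _ hx =>
      obtain ⟨c, rfl⟩ := hx
      exact ⟨r • c, by rw [Matrix.mulVec_smul]⟩
  · rintro ⟨c, rfl⟩
    have : (towerSplit h₀ m k hk).Y *ᵥ c = ∑ j, c j • Pi.single (idxY m d k hk j) 1 := by
      ext i
      simp [towerSplit, Matrix.mulVec, dotProduct, Matrix.one_apply, Pi.single_apply, mul_comm]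
    rw [this]
    refine Submodule.sum_mem _ fun j _ => Submodule.smul_mem _ _ (Submodule.subset_span ?_)
    exact ⟨⟨j.val, by omega⟩, j.2, rfl⟩

theorem mem_parab_of_mul [Finite D] {k : ℕ} (hk : k ≤ m) {g : (h₀.tower m).isom}
    {a : Matrix (Fin k) (Fin k) D}
    (h : (g.1 : Matrix (Idx m d) (Idx m d) D) * (towerSplit h₀ m k hk).X =
      (towerSplit h₀ m k hk).X * a) : g ∈ parab h₀ m k := by
  refine mem_stab_of_le fun x hx => ?_
  rw [mem_isoX_iff (h₀ := h₀) hk] at hx ⊢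
  obtain ⟨c, rfl⟩ := hx
  exact ⟨a *ᵥ c, by rw [Matrix.mulVec_mulVec, Matrix.mulVec_mulVec]; exact congrArg (· *ᵥ c) h⟩

theorem mem_levi_of_mul [Finite D] {k : ℕ} (hk : k ≤ m) {g : (h₀.tower m).isom}
    {a b : Matrix (Fin k) (Fin k) D}
    (h : (g.1 : Matrix (Idx m d) (Idx m d) D) * (towerSplit h₀ m k hk).X =
      (towerSplit h₀ m k hk).X * a)
    (h' : (g.1 : Matrix (Idx m d) (Idx m d) D) * (towerSplit h₀ m k hk).Y =
      (towerSplit h₀ m k hk).Y * b) : g ∈ levi h₀ m k := by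
  refine ⟨mem_parab_of_mul hk h, mem_stab_of_le fun x hx => ?_⟩
  rw [mem_isoY_iff (h₀ := h₀) hk] at hx ⊢
  obtain ⟨c, rfl⟩ := hx
  exact ⟨b *ᵥ c, by rw [Matrix.mulVec_mulVec, Matrix.mulVec_mulVec]; exact congrArg (· *ᵥ c) h'⟩

theorem coe_toGL {k : ℕ} (hk : k ≤ m) (g : parab h₀ m k) :
    (toGL h₀ k hk g : Matrix (Fin k) (Fin k) D) = (towerSplit h₀ m k hk).Xᴴ *
      (g.1.1 : Matrix (Idx m d) (Idx m d) D) * (towerSplit h₀ m k hk).X := by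
  rw [towerSplit, one_submatrix_conjTranspose_mul, mul_one_submatrix]
  rfl

theorem coe_toIsom {k : ℕ} (hk : k ≤ m) (g : parab h₀ m k) :
    ((toIsom h₀ k g).1 : Matrix (Idx (m - k) d) (Idx (m - k) d) D) =
      (towerSplit h₀ m k hk).Wᴴ *
        (g.1.1 : Matrix (Idx m d) (Idx m d) D) * (towerSplit h₀ m k hk).W := by
  rw [towerSplit, one_submatrix_conjTranspose_mul, mul_one_submatrix]
  rfl

theorem exists_mul_X_of_mem_stab {k : ℕ} (hk : k ≤ m) {g : GL (Idx m d) D}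
    (hg : g ∈ stab (isoX D m d k)) : ∃ a : Matrix (Fin k) (Fin k) D, (g : Matrix (Idx m d) (Idx m d) D) *
      (towerSplit h₀ m k hk).X = (towerSplit h₀ m k hk).X * a := by
  have h1 : ∀ j, ∃ c, (g : Matrix (Idx m d) (Idx m d) D) *ᵥ
      ((towerSplit h₀ m k hk).X *ᵥ Pi.single j 1) = (towerSplit h₀ m k hk).X *ᵥ c :=
    fun j => (mem_isoX_iff hk _).1 ((hg _).2 ((mem_isoX_iff hk _).2 ⟨_, rfl⟩))
  choose c hc using h1
  refine ⟨Matrix.of fun i j => c j i, ?_⟩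
  ext i j
  have := congrFun (hc j) i
  rw [Matrix.mulVec_mulVec, Matrix.mulVec_single_one] at this
  exact this

theorem exists_mul_Y_of_mem_stab {k : ℕ} (hk : k ≤ m) {g : GL (Idx m d) D}
    (hg : g ∈ stab (isoY D m d k)) : ∃ a : Matrix (Fin k) (Fin k) D, (g : Matrix (Idx m d) (Idx m d) D) *
      (towerSplit h₀ m k hk).Y = (towerSplit h₀ m k hk).Y * a := by
  have h1 : ∀ j, ∃ c, (g : Matrix (Idx m d) (Idx m d) D) *ᵥ
      ((towerSplit h₀ m k hk).Y *ᵥ Pi.single j 1) = (towerSplit h₀ m k hk).Y *ᵥ c :=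
    fun j => (mem_isoY_iff hk _).1 ((hg _).2 ((mem_isoY_iff hk _).2 ⟨_, rfl⟩))
  choose c hc using h1
  refine ⟨Matrix.of fun i j => c j i, ?_⟩
  ext i j
  have := congrFun (hc j) i
  rw [Matrix.mulVec_mulVec, Matrix.mulVec_single_one] at this
  exact this

theorem parab_isPara {k : ℕ} (hk : k ≤ m) (g : parab h₀ m k) :
    (towerSplit h₀ m k hk).IsPara g.1.1 (toGL h₀ k hk g) (toIsom h₀ k g).1 := by
  obtain ⟨a, ha⟩ := exists_mul_X_of_mem_stab (h₀ := h₀) hk g.2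
  have ha' : (g.1.1 : Matrix (Idx m d) (Idx m d) D) * (towerSplit h₀ m k hk).X =
    (towerSplit h₀ m k hk).X * a := ha
  refine ⟨?_, coe_toIsom hk g⟩
  rw [coe_toGL, Matrix.mul_assoc _ _ (towerSplit h₀ m k hk).X]
  rw [ha']
  rw [← Matrix.mul_assoc _ _ a, (towerSplit h₀ m k hk).XX, Matrix.one_mul]

/-- The elements of the Levi subgroup commute with the projection to `X`. -/
theorem levi_X_mul {k : ℕ} (hk : k ≤ m) (g : levi h₀ m k) :
    (towerSplit h₀ m k hk).Xᴴ * (g.1.1 : Matrix (Idx m d) (Idx m d) D) =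
      (toGL h₀ k hk ⟨g.1, levi_le h₀ m k g.2⟩ : Matrix (Fin k) (Fin k) D) * (towerSplit h₀ m k hk).Xᴴ := by
  set s := towerSplit h₀ m k hk with hs
  obtain ⟨b, hb⟩ := exists_mul_Y_of_mem_stab (h₀ := h₀) hk ((stab (isoY D m d k)).inv_mem g.2.2)
  have h1 : s.Xᴴ = (ε : ℤ) • (s.Yᴴ * (h₀.tower m).gram) := by
    have h2 := congrArg Matrix.conjTranspose s.JY
    rw [Matrix.conjTranspose_mul, (h₀.tower m).herm, Matrix.mul_smul] at h2
    exact h2.symm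
  have h2 : s.Xᴴ * (g.1.1 : Matrix (Idx m d) (Idx m d) D) = bᴴ * s.Xᴴ := by
    have h3 := congrArg Matrix.conjTranspose hb
    rw [Matrix.conjTranspose_mul, Matrix.conjTranspose_mul] at h3
    rw [h1, Matrix.smul_mul, Matrix.mul_assoc, (h₀.tower m).isom_mul g.1.2, Matrix.mul_smul,
      ← Matrix.mul_assoc, ← Matrix.mul_assoc]
    exact congrArg (fun M => (ε : ℤ) • (M * (h₀.tower m).gram)) h3
  rw [coe_toGL, ← hs]
  change _ = s.Xᴴ * (g.1.1 : Matrix (Idx m d) (Idx m d) D) * s.X * s.Xᴴ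
  rw [h2, Matrix.mul_assoc bᴴ, s.XX, Matrix.mul_one]

theorem unipRad_isPara {k : ℕ} (hk : k ≤ m) (g : parab h₀ m k) : g ∈ unipRad h₀ k hk ↔
    (towerSplit h₀ m k hk).IsPara g.1.1 1 (1 : (h₀.tower (m - k)).isom).1 := by
  have hp := parab_isPara hk g
  constructor
  · intro hg
    have h1 : toGL h₀ k hk g = 1 := congrArg Prod.fst hg
    have h2 : toIsom h₀ k g = 1 := congrArg Prod.snd hg
    rwa [h1, h2] at hp
  · intro hg
    refine Prod.ext (Units.ext ?_) (Subtype.ext (Units.ext ?_))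
    · change (toGL h₀ k hk g : Matrix (Fin k) (Fin k) D) = 1
      rw [coe_toGL, Matrix.mul_assoc, hg.1, Units.val_one, Matrix.mul_one,
        (towerSplit h₀ m k hk).XX]
    · exact hp.2.trans hg.2.symm

end TowerSplit

/-! ### Quasi-reflections. -/

section Reflection

variable {D ι ι₁ ι₂ κ : Type*} [Field D] [StarRing D] [Fintype ι] [DecidableEq ι]
  [Fintype ι₁] [DecidableEq ι₁] [Fintype ι₂] [DecidableEq ι₂] [Fintype κ] [DecidableEq κ]
  {ε : ℤˣ} {h : HermForm D ε ι} {h₁ : HermForm D ε ι₁} {h₂ : HermForm D ε ι₂}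

theorem gram_conjTranspose (a : Matrix ι ι₁ D) (b : Matrix ι ι₂ D) :
    (aᴴ * h.gram * b)ᴴ = (ε : ℤ) • (bᴴ * h.gram * a) := by
  rw [Matrix.conjTranspose_mul, Matrix.conjTranspose_mul, h.herm,
    Matrix.conjTranspose_conjTranspose, Matrix.smul_mul, Matrix.mul_smul, Matrix.mul_assoc]

theorem fin_one_eq_smul (M : Matrix (Fin 1) (Fin 1) D) : M = M 0 0 • 1 := by
  ext i j
  fin_cases i
  fin_cases j
  simp

/-- A quasi-reflection exchanges isotropic vectors that are not orthogonal. -/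
theorem exists_reflection (a b : Matrix ι (Fin 1) D) (ha : aᴴ * h.gram * a = 0)
    (hb : bᴴ * h.gram * b = 0) (hab : aᴴ * h.gram * b ≠ 0) :
    ∃ g : h.isom, (g.1 : Matrix ι ι D) * a = b ∧ ∀ M : Matrix ι κ D, aᴴ * h.gram * M = 0 →
      bᴴ * h.gram * M = 0 → (g.1 : Matrix ι ι D) * M = M := by
  have hε : ((ε : ℤ) : D) * ((ε : ℤ) : D) = 1 := by
    rcases Int.units_eq_one_or ε with rfl | rfl <;> simp
  have hεs : star ((ε : ℤ) : D) = ((ε : ℤ) : D) := by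
    rcases Int.units_eq_one_or ε with rfl | rfl <;> simp
  obtain ⟨c, hc⟩ : ∃ c, c = (aᴴ * h.gram * b) 0 0 := ⟨_, rfl⟩
  have hc1 : aᴴ * h.gram * b = c • 1 := by
    rw [hc]
    exact fin_one_eq_smul _
  have hc0 : c ≠ 0 := by
    rintro rfl
    exact hab (by rw [hc1, zero_smul])
  have hcs : star c ≠ 0 := star_ne_zero.2 hc0
  have hc2 : bᴴ * h.gram * a = (((ε : ℤ) : D) * star c) • 1 := by
    have h1 := gram_conjTranspose (h := h) a b
    rw [hc1, Matrix.conjTranspose_smul, Matrix.conjTranspose_one] at h1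
    have h2 := congrArg (fun M => ((ε : ℤ) : D) • M) h1
    simp only [← Int.cast_smul_eq_zsmul D, smul_smul, hε, one_smul] at h2
    exact h2.symm
  obtain ⟨r, hr⟩ : ∃ r, r = b - a := ⟨_, rfl⟩
  have hrr : rᴴ * h.gram * r = (-(c + ((ε : ℤ) : D) * star c)) • 1 := by
    rw [hr, Matrix.conjTranspose_sub, Matrix.sub_mul, Matrix.sub_mul, Matrix.mul_sub,
      Matrix.mul_sub, ha, hb, hc1, hc2, neg_smul, add_smul]
    abel
  -- For this `l` the map `x ↦ x + l r (r, x)` sends `a` to `b`, because `(r, a) = (b, a) = ε · star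
  -- c`. It is an isometry by `e3`, which uses the value of `(r, r)` for isotropic `a` and `b`.
  obtain ⟨l, hl⟩ : ∃ l, l = ((ε : ℤ) : D) / star c := ⟨_, rfl⟩
  obtain ⟨M, hM⟩ : ∃ M, M = 1 + l • (r * (rᴴ * h.gram)) := ⟨_, rfl⟩
  have hMadj : Mᴴ = 1 + (star l * ((ε : ℤ) : D)) • (h.gram * (r * rᴴ)) := by
    rw [hM, Matrix.conjTranspose_add, Matrix.conjTranspose_one, Matrix.conjTranspose_smul,
      Matrix.conjTranspose_mul, Matrix.conjTranspose_mul, h.herm,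
      Matrix.conjTranspose_conjTranspose, Matrix.smul_mul, Matrix.smul_mul,
      ← Int.cast_smul_eq_zsmul D, smul_smul, Matrix.mul_assoc]
  have hMi : Mᴴ * h.gram * M = h.gram := by
    have e1 : h.gram * (r * rᴴ) * h.gram * (r * (rᴴ * h.gram)) =
        (-(c + ((ε : ℤ) : D) * star c)) • (h.gram * (r * rᴴ) * h.gram) := by
      calc h.gram * (r * rᴴ) * h.gram * (r * (rᴴ * h.gram))
          = h.gram * r * (rᴴ * h.gram * r) * (rᴴ * h.gram) := by simp only [Matrix.mul_assoc]
        _ = _ := by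
          rw [hrr, Matrix.mul_smul, Matrix.mul_one, Matrix.smul_mul]
          simp only [Matrix.mul_assoc]
    have e2 : h.gram * (r * (rᴴ * h.gram)) = h.gram * (r * rᴴ) * h.gram := by
      simp only [Matrix.mul_assoc]
    rw [hMadj, hM, Matrix.mul_add, Matrix.mul_one, Matrix.add_mul, Matrix.one_mul, Matrix.mul_smul,
      Matrix.add_mul, Matrix.smul_mul, Matrix.smul_mul, e1, e2, smul_add, smul_smul, smul_smul,
      add_assoc, ← add_smul, ← add_smul]
    have e3 : star l * ((ε : ℤ) : D) + (l + l * (star l * ((ε : ℤ) : D)) *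
        -(c + ((ε : ℤ) : D) * star c)) = 0 := by
      rw [hl, star_div₀, star_star, hεs]
      field_simp
      linear_combination (-(c * ((ε : ℤ) : D)) - ((ε : ℤ) : D) ^ 2 * star c) * hε
    rw [e3, zero_smul, add_zero]
  refine ⟨HypSplit.isomOf h M hMi, ?_, fun N h1 h2 => ?_⟩
  · change M * a = b
    rw [hM, Matrix.add_mul, Matrix.one_mul, Matrix.smul_mul, Matrix.mul_assoc]
    have : rᴴ * h.gram * a = (((ε : ℤ) : D) * star c) • 1 := by
      rw [hr, Matrix.conjTranspose_sub, Matrix.sub_mul, Matrix.sub_mul, ha, hc2, sub_zero]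
    rw [this, Matrix.mul_smul, Matrix.mul_one, smul_smul, hl]
    have e : ((ε : ℤ) : D) / star c * (((ε : ℤ) : D) * star c) = 1 := by
      field_simp
      linear_combination hε
    rw [e, one_smul, hr, add_sub_cancel]
  · change M * N = N
    have : rᴴ * h.gram * N = 0 := by
      rw [hr, Matrix.conjTranspose_sub, Matrix.sub_mul, Matrix.sub_mul, h1, h2, sub_zero]
    rw [hM, Matrix.add_mul, Matrix.one_mul, Matrix.smul_mul, Matrix.mul_assoc, this,
      Matrix.mul_zero, smul_zero, add_zero]

theorem isom_gram_mul (g : h.isom) (a : Matrix ι ι₁ D) (b : Matrix ι ι₂ D) :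
    ((g.1 : Matrix ι ι D) * a)ᴴ * h.gram * ((g.1 : Matrix ι ι D) * b) = aᴴ * h.gram * b := by
  have h1 := (h.isom_iff g.1).1 g.2
  rw [Matrix.conjTranspose_mul]
  calc _ = aᴴ * ((g.1 : Matrix ι ι D)ᴴ * h.gram * (g.1 : Matrix ι ι D)) * b := by
        simp only [Matrix.mul_assoc]
    _ = _ := by rw [h1]

namespace HypSplit

/-- Transform `Y` by a unipotent element with block `b`. The result is isotropic with `Y`-coordinate
one, and its pairing with `x` is the conjugate of the `X`-coordinate of a transform of `x`, which a
suitable `b` makes nonzero. -/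
theorem exists_isotropic_pairing [Finite D] [NeZero (2 : D)] (t : HypSplit h₁.gram h₂.gram (Fin 1))
    (x : Matrix ι₁ (Fin 1) D)
    (hx : x ≠ 0) (hYx : t.Yᴴ * x = 0) : ∃ z : Matrix ι₁ (Fin 1) D, zᴴ * h₁.gram * z = 0 ∧
      xᴴ * h₁.gram * z ≠ 0 ∧ t.Yᴴ * z ≠ 0 := by
  have hdec : x = t.X * (t.Xᴴ * x) + t.W * (t.Wᴴ * x) := by
    conv_lhs => rw [t.decomp x, hYx, Matrix.mul_zero, add_zero]
  obtain ⟨b, hb⟩ : ∃ b : Matrix (Fin 1) ι₂ D, t.Xᴴ * x + b * (t.Wᴴ * x) ≠ 0 := by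
    by_cases h0 : t.Xᴴ * x = 0
    · by_contra hcon
      push Not at hcon
      apply hx
      have h1 : t.Wᴴ * x = 0 := by
        ext i j
        have h2 := congrFun (congrFun (hcon (Matrix.of fun _ => Pi.single i 1)) 0) j
        rw [h0, zero_add, Matrix.mul_apply] at h2
        simpa [Pi.single_apply] using h2
      rw [hdec, h0, h1, Matrix.mul_zero, Matrix.mul_zero, add_zero]
    · exact ⟨0, by simpa using h0⟩
  obtain ⟨g, hg, hgb⟩ := exists_isPara_one t b
  have hXY : t.Yᴴ * h₁.gram * t.Y = 0 := by
    rw [Matrix.mul_assoc, t.JY, t.YX]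
  refine ⟨((g⁻¹).1 : Matrix ι₁ ι₁ D) * t.Y, ?_, ?_, ?_⟩
  · rw [isom_gram_mul, hXY]
  · have e1 : xᴴ * h₁.gram * (((g⁻¹).1 : Matrix ι₁ ι₁ D) * t.Y) =
        (t.Xᴴ * ((g.1 : Matrix ι₁ ι₁ D) * x))ᴴ := by
      have h1 : (g.1 : Matrix ι₁ ι₁ D) * ((g⁻¹).1 : Matrix ι₁ ι₁ D) = 1 := g.1.mul_inv
      rw [← isom_gram_mul g, ← Matrix.mul_assoc (g.1 : Matrix ι₁ ι₁ D), h1, Matrix.one_mul,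
        Matrix.mul_assoc, t.JY, Matrix.conjTranspose_mul t.Xᴴ, Matrix.conjTranspose_conjTranspose]
    have e2 : t.Xᴴ * ((g.1 : Matrix ι₁ ι₁ D) * x) = t.Xᴴ * x + b * (t.Wᴴ * x) := by
      conv_lhs => rw [hdec]
      rw [Matrix.mul_add, ← Matrix.mul_assoc _ t.X, hg.1, Units.val_one, Matrix.mul_one,
        Matrix.mul_add, ← Matrix.mul_assoc t.Xᴴ t.X, t.XX, Matrix.one_mul, ← hgb]
      simp only [Matrix.mul_assoc]
    rw [e1, e2]
    exact fun h0 => hb (Matrix.conjTranspose_eq_zero.1 h0)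
  · have e1 := Y_mul (g⁻¹).2 (hg.inv g.2).1
    rw [← Matrix.mul_assoc]
    change t.Yᴴ * ((g⁻¹).1 : Matrix ι₁ ι₁ D) * t.Y ≠ 0
    rw [e1, Matrix.mul_assoc, t.YY]
    simp

/-- One quasi-reflection suffices if `w` and the target are not orthogonal. Otherwise two of them
pass through an isotropic vector of `W₁` orthogonal to neither. All vectors involved are orthogonal
to `X`, so `X` is fixed. -/
theorem exists_isom_mul_eq [Finite D] [NeZero (2 : D)] (s : HypSplit h.gram h₁.gram κ)
    (t : HypSplit h₁.gram h₂.gram (Fin 1)) (w : Matrix ι (Fin 1) D) (hYw : s.Yᴴ * w = 0)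
    (hWw : s.Wᴴ * w ≠ 0) (hw : wᴴ * h.gram * w = 0) :
    ∃ g : h.isom, (g.1 : Matrix ι ι D) * w = s.W * t.X ∧ (g.1 : Matrix ι ι D) * s.X = s.X := by
  have hsm : ∀ {M : Matrix (Fin 1) (Fin 1) D}, M ≠ 0 → (ε : ℤ) • M ≠ 0 := by
    intro M hM
    rcases Int.units_eq_one_or ε with rfl | rfl <;> simpa using hM
  have hwX : ∀ v : Matrix ι (Fin 1) D, s.Yᴴ * v = 0 → vᴴ * h.gram * s.X = 0 := by
    intro v hv
    have := congrArg Matrix.conjTranspose hv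
    rw [Matrix.conjTranspose_mul, Matrix.conjTranspose_conjTranspose] at this
    rw [Matrix.mul_assoc, s.gram_X, Matrix.mul_smul, this, Matrix.conjTranspose_zero, smul_zero]
  have hYW : ∀ x : Matrix ι₁ (Fin 1) D, s.Yᴴ * (s.W * x) = 0 := fun x => by
    rw [← Matrix.mul_assoc, s.YW, Matrix.zero_mul]
  have hWW : ∀ x y : Matrix ι₁ (Fin 1) D, (s.W * x)ᴴ * h.gram * (s.W * y) =
      xᴴ * h₁.gram * y := by
    intro x y
    rw [Matrix.conjTranspose_mul, Matrix.mul_assoc xᴴ, s.WJ]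
    calc _ = xᴴ * h₁.gram * ((s.Wᴴ * s.W) * y) := by simp only [Matrix.mul_assoc]
      _ = _ := by rw [s.WW, Matrix.one_mul]
  have hwW : ∀ y : Matrix ι₁ (Fin 1) D, wᴴ * h.gram * (s.W * y) =
      (s.Wᴴ * w)ᴴ * h₁.gram * y := by
    intro y
    rw [Matrix.mul_assoc, ← Matrix.mul_assoc h.gram, s.JW, Matrix.conjTranspose_mul,
      Matrix.conjTranspose_conjTranspose]
    simp only [Matrix.mul_assoc]
  have hu : (s.W * t.X)ᴴ * h.gram * (s.W * t.X) = 0 := by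
    rw [hWW, t.XJ, t.YX]
  have hpair : ∀ x : Matrix ι₁ (Fin 1) D, t.Yᴴ * x ≠ 0 → xᴴ * h₁.gram * t.X ≠ 0 := by
    intro x hx
    rw [Matrix.mul_assoc, t.gram_X, Matrix.mul_smul]
    refine hsm fun h0 => hx ?_
    have := congrArg Matrix.conjTranspose h0
    simpa using this
  by_cases hY : t.Yᴴ * (s.Wᴴ * w) = 0
  · obtain ⟨z, hz, hxz, hYz⟩ := exists_isotropic_pairing t _ hWw hY
    obtain ⟨g₁, h1, h1'⟩ := exists_reflection (κ := κ) w (s.W * z) hw (by rw [hWW, hz])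
      (by rwa [hwW])
    obtain ⟨g₂, h2, h2'⟩ := exists_reflection (κ := κ) (s.W * z) (s.W * t.X) (by rw [hWW, hz]) hu
      (by rw [hWW]; exact hpair z hYz)
    refine ⟨g₂ * g₁, ?_, ?_⟩
    · change ((g₂.1 * g₁.1 : GL ι D) : Matrix ι ι D) * w = _
      rw [Units.val_mul, Matrix.mul_assoc, h1, h2]
    · change ((g₂.1 * g₁.1 : GL ι D) : Matrix ι ι D) * s.X = _
      rw [Units.val_mul, Matrix.mul_assoc, h1' _ (hwX _ hYw) (hwX _ (hYW _)),
        h2' _ (hwX _ (hYW _)) (hwX _ (hYW _))]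
  · obtain ⟨g, h1, h1'⟩ := exists_reflection (κ := κ) w (s.W * t.X) hw hu
      (by rw [hwW]; exact hpair _ hY)
    exact ⟨g, h1, h1' _ (hwX _ hYw) (hwX _ (hYW _))⟩

end HypSplit

end Reflection

/-! ### Witt's theorem for totally isotropic subspaces. -/

section Witt

variable {D : Type*} [Field D] [StarRing D] {ε : ℤˣ} {d : ℕ} (h₀ : HermForm D ε (Fin d))

theorem eq_zero_of_anisotropic (han : h₀.Anisotropic) {n : ℕ} (hn : n = 0)
    (x : Matrix (Idx n d) (Fin 1) D) (hx : xᴴ * (h₀.tower n).gram * x = 0) : x = 0 := by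
  subst hn
  have h1 : (fun a => x (Sum.inr (Sum.inl a)) 0) = 0 := by
    apply han
    have h2 := congrFun (congrFun hx 0) 0
    rw [Matrix.mul_assoc] at h2
    simpa [Matrix.mul_apply, dotProduct, Matrix.mulVec, HermForm.tower, towerGram] using h2
  ext i j
  fin_cases j
  rcases i with i | i | i
  · exact i.elim0
  · exact congrFun h1 i
  · exact i.elim0

/-- Totally isotropic subspaces of the same dimension are conjugate. -/
theorem exists_isom_mul_eq_X [Finite D] [NeZero (2 : D)] (han : h₀.Anisotropic) (m i : ℕ)
    (z : Matrix (Idx m d) (Fin i) D) (hz : zᴴ * (h₀.tower m).gram * z = 0)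
    (l : Matrix (Fin i) (Idx m d) D) (hl : l * z = 1) :
    ∃ (hi : i ≤ m) (g : (h₀.tower m).isom),
      (g.1 : Matrix (Idx m d) (Idx m d) D) * z = (towerSplit h₀ m i hi).X := by
  induction i with
  | zero => exact ⟨Nat.zero_le _, 1, Subsingleton.elim _ _⟩
  | succ i ih =>
    obtain ⟨hi, g, hg⟩ := ih (z.submatrix id Fin.castSucc) (by
      have := congrArg (fun M => M.submatrix Fin.castSucc Fin.castSucc) hz
      exact this) (l.submatrix Fin.castSucc id) (by
      have := congrArg (fun M => M.submatrix Fin.castSucc Fin.castSucc) hl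
      rw [Matrix.submatrix_one _ (Fin.castSucc_injective i)] at this
      exact this)
    set s := towerSplit h₀ m i hi with hs
    obtain ⟨w₀, hw₀⟩ : ∃ w₀, w₀ = z.submatrix id (fun _ : Fin 1 => Fin.last i) := ⟨_, rfl⟩
    obtain ⟨w, hw⟩ : ∃ w, w = (g.1 : Matrix (Idx m d) (Idx m d) D) * w₀ := ⟨_, rfl⟩
    have hww : wᴴ * (h₀.tower m).gram * w = 0 := by
      rw [hw, isom_gram_mul, hw₀]
      exact congrArg (fun M => M.submatrix (fun _ : Fin 1 => Fin.last i)
        (fun _ : Fin 1 => Fin.last i)) hz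
    have hYw : s.Yᴴ * w = 0 := by
      rw [← s.XJ, ← hg, hw, isom_gram_mul, hw₀]
      exact congrArg (fun M => M.submatrix Fin.castSucc (fun _ : Fin 1 => Fin.last i)) hz
    -- Otherwise the last column of `z` would be a combination of the preceding ones, which the left
    -- inverse `l` excludes.
    have hWw : s.Wᴴ * w ≠ 0 := by
      intro h0
      have h1 : w = s.X * (s.Xᴴ * w) := by
        conv_lhs => rw [s.decomp w, h0, hYw, Matrix.mul_zero, Matrix.mul_zero, add_zero, add_zero]
      have hgi : (↑g.1⁻¹ : Matrix (Idx m d) (Idx m d) D) *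
        (g.1 : Matrix (Idx m d) (Idx m d) D) = 1 := g.1.inv_mul
      have h2 : w₀ = z.submatrix id Fin.castSucc * (s.Xᴴ * w) := by
        have hgX : (↑g.1⁻¹ : Matrix (Idx m d) (Idx m d) D) * s.X = z.submatrix id Fin.castSucc := by
          rw [← hg, ← Matrix.mul_assoc, hgi, Matrix.one_mul]
        rw [← hgX, Matrix.mul_assoc, ← h1, hw, ← Matrix.mul_assoc, hgi, Matrix.one_mul]
      have h3 := congrArg (fun M => (l * M) (Fin.last i) 0) h2
      simp only [← Matrix.mul_assoc] at h3
      have h4 : (l * w₀) (Fin.last i) 0 = (l * z) (Fin.last i) (Fin.last i) := by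
        rw [hw₀]
        rfl
      have h5 : (l * z.submatrix id Fin.castSucc * (s.Xᴴ * w)) (Fin.last i) 0 = 0 := by
        rw [Matrix.mul_apply]
        refine Finset.sum_eq_zero fun x _ => ?_
        have : (l * z.submatrix id Fin.castSucc) (Fin.last i) x =
          (l * z) (Fin.last i) x.castSucc := rfl
        rw [this, hl, Matrix.one_apply_ne (Fin.castSucc_lt_last x).ne', zero_mul]
      rw [h4, hl, Matrix.one_apply_eq] at h3
      rw [← Matrix.mul_assoc] at h5
      exact one_ne_zero (h3.trans h5)
    -- For `i = m` the space `W₁` is anisotropic, but the `W₁`-component of `w` is isotropic and not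
    -- zero.
    have hlt : i < m := by
      by_contra hge
      refine hWw (eq_zero_of_anisotropic h₀ han (n := m - i) (by omega) _ ?_)
      have h1 : w = s.X * (s.Xᴴ * w) + s.W * (s.Wᴴ * w) := by
        conv_lhs => rw [s.decomp w, hYw, Matrix.mul_zero, add_zero]
      have h2 : wᴴ * s.Y = 0 := by
        have := congrArg Matrix.conjTranspose hYw
        simpa using this
      have h3 : (s.Wᴴ * w)ᴴ * (h₀.tower (m - i)).gram * (s.Wᴴ * w) =
          wᴴ * (h₀.tower m).gram * w := by
        have h4 : wᴴ * (h₀.tower m).gram * w = wᴴ * (h₀.tower m).gram *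
          (s.X * (s.Xᴴ * w) + s.W * (s.Wᴴ * w)) := congrArg _ h1
        rw [h4, Matrix.mul_add, Matrix.mul_assoc _ _ (s.X * _), ← Matrix.mul_assoc _ s.X,
          s.gram_X, Matrix.smul_mul, Matrix.mul_smul, ← Matrix.mul_assoc _ s.Y, h2,
          Matrix.zero_mul, smul_zero, zero_add, Matrix.mul_assoc _ _ (s.W * _),
          ← Matrix.mul_assoc _ s.W, s.JW, Matrix.conjTranspose_mul,
          Matrix.conjTranspose_conjTranspose]
        simp only [Matrix.mul_assoc]
      rw [h3, hww]
    -- The target is the first hyperbolic vector of `W_{m-i}`, which is `e_{i+1}` in `W_m`.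
    obtain ⟨g', h1, h2⟩ := s.exists_isom_mul_eq (towerSplit h₀ (m - i) 1 (by omega)) w hYw hWw hww
    refine ⟨hlt, g' * g, ?_⟩
    change ((g'.1 * g.1 : GL (Idx m d) D) : Matrix (Idx m d) (Idx m d) D) * z = _
    rw [Units.val_mul, Matrix.mul_assoc]
    ext r c
    refine Fin.lastCases ?_ (fun c => ?_) c
    · have := congrFun (congrFun h1 r) 0
      rw [hw, hw₀] at this
      refine this.trans ?_
      rw [hs, towerSplit, towerSplit, mul_one_submatrix]
      have e : idxW m d i (idxX (m - i) d 0 1 (by omega) 0) =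
          idxX m d 0 (i + 1) (by omega) (Fin.last i) := by simp [idxW, idxX]
      exact congrArg (fun a => (1 : Matrix (Idx m d) (Idx m d) D) r a) e
    · have := congrFun (congrFun h2 r) c
      rw [← hg] at this
      refine this.trans ?_
      rw [hg, hs]
      rfl

end Witt

/-! ### Column reduction and the projection to the last coordinates. -/

section Tail

variable (D : Type*) [Field D] [StarRing D]

/-- The `j`-th among the last `i` of `k` indices. -/
def tailIdx {i k : ℕ} (hi : i ≤ k) (j : Fin i) : Fin k := ⟨k - i + j.val, by omega⟩

/-- The matrix of the projection to the last `i` of `k` coordinates. -/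
def tailMat {i k : ℕ} (hi : i ≤ k) : Matrix (Fin i) (Fin k) D :=
  ((1 : Matrix (Fin k) (Fin k) D).submatrix id (tailIdx hi))ᴴ

/-- The matrix of the inclusion of the first `k - i` of `k` coordinates. -/
def headMat (i k : ℕ) : Matrix (Fin k) (Fin (k - i)) D :=
  (1 : Matrix (Fin k) (Fin k) D).submatrix id (Fin.castLE (Nat.sub_le k i))

variable {D} {i k : ℕ} (hi : i ≤ k)

theorem tailIdx_injective : Function.Injective (tailIdx hi) := by
  intro a b h
  simpa [tailIdx, Fin.ext_iff] using h

theorem tailMat_mul_conjTranspose : tailMat D hi * (tailMat D hi)ᴴ = 1 := by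
  rw [tailMat, Matrix.conjTranspose_conjTranspose]
  exact one_submatrix_orthonormal _ (tailIdx_injective hi)

theorem tailMat_mul_headMat : tailMat D hi * headMat D i k = 0 :=
  one_submatrix_orthogonal _ _ fun a b => by
    simp [tailIdx, Fin.ext_iff]
    omega

theorem headMat_add_tailMat :
    headMat D i k * (headMat D i k)ᴴ + (tailMat D hi)ᴴ * tailMat D hi = 1 := by
  have h := one_submatrix_sum (D := D) (Fin.castLE (Nat.sub_le k i)) (tailIdx hi)
    (Fin.elim0 : Fin 0 → Fin k) (Fin.castLE_injective _) (tailIdx_injective hi)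
    (fun a => a.elim0) (fun a b => by simp [tailIdx, Fin.ext_iff]; omega)
    (fun _ b => b.elim0) (fun _ b => b.elim0) (fun x => by
      by_cases hx : x.val < k - i
      · exact Or.inl ⟨⟨x.val, hx⟩, rfl⟩
      · exact Or.inr (Or.inl ⟨⟨x.val - (k - i), by omega⟩, by simp [tailIdx, Fin.ext_iff]; omega⟩))
  refine Eq.trans ?_ h
  rw [headMat, tailMat, Matrix.conjTranspose_conjTranspose, eq_comm, add_eq_left]
  ext a b
  simp [Matrix.mul_apply]

theorem le_of_mul_eq_one {M : Matrix (Fin i) (Fin k) D} {N : Matrix (Fin k) (Fin i) D}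
    (h : M * N = 1) : i ≤ k := by
  have h1 : (1 : Matrix (Fin i) (Fin i) D).rank = i := by simp
  rw [← h1, ← h]
  exact (Matrix.rank_mul_le_left M N).trans (by simpa using M.rank_le_width)

/-- A matrix with `k` columns can be brought by invertible column operations to the form in which
the first `k - i` columns vanish and the last `i` columns are linearly independent. -/
theorem exists_column_reduction {ι : Type*} [Fintype ι] [DecidableEq ι]
    (y : Matrix ι (Fin k) D) : ∃ (i : ℕ) (hi : i ≤ k) (a : GL (Fin k) D) (z : Matrix ι (Fin i) D)
      (l : Matrix (Fin i) ι D), l * z = 1 ∧ y * (a : Matrix (Fin k) (Fin k) D) =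
        z * tailMat D hi := by
  -- The columns of `a` will be a basis of the kernel of `y` followed by a basis of a complement
  -- `C`. On `C` the matrix `y` is injective, and this gives the left inverse of `z`.
  obtain ⟨C, hC⟩ := Submodule.exists_isCompl (LinearMap.ker y.mulVecLin)
  set K := LinearMap.ker y.mulVecLin with hK
  have hdim : finrank D K + finrank D C = k := by
    simpa using Submodule.finrank_add_eq_of_isCompl hC
  have hi : finrank D C ≤ k := by omega
  set bK : Basis (Fin (k - finrank D C)) D K := finBasisOfFinrankEq D K (by omega)
  set bC : Basis (Fin (finrank D C)) D C := finBasisOfFinrankEq D C rfl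
  have hk : k - finrank D C + finrank D C = k := by omega
  set b : Basis (Fin k) D (Fin k → D) := ((bK.prod bC).map
    (Submodule.prodEquivOfIsCompl K C hC)).reindex (finSumFinEquiv.trans (finCongr hk)) with hb
  have hb1 : ∀ x, b (tailIdx hi x) = bC x := by
    intro x
    have : (finSumFinEquiv.trans (finCongr hk)).symm (tailIdx hi x) = Sum.inr x := by
      rw [Equiv.symm_apply_eq]
      simp [tailIdx, Fin.ext_iff]
    rw [hb, Basis.reindex_apply, this]
    simp
  have hb2 : ∀ x : Fin k, x.val < k - finrank D C → b x ∈ K := by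
    intro x hx
    have : (finSumFinEquiv.trans (finCongr hk)).symm x = Sum.inl ⟨x.val, hx⟩ := by
      rw [Equiv.symm_apply_eq]
      simp
    rw [hb, Basis.reindex_apply, this]
    simp
  set a₀ := (Pi.basisFun D (Fin k)).toMatrix b with ha₀
  have hent : ∀ r c, a₀ r c = b c r := fun r c => by simp [ha₀, Basis.toMatrix_apply]
  set z : Matrix ι (Fin (finrank D C)) D := Matrix.of fun r c => (y *ᵥ (bC c : Fin k → D)) r with hz
  have hzv : ∀ c : Fin (finrank D C) → D, z *ᵥ c =
      y *ᵥ ((∑ x, c x • bC x : C) : Fin k → D) := by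
    intro c
    have h1 : ((∑ x, c x • bC x : C) : Fin k → D) = ∑ x, c x • (bC x : Fin k → D) := by simp
    rw [h1, ← Matrix.mulVecLin_apply y, map_sum]
    ext r
    simp [Matrix.mulVec, dotProduct, hz, mul_comm]
  have hinj : Function.Injective z.mulVecLin := by
    rw [← LinearMap.ker_eq_bot, LinearMap.ker_eq_bot']
    intro c hc
    rw [Matrix.mulVecLin_apply, hzv] at hc
    have h1 : ((∑ x, c x • bC x : C) : Fin k → D) ∈ K ⊓ C := ⟨hc, Subtype.prop _⟩
    rw [hC.inf_eq_bot, Submodule.mem_bot, ZeroMemClass.coe_eq_zero] at h1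
    have h2 := (Fintype.linearIndependent_iff.1 bC.linearIndependent) c h1
    exact funext h2
  obtain ⟨L, hL⟩ := LinearMap.exists_leftInverse_of_injective _ (LinearMap.ker_eq_bot.2 hinj)
  refine ⟨_, hi, ⟨a₀, b.toMatrix (Pi.basisFun D (Fin k)), Basis.toMatrix_mul_toMatrix_flip _ _,
    Basis.toMatrix_mul_toMatrix_flip _ _⟩, z, LinearMap.toMatrix' L, ?_, ?_⟩
  · have h1 := congrArg LinearMap.toMatrix' hL
    rw [LinearMap.toMatrix'_comp, LinearMap.toMatrix'_id] at h1
    rwa [show LinearMap.toMatrix' z.mulVecLin = z from LinearMap.toMatrix'_toLin' z] at h1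
  · ext r c
    change (y * a₀) r c = (z * tailMat D hi) r c
    have h1 : (y * a₀) r c = (y *ᵥ b c) r := by
      simp [Matrix.mul_apply, Matrix.mulVec, dotProduct, hent]
    rw [h1]
    by_cases hc : c.val < k - finrank D C
    · have h2 : y *ᵥ b c = 0 := hb2 c hc
      rw [h2, Matrix.mul_apply]
      refine (Finset.sum_eq_zero fun x _ => ?_).symm
      have : c ≠ tailIdx hi x := fun h => by
        rw [h] at hc
        simp [tailIdx] at hc
      simp [tailMat, this]
    · obtain ⟨x, rfl⟩ : ∃ x, c = tailIdx hi x :=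
        ⟨⟨c.val - (k - finrank D C), by omega⟩, by simp [tailIdx, Fin.ext_iff]; omega⟩
      rw [hb1, Matrix.mul_apply, Finset.sum_eq_single x]
      · simp [tailMat, hz, Matrix.one_apply]
      · intro x' _ hx'
        have : tailIdx hi x ≠ tailIdx hi x' := fun h => hx' (tailIdx_injective hi h).symm
        simp [tailMat, this]
      · simp

end Tail

/-- The homomorphism from `W_m` to `W'_{m'}` that maps the last `i` of the vectors `e_1, …, e_k`
to `e'_1, …, e'_i` and the other basis vectors to `0`. -/
def partialIso {D : Type*} [Field D] [StarRing D] {ε ε' : ℤˣ} {d d' : ℕ}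
    (h₀ : HermForm D ε (Fin d)) (h₀' : HermForm D ε' (Fin d')) {m m' k i : ℕ} (hk : k ≤ m)
    (hi : i ≤ k) (hi' : i ≤ m') : Matrix (Idx m' d') (Idx m d) D :=
  (towerSplit h₀' m' i hi').X * tailMat D hi * (towerSplit h₀ m k hk).Xᴴ

/-! ### The stabilizer of the standard homomorphism of rank `i`. -/

section LeviParab

variable {D : Type*} [Field D] [StarRing D] {ε : ℤˣ} {d : ℕ} {h₀ : HermForm D ε (Fin d)}
  {m k i : ℕ} (hk : k ≤ m) (hi : i ≤ k)

theorem coe_leviParabGL (p : leviParab h₀ m k (k - i)) :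
    (leviParabGL h₀ k i hk hi p : Matrix (Fin i) (Fin i) D) = tailMat D hi *
      (toGL h₀ k hk ⟨p.1.1, levi_le h₀ m k p.1.2⟩ : Matrix (Fin k) (Fin k) D) * (tailMat D hi)ᴴ := by
  rw [tailMat, Matrix.conjTranspose_conjTranspose, one_submatrix_conjTranspose_mul,
    mul_one_submatrix]
  ext x y
  change (p.1.1.1 : Matrix (Idx m d) (Idx m d) D) (idxX m d (k - i) i _ x) (idxX m d (k - i) i _ y) =
    (p.1.1.1 : Matrix (Idx m d) (Idx m d) D) (idxX m d 0 k _ (tailIdx hi x))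
      (idxX m d 0 k _ (tailIdx hi y))
  simp [idxX, tailIdx]

/-- An element that stabilizes `X_{k-i}` has lower left block zero, so the projection to `X_k /
X_{k-i}` intertwines its actions. -/
theorem tailMat_mul_toGL (p : leviParab h₀ m k (k - i)) :
    tailMat D hi * (toGL h₀ k hk ⟨p.1.1, levi_le h₀ m k p.1.2⟩ : Matrix (Fin k) (Fin k) D) =
      (leviParabGL h₀ k i hk hi p : Matrix (Fin i) (Fin i) D) * tailMat D hi := by
  have h1 : tailMat D hi * (toGL h₀ k hk ⟨p.1.1, levi_le h₀ m k p.1.2⟩ : Matrix (Fin k) (Fin k) D) *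
      headMat D i k = 0 := by
    rw [tailMat, one_submatrix_conjTranspose_mul, headMat, mul_one_submatrix]
    ext x y
    refine stab_isoX_entry (g := p.1.1.1) p.2 (j := ⟨0 + y.val, by omega⟩) (by simp) ?_
    intro z hz
    simp [idxX, tailIdx, Fin.ext_iff]
    omega
  have h2 := congrArg (tailMat D hi *
    (toGL h₀ k hk ⟨p.1.1, levi_le h₀ m k p.1.2⟩ : Matrix (Fin k) (Fin k) D) * ·)
    (headMat_add_tailMat (D := D) hi)
  beta_reduce at h2
  rw [Matrix.mul_one, Matrix.mul_add, ← Matrix.mul_assoc, h1, Matrix.zero_mul, zero_add,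
    ← Matrix.mul_assoc] at h2
  rw [coe_leviParabGL]
  exact h2.symm

theorem towerSplit_X_mul_headMat : (towerSplit h₀ m k hk).X * headMat D i k =
    (towerSplit h₀ m (k - i) ((Nat.sub_le k i).trans hk)).X := by
  rw [headMat, mul_one_submatrix]
  rfl

theorem mem_leviParab_of_mul [Finite D] {p : levi h₀ m k} {b : Matrix (Fin i) (Fin i) D}
    (h : tailMat D hi * (toGL h₀ k hk ⟨p.1, levi_le h₀ m k p.2⟩ : Matrix (Fin k) (Fin k) D) =
      b * tailMat D hi) : p ∈ leviParab h₀ m k (k - i) := by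
  have hp : (p.1.1 : Matrix (Idx m d) (Idx m d) D) * (towerSplit h₀ m k hk).X = _ :=
    (parab_isPara hk ⟨p.1, levi_le h₀ m k p.2⟩).1
  refine mem_parab_of_mul (g := p.1) (k := k - i) (by omega) (a := (headMat D i k)ᴴ *
    ((toGL h₀ k hk ⟨p.1, levi_le h₀ m k p.2⟩ : Matrix (Fin k) (Fin k) D) * headMat D i k)) ?_
  rw [← towerSplit_X_mul_headMat (i := i) hk, ← Matrix.mul_assoc, hp, Matrix.mul_assoc, Matrix.mul_assoc]
  congr 1
  conv_lhs => rw [← Matrix.one_mul ((toGL h₀ k hk ⟨p.1, levi_le h₀ m k p.2⟩ : Matrix (Fin k) (Fin k) D) *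
    headMat D i k), ← headMat_add_tailMat hi, Matrix.add_mul, Matrix.mul_assoc (tailMat D hi)ᴴ,
    ← Matrix.mul_assoc (tailMat D hi), h, Matrix.mul_assoc b, tailMat_mul_headMat hi, Matrix.mul_zero,
    Matrix.mul_zero, add_zero, Matrix.mul_assoc]

variable {ε' : ℤˣ} {d' m' j : ℕ} {h₀' : HermForm D ε' (Fin d')} (hi' : i ≤ m') (hj : j ≤ k)
  (hj' : j ≤ m')

theorem isom_mul_partialIso (p : leviParab h₀ m k (k - i)) (p' : parab h₀' m' i)
    (h : leviParabGL h₀ k i hk hi p = toGL h₀' i hi' p') :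
    (p'.1.1 : Matrix (Idx m' d') (Idx m' d') D) * partialIso h₀ h₀' hk hi hi' =
      partialIso h₀ h₀' hk hi hi' * (p.1.1.1 : Matrix (Idx m d) (Idx m d) D) := by
  rw [partialIso, Matrix.mul_assoc _ _ (p.1.1.1 : Matrix (Idx m d) (Idx m d) D), levi_X_mul,
    ← Matrix.mul_assoc, ← Matrix.mul_assoc, (parab_isPara hi' p').1, ← h, Matrix.mul_assoc _ _
    (tailMat D hi), ← tailMat_mul_toGL]
  simp only [Matrix.mul_assoc]

theorem partialIso_mul_X : partialIso h₀ h₀' hk hi hi' * (towerSplit h₀ m k hk).X =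
    (towerSplit h₀' m' i hi').X * tailMat D hi := by
  rw [partialIso, Matrix.mul_assoc, (towerSplit h₀ m k hk).XX, Matrix.mul_one]

theorem isom_mul_X_mul_tailMat {p : levi h₀ m k} {p' : (h₀'.tower m').isom}
    (h : (p'.1 : Matrix (Idx m' d') (Idx m' d') D) * partialIso h₀ h₀' hk hj hj' =
      partialIso h₀ h₀' hk hi hi' * (p.1.1 : Matrix (Idx m d) (Idx m d) D)) :
    (p'.1 : Matrix (Idx m' d') (Idx m' d') D) * ((towerSplit h₀' m' j hj').X * tailMat D hj) =
      (towerSplit h₀' m' i hi').X * tailMat D hi *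
        (toGL h₀ k hk ⟨p.1, levi_le h₀ m k p.2⟩ : Matrix (Fin k) (Fin k) D) := by
  have h1 := congrArg (· * (towerSplit h₀ m k hk).X) h
  have hp : (p.1.1 : Matrix (Idx m d) (Idx m d) D) * (towerSplit h₀ m k hk).X = _ :=
    (parab_isPara hk ⟨p.1, levi_le h₀ m k p.2⟩).1
  beta_reduce at h1
  rwa [Matrix.mul_assoc, partialIso_mul_X, Matrix.mul_assoc (partialIso _ _ _ _ _), hp,
    ← Matrix.mul_assoc (partialIso _ _ _ _ _), partialIso_mul_X] at h1

/-- Invertible transformations preserve the rank, and the rank of `partialIso` is `i`; the argument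
exhibits an identity matrix of size `i` that factors through dimension `j`. -/
theorem le_of_isom_mul_partialIso {p : levi h₀ m k} {p' : (h₀'.tower m').isom}
    (h : (p'.1 : Matrix (Idx m' d') (Idx m' d') D) * partialIso h₀ h₀' hk hj hj' =
      partialIso h₀ h₀' hk hi hi' * (p.1.1 : Matrix (Idx m d) (Idx m d) D)) : i ≤ j := by
  have h1 := isom_mul_X_mul_tailMat hk hi hi' hj hj' h
  set a := toGL h₀ k hk ⟨p.1, levi_le h₀ m k p.2⟩
  have ha : (a : Matrix (Fin k) (Fin k) D) * (↑a⁻¹ : Matrix (Fin k) (Fin k) D) = 1 := a.mul_inv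
  refine le_of_mul_eq_one (M := (towerSplit h₀' m' i hi').Xᴴ *
    ((p'.1 : Matrix (Idx m' d') (Idx m' d') D) * (towerSplit h₀' m' j hj').X))
    (N := tailMat D hj * ((↑a⁻¹ : Matrix (Fin k) (Fin k) D) * (tailMat D hi)ᴴ)) ?_
  calc _ = (towerSplit h₀' m' i hi').Xᴴ * ((p'.1 : Matrix (Idx m' d') (Idx m' d') D) *
      ((towerSplit h₀' m' j hj').X * tailMat D hj)) * (↑a⁻¹ : Matrix (Fin k) (Fin k) D) *
        (tailMat D hi)ᴴ := by simp only [Matrix.mul_assoc]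
    _ = (towerSplit h₀' m' i hi').Xᴴ * (towerSplit h₀' m' i hi').X * (tailMat D hi *
      ((a : Matrix (Fin k) (Fin k) D) * (↑a⁻¹ : Matrix (Fin k) (Fin k) D)) *
        (tailMat D hi)ᴴ) := by rw [h1]; simp only [Matrix.mul_assoc]
    _ = 1 := by rw [ha, (towerSplit h₀' m' i hi').XX, Matrix.mul_one, tailMat_mul_conjTranspose,
      Matrix.mul_one]

theorem eq_of_isom_mul_partialIso {p : levi h₀ m k} {p' : (h₀'.tower m').isom}
    (h : (p'.1 : Matrix (Idx m' d') (Idx m' d') D) * partialIso h₀ h₀' hk hj hj' =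
      partialIso h₀ h₀' hk hi hi' * (p.1.1 : Matrix (Idx m d) (Idx m d) D)) : i = j := by
  refine le_antisymm (le_of_isom_mul_partialIso hk hi hi' hj hj' h)
    (le_of_isom_mul_partialIso hk hj hj' hi hi' (p := p⁻¹) (p' := p'⁻¹) ?_)
  have h1 : (p.1.1 : Matrix (Idx m d) (Idx m d) D) * (↑p.1.1⁻¹ : Matrix (Idx m d) (Idx m d) D) = 1 :=
    p.1.1.mul_inv
  have h2 : (↑p'.1⁻¹ : Matrix (Idx m' d') (Idx m' d') D) *
    (p'.1 : Matrix (Idx m' d') (Idx m' d') D) = 1 := p'.1.inv_mul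
  change (↑p'.1⁻¹ : Matrix (Idx m' d') (Idx m' d') D) * _ =
    _ * (↑p.1.1⁻¹ : Matrix (Idx m d) (Idx m d) D)
  rw [← Matrix.mul_one (partialIso h₀ h₀' hk hi hi'), ← h1, ← Matrix.mul_assoc _
    (p.1.1 : Matrix (Idx m d) (Idx m d) D), ← h, ← Matrix.mul_assoc, ← Matrix.mul_assoc, h2,
    Matrix.one_mul]

/-- The image of `partialIso` is `X'_i` and its kernel on `X_k` is `X_{k-i}`, so a stabilizing pair
preserves both and acts compatibly on `X_k / X_{k-i} ≃ X'_i`. With `isom_mul_partialIso` this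
determines the stabilizer. -/
theorem mem_of_isom_mul_partialIso [Finite D] {p : levi h₀ m k} {p' : (h₀'.tower m').isom}
    (h : (p'.1 : Matrix (Idx m' d') (Idx m' d') D) * partialIso h₀ h₀' hk hi hi' =
      partialIso h₀ h₀' hk hi hi' * (p.1.1 : Matrix (Idx m d) (Idx m d) D)) :
    ∃ (hp : p ∈ leviParab h₀ m k (k - i)) (hp' : p' ∈ parab h₀' m' i),
      leviParabGL h₀ k i hk hi ⟨p, hp⟩ = toGL h₀' i hi' ⟨p', hp'⟩ := by
  have h1 := isom_mul_X_mul_tailMat hk hi hi' hi hi' h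
  set s' := towerSplit h₀' m' i hi'
  set a := toGL h₀ k hk ⟨p.1, levi_le h₀ m k p.2⟩ with ha
  have h2 : (p'.1 : Matrix (Idx m' d') (Idx m' d') D) * s'.X =
      s'.X * (tailMat D hi * (a : Matrix (Fin k) (Fin k) D) * (tailMat D hi)ᴴ) := by
    have := congrArg (· * (tailMat D hi)ᴴ) h1
    beta_reduce at this
    rw [Matrix.mul_assoc, Matrix.mul_assoc s'.X, tailMat_mul_conjTranspose, Matrix.mul_one] at this
    rw [this]
    simp only [Matrix.mul_assoc]
  have hp' : p' ∈ parab h₀' m' i := mem_parab_of_mul hi' h2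
  have hpm : p ∈ leviParab h₀ m k (k - i) := by
    refine mem_leviParab_of_mul hk hi (b := tailMat D hi * (a : Matrix (Fin k) (Fin k) D) *
      (tailMat D hi)ᴴ) ?_
    rw [← ha]
    have := congrArg (s'.Xᴴ * ·) h1
    beta_reduce at this
    rw [← Matrix.mul_assoc _ s'.X, h2, Matrix.mul_assoc s'.X, ← Matrix.mul_assoc s'.Xᴴ,
      Matrix.mul_assoc s'.X, ← Matrix.mul_assoc s'.Xᴴ, s'.XX, Matrix.one_mul, Matrix.one_mul] at this
    exact this.symm
  refine ⟨hpm, hp', Units.ext ?_⟩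
  rw [coe_leviParabGL, coe_toGL hi', Matrix.mul_assoc _ _ (towerSplit h₀' m' i hi').X]
  change _ = s'.Xᴴ * ((p'.1 : Matrix (Idx m' d') (Idx m' d') D) * s'.X)
  rw [h2, ← Matrix.mul_assoc s'.Xᴴ, s'.XX, Matrix.one_mul]

theorem toGL_surjective [Finite D] (x : GL (Fin k) D) : ∃ g : parab h₀ m k, toGL h₀ k hk g = x := by
  obtain ⟨g, h1, -, -⟩ := (towerSplit h₀ m k hk).exists_levi x
  refine ⟨⟨g, mem_parab_of_mul hk h1⟩, Units.ext ?_⟩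
  rw [coe_toGL, Matrix.mul_assoc, h1, ← Matrix.mul_assoc, (towerSplit h₀ m k hk).XX, Matrix.one_mul]

theorem exists_levi_toGL [Finite D] (x : GL (Fin k) D) : ∃ g : levi h₀ m k,
    toGL h₀ k hk ⟨g.1, levi_le h₀ m k g.2⟩ = x := by
  obtain ⟨g, h1, -, h2⟩ := (towerSplit h₀ m k hk).exists_levi x
  refine ⟨⟨g, mem_levi_of_mul hk h1 h2⟩, Units.ext ?_⟩
  rw [coe_toGL, Matrix.mul_assoc, h1, ← Matrix.mul_assoc, (towerSplit h₀ m k hk).XX, Matrix.one_mul]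

end LeviParab

/-! ### Projections for nested isotropic subspaces. -/

section IsoProj

variable {F V : Type*} [Field F] [Finite F] [NeZero (2 : F)] [AddCommGroup V] [Module F V]
  [Finite V] {B : LinearMap.BilinForm F V} {ψ : AddChar F ℂ} {A A' : Submodule F V}

theorem isoProj_heisRep_of_mem (hB : IsSymplectic B) (hA : ∀ a ∈ A, ∀ b ∈ A, B a b = 0) {a : V}
    (ha : a ∈ A) : isoProj B ψ A 0 * heisRep B ψ ⟨a, 0⟩ = isoProj B ψ A 0 := by
  rw [isoProj_mul_heisRep hB, isoProj_congr (v' := 0) fun b hb => by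
    rw [zero_sub, map_neg, hA b hb a ha, map_zero, neg_zero]]
  exact LinearMap.ext fun w => isoProj_fixed hA w a ha

theorem isoProj_mul_isoProj_of_le (hB : IsSymplectic B) (hA : ∀ a ∈ A, ∀ b ∈ A, B a b = 0)
    (hle : A' ≤ A) : isoProj B ψ A 0 * isoProj B ψ A' 0 = isoProj B ψ A 0 := by
  have := Fintype.ofFinite A'
  rw [isoProj_eq (A := A'), mul_smul_comm, Finset.mul_sum]
  have h1 : ∀ a : A', isoProj B ψ A 0 * ψ (-B a.1 0) • heisRep B ψ ⟨a.1, 0⟩ =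
      isoProj B ψ A 0 := fun a => by
    rw [map_zero, neg_zero, AddChar.map_zero_eq_one, one_smul,
      isoProj_heisRep_of_mem hB hA (hle a.2)]
  rw [Finset.sum_congr rfl fun a _ => h1 a, Finset.sum_const, Finset.card_univ,
    ← Nat.cast_smul_eq_nsmul ℂ,
    smul_smul, Nat.card_eq_fintype_card, inv_mul_cancel₀, one_smul]
  exact Nat.cast_ne_zero.2 Fintype.card_ne_zero

theorem heisRep_isoProj_heisRep_neg (hB : IsSymplectic B) (v : V)
    (u : Fin (heisDim B ψ) → ℂ) : heisRep B ψ ⟨v, 0⟩ (isoProj B ψ A 0 (heisRep B ψ ⟨-v, 0⟩ u)) =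
      isoProj B ψ A v u := by
  have := LinearMap.congr_fun (isoProj_mul_heisRep (ψ := ψ) (A := A) hB 0 (-v)) u
  rw [zero_sub, neg_neg] at this
  exact (congrArg (heisRep B ψ ⟨v, 0⟩) this).trans (heisRep_apply_neg hB v _)

end IsoProj

/-! ### The functional attached to one component. -/

namespace HypSplit

variable (F : Type*) {D ι ι₁ κ ι' ι₁' κ' : Type*} [Field F] [Field D] [StarRing D] [Algebra F D]
  [IsFixedField F D] [Finite F] [Finite D] [NeZero (2 : F)] [Fintype ι] [DecidableEq ι]
  [Fintype ι₁] [DecidableEq ι₁] [Fintype κ] [DecidableEq κ] [Fintype ι'] [DecidableEq ι']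
  [Fintype ι₁'] [DecidableEq ι₁'] [Fintype κ'] [DecidableEq κ'] {ε : ℤˣ}
  {h : HermForm D ε ι} {h₁ : HermForm D ε ι₁} {h' : HermForm D (-ε) ι'}
  {h₁' : HermForm D (-ε) ι₁'} (s : HypSplit h.gram h₁.gram κ)
  (s' : HypSplit h'.gram h₁'.gram κ') {ψ : AddChar F ℂ} (hψ : ψ ≠ 1)

theorem mul_mem_isoSub {p : h.isom} {p' : h'.isom} {a : GL κ D} {a' : GL κ' D} {g₀ : h₁.isom}
    {g₀' : h₁'.isom} (hp : s.IsPara p.1 a g₀.1) (hp' : s'.IsPara p'.1 a' g₀'.1)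
    {u : Matrix ι' ι D} (hu : u ∈ isoSub F s s') :
    (p'.1 : Matrix ι' ι' D) * u * (↑p.1⁻¹ : Matrix ι ι D) ∈ isoSub F s s' := by
  rw [mem_isoSub] at hu ⊢
  obtain ⟨h1, h2, h3⟩ := hu
  have hpi := hp.inv p.2
  have e1 : (p'.1 : Matrix ι' ι' D) * u * (↑p.1⁻¹ : Matrix ι ι D) * s.W =
      (p'.1 : Matrix ι' ι' D) * (u * s.W) * (↑g₀.1⁻¹ : Matrix ι₁ ι₁ D) := by
    rw [Matrix.mul_assoc, hpi.mul_W (g := p.1⁻¹) (p⁻¹).2, Matrix.mul_add, Matrix.mul_assoc _ u,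
      ← Matrix.mul_assoc u s.X, h1, Matrix.zero_mul, Matrix.mul_zero, zero_add]
    simp only [Matrix.mul_assoc]
  refine ⟨?_, ?_, ?_⟩
  · rw [Matrix.mul_assoc, hpi.1, Matrix.mul_assoc, ← Matrix.mul_assoc u, h1, Matrix.zero_mul,
      Matrix.mul_zero]
  · rw [e1, ← Matrix.mul_assoc, ← Matrix.mul_assoc, Y_mul p'.2 hp'.1, Matrix.mul_assoc _ s'.Yᴴ, h2,
      Matrix.mul_zero, Matrix.zero_mul]
  · rw [e1, ← Matrix.mul_assoc, ← Matrix.mul_assoc, hp'.W_mul, Matrix.add_mul,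
      Matrix.mul_assoc _ s'.Yᴴ, h2, Matrix.mul_assoc _ s'.Wᴴ, h3, Matrix.mul_zero,
      Matrix.mul_zero, add_zero, Matrix.zero_mul]

theorem isPara_refl (p' : h'.isom) : (refl h').IsPara p'.1 1 p'.1 :=
  ⟨Subsingleton.elim _ _, by simp [refl]⟩

theorem mul_mem_ySub {p : h.isom} (p' : h'.isom) {a : GL κ D} {g₀ : h₁.isom}
    (hp : s.IsPara p.1 a g₀.1) {u : Matrix ι' ι D} (hu : u ∈ ySub (h' := h') F s) :
    (p'.1 : Matrix ι' ι' D) * u * (↑p.1⁻¹ : Matrix ι ι D) ∈ ySub (h' := h') F s :=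
  mul_mem_isoSub F s (refl h') hp (isPara_refl p') hu

theorem ySub_isotropic : ∀ a ∈ ySub (h' := h') F s, ∀ b ∈ ySub (h' := h') F s,
    pairForm F h h' a b = 0 :=
  isoSub_isotropic F s (refl h')

theorem flatRep_ySub_fixed {p : h.isom} (p' : h'.isom) {a : GL κ D} {g₀ : h₁.isom}
    (hp : s.IsPara p.1 a g₀.1) {w : Fin (heisDim (pairForm F h h') ψ) → ℂ}
    (hw : ∀ a ∈ ySub (h' := h') F s, heisRep (pairForm F h h') ψ ⟨a, 0⟩ w = w) :
    ∀ a ∈ ySub (h' := h') F s, heisRep (pairForm F h h') ψ ⟨a, 0⟩ (flatRep F h h' hψ (p, p') w) =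
      flatRep F h h' hψ (p, p') w := by
  intro b hb
  have h1 := mul_mem_ySub F s p'⁻¹ (g₀ := g₀⁻¹) (hp.inv p.2) (p := p⁻¹) hb
  have h2 := flatRep_heisRep F hψ (p, p')
    (((p'⁻¹).1 : Matrix ι' ι' D) * b * (↑(p⁻¹).1⁻¹ : Matrix ι ι D)) 0 w
  rw [hw _ h1] at h2
  have e1 : (p'.1 : Matrix ι' ι' D) * ((p'⁻¹).1 : Matrix ι' ι' D) = 1 := p'.1.mul_inv
  have e2 : (↑(p⁻¹).1⁻¹ : Matrix ι ι D) * (↑p.1⁻¹ : Matrix ι ι D) = 1 := by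
    rw [InvMemClass.coe_inv, inv_inv]
    exact p.1.mul_inv
  have e3 : (p'.1 : Matrix ι' ι' D) * (((p'⁻¹).1 : Matrix ι' ι' D) * b *
      (↑(p⁻¹).1⁻¹ : Matrix ι ι D)) * (↑p.1⁻¹ : Matrix ι ι D) = b := by
    rw [Matrix.mul_assoc, Matrix.mul_assoc _ _ (↑p.1⁻¹ : Matrix ι ι D), e2, Matrix.mul_one,
      ← Matrix.mul_assoc, e1, Matrix.one_mul]
  rw [e3] at h2
  exact h2.symm

/-- The components of a vector fixed by the unipotent radical are fixed by the unipotent radical. -/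
theorem unip_fixed_isoProj {u : Fin (heisDim (pairForm F h h') ψ) → ℂ}
    (hu : ∀ n : h.isom, s.IsPara n.1 1 (1 : h₁.isom).1 → flatRep F h h' hψ (n, 1) u = u)
    (v : Matrix ι' ι D) (n : h.isom) (hn : s.IsPara n.1 1 (1 : h₁.isom).1) :
    flatRep F h h' hψ (n, 1) (isoProj (pairForm F h h') ψ (ySub (h' := h') F s) v u) =
      isoProj (pairForm F h h') ψ (ySub (h' := h') F s) v u := by
  rw [flatRep_isoProj F hψ (n, 1) _ fun a ha => mul_mem_ySub F s 1 hn ha, hu n hn]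
  -- `n` is trivial on `X`, so it does not change the character of `ySub` attached to `v`.
  refine congrFun (congrArg _ (isoProj_congr fun a ha => ?_)) u
  rw [← sub_eq_zero, ← map_sub]
  refine pairForm_ySub F s ha ?_
  have h1 : (↑n.1⁻¹ : Matrix ι ι D) * s.X = s.X := by
    have := (hn.inv n.2).1
    simpa using this
  change (((1 : h'.isom).1 : Matrix ι' ι' D) * v * (↑n.1⁻¹ : Matrix ι ι D) - v) * s.X = 0
  rw [Matrix.sub_mul, Matrix.mul_assoc, h1]
  simp

/-- The functional `φ` onto the model of the small pair that is attached to `y = X' π X*`, and a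
section `θ` of it. -/
theorem exists_mackey_pair (hn : Fintype.card ι = Fintype.card ι₁ + 2 * Fintype.card κ)
    (hn' : Fintype.card ι' = Fintype.card ι₁' + 2 * Fintype.card κ')
    (heven : (∀ x : D, star x = x) → Even (Fintype.card ι) ∧ Even (Fintype.card ι'))
    (π : Matrix κ' κ D) :
    ∃ (φ : (Fin (heisDim (pairForm F h h') ψ) → ℂ) →ₗ[ℂ] (Fin (heisDim (pairForm F h₁ h₁') ψ) → ℂ))
      (θ : (Fin (heisDim (pairForm F h₁ h₁') ψ) → ℂ) →ₗ[ℂ] (Fin (heisDim (pairForm F h h') ψ) → ℂ)),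
      (∀ (p : h.isom) (p' : h'.isom) (a : GL κ D) (a' : GL κ' D) (g₀ : h₁.isom) (g₀' : h₁'.isom),
        s.IsPara p.1 a g₀.1 → s'.IsPara p'.1 a' g₀'.1 →
        (p'.1 : Matrix ι' ι' D) * (s'.X * π * s.Xᴴ) = s'.X * π * s.Xᴴ * (p.1 : Matrix ι ι D) →
        ∀ u, φ (flatRep F h h' hψ (p, p') u) = flatRep F h₁ h₁' hψ (g₀, g₀') (φ u)) ∧
      (∀ n : h.isom, s.IsPara n.1 1 (1 : h₁.isom).1 → ∀ u, φ (flatRep F h h' hψ (n, 1) u) = φ u) ∧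
      (∀ t, φ (θ t) = t) ∧
      (∀ u, φ u = 0 ↔ isoProj (pairForm F h h') ψ (isoSub F s s') 0
        (heisRep (pairForm F h h') ψ ⟨-(s'.X * π * s.Xᴴ), 0⟩ u) = 0) ∧
      ∀ t, ∃ w, (∀ a ∈ ySub (h' := h') F s, heisRep (pairForm F h h') ψ ⟨a, 0⟩ w = w) ∧
        θ t = heisRep (pairForm F h h') ψ ⟨s'.X * π * s.Xᴴ, 0⟩ w := by
  have hB := pairForm_isSymplectic F h h'
  have hA := isoSub_isotropic F s s' (h := h) (h' := h')
  obtain ⟨j, j1, j2, -, j4⟩ := exists_flatRep_embedding F s s' hψ hn hn' heven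
  obtain ⟨jl, hjl⟩ := LinearMap.exists_leftInverse_of_injective j (LinearMap.ker_eq_bot.2 j1)
  have hjl' : ∀ w, jl (j w) = w := fun w => LinearMap.congr_fun hjl w
  set y := s'.X * π * s.Xᴴ with hy
  set P := isoProj (pairForm F h h') ψ (isoSub F s s') 0 with hP
  have hPj : ∀ u, j (jl (P u)) = P u := by
    intro u
    obtain ⟨w, hw⟩ := (j2 (P u)).2 (isoProj_fixed hA u)
    rw [← hw, hjl']
  -- `φ` translates the component of `y` to that of `0`, projects to the fixed vectors of `isoSub`
  -- and identifies them with the small representation; `θ` goes back the same way.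
  refine ⟨jl.comp (P.comp (heisRep (pairForm F h h') ψ ⟨-y, 0⟩)),
    (heisRep (pairForm F h h') ψ ⟨y, 0⟩).comp j, ?_, ?_, ?_, ?_, ?_⟩
  · intro p p' a a' g₀ g₀' hp hp' hyp u
    have e1 : (p'.1 : Matrix ι' ι' D) * -y * (↑p.1⁻¹ : Matrix ι ι D) = -y := by
      have h1 : (p.1 : Matrix ι ι D) * (↑p.1⁻¹ : Matrix ι ι D) = 1 := p.1.mul_inv
      rw [Matrix.mul_neg, hyp, Matrix.neg_mul, Matrix.mul_assoc y, h1, Matrix.mul_one]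
    have e2 := flatRep_heisRep F hψ (p, p') (-y) 0 u
    dsimp only at e2
    rw [e1] at e2
    have e3 := flatRep_isoProj F hψ (p, p') (isoSub F s s')
      (fun a ha => mul_mem_isoSub F s s' hp hp' ha) 0 (heisRep (pairForm F h h') ψ ⟨-y, 0⟩ u)
    rw [Matrix.mul_zero, Matrix.zero_mul, ← hP, e2] at e3
    change jl (P (heisRep (pairForm F h h') ψ ⟨-y, 0⟩ (flatRep F h h' hψ (p, p') u))) = _
    rw [← e3, ← hPj, j4 p p' a a' g₀ g₀' hp hp', hjl']
    rfl
  · intro n hnp u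
    exact congrArg jl (isoProj_flatRep_unip F s s' hψ hn hn' heven π n hnp u)
  · intro t
    change jl (P (heisRep (pairForm F h h') ψ ⟨-y, 0⟩ (heisRep (pairForm F h h') ψ ⟨y, 0⟩ (j t)))) = t
    rw [heisRep_neg_apply hB, hP, isoProj_zero_apply_eq_self ((j2 _).1 ⟨t, rfl⟩), hjl']
  · intro u
    change jl (P _) = 0 ↔ P _ = 0
    refine ⟨fun h0 => ?_, fun h0 => by rw [h0, map_zero]⟩
    rw [← hPj, h0, map_zero]
  · intro t
    exact ⟨j t, fun a ha => (j2 _).1 ⟨t, rfl⟩ a (ySub_le_isoSub F s s' ha), rfl⟩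

/-- Vectors of different degrees with respect to `Y ⊗ W'` are orthogonal. -/
theorem mul_X_eq_of_isoProj_ne_zero {y z : Matrix ι' ι D}
    {w : Fin (heisDim (pairForm F h h') ψ) → ℂ} (hψ : ψ ≠ 1)
    (hw : ∀ a ∈ ySub (h' := h') F s, heisRep (pairForm F h h') ψ ⟨a, 0⟩ w = w)
    (h0 : isoProj (pairForm F h h') ψ (isoSub F s s') 0 (heisRep (pairForm F h h') ψ ⟨-y, 0⟩
      (heisRep (pairForm F h h') ψ ⟨z, 0⟩ w)) ≠ 0) : z * s.X = y * s.X := by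
  have hB := pairForm_isSymplectic F h h'
  classical
  by_contra hne
  refine h0 ?_
  -- The projection for `isoSub` factors through that for the smaller space `ySub`, where translates
  -- by elements that differ on `X` belong to different characters.
  rw [← isoProj_mul_isoProj_of_le hB (isoSub_isotropic F s s') (ySub_le_isoSub F s s'),
    ← isoProj_zero_apply_eq_self hw]
  have h1 := isoProj_mul_heisRep (ψ := ψ) (A := ySub (h' := h') F s) hB 0 (-y)
  have h2 := isoProj_mul_heisRep (ψ := ψ) (A := ySub (h' := h') F s) hB (0 - -y) z
  have h3 := isoProj_mul_isoProj (B := pairForm F h h') (ψ := ψ) hψ (ySub_isotropic F s (h' := h'))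
    (0 - -y - z) 0
  rw [if_neg] at h3
  · have h4 : isoProj (pairForm F h h') ψ (ySub (h' := h') F s) 0 * heisRep (pairForm F h h') ψ ⟨-y, 0⟩ *
        heisRep (pairForm F h h') ψ ⟨z, 0⟩ * isoProj (pairForm F h h') ψ (ySub (h' := h') F s) 0 = 0 := by
      rw [h1, mul_assoc (heisRep (pairForm F h h') ψ ⟨-y, 0⟩), h2, mul_assoc, mul_assoc, h3,
        mul_zero, mul_zero]
    change isoProj (pairForm F h h') ψ (isoSub F s s') 0 ((isoProj (pairForm F h h') ψ (ySub (h' := h') F s) 0 *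
      heisRep (pairForm F h h') ψ ⟨-y, 0⟩ * heisRep (pairForm F h h') ψ ⟨z, 0⟩ *
      isoProj (pairForm F h h') ψ (ySub (h' := h') F s) 0) w) = 0
    rw [h4, LinearMap.zero_apply, map_zero]
  · intro h5
    have h6 := ySub_perp F s (h' := h') h5
    rw [show (0 : Matrix ι' ι D) - (0 - -y - z) = z - y by abel, Matrix.sub_mul, sub_eq_zero] at h6
    exact hne h6

end HypSplit

/-! ### Orbits and the vanishing criterion. -/

section MackeyData

variable (F : Type*) {D : Type*} [Field F] [Field D] [StarRing D] [Algebra F D]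
  [IsFixedField F D] [Finite F] [Finite D] [NeZero (2 : F)] {ε : ℤˣ} {d d' : ℕ}
  {h₀ : HermForm D ε (Fin d)} {h₀' : HermForm D (-ε) (Fin d')} {ψ : AddChar F ℂ} (hψ : ψ ≠ 1)
  {m m' k i j : ℕ} (hk : k ≤ m) (hi : i ≤ k) (hi' : i ≤ m') (hj : j ≤ k) (hj' : j ≤ m')

theorem card_idx (m k d : ℕ) (hk : k ≤ m) :
    Fintype.card (Idx m d) = Fintype.card (Idx (m - k) d) + 2 * Fintype.card (Fin k) := by
  simp
  omega

theorem even_card_idx (heven : (∀ x : D, star x = x) → Even d ∧ Even d') (m m' : ℕ) :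
    (∀ x : D, star x = x) → Even (Fintype.card (Idx m d)) ∧ Even (Fintype.card (Idx m' d')) := by
  intro hx
  obtain ⟨⟨a, ha⟩, ⟨b, hb⟩⟩ := heven hx
  exact ⟨⟨m + a, by simp; omega⟩, ⟨m' + b, by simp; omega⟩⟩

/-- An element that carries `y_j` to something not orthogonal to `y_i` stabilizes `y_i`. -/
theorem stabPartialIso_of_ne_zero {p : levi h₀ m k} {p' : (h₀'.tower m').isom}
    {w : Fin (heisDim (pairForm F (h₀.tower m) (h₀'.tower m')) ψ) → ℂ}
    (hw : ∀ a ∈ HypSplit.ySub (h' := h₀'.tower m') F (towerSplit h₀ m k hk),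
      heisRep (pairForm F (h₀.tower m) (h₀'.tower m')) ψ ⟨a, 0⟩ w = w)
    (h0 : isoProj (pairForm F (h₀.tower m) (h₀'.tower m')) ψ
      (HypSplit.isoSub F (towerSplit h₀ m k hk) (towerSplit h₀' m' i hi')) 0
      (heisRep (pairForm F (h₀.tower m) (h₀'.tower m')) ψ
        ⟨-((towerSplit h₀' m' i hi').X * tailMat D hi * (towerSplit h₀ m k hk).Xᴴ), 0⟩
        (flatRep F (h₀.tower m) (h₀'.tower m') hψ (p.1, p')
          (heisRep (pairForm F (h₀.tower m) (h₀'.tower m')) ψ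
            ⟨(towerSplit h₀' m' j hj').X * tailMat D hj * (towerSplit h₀ m k hk).Xᴴ, 0⟩ w))) ≠ 0) :
    i = j ∧ ∃ (hp : p ∈ leviParab h₀ m k (k - i)) (hp' : p' ∈ parab h₀' m' i),
      leviParabGL h₀ k i hk hi ⟨p, hp⟩ = toGL h₀' i hi' ⟨p', hp'⟩ := by
  rw [HypSplit.flatRep_heisRep] at h0
  -- The element carries the component of `y_j` to that of `p' y_j p⁻¹`, and a nonzero functional
  -- forces agreement with `y_i` on `X`.
  have h1 := HypSplit.mul_X_eq_of_isoProj_ne_zero F _ _ hψ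
    (HypSplit.flatRep_ySub_fixed F _ hψ p' (parab_isPara hk ⟨p.1, levi_le h₀ m k p.2⟩) hw) h0
  obtain ⟨b, hpi⟩ : ∃ b : Matrix (Fin k) (Fin k) D, (towerSplit h₀ m k hk).Xᴴ *
      (↑p.1.1⁻¹ : Matrix (Idx m d) (Idx m d) D) = b * (towerSplit h₀ m k hk).Xᴴ :=
    ⟨_, levi_X_mul hk p⁻¹⟩
  have h2 : (p'.1 : Matrix (Idx m' d') (Idx m' d') D) * partialIso h₀ h₀' hk hj hj' *
      (↑p.1.1⁻¹ : Matrix (Idx m d) (Idx m d) D) = partialIso h₀ h₀' hk hi hi' := by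
    have h3 := congrArg (· * (towerSplit h₀ m k hk).Xᴴ) h1
    beta_reduce at h3
    rw [← partialIso, ← partialIso, partialIso_mul_X, ← partialIso] at h3
    rw [← h3]
    rw [partialIso, Matrix.mul_assoc, Matrix.mul_assoc _ (towerSplit h₀ m k hk).Xᴴ, hpi]
    simp only [← Matrix.mul_assoc]
    rw [Matrix.mul_assoc _ (towerSplit h₀ m k hk).Xᴴ (towerSplit h₀ m k hk).X,
      (towerSplit h₀ m k hk).XX, Matrix.mul_one]
  have h4 : (p'.1 : Matrix (Idx m' d') (Idx m' d') D) * partialIso h₀ h₀' hk hj hj' =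
      partialIso h₀ h₀' hk hi hi' * (p.1.1 : Matrix (Idx m d) (Idx m d) D) := by
    have h5 : (↑p.1.1⁻¹ : Matrix (Idx m d) (Idx m d) D) * (p.1.1 : Matrix (Idx m d) (Idx m d) D) = 1 :=
      p.1.1.inv_mul
    rw [← h2, Matrix.mul_assoc, h5, Matrix.mul_one]
  obtain rfl := eq_of_isom_mul_partialIso hk hi hi' hj hj' h4
  exact ⟨rfl, mem_of_isom_mul_partialIso hk hi hi' h4⟩

/-- The unipotent radical is normal in the parabolic subgroup and commutes with the second member of
the pair. -/
theorem unip_conj_fixed {u : Fin (heisDim (pairForm F (h₀.tower m) (h₀'.tower m')) ψ) → ℂ}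
    (hu : ∀ n ∈ unipRad h₀ k hk, flatRep F (h₀.tower m) (h₀'.tower m') hψ (n.1, 1) u = u)
    (p : parab h₀ m k) (p' : (h₀'.tower m').isom) (n : parab h₀ m k) (hn : n ∈ unipRad h₀ k hk) :
    flatRep F (h₀.tower m) (h₀'.tower m') hψ (n.1, 1)
      (flatRep F (h₀.tower m) (h₀'.tower m') hψ (p.1, p') u) =
      flatRep F (h₀.tower m) (h₀'.tower m') hψ (p.1, p') u := by
  have h1 : p⁻¹ * n * p ∈ unipRad h₀ k hk := by
    have := (inferInstance : (unipRad h₀ k hk).Normal).conj_mem n hn p⁻¹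
    rwa [inv_inv] at this
  have h2 := hu _ h1
  have h3 : ((n.1, 1) : (h₀.tower m).isom × (h₀'.tower m').isom) * (p.1, p') =
      (p.1, p') * ((p⁻¹ * n * p).1, 1) := by
    refine Prod.ext ?_ ?_
    · change n.1 * p.1 = p.1 * (p.1⁻¹ * n.1 * p.1)
      group
    · simp
  have h4 := LinearMap.congr_fun (map_mul (flatRep F (h₀.tower m) (h₀'.tower m') hψ) (n.1, 1)
    (p.1, p')) u
  have h5 := LinearMap.congr_fun (map_mul (flatRep F (h₀.tower m) (h₀'.tower m') hψ) (p.1, p')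
    ((p⁻¹ * n * p).1, 1)) u
  rw [h3, h5] at h4
  refine Eq.trans h4.symm ?_
  exact congrArg (flatRep F (h₀.tower m) (h₀'.tower m') hψ (p.1, p')) h2

/-- A vector that is fixed by the unipotent radical and is killed by all functionals is zero. -/
theorem eq_zero_of_isoProj_eq_zero (han' : h₀'.Anisotropic)
    (heven : (∀ x : D, star x = x) → Even d ∧ Even d')
    {u : Fin (heisDim (pairForm F (h₀.tower m) (h₀'.tower m')) ψ) → ℂ}
    (hu : ∀ n ∈ unipRad h₀ k hk, flatRep F (h₀.tower m) (h₀'.tower m') hψ (n.1, 1) u = u)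
    (h0 : ∀ (i : ℕ) (hi : i ≤ k) (hi' : i ≤ m') (p : levi h₀ m k) (p' : (h₀'.tower m').isom),
      isoProj (pairForm F (h₀.tower m) (h₀'.tower m')) ψ
      (HypSplit.isoSub F (towerSplit h₀ m k hk) (towerSplit h₀' m' i hi')) 0
      (heisRep (pairForm F (h₀.tower m) (h₀'.tower m')) ψ
        ⟨-((towerSplit h₀' m' i hi').X * tailMat D hi * (towerSplit h₀ m k hk).Xᴴ), 0⟩
        (flatRep F (h₀.tower m) (h₀'.tower m') hψ (p.1, p') u)) = 0) : u = 0 := by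
  have := neZero_two_of_algebra F D
  have hB := pairForm_isSymplectic F (h₀.tower m) (h₀'.tower m')
  have := Fintype.ofFinite (Matrix (Idx m' d') (Idx m d) D)
  set s := towerSplit h₀ m k hk with hs
  set A : Submodule F (Matrix (Idx m' d') (Idx m d) D) :=
    HypSplit.ySub (h' := h₀'.tower m') F s with hA
  set Ω := flatRep F (h₀.tower m) (h₀'.tower m') hψ with hΩ
  have hev := even_card_idx (D := D) heven m m'
  have hu' : ∀ n : (h₀.tower m).isom, s.IsPara n.1 1 (1 : (h₀.tower (m - k)).isom).1 →
      Ω (n, 1) u = u := by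
    intro n hn
    have hnp : n ∈ parab h₀ m k := mem_parab_of_mul hk hn.1
    exact hu ⟨n, hnp⟩ ((unipRad_isPara hk ⟨n, hnp⟩).2 hn)
  -- The components under `ySub` exhaust the space: for `q = id` the identity `gradOp_one` writes
  -- `1` as a multiple of the sum of the projections.
  suffices H : ∀ v, isoProj (pairForm F (h₀.tower m) (h₀'.tower m')) ψ A v u = 0 by
    have h1 := LinearMap.congr_fun (gradOp_one (A := A) (ψ := ψ) (q := LinearMap.id (R := F)) hB hψ) u
    rw [Module.End.one_apply] at h1
    rw [← h1, gradOp, LinearMap.smul_apply, LinearMap.sum_apply]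
    simp [H]
  intro v
  obtain ⟨y, hy⟩ : ∃ y, y = v * s.X := ⟨_, rfl⟩
  have hv : isoProj (pairForm F (h₀.tower m) (h₀'.tower m')) ψ A v =
      isoProj (pairForm F (h₀.tower m) (h₀'.tower m')) ψ A (y * s.Xᴴ) := by
    refine isoProj_congr fun a ha => ?_
    rw [← sub_eq_zero, ← map_sub]
    refine HypSplit.pairForm_ySub F s ha ?_
    rw [Matrix.sub_mul, Matrix.mul_assoc y, s.XX, Matrix.mul_one, hy, sub_self]
  rw [hv]
  by_cases hyy : yᴴ * (h₀'.tower m').gram * y = 0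
  swap
  -- The image of `y` is not totally isotropic, and the unipotent radical has no fixed vector in
  -- such a component.
  · rw [← heisRep_isoProj_heisRep_neg hB]
    rw [s.eq_zero_of_unip_fixed F hψ (card_idx m k d hk) hev y hyy
      (isoProj_fixed (HypSplit.ySub_isotropic F s) _) fun n hn => ?_, map_zero]
    rw [heisRep_isoProj_heisRep_neg hB]
    exact s.unip_fixed_isoProj F hψ hu' _ n hn
  -- If the image is totally isotropic, a Levi element brings the columns of `y` into reduced form
  -- and, by Witt's theorem, an isometry of `W'` moves the image to `X'_i`. So the component may be
  -- moved to that of `y'`.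
  obtain ⟨i, hi, a, z, l, hl, hya⟩ := exists_column_reduction y
  have hzz : zᴴ * (h₀'.tower m').gram * z = 0 := by
    have h1 : z = y * (a : Matrix (Fin k) (Fin k) D) * (tailMat D hi)ᴴ := by
      rw [hya, Matrix.mul_assoc, tailMat_mul_conjTranspose, Matrix.mul_one]
    have h2 : zᴴ * (h₀'.tower m').gram * z = ((a : Matrix (Fin k) (Fin k) D) * (tailMat D hi)ᴴ)ᴴ *
        (yᴴ * (h₀'.tower m').gram * y) * ((a : Matrix (Fin k) (Fin k) D) * (tailMat D hi)ᴴ) := by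
      rw [h1, Matrix.mul_assoc y, Matrix.conjTranspose_mul y]
      simp only [Matrix.mul_assoc]
    rw [h2, hyy, Matrix.mul_zero, Matrix.zero_mul]
  obtain ⟨hi', g, hg⟩ := exists_isom_mul_eq_X h₀' han' m' i z hzz l hl
  obtain ⟨p, hp⟩ := exists_levi_toGL (h₀ := h₀) hk a⁻¹
  have hpi : s.Xᴴ * (↑p.1.1⁻¹ : Matrix (Idx m d) (Idx m d) D) =
      (a : Matrix (Fin k) (Fin k) D) * s.Xᴴ := by
    have h1 := levi_X_mul hk p⁻¹
    have h2 : toGL h₀ k hk ⟨(p⁻¹).1, levi_le h₀ m k (p⁻¹).2⟩ = a := by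
      rw [← inv_inj, ← hp, ← map_inv]
      exact congrArg (toGL h₀ k hk) (Subtype.ext (inv_inv p.1))
    rw [h2] at h1
    exact h1
  set s' := towerSplit h₀' m' i hi' with hs'
  set y' := s'.X * tailMat D hi * s.Xᴴ with hy'
  have hyp : (g.1 : Matrix (Idx m' d') (Idx m' d') D) * (y * s.Xᴴ) *
      (↑p.1.1⁻¹ : Matrix (Idx m d) (Idx m d) D) = y' := by
    rw [Matrix.mul_assoc, Matrix.mul_assoc y, hpi, ← Matrix.mul_assoc y, hya, hy', ← hg]
    simp only [Matrix.mul_assoc]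
  have hpp := parab_isPara hk ⟨p.1, levi_le h₀ m k p.2⟩
  have e1 := HypSplit.flatRep_isoProj F hψ (p.1, g) A
    (fun a ha => HypSplit.mul_mem_ySub F s g hpp ha) (y * s.Xᴴ) u
  dsimp only at e1
  rw [hyp, ← hΩ] at e1
  set u' := Ω (p.1, g) u with hu'def
  have hu'' : ∀ n : (h₀.tower m).isom, s.IsPara n.1 1 (1 : (h₀.tower (m - k)).isom).1 →
      Ω (n, 1) u' = u' := by
    intro n hn
    have hnp : n ∈ parab h₀ m k := mem_parab_of_mul hk hn.1
    exact unip_conj_fixed F hψ hk hu ⟨p.1, levi_le h₀ m k p.2⟩ g ⟨n, hnp⟩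
      ((unipRad_isPara hk ⟨n, hnp⟩).2 hn)
  -- In this component a vector fixed by the unipotent radical is, after translation, fixed by
  -- `isoSub`, so it is determined by the functional that vanishes according to `h0`.
  have e2 : isoProj (pairForm F (h₀.tower m) (h₀'.tower m')) ψ A y' u' = 0 := by
    rw [← heisRep_isoProj_heisRep_neg hB]
    have h1 := HypSplit.fixed_of_unip_fixed F s s' hψ (card_idx m k d hk) hev (tailMat D hi)
      (tailMat_mul_conjTranspose hi)
      (v := isoProj (pairForm F (h₀.tower m) (h₀'.tower m')) ψ A 0
        (heisRep (pairForm F (h₀.tower m) (h₀'.tower m')) ψ ⟨-y', 0⟩ u'))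
      (isoProj_fixed (HypSplit.ySub_isotropic F s) _) fun n hn => by
        rw [← hy', heisRep_isoProj_heisRep_neg hB]
        exact s.unip_fixed_isoProj F hψ hu'' _ n hn
    have h2 := isoProj_zero_apply_eq_self h1
    have h3 := LinearMap.congr_fun (isoProj_mul_isoProj_of_le (ψ := ψ) hB
      (HypSplit.isoSub_isotropic F s s') (HypSplit.ySub_le_isoSub F s s'))
      (heisRep (pairForm F (h₀.tower m) (h₀'.tower m')) ψ ⟨-y', 0⟩ u')
    rw [Module.End.mul_apply, h0 i hi hi' p g] at h3
    rw [← h2]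
    exact (congrArg _ h3).trans (map_zero _)
  rw [e2] at e1
  have e3 := congrArg (Ω (p.1, g)⁻¹) e1
  rw [map_zero, ← Module.End.mul_apply, ← map_mul, inv_mul_cancel, map_one] at e3
  exact e3

end MackeyData

/-! ### The functionals for all ranks. -/

section MackeyData

variable (F : Type*) {D : Type*} [Field F] [Field D] [StarRing D] [Algebra F D]
  [IsFixedField F D] [Finite F] [Finite D] [NeZero (2 : F)] {ε ε' : ℤˣ} {d d' : ℕ}

/-- The functionals `φ_i` and their sections `θ_i` that describe the coinvariants of the unipotent
radical. -/
theorem exists_mackey_data (h₀ : HermForm D ε (Fin d)) (h₀' : HermForm D (-ε) (Fin d'))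
    (han' : h₀'.Anisotropic) (heven : (∀ x : D, star x = x) → Even d ∧ Even d')
    {ψ : AddChar F ℂ} (hψ : ψ ≠ 1) (m m' k : ℕ) (hk : k ≤ m) :
    ∃ (φ : ∀ i : Fin (min k m' + 1),
        (Fin (heisDim (pairForm F (h₀.tower m) (h₀'.tower m')) ψ) → ℂ) →ₗ[ℂ]
        (Fin (heisDim (pairForm F (h₀.tower (m - k)) (h₀'.tower (m' - i))) ψ) → ℂ))
      (θ : ∀ i : Fin (min k m' + 1),
        (Fin (heisDim (pairForm F (h₀.tower (m - k)) (h₀'.tower (m' - i))) ψ) → ℂ) →ₗ[ℂ]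
        (Fin (heisDim (pairForm F (h₀.tower m) (h₀'.tower m')) ψ) → ℂ)),
      (∀ (i : Fin (min k m' + 1)) (p : leviParab h₀ m k (k - i)) (p' : parab h₀' m' i),
        leviParabGL h₀ k i hk (le_left_of_fin i) p = toGL h₀' i (le_right_of_fin i) p' →
        ∀ u, φ i (flatRep F (h₀.tower m) (h₀'.tower m') hψ (p.1.1, p'.1) u) =
          flatRep F (h₀.tower (m - k)) (h₀'.tower (m' - i)) hψ
            (leviParabIsom h₀ k (k - i) p, toIsom h₀' i p') (φ i u)) ∧
      (∀ i : Fin (min k m' + 1), ∀ n ∈ unipRad h₀ k hk, ∀ u,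
        φ i (flatRep F (h₀.tower m) (h₀'.tower m') hψ (n.1, 1) u) = φ i u) ∧
      (∀ i t, φ i (θ i t) = t) ∧
      (∀ (i j : Fin (min k m' + 1)) (p : levi h₀ m k) (p' : (h₀'.tower m').isom) t,
        φ i (flatRep F (h₀.tower m) (h₀'.tower m') hψ (p.1, p') (θ j t)) ≠ 0 → i = j ∧
        ∃ (hp : p ∈ leviParab h₀ m k (k - i)) (hp' : p' ∈ parab h₀' m' i),
          leviParabGL h₀ k i hk (le_left_of_fin i) ⟨p, hp⟩ =
            toGL h₀' i (le_right_of_fin i) ⟨p', hp'⟩) ∧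
      ∀ u, (∀ n ∈ unipRad h₀ k hk, flatRep F (h₀.tower m) (h₀'.tower m') hψ (n.1, 1) u = u) →
        (∀ i (p : levi h₀ m k) (p' : (h₀'.tower m').isom),
          φ i (flatRep F (h₀.tower m) (h₀'.tower m') hψ (p.1, p') u) = 0) → u = 0 := by
  have H := fun i : Fin (min k m' + 1) => HypSplit.exists_mackey_pair F (towerSplit h₀ m k hk)
    (towerSplit h₀' m' i (le_right_of_fin i)) hψ (card_idx m k d hk)
    (card_idx m' i d' (le_right_of_fin i)) (even_card_idx heven m m')
    (tailMat D (le_left_of_fin i))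
  choose φ θ h1 h3 h4 h5 h6 using H
  refine ⟨φ, θ, fun i p p' hpp u => ?_, fun i n hn u => ?_, h4, fun i j p p' t h0 => ?_,
    fun u hu h0 => ?_⟩
  · exact h1 i p.1.1 p'.1 _ _ _ _ (parab_isPara hk ⟨p.1.1, levi_le h₀ m k p.1.2⟩)
      (parab_isPara (le_right_of_fin i) p')
      (isom_mul_partialIso hk (le_left_of_fin i) (le_right_of_fin i) p p' hpp) u
  · exact h3 i n.1 ((unipRad_isPara hk n).1 hn) u
  · obtain ⟨w, hw, hwt⟩ := h6 j t
    rw [ne_eq, h5, hwt] at h0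
    obtain ⟨hij, hh⟩ := stabPartialIso_of_ne_zero F hψ hk (le_left_of_fin i) (le_right_of_fin i)
      (le_left_of_fin j) (le_right_of_fin j) hw h0
    exact ⟨Fin.ext hij, hh⟩
  · refine eq_zero_of_isoProj_eq_zero F hψ hk han' heven hu fun i hi hi' p p' => ?_
    exact (h5 ⟨i, Nat.lt_succ_of_le (le_min hi hi')⟩ _).1 (h0 _ p p')

/-- For the exchanged pair the second form has sign `ε`, which is only propositionally `-(-ε)`. With
the sign as a variable the equality can be eliminated. -/
theorem exists_mackey_data_cast (e : ε' = -ε) (h₀ : HermForm D ε (Fin d))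
    (h₀' : HermForm D ε' (Fin d'))
    (han' : h₀'.Anisotropic) (heven : (∀ x : D, star x = x) → Even d ∧ Even d')
    {ψ : AddChar F ℂ} (hψ : ψ ≠ 1) (m m' k : ℕ) (hk : k ≤ m) :
    ∃ (φ : ∀ i : Fin (min k m' + 1),
        (Fin (heisDim (pairForm F (h₀.tower m) ((h₀'.tower m').cast e)) ψ) → ℂ) →ₗ[ℂ]
        (Fin (heisDim (pairForm F (h₀.tower (m - k)) ((h₀'.tower (m' - i)).cast e)) ψ) → ℂ))
      (θ : ∀ i : Fin (min k m' + 1),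
        (Fin (heisDim (pairForm F (h₀.tower (m - k)) ((h₀'.tower (m' - i)).cast e)) ψ) → ℂ) →ₗ[ℂ]
        (Fin (heisDim (pairForm F (h₀.tower m) ((h₀'.tower m').cast e)) ψ) → ℂ)),
      (∀ (i : Fin (min k m' + 1)) (p : leviParab h₀ m k (k - i)) (p' : parab h₀' m' i),
        leviParabGL h₀ k i hk (le_left_of_fin i) p = toGL h₀' i (le_right_of_fin i) p' →
        ∀ u, φ i (flatRep F (h₀.tower m) ((h₀'.tower m').cast e) hψ (p.1.1, castIsom e _ p'.1) u) =
          flatRep F (h₀.tower (m - k)) ((h₀'.tower (m' - i)).cast e) hψ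
            (leviParabIsom h₀ k (k - i) p, castIsom e _ (toIsom h₀' i p')) (φ i u)) ∧
      (∀ i : Fin (min k m' + 1), ∀ n ∈ unipRad h₀ k hk, ∀ u,
        φ i (flatRep F (h₀.tower m) ((h₀'.tower m').cast e) hψ (n.1, 1) u) = φ i u) ∧
      (∀ i t, φ i (θ i t) = t) ∧
      (∀ (i j : Fin (min k m' + 1)) (p : levi h₀ m k) (p' : (h₀'.tower m').isom) t,
        φ i (flatRep F (h₀.tower m) ((h₀'.tower m').cast e) hψ (p.1, castIsom e _ p') (θ j t)) ≠ 0 →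
        i = j ∧
        ∃ (hp : p ∈ leviParab h₀ m k (k - i)) (hp' : p' ∈ parab h₀' m' i),
          leviParabGL h₀ k i hk (le_left_of_fin i) ⟨p, hp⟩ =
            toGL h₀' i (le_right_of_fin i) ⟨p', hp'⟩) ∧
      ∀ u, (∀ n ∈ unipRad h₀ k hk,
          flatRep F (h₀.tower m) ((h₀'.tower m').cast e) hψ (n.1, 1) u = u) →
        (∀ i (p : levi h₀ m k) (p' : (h₀'.tower m').isom),
          φ i (flatRep F (h₀.tower m) ((h₀'.tower m').cast e) hψ (p.1, castIsom e _ p') u) = 0) →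
        u = 0 := by
  subst e
  exact exists_mackey_data F h₀ h₀' han' heven hψ m m' k hk

end MackeyData

open scoped TensorProduct

/-! ### The two parabolic restrictions. -/

section Final

variable (F : Type*) {D : Type*} [Field F] [Field D] [StarRing D] [Algebra F D]
  [IsFixedField F D] [Finite F] [Finite D] [NeZero (2 : F)] {ε : ℤˣ} {d d' : ℕ}
  (h₀ : HermForm D ε (Fin d)) (h₀' : HermForm D (-ε) (Fin d'))
  {ψ : AddChar F ℂ} (hψ : ψ ≠ 1) (m m' k : ℕ)

theorem gradedLeft_tmul (i : ℕ) (hk : k ≤ m) (hi : i ≤ k) (hi' : i ≤ m')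
    (x : (leviParab h₀ m k (k - i)).prod (parab h₀' m' i)) (f : GL (Fin i) D → ℂ)
    (t : Fin (heisDim (pairForm F (h₀.tower (m - k)) (h₀'.tower (m' - i))) ψ) → ℂ) :
    gradedLeft F h₀ h₀' hψ m m' k i hk hi hi' x (f ⊗ₜ[ℂ] t) =
      regRep (GL (Fin i) D) (leviParabGL h₀ k i hk hi ⟨x.1.1, x.2.1⟩,
        toGL h₀' i hi' ⟨x.1.2, x.2.2⟩) f ⊗ₜ[ℂ]
      omegaFlat F h₀ h₀' hψ (m - k) (m' - i) (leviParabIsom h₀ k (k - i) ⟨x.1.1, x.2.1⟩,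
        toIsom h₀' i ⟨x.1.2, x.2.2⟩) t := TensorProduct.map_tmul _ _ _ _

theorem gradedRight_tmul (i : ℕ) (hk : k ≤ m') (hi' : i ≤ k) (hi : i ≤ m)
    (x : (parab h₀ m i).prod (leviParab h₀' m' k (k - i))) (f : GL (Fin i) D → ℂ)
    (t : Fin (heisDim (pairForm F (h₀.tower (m - i)) (h₀'.tower (m' - k))) ψ) → ℂ) :
    gradedRight F h₀ h₀' hψ m m' k i hk hi' hi x (f ⊗ₜ[ℂ] t) =
      regRep (GL (Fin i) D) (toGL h₀ i hi ⟨x.1.1, x.2.1⟩,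
        leviParabGL h₀' k i hk hi' ⟨x.1.2, x.2.2⟩) f ⊗ₜ[ℂ]
      omegaFlat F h₀ h₀' hψ (m - i) (m' - k) (toIsom h₀ i ⟨x.1.1, x.2.1⟩,
        leviParabIsom h₀' k (k - i) ⟨x.1.2, x.2.2⟩) t := TensorProduct.map_tmul _ _ _ _

set_option maxHeartbeats 1000000 in
/-- The parabolic restriction with respect to `P_k` is the sum of the induced representations. -/
theorem restrictLeft_equiv (han' : h₀'.Anisotropic)
    (heven : (∀ x : D, star x = x) → Even d ∧ Even d') (hk : k ≤ m) :
    Nonempty ((restrictLeft F h₀ h₀' hψ m m' k hk).Equiv (Representation.directSum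
      fun i : Fin (min k m' + 1) =>
        indLeft F h₀ h₀' hψ m m' k i hk (le_left_of_fin i) (le_right_of_fin i))) := by
  obtain ⟨φ, θ, h1, h3, h4, h5, h6⟩ := exists_mackey_data F h₀ h₀' han' heven hψ m m' k hk
  refine coinvariants_equiv_directSum ((unipRad h₀ k hk).prod ⊥)
    ((Subgroup.inclusion (levi_le h₀ m k)).prodMap (MonoidHom.id (h₀'.tower m').isom))
    ((omegaFlat F h₀ h₀' hψ m m').comp
      ((parab h₀ m k).subtype.prodMap (MonoidHom.id (h₀'.tower m').isom)))
    (fun i : Fin (min k m' + 1) => (leviParab h₀ m k (k - i)).prod (parab h₀' m' i))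
    (C := fun i : Fin (min k m' + 1) => GL (Fin i) D)
    (fun i => (leviParabGL h₀ k i hk (le_left_of_fin i)).comp
      ((MonoidHom.fst _ _).comp (Subgroup.prodEquiv _ _).toMonoidHom))
    (fun i => (toGL h₀' i (le_right_of_fin i)).comp
      ((MonoidHom.snd _ _).comp (Subgroup.prodEquiv _ _).toMonoidHom))
    (fun i => (omegaFlat F h₀ h₀' hψ (m - k) (m' - i)).comp
      (((leviParabIsom h₀ k (k - i)).prodMap (toIsom h₀' i)).comp
        (Subgroup.prodEquiv _ _).toMonoidHom))
    (fun i => gradedLeft F h₀ h₀' hψ m m' k i hk (le_left_of_fin i) (le_right_of_fin i))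
    (fun i h f t => by rw [gradedLeft_tmul]; rfl) φ θ ?_ ?_ h4 ?_ ?_ ?_ ?_
  · rintro i ⟨⟨p, p'⟩, hp, hp'⟩ hαβ u
    exact h1 i ⟨p, hp⟩ ⟨p', hp'⟩ hαβ u
  · rintro i ⟨n, n'⟩ ⟨hn, hn'⟩ u
    obtain rfl : n' = 1 := hn'
    exact h3 i n hn u
  · rintro i j hij ⟨p, p'⟩ t
    by_contra h0
    exact hij (h5 i j p p' t h0).1
  · rintro i ⟨p, p'⟩ t hne
    by_contra h0
    obtain ⟨-, hp, hp', heq⟩ := h5 i i p p' t h0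
    exact hne ⟨hp, hp'⟩ heq
  · intro u hu h0
    exact h6 u (fun n hn => hu (n, 1) ⟨hn, rfl⟩) fun i p p' => h0 i (p, p')
  · intro i x
    -- The factor `P'_i` alone already maps onto `GL_i`, so the first entry can be `1`.
    obtain ⟨g, hg⟩ := toGL_surjective (h₀ := h₀') (le_right_of_fin i) x
    refine ⟨⟨(1, g.1), one_mem _, g.2⟩, ?_⟩
    refine Eq.trans ?_ hg
    rw [← one_mul (toGL h₀' i (le_right_of_fin i) g)]
    refine congrArg₂ (· * ·) ?_ rfl
    exact inv_eq_one.2 (map_one (leviParabGL h₀ k i hk (le_left_of_fin i)))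

set_option maxHeartbeats 1000000 in
/-- The parabolic restriction with respect to `P'_k` is the sum of the induced representations. -/
theorem restrictRight_equiv (han : h₀.Anisotropic)
    (heven : (∀ x : D, star x = x) → Even d ∧ Even d') (hk : k ≤ m') :
    Nonempty ((restrictRight F h₀ h₀' hψ m m' k hk).Equiv (Representation.directSum
      fun i : Fin (min k m + 1) =>
        indRight F h₀ h₀' hψ m m' k i hk (le_left_of_fin i) (le_right_of_fin i))) := by
  -- The data for the exchanged pair, transported back by the adjoint through `E` and `E'`.
  obtain ⟨φ, θ, h1, h3, h4, h5, h6⟩ := exists_mackey_data_cast F (neg_neg ε).symm h₀' h₀ han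
    (fun h => (heven h).symm) hψ m' m k hk
  obtain ⟨E, hE⟩ := exists_flatRep_swap F (h₀.tower m) (h₀'.tower m') hψ
  choose E' hE' using fun i : Fin (min k m + 1) =>
    exists_flatRep_swap F (h₀.tower (m - i)) (h₀'.tower (m' - k)) hψ
  refine coinvariants_equiv_directSum ((⊥ : Subgroup (h₀.tower m).isom).prod (unipRad h₀' k hk))
    ((MonoidHom.id (h₀.tower m).isom).prodMap (Subgroup.inclusion (levi_le h₀' m' k)))
    ((omegaFlat F h₀ h₀' hψ m m').comp
      ((MonoidHom.id (h₀.tower m).isom).prodMap (parab h₀' m' k).subtype))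
    (fun i : Fin (min k m + 1) => (parab h₀ m i).prod (leviParab h₀' m' k (k - i)))
    (C := fun i : Fin (min k m + 1) => GL (Fin i) D)
    (fun i => (toGL h₀ i (le_right_of_fin i)).comp
      ((MonoidHom.fst _ _).comp (Subgroup.prodEquiv _ _).toMonoidHom))
    (fun i => (leviParabGL h₀' k i hk (le_left_of_fin i)).comp
      ((MonoidHom.snd _ _).comp (Subgroup.prodEquiv _ _).toMonoidHom))
    (fun i => (omegaFlat F h₀ h₀' hψ (m - i) (m' - k)).comp
      (((toIsom h₀ i).prodMap (leviParabIsom h₀' k (k - i))).comp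
        (Subgroup.prodEquiv _ _).toMonoidHom))
    (fun i => gradedRight F h₀ h₀' hψ m m' k i hk (le_left_of_fin i) (le_right_of_fin i))
    (fun i h f t => by rw [gradedRight_tmul]; rfl)
    (fun i => (E' i).symm.toLinearMap.comp ((φ i).comp E.toLinearMap))
    (fun i => E.symm.toLinearMap.comp ((θ i).comp (E' i).toLinearMap)) ?_ ?_ ?_ ?_ ?_ ?_ ?_
  · rintro i ⟨⟨p, p'⟩, hp, hp'⟩ hαβ u
    change (E' i).symm (φ i (E (flatRep F (h₀.tower m) (h₀'.tower m') hψ (p, p'.1) u))) =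
      flatRep F (h₀.tower (m - i)) (h₀'.tower (m' - k)) hψ (toIsom h₀ i ⟨p, hp⟩,
        leviParabIsom h₀' k (k - i) ⟨p', hp'⟩) ((E' i).symm (φ i (E u)))
    rw [LinearEquiv.symm_apply_eq, hE', LinearEquiv.apply_symm_apply, hE]
    exact h1 i ⟨p', hp'⟩ ⟨p, hp⟩ hαβ.symm (E u)
  · rintro i ⟨n', n⟩ ⟨hn', hn⟩ u
    obtain rfl : n' = 1 := hn'
    change (E' i).symm (φ i (E (flatRep F (h₀.tower m) (h₀'.tower m') hψ (1, n.1) u))) =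
      (E' i).symm (φ i (E u))
    rw [hE]
    exact congrArg (E' i).symm (h3 i n hn (E u))
  · intro i t
    change (E' i).symm (φ i (E (E.symm (θ i (E' i t))))) = t
    rw [LinearEquiv.apply_symm_apply, h4, LinearEquiv.symm_apply_apply]
  · rintro i j hij ⟨p, p'⟩ t
    by_contra h0
    change (E' i).symm (φ i (E (flatRep F (h₀.tower m) (h₀'.tower m') hψ (p, p'.1)
      (E.symm (θ j (E' j t)))))) ≠ 0 at h0
    rw [hE, LinearEquiv.apply_symm_apply, ne_eq, LinearEquiv.map_eq_zero_iff] at h0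
    exact hij (h5 i j p' p _ h0).1
  · rintro i ⟨p, p'⟩ t hne
    by_contra h0
    change (E' i).symm (φ i (E (flatRep F (h₀.tower m) (h₀'.tower m') hψ (p, p'.1)
      (E.symm (θ i (E' i t)))))) ≠ 0 at h0
    rw [hE, LinearEquiv.apply_symm_apply, ne_eq, LinearEquiv.map_eq_zero_iff] at h0
    obtain ⟨-, hp', hp, heq⟩ := h5 i i p' p _ h0
    exact hne ⟨hp, hp'⟩ heq.symm
  · intro u hu h0
    refine (LinearEquiv.map_eq_zero_iff E).1 (h6 (E u) (fun n hn => ?_) fun i p' p => ?_)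
    · have h7 := congrArg E (hu (1, n) ⟨rfl, hn⟩)
      exact (hE 1 n.1 u).symm.trans h7
    · have h7 : (E' i).symm (φ i (E (flatRep F (h₀.tower m) (h₀'.tower m') hψ (p, p'.1) u))) = 0 :=
        h0 i (p, p')
      rw [LinearEquiv.map_eq_zero_iff, hE] at h7
      exact h7
  · intro i x
    -- The inverse is needed because here `P_i` provides the homomorphism `α`, which enters `α⁻¹ *
    -- β` inverted.
    obtain ⟨g, hg⟩ := toGL_surjective (h₀ := h₀) (le_right_of_fin i) x⁻¹
    refine ⟨⟨(g.1, 1), g.2, one_mem _⟩, ?_⟩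
    have h7 : leviParabGL h₀' k i hk (le_left_of_fin i) 1 = 1 := map_one _
    refine (congrArg₂ (fun a b => a⁻¹ * b) hg h7).trans ?_
    rw [inv_inv, mul_one]

end Final
theorem mainTheorem6 {F D : Type*} [Field F] [Field D] [StarRing D] [Algebra F D]
    [IsFixedField F D] [Finite F] [Finite D] [NeZero (2 : F)] {ε : ℤˣ} {d d' : ℕ}
    (h₀ : HermForm D ε (Fin d)) (h₀' : HermForm D (-ε) (Fin d'))
    (han : h₀.Anisotropic) (han' : h₀'.Anisotropic)
    (heven : (∀ x : D, star x = x) → Even d ∧ Even d')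
    {ψ : AddChar F ℂ} (hψ : ψ ≠ 1) (m m' : ℕ) :
    (∀ (k : ℕ) (hk : k ≤ m),
      let σ := fun i : Fin (min k m' + 1) =>
        indLeft F h₀ h₀' hψ m m' k i hk (le_left_of_fin i) (le_right_of_fin i)
      HasFiltration (restrictLeft F h₀ h₀' hψ m m' k hk) σ ∧
        Nonempty ((restrictLeft F h₀ h₀' hψ m m' k hk).Equiv (Representation.directSum σ))) ∧
    (∀ (k' : ℕ) (hk' : k' ≤ m'),
      let σ' := fun i : Fin (min k' m + 1) =>
        indRight F h₀ h₀' hψ m m' k' i hk' (le_left_of_fin i) (le_right_of_fin i)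
      HasFiltration (restrictRight F h₀ h₀' hψ m m' k' hk') σ' ∧
        Nonempty ((restrictRight F h₀ h₀' hψ m m' k' hk').Equiv
          (Representation.directSum σ'))) := by
  refine ⟨fun k hk => ?_, fun k' hk' => ?_⟩
  · have h := restrictLeft_equiv F h₀ h₀' hψ m m' k han' heven hk
    exact ⟨h.elim fun e => hasFiltration_of_equiv _ _ e, h⟩
  · have h := restrictRight_equiv F h₀ h₀' hψ m m' k' han heven hk'
    exact ⟨h.elim fun e => hasFiltration_of_equiv _ _ e, h⟩
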